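/- Let $k$ be an algebraically closed field of characteristic $p>0$, $X$ a smooth $k$-scheme (in particular, any smooth variety), $\mathrm{Fr}\colon X\to X^{(1)}$ its relative Frobenius morphism over $k$, $(\mathcal L,\nabla)$ a line bundle on $X$ with a (not necessarily flat) connection, and $c\in k$. *The algebra.* Let $\mathcal D$ be the sheaf of crystalline differential operators on $X$ (the universal enveloping algebra of the Lie algebroid of vector fields). Let $\mathcal D_{\mathcal L^c}$ be the sheaf of algebras on $X$ obtained by gluing the algebras $\mathcal D|_U$, one for each local generator $e$ of $\mathcal L$ over an open set $U$, along the isomorphisms $f\mapsto f$, $\xi\mapsto \xi+c\,\xi(h)/h$ for a change of generator $e'=he$. If $\nabla e=\omega\otimes e$, then $\nabla e'=(\omega+dh/h)\otimes e'$. Let $\mathcal D_{\mathcal L^c,\nabla^{(1)}}$ be the central reduction of $\mathcal D_{\mathcal L^c}$ at the $(c^p-c)$-connection $(c^p-c)\nabla^{(1)}$ on $\mathcal L^{(1)}$: in terms of a local generator with connection form $\omega$ it is the quotient of $\mathcal D$ by the two-sided ideal generated by the central elements $\xi^p-\xi^{[p]}+(c^p-c)\,\omega(\xi)^p$ for all vector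 fields $\xi$. It is an algebra over $\mathcal O_{X^{(1)}}$ through $\mathrm{Fr}^{\#}$. It contains $\mathcal O_X$, and each vector field $\xi$ has a lift $\tilde\xi\in\mathcal D_{\mathcal L^c,\nabla^{(1)}}$ given locally by $\xi+c\,\omega(\xi)$, independently of the generator. A *splitting* of it is a vector bundle $E$ on $X^{(1)}$ together with an isomorphism of sheaves of $\mathcal O_{X^{(1)}}$-algebras $\mathrm{Fr}_*\mathcal D_{\mathcal L^c,\nabla^{(1)}}\cong\mathcal End_{\mathcal O_{X^{(1)}}}(E)$. *Extended curvature.* Let $\mathcal F_X=\Omega^1_X/d\mathcal O_X$ (cokernel of sheaves), let $\delta\colon\Omega^1_X\to\mathcal F_X$ be the projection, let $C^{-1}\colon\Omega^1_X\to\mathcal F_X$ be the additive map with $C^{-1}(f\,dg)=\delta(f^pg^{p-1}dg)$, and let $\kappa=C^{-1}-\delta$. The extended curvature $\widetilde{\mathrm{curv}}(\mathcal L,\nabla)\in\Gamma(X,\mathcal F_X)$ is the section locally equal to $\kappa(\omega)$, where $\omega$ is the connection form of $\nabla$ in a local trivialization of $\mathcal L$. **Proposition.** Splittings of $\mathcal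 D_{\mathcal L^c,\nabla^{(1)}}$ correspond canonically to line bundles with connection $(\mathcal L',\nabla')$ on $X$ such that $$\widetilde{\mathrm{curv}}(\mathcal L',\nabla')=c\cdot\widetilde{\mathrm{curv}}(\mathcal L,\nabla).$$ More precisely, there is an equivalence between the groupoid of splittings of $\mathcal D_{\mathcal L^c,\nabla^{(1)}}$ and the groupoid of such pairs $(\mathcal L',\nabla')$, together with an isomorphism of sheaves of abelian groups $E\cong\mathrm{Fr}_*\mathcal L'$, natural in the splitting, under which functions $f\in\mathcal O_X$ act on $\mathcal L'$ by multiplication and the lifts $\tilde\xi$ of vector fields act as $\nabla'_\xi$. -/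

import Mathlib

open CategoryTheory AlgebraicGeometry TopologicalSpace Opposite
open scoped TensorProduct KaehlerDifferential AlgebraicGeometry
universe u
namespace PCurv
noncomputable section
section Algebra

theorem prime_cast_choose_eq_zero {A : Type u} [CommRing A] {p : ℕ} [Fact p.Prime]
    (hp : (p : A) = 0) {i : ℕ} (h0 : i ≠ 0) (h1 : i < p) : ((p.choose i : ℕ) : A) = 0 := by
  obtain ⟨m, hm⟩ := (Fact.out : p.Prime).dvd_choose_self h0 h1
  rw [hm, Nat.cast_mul, hp, zero_mul]

theorem add_pow_of_cast_eq_zero {A : Type u} [CommRing A] {p : ℕ} [Fact p.Prime]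
    (hp : (p : A) = 0) (a b : A) : (a + b) ^ p = a ^ p + b ^ p := by
  rw [add_pow_prime_eq (Fact.out : p.Prime), hp]
  simp

/-- The `p`-th power map of a commutative ring in which `p = 0`. -/
def frobHom {A : Type u} [CommRing A] {p : ℕ} [Fact p.Prime] (hp : (p : A) = 0) : A →+* A where
  toFun a := a ^ p
  map_one' := one_pow p
  map_mul' a b := mul_pow a b p
  map_zero' := zero_pow (Fact.out : p.Prime).ne_zero
  map_add' := add_pow_of_cast_eq_zero hp

variable (k : Type u) [Field k] (A : Type u) [CommRing A] [Algebra k A]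

theorem cast_eq_zero_of_charP (p : ℕ) [CharP k p] : (p : A) = 0 := by
  rw [← map_natCast (algebraMap k A), CharP.cast_eq_zero, map_zero]

/-- `Ω[A⁄k] / dA`. -/
abbrev GenForms : Type u :=
  Ω[A⁄k] ⧸ LinearMap.range (KaehlerDifferential.D k A : A →ₗ[k] Ω[A⁄k])

variable {A}

/-- The class of a form modulo exact forms -/
abbrev delta : Ω[A⁄k] →ₗ[k] GenForms k A := Submodule.mkQ _

theorem delta_eq_zero_iff (η : Ω[A⁄k]) : delta k η = 0 ↔ ∃ a, KaehlerDifferential.D k A a = η := by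
  simp [delta]

theorem sum_choose_aux (n : ℕ) (a b : A) : ∑ j ∈ Finset.range n,
    ((n.choose j : ℕ) : A) * (a ^ j * b ^ (n - j)) = (a + b) ^ n - a ^ n := by
  rw [add_pow, Finset.sum_range_succ]
  simp
  exact Finset.sum_congr rfl fun _ _ => by ring

theorem exact_aux (p : ℕ) [Fact p.Prime] (a b : A) :
    ∃ P : A, KaehlerDifferential.D k A P =
      (a + b) ^ (p - 1) • KaehlerDifferential.D k A (a + b)
        - a ^ (p - 1) • KaehlerDifferential.D k A a - b ^ (p - 1) • KaehlerDifferential.D k A b := by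
  obtain ⟨n, rfl⟩ : ∃ n, p = n + 1 := ⟨p - 1, (Nat.succ_pred_prime Fact.out).symm⟩
  have hp : (n + 1).Prime := Fact.out
  have hd : ∀ j ∈ Finset.range n, (n + 1) ∣ (n + 1).choose (j + 1) := fun j hj =>
    hp.dvd_choose_self (by omega) (by have := Finset.mem_range.1 hj; omega)
  let c : ℕ → ℕ := fun j => (n + 1).choose (j + 1) / (n + 1)
  have h1 : ∀ j ∈ Finset.range n, (j + 1) * c j = n.choose j := by
    intro j hj
    have := Nat.div_mul_cancel (hd j hj)
    have h2 := Nat.add_one_mul_choose_eq n j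
    have : (n + 1) * ((j + 1) * c j) = (n + 1) * n.choose j := by
      rw [h2, ← this]; simp only [c]; ring
    exact Nat.eq_of_mul_eq_mul_left (Nat.succ_pos n) this
  have h3 : ∀ j ∈ Finset.range n, (n - j) * c j = n.choose (j + 1) := by
    intro j hj
    have hj' := Finset.mem_range.1 hj
    have := Nat.div_mul_cancel (hd j hj)
    have h2 := Nat.choose_mul_succ_eq n (j + 1)
    have : (n + 1) * ((n - j) * c j) = (n + 1) * n.choose (j + 1) := by
      rw [mul_comm (n + 1) (n.choose _), h2, ← this]
      have : n + 1 - (j + 1) = n - j := by omega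
      rw [this]; simp only [c]; ring
    exact Nat.eq_of_mul_eq_mul_left (Nat.succ_pos n) this
  refine ⟨∑ j ∈ Finset.range n, (c j : A) * (a ^ (j + 1) * b ^ (n - j)), ?_⟩
  have e1 : ∀ j ∈ Finset.range n,
      KaehlerDifferential.D k A ((c j : A) * (a ^ (j + 1) * b ^ (n - j))) =
      (((n.choose j : ℕ) : A) * (a ^ j * b ^ (n - j))) • KaehlerDifferential.D k A a +
      (((n.choose (j + 1) : ℕ) : A) * (a ^ (j + 1) * b ^ (n - (j + 1)))) •
        KaehlerDifferential.D k A b := by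
    intro j hj
    rw [← h1 j hj, ← h3 j hj]
    simp only [Derivation.leibniz, Derivation.leibniz_pow, Derivation.map_natCast, smul_zero,
      add_zero, ← Nat.cast_smul_eq_nsmul A, smul_add, smul_smul, add_tsub_cancel_right]
    push_cast
    rw [add_comm, show n - j - 1 = n - (j + 1) by omega]
    congr 2 <;> ring
  have e2 : ∑ j ∈ Finset.range n,
      ((n.choose (j + 1) : ℕ) : A) * (a ^ (j + 1) * b ^ (n - (j + 1))) = (a + b) ^ n - b ^ n := by
    rw [add_pow, Finset.sum_range_succ']
    simp
    exact Finset.sum_congr rfl fun _ _ => by ring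
  rw [map_sum, Finset.sum_congr rfl e1, Finset.sum_add_distrib, ← Finset.sum_smul,
    ← Finset.sum_smul, sum_choose_aux, e2]
  simp only [add_tsub_cancel_right, map_add, smul_add, sub_smul]
  abel

variable {k} in
theorem pow_smul_mem_exact {p : ℕ} [CharP k p] (f a : A) :
    f ^ p • KaehlerDifferential.D k A a = KaehlerDifferential.D k A (f ^ p * a) := by
  rw [Derivation.leibniz, Derivation.leibniz_pow, ← Nat.cast_smul_eq_nsmul A,
    cast_eq_zero_of_charP k A p]
  simp

variable (p : ℕ) [Fact p.Prime] [CharP k p]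

/-- `∑ fᵢ [gᵢ] ↦ ∑ fᵢ ^ p gᵢ ^ (p - 1) dgᵢ` modulo exact forms. -/
def preInvCartier : (A →₀ A) →+ GenForms k A :=
  Finsupp.liftAddHom fun g =>
    { toFun := fun f => delta k (f ^ p • g ^ (p - 1) • KaehlerDifferential.D k A g)
      map_zero' := by simp [(Fact.out : p.Prime).ne_zero]
      map_add' := fun f f' => by
        rw [add_pow_of_cast_eq_zero (cast_eq_zero_of_charP k A p), add_smul, map_add] }

theorem preInvCartier_single (f g : A) : preInvCartier k p (Finsupp.single g f) =
    delta k (f ^ p • g ^ (p - 1) • KaehlerDifferential.D k A g) := by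
  unfold preInvCartier
  rw [Finsupp.liftAddHom_apply_single]
  rfl

theorem preInvCartier_kerTotal (x : A →₀ A) (hx : x ∈ KaehlerDifferential.kerTotal k A) :
    preInvCartier k p x = 0 := by
  suffices h : ∀ f : A, preInvCartier k p (f • x) = 0 by simpa using h 1
  refine Submodule.span_induction (p := fun x _ => ∀ f : A, preInvCartier k p (f • x) = 0)
    ?_ ?_ ?_ ?_ hx
  · rintro _ ((⟨⟨a, b⟩, rfl⟩ | ⟨⟨a, b⟩, rfl⟩) | ⟨r, rfl⟩) f
    · simp only [smul_sub, smul_add, Finsupp.smul_single, smul_eq_mul, mul_one, map_sub, map_add,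
        preInvCartier_single]
      obtain ⟨P, hP⟩ := exact_aux k p a b
      simp only [← map_add (delta k)]
      rw [← map_sub (delta k), delta_eq_zero_iff]
      refine ⟨- (f ^ p * P), ?_⟩
      rw [map_neg, ← pow_smul_mem_exact, hP]
      simp only [smul_sub, smul_add, map_add]
      abel
    · simp only [smul_sub, smul_add, Finsupp.smul_single, smul_eq_mul, mul_one, map_sub, map_add,
        preInvCartier_single]
      rw [← map_add, ← map_sub]
      convert map_zero (delta k)
      have hp : p - 1 + 1 = p := Nat.succ_pred_prime Fact.out
      simp only [Derivation.leibniz, smul_add, smul_smul]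
      have e1 : f ^ p * ((a * b) ^ (p - 1) * a) = (f * a) ^ p * b ^ (p - 1) := by
        rw [mul_pow f, ← hp, add_tsub_cancel_right]; ring
      have e2 : f ^ p * ((a * b) ^ (p - 1) * b) = (f * b) ^ p * a ^ (p - 1) := by
        rw [mul_pow f, ← hp, add_tsub_cancel_right]; ring
      rw [e1, e2]
      abel
    · simp [preInvCartier_single]
  · simp
  · intro x y _ _ hx hy f
    rw [smul_add, map_add, hx, hy, add_zero]
  · intro a x _ hx f
    rw [smul_smul]
    exact hx _

/-- The inverse Cartier operator `Ω[A⁄k] → Ω[A⁄k] / dA`, the additive map with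
`f dg ↦ f ^ p g ^ (p - 1) dg`. -/
def invCartier : Ω[A⁄k] →+ GenForms k A :=
  (QuotientAddGroup.lift (KaehlerDifferential.kerTotal k A).toAddSubgroup (preInvCartier k p)
    (fun x hx => preInvCartier_kerTotal k p x hx)).comp
    (KaehlerDifferential.quotKerTotalEquiv k A).symm.toAddEquiv.toAddMonoidHom

theorem invCartier_smul_D (f g : A) : invCartier k p (f • KaehlerDifferential.D k A g) =
    delta k (f ^ p • g ^ (p - 1) • KaehlerDifferential.D k A g) := by
  rw [← preInvCartier_single]
  have : (KaehlerDifferential.quotKerTotalEquiv k A).symm (f • KaehlerDifferential.D k A g) =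
      (KaehlerDifferential.kerTotal k A).mkQ (Finsupp.single g f) := by
    rw [LinearEquiv.symm_apply_eq]
    simp [KaehlerDifferential.quotKerTotalEquiv]
  exact congrArg (QuotientAddGroup.lift (KaehlerDifferential.kerTotal k A).toAddSubgroup
    (preInvCartier k p) fun x hx => preInvCartier_kerTotal k p x hx) this

/-- `κ(ω) = C⁻¹(ω) - ω` modulo exact forms. -/
def kappa : Ω[A⁄k] →+ GenForms k A := invCartier k p - (delta k).toAddMonoidHom

theorem kappa_smul_D (f g : A) : kappa k p (f • KaehlerDifferential.D k A g) =
    delta k (f ^ p • g ^ (p - 1) • KaehlerDifferential.D k A g - f • KaehlerDifferential.D k A g) := by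
  rw [map_sub, ← invCartier_smul_D]; rfl

theorem kappa_dlog (h : Aˣ) :
    kappa k p ((↑h⁻¹ : A) • KaehlerDifferential.D k A (h : A)) = 0 := by
  rw [kappa_smul_D]
  have hp : p - 1 + 1 = p := Nat.succ_pred_prime Fact.out
  have : (↑h⁻¹ : A) ^ p * (h : A) ^ (p - 1) = ↑h⁻¹ := by
    rw [← hp, add_tsub_cancel_right, pow_succ, mul_right_comm, ← mul_pow]
    simp
  rw [smul_smul, this, sub_self, map_zero]

variable {k} {B : Type u} [CommRing B] [Algebra k B]

/-- The pullback of differential forms along a homomorphism of `k`-algebras. -/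
def formMap (φ : A →ₐ[k] B) : Ω[A⁄k] →ₗ[k] Ω[B⁄k] :=
  letI := φ.toRingHom.toAlgebra
  haveI : IsScalarTower k A B := IsScalarTower.of_algebraMap_eq' φ.comp_algebraMap.symm
  (KaehlerDifferential.map k k A B).restrictScalars k

theorem formMap_D (φ : A →ₐ[k] B) (a : A) :
    formMap φ (KaehlerDifferential.D k A a) = KaehlerDifferential.D k B (φ a) := by
  let := φ.toRingHom.toAlgebra
  have : IsScalarTower k A B := IsScalarTower.of_algebraMap_eq' φ.comp_algebraMap.symm
  exact KaehlerDifferential.map_D k k A B a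

theorem formMap_smul (φ : A →ₐ[k] B) (a : A) (η : Ω[A⁄k]) :
    formMap φ (a • η) = φ a • formMap φ η := by
  let := φ.toRingHom.toAlgebra
  have : IsScalarTower k A B := IsScalarTower.of_algebraMap_eq' φ.comp_algebraMap.symm
  exact (KaehlerDifferential.map k k A B).map_smul a η

theorem form_induction {P : Ω[A⁄k] → Prop} (h0 : P 0) (hadd : ∀ x y, P x → P y → P (x + y))
    (hD : ∀ f g : A, P (f • KaehlerDifferential.D k A g)) (η : Ω[A⁄k]) : P η := by
  have hη : η ∈ Submodule.span A (Set.range (KaehlerDifferential.D k A)) := by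
    rw [KaehlerDifferential.span_range_derivation]; trivial
  suffices h : ∀ f : A, P (f • η) by simpa using h 1
  refine Submodule.span_induction (p := fun x _ => ∀ f : A, P (f • x)) ?_ ?_ ?_ ?_ hη
  · rintro _ ⟨g, rfl⟩ f; exact hD f g
  · simpa using h0
  · intro x y _ _ hx hy f; rw [smul_add]; exact hadd _ _ (hx f) (hy f)
  · intro a x _ hx f; rw [smul_smul]; exact hx _

theorem formMap_comp {C : Type u} [CommRing C] [Algebra k C] (φ : A →ₐ[k] B) (ψ : B →ₐ[k] C)
    (χ : A →ₐ[k] C) (h : ∀ a, ψ (φ a) = χ a) (η : Ω[A⁄k]) :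
    formMap ψ (formMap φ η) = formMap χ η := by
  induction η using form_induction with
  | h0 => simp
  | hadd x y hx hy => simp [hx, hy]
  | hD f g => simp [formMap_smul, formMap_D, h]

/-- The map on forms modulo exact forms induced by a homomorphism of `k`-algebras. -/
def genFormMap (φ : A →ₐ[k] B) : GenForms k A →ₗ[k] GenForms k B :=
  Submodule.mapQ _ _ (formMap φ) (by
    rintro _ ⟨a, rfl⟩
    exact ⟨φ a, (formMap_D φ a).symm⟩)

theorem genFormMap_delta (φ : A →ₐ[k] B) (η : Ω[A⁄k]) :
    genFormMap φ (delta k η) = delta k (formMap φ η) := rfl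

theorem genFormMap_kappa (φ : A →ₐ[k] B) (η : Ω[A⁄k]) :
    genFormMap φ (kappa k p η) = kappa k p (formMap φ η) := by
  induction η using form_induction with
  | h0 => simp
  | hadd x y hx hy => simp [hx, hy]
  | hD f g =>
    rw [kappa_smul_D, genFormMap_delta, formMap_smul, formMap_D, kappa_smul_D]
    simp [formMap_smul, formMap_D]

theorem iterate_derivation_mul (D : Derivation k A A) (n : ℕ) (a b : A) :
    D^[n] (a * b) = ∑ ij ∈ Finset.HasAntidiagonal.antidiagonal n,
      n.choose ij.1 • (D^[ij.1] a * D^[ij.2] b) := by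
  induction n with
  | zero => simp
  | succ n ih =>
    rw [Finset.sum_antidiagonal_choose_succ_nsmul (fun i j => D^[i] a * D^[j] b)]
    rw [Function.iterate_succ_apply', ih, map_sum, ← Finset.sum_add_distrib]
    refine Finset.sum_congr rfl fun ij hij => ?_
    have hs : n.choose ij.2 = n.choose ij.1 := Nat.choose_symm_of_eq_add (by
      have := Finset.HasAntidiagonal.mem_antidiagonal.1 hij; omega)
    rw [hs, map_nsmul, Derivation.leibniz, ← nsmul_add, Function.iterate_succ_apply',
      Function.iterate_succ_apply']
    simp only [smul_eq_mul]
    ring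

/-- The `p`-th power of a derivation in characteristic `p`. -/
def derivationPow (D : Derivation k A A) : Derivation k A A :=
  Derivation.mk' ((D : A →ₗ[k] A) ^ p) (fun a b => by
    have h : ∀ c : A, ((D : A →ₗ[k] A) ^ p) c = D^[p] c := fun c => by
      rw [Module.End.pow_apply]; rfl
    rw [h, h, h, iterate_derivation_mul]
    have hp : p ≠ 0 := (Fact.out : p.Prime).ne_zero
    rw [← Finset.sum_subset (s₁ := {(0, p), (p, 0)})]
    · rw [Finset.sum_pair (by simp [hp])]
      simp
      ring
    · intro x hx
      rcases Finset.mem_insert.1 hx with rfl | hx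
      · simp
      · rw [Finset.mem_singleton.1 hx]; simp
    · rintro ⟨i, j⟩ hij hx
      have h1 := Finset.HasAntidiagonal.mem_antidiagonal.1 hij
      simp only [Finset.mem_insert, Finset.mem_singleton, Prod.mk.injEq, not_or] at hx h1
      rw [← Nat.cast_smul_eq_nsmul A, prime_cast_choose_eq_zero (cast_eq_zero_of_charP k A p)
        (by omega) (by omega), zero_smul])

theorem derivationPow_apply (D : Derivation k A A) (a : A) : derivationPow p D a = D^[p] a := by
  change ((D : A →ₗ[k] A) ^ p) a = _
  rw [Module.End.pow_apply]; rfl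

end Algebra

section Frobenius

variable {X Y : Scheme.{u}} {p : ℕ}

theorem sections_cast_eq_zero (hp : (p : Γ(X, ⊤)) = 0) (U : X.Opens) : (p : Γ(X, U)) = 0 := by
  rw [← map_natCast (X.presheaf.map (homOfLE (le_top : U ≤ ⊤)).op).hom, hp, map_zero]

variable [Fact p.Prime]

/-- The morphism of presheafed spaces underlying the absolute Frobenius. -/
def absFrobPresheafed (hp : (p : Γ(X, ⊤)) = 0) :
    X.toPresheafedSpace.Hom X.toPresheafedSpace where
  base := 𝟙 _
  c :=
    { app := fun U => CommRingCat.ofHom (frobHom (sections_cast_eq_zero hp U.unop))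
      naturality := fun U V i => by
        ext f
        exact (map_pow (X.presheaf.map i).hom f p).symm }

/-- The absolute Frobenius endomorphism of a scheme in which `p = 0`: the identity on points and
`f ↦ f ^ p` on functions. -/
def absFrob (hp : (p : Γ(X, ⊤)) = 0) : X ⟶ X where
  __ := absFrobPresheafed hp
  prop := fun x => ⟨fun t ht => by
    obtain ⟨U, hx, s, rfl⟩ := X.presheaf.exists_germ_eq (show X.presheaf.stalk x from t)
    have h := PresheafedSpace.stalkMap_germ_apply
      (show X.toPresheafedSpace ⟶ X.toPresheafedSpace from absFrobPresheafed hp) U x hx s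
    have h2 : IsUnit (X.presheaf.germ U x hx (s ^ p)) := by
      erw [h] at ht
      exact ht
    rw [map_pow] at h2
    exact (isUnit_pow_iff (Fact.out : p.Prime).ne_zero).1 h2⟩

theorem absFrob_app (hp : (p : Γ(X, ⊤)) = 0) (U : X.Opens) (f : Γ(X, U)) :
    (absFrob hp).app U f = f ^ p := rfl

theorem absFrob_naturality (f : X ⟶ Y) (hX : (p : Γ(X, ⊤)) = 0) (hY : (p : Γ(Y, ⊤)) = 0) :
    absFrob hX ≫ f = f ≫ absFrob hY := by
  refine Scheme.Hom.ext rfl fun U => ?_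
  have h : ∀ (W : X.Opens) (e : W = W), X.presheaf.map (eqToHom e).op = 𝟙 _ := fun W e => by simp
  ext s
  have h1 : (absFrob hX ≫ f).app U s = f.app U s ^ p := by
    rw [Scheme.Hom.comp_app]; rfl
  have h2 : (f ≫ absFrob hY).app U s = f.app U s ^ p := by
    rw [Scheme.Hom.comp_app]
    exact map_pow (f.app U).hom s p
  change X.presheaf.map _ ((absFrob hX ≫ f).app U s) = (f ≫ absFrob hY).app U s
  rw [h2]
  erw [h1, h]
  rfl

theorem spec_cast_eq_zero {k : Type u} [Field k] (p : ℕ) [CharP k p] :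
    (p : Γ(Spec (.of k), ⊤)) = 0 := by
  rw [← map_natCast (Scheme.ΓSpecIso (.of k)).inv.hom]
  erw [CharP.cast_eq_zero k p, map_zero]

theorem over_cast_eq_zero {k : Type u} [Field k] (π : X ⟶ Spec (.of k)) (p : ℕ) [CharP k p] :
    (p : Γ(X, ⊤)) = 0 := by
  have h := congrArg (π.app ⊤).hom (spec_cast_eq_zero (k := k) p)
  rw [map_natCast, map_zero] at h
  exact h

variable (X) (k : Type u) [Field k] [X.Over (Spec (.of k))]

/-- The Frobenius twist `X⁽¹⁾` of a scheme `X` over `k`: the base change of `X` along the absolute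
Frobenius of `Spec k`. -/
def frobTwist (p : ℕ) [Fact p.Prime] [CharP k p] : Scheme.{u} :=
  Limits.pullback (X ↘ Spec (.of k)) (absFrob (spec_cast_eq_zero (k := k) p))

/-- The relative Frobenius morphism `X ⟶ X⁽¹⁾`. -/
def relFrob (p : ℕ) [Fact p.Prime] [CharP k p] : X ⟶ frobTwist X k p :=
  Limits.pullback.lift (absFrob (over_cast_eq_zero (X ↘ Spec (.of k)) p)) (X ↘ Spec (.of k))
    (absFrob_naturality _ _ _)

end Frobenius

section Sections

variable (k : Type u) [Field k] {X : Scheme.{u}} [X.Over (Spec (.of k))]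

/-- The structure map `k → Γ(X, U)` of a scheme over `k`. -/
def structMap (X : Scheme.{u}) [X.Over (Spec (.of k))] (U : X.Opens) : k →+* Γ(X, U) :=
  ((X.presheaf.map (homOfLE (le_top : U ≤ ⊤)).op).hom.comp
    ((X ↘ Spec (.of k)).app ⊤).hom).comp (Scheme.ΓSpecIso (.of k)).inv.hom

instance sectionsAlgebra (U : X.Opens) : Algebra k Γ(X, U) := (structMap k X U).toAlgebra

instance stalkAlgebra (x : X) : Algebra k (X.presheaf.stalk x) :=
  ((X.presheaf.germ ⊤ x trivial).hom.comp (structMap k X ⊤)).toAlgebra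

theorem map_structMap {U V : X.Opens} (i : V ⟶ U) (a : k) :
    X.presheaf.map i.op (structMap k X U a) = structMap k X V a := by
  have h : X.presheaf.map (homOfLE (le_top : U ≤ ⊤)).op ≫ X.presheaf.map i.op =
      X.presheaf.map (homOfLE (le_top : V ≤ ⊤)).op := by
    rw [← Functor.map_comp]; rfl
  exact congr($h (((X ↘ Spec (.of k)).app ⊤).hom ((Scheme.ΓSpecIso (.of k)).inv.hom a)))

/-- Restriction of functions, as a homomorphism of `k`-algebras. -/
def res {U V : X.Opens} (h : V ≤ U) : Γ(X, U) →ₐ[k] Γ(X, V) :=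
  { (X.presheaf.map (homOfLE h).op).hom with
    commutes' := fun a => map_structMap k (homOfLE h) a }

/-- The germ of a function at a point, as a homomorphism of `k`-algebras. -/
def germ {U : X.Opens} {x : X} (h : x ∈ U) : Γ(X, U) →ₐ[k] X.presheaf.stalk x :=
  { (X.presheaf.germ U x h).hom with
    commutes' := fun a => by
      change X.presheaf.germ U x h (structMap k X U a) = X.presheaf.germ ⊤ x trivial (structMap k X ⊤ a)
      rw [← map_structMap k (homOfLE (le_top : U ≤ ⊤)) a]
      exact X.presheaf.germ_res_apply (homOfLE (le_top : U ≤ ⊤)) x h _ }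

theorem res_self {U : X.Opens} (f : Γ(X, U)) : res k (le_refl U) f = f := by
  have h : X.presheaf.map (homOfLE (le_refl U)).op = 𝟙 _ := X.presheaf.map_id _
  exact congr($h f)

theorem res_res {U V W : X.Opens} (h : V ≤ U) (h' : W ≤ V) (f : Γ(X, U)) :
    res k h' (res k h f) = res k (h'.trans h) f := by
  have e : X.presheaf.map (homOfLE h).op ≫ X.presheaf.map (homOfLE h').op =
      X.presheaf.map (homOfLE (h'.trans h)).op := by
    rw [← Functor.map_comp]; rfl
  exact congr($e f)

theorem germ_res {U V : X.Opens} (h : V ≤ U) {x : X} (hx : x ∈ V) (f : Γ(X, U)) :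
    germ k hx (res k h f) = germ k (h hx) f :=
  X.presheaf.germ_res_apply (homOfLE h) x hx f

/-- Restriction of sections of a sheaf of modules. -/
def mres (M : X.Modules) {U V : X.Opens} (h : V ≤ U) : Γ(M, U) →+ Γ(M, V) :=
  (M.presheaf.map (homOfLE h).op).hom

theorem mres_self (M : X.Modules) {U : X.Opens} (s : Γ(M, U)) : mres M (le_refl U) s = s := by
  have h : M.presheaf.map (homOfLE (le_refl U)).op = 𝟙 _ := M.presheaf.map_id _
  exact congr($h s)

theorem mres_mres (M : X.Modules) {U V W : X.Opens} (h : V ≤ U) (h' : W ≤ V) (s : Γ(M, U)) :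
    mres M h' (mres M h s) = mres M (h'.trans h) s := by
  have e : M.presheaf.map (homOfLE h).op ≫ M.presheaf.map (homOfLE h').op =
      M.presheaf.map (homOfLE (h'.trans h)).op := by
    rw [← Functor.map_comp]; rfl
  exact congr($e s)

theorem mres_smul (M : X.Modules) {U V : X.Opens} (h : V ≤ U) (f : Γ(X, U)) (s : Γ(M, U)) :
    mres M h (f • s) = res k h f • mres M h s :=
  M.map_smul (homOfLE h) f s

end Sections

section VectorFields

variable (k : Type u) [Field k] {X : Scheme.{u}} [X.Over (Spec (.of k))]

/-- Families of `k`-derivations of `Γ(X, W)`, `W ≤ U`, compatible with restriction. -/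
def vectSubgroup (U : X.Opens) :
    AddSubgroup (∀ W : {W : X.Opens // W ≤ U}, Derivation k Γ(X, W.1) Γ(X, W.1)) where
  carrier := {ξ | ∀ (W W' : {W : X.Opens // W ≤ U}) (h : W'.1 ≤ W.1) (f : Γ(X, W.1)),
    ξ W' (res k h f) = res k h (ξ W f)}
  zero_mem' := fun W W' h f => by simp
  add_mem' := fun {a b} ha hb W W' h f => by simp [ha W W' h f, hb W W' h f]
  neg_mem' := fun {a} ha W W' h f => by simp [ha W W' h f]

/-- The vector fields on `U`: the sections over `U` of the sheaf `Der_k(𝒪_X, 𝒪_X)`. -/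
def Vect (U : X.Opens) : Type u := vectSubgroup k U

instance (U : X.Opens) : AddCommGroup (Vect k U) := inferInstanceAs (AddCommGroup (vectSubgroup k U))

namespace Vect

variable {k} {U V : X.Opens}

/-- The derivation of `Γ(X, U)` given by a vector field on `U`. -/
def der (ξ : Vect k U) : Derivation k Γ(X, U) Γ(X, U) := ξ.1 ⟨U, le_rfl⟩

/-- Restriction of vector fields -/
def restrict (h : V ≤ U) : Vect k U →+ Vect k V where
  toFun ξ := ⟨fun W => ξ.1 ⟨W.1, W.2.trans h⟩, fun W W' h' f => ξ.2 ⟨W.1, _⟩ ⟨W'.1, _⟩ h' f⟩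
  map_zero' := rfl
  map_add' _ _ := rfl

theorem der_restrict (h : V ≤ U) (ξ : Vect k U) (f : Γ(X, U)) :
    (restrict h ξ).der (res k h f) = res k h (ξ.der f) :=
  ξ.2 ⟨U, le_rfl⟩ ⟨V, h⟩ h f

/-- The product `f ξ` of a function and a vector field -/
def fsmul (f : Γ(X, U)) (ξ : Vect k U) : Vect k U :=
  ⟨fun W => res k W.2 f • ξ.1 W, fun W W' h g => by
    simp only [Derivation.smul_apply, smul_eq_mul, map_mul, res_res]
    rw [ξ.2 W W' h g]⟩

/-- The commutator of vector fields -/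
def bracket (ξ η : Vect k U) : Vect k U :=
  ⟨fun W => ⁅ξ.1 W, η.1 W⁆, fun W W' h g => by
    simp only [Derivation.commutator_apply, map_sub]
    rw [ξ.2 W W' h g, η.2 W W' h g, ξ.2 W W' h, η.2 W W' h]⟩

/-- The `p`-th power `ξ^[p]` of a vector field in characteristic `p` -/
def pPow (p : ℕ) [Fact p.Prime] [CharP k p] (ξ : Vect k U) : Vect k U :=
  ⟨fun W => derivationPow p (ξ.1 W), fun W W' h g => by
    simp only [derivationPow_apply]
    exact ((show Function.Semiconj (res k h) (ξ.1 W) (ξ.1 W') from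
      fun f => (ξ.2 W W' h f).symm).iterate_right p g).symm⟩

/-- The contraction `⟨ω, ξ⟩` of a form with a vector field -/
def pair (ξ : Vect k U) : Ω[Γ(X, U)⁄k] →ₗ[Γ(X, U)] Γ(X, U) := ξ.der.liftKaehlerDifferential

theorem pair_D (ξ : Vect k U) (f : Γ(X, U)) : ξ.pair (KaehlerDifferential.D k _ f) = ξ.der f :=
  Derivation.liftKaehlerDifferential_comp_D _ _

theorem pair_restrict (h : V ≤ U) (ξ : Vect k U) (ω : Ω[Γ(X, U)⁄k]) :
    (restrict h ξ).pair (formMap (res k h) ω) = res k h (ξ.pair ω) := by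
  induction ω using form_induction with
  | h0 => simp
  | hadd x y hx hy => simp [hx, hy]
  | hD f g => simp [formMap_smul, formMap_D, pair_D, der_restrict]

theorem restrict_fsmul (h : V ≤ U) (f : Γ(X, U)) (ξ : Vect k U) :
    restrict h (ξ.fsmul f) = (restrict h ξ).fsmul (res k h f) := by
  refine Subtype.ext (funext fun W => ?_)
  exact congrArg (fun g : Γ(X, W.1) => g • ξ.1 ⟨W.1, W.2.trans h⟩) (res_res k h W.2 f).symm

theorem restrict_bracket (h : V ≤ U) (ξ η : Vect k U) :
    restrict h (ξ.bracket η) = (restrict h ξ).bracket (restrict h η) := rfl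

/-- The logarithmic derivative `ξ(h) / h` of a unit along a vector field -/
def dlog (ξ : Vect k U) (h : Γ(X, U)ˣ) : Γ(X, U) := (↑h⁻¹ : Γ(X, U)) * ξ.der (h : Γ(X, U))

theorem der_add (ξ η : Vect k U) (f : Γ(X, U)) : (ξ + η).der f = ξ.der f + η.der f := rfl

theorem der_fsmul (g : Γ(X, U)) (ξ : Vect k U) (f : Γ(X, U)) :
    (ξ.fsmul g).der f = g * ξ.der f := by
  have : (ξ.fsmul g).der = res k le_rfl g • ξ.der := rfl
  rw [this, Derivation.smul_apply, res_self, smul_eq_mul]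

theorem der_bracket (ξ η : Vect k U) (f : Γ(X, U)) :
    (ξ.bracket η).der f = ξ.der (η.der f) - η.der (ξ.der f) :=
  Derivation.commutator_apply (D1 := ξ.der) (D2 := η.der) f

theorem dlog_add (ξ η : Vect k U) (h : Γ(X, U)ˣ) : (ξ + η).dlog h = ξ.dlog h + η.dlog h := by
  rw [dlog, der_add, mul_add]; rfl

theorem dlog_fsmul (g : Γ(X, U)) (ξ : Vect k U) (h : Γ(X, U)ˣ) :
    (ξ.fsmul g).dlog h = g * ξ.dlog h := by
  rw [dlog, der_fsmul, dlog, mul_left_comm]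

theorem dlog_bracket (ξ η : Vect k U) (h : Γ(X, U)ˣ) :
    ξ.der (η.dlog h) - η.der (ξ.dlog h) = (ξ.bracket η).dlog h := by
  have e : ∀ D : Derivation k Γ(X, U) Γ(X, U), D (↑h⁻¹ : Γ(X, U)) =
      - ((↑h⁻¹ : Γ(X, U)) * (↑h⁻¹ : Γ(X, U)) * D (h : Γ(X, U))) := by
    intro D
    have h1 : D ((↑h⁻¹ : Γ(X, U)) * h) = 0 := by simp
    rw [Derivation.leibniz] at h1
    simp only [smul_eq_mul] at h1
    have h2 : (h : Γ(X, U)) * (↑h⁻¹ : Γ(X, U)) = 1 := by simp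
    linear_combination (↑h⁻¹ : Γ(X, U)) * h1 - D (↑h⁻¹ : Γ(X, U)) * h2
  simp only [dlog]
  rw [der_bracket, Derivation.leibniz, Derivation.leibniz, e, e]
  simp only [smul_eq_mul]
  ring

end Vect

end VectorFields

section DiffOp

variable (k : Type u) [Field k] {X : Scheme.{u}} [X.Over (Spec (.of k))]

/-- The relations of the algebra of differential operators, on the generators `f ∈ Γ(X, U)` and
`ξ ∈ Vect U`. -/
inductive DiffOpRel (U : X.Opens) : FreeAlgebra k (Γ(X, U) ⊕ Vect k U) →
    FreeAlgebra k (Γ(X, U) ⊕ Vect k U) → Prop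
  | scalar (a : k) : DiffOpRel U (.ι k (.inl (algebraMap k _ a))) (algebraMap k _ a)
  | add (f g : Γ(X, U)) : DiffOpRel U (.ι k (.inl (f + g))) (.ι k (.inl f) + .ι k (.inl g))
  | mul (f g : Γ(X, U)) : DiffOpRel U (.ι k (.inl (f * g))) (.ι k (.inl f) * .ι k (.inl g))
  | vadd (ξ η : Vect k U) : DiffOpRel U (.ι k (.inr (ξ + η))) (.ι k (.inr ξ) + .ι k (.inr η))
  | vsmul (f : Γ(X, U)) (ξ : Vect k U) :
      DiffOpRel U (.ι k (.inr (ξ.fsmul f))) (.ι k (.inl f) * .ι k (.inr ξ))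
  | leibniz (ξ : Vect k U) (f : Γ(X, U)) :
      DiffOpRel U (.ι k (.inr ξ) * .ι k (.inl f))
        (.ι k (.inl f) * .ι k (.inr ξ) + .ι k (.inl (ξ.der f)))
  | comm (ξ η : Vect k U) :
      DiffOpRel U (.ι k (.inr (ξ.bracket η)))
        (.ι k (.inr ξ) * .ι k (.inr η) - .ι k (.inr η) * .ι k (.inr ξ))

/-- The algebra `D(U)` of (crystalline) differential operators: the universal enveloping algebra of
the Lie algebroid of vector fields. -/
abbrev DiffOp (U : X.Opens) : Type u := RingQuot (DiffOpRel k U)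

namespace DiffOp

variable {k} {U V : X.Opens}

theorem rel {a b : FreeAlgebra k (Γ(X, U) ⊕ Vect k U)} (h : DiffOpRel k U a b) :
    RingQuot.mkAlgHom k (DiffOpRel k U) a = RingQuot.mkAlgHom k (DiffOpRel k U) b :=
  RingQuot.mkAlgHom_rel k h

/-- Functions as differential operators -/
def fn : Γ(X, U) →+* DiffOp k U where
  toFun f := RingQuot.mkAlgHom k (DiffOpRel k U) (.ι k (.inl f))
  map_one' := by
    have := rel (DiffOpRel.scalar (U := U) (1 : k))
    simpa using this
  map_mul' f g := by rw [rel (.mul f g), map_mul]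
  map_zero' := by
    have := rel (DiffOpRel.scalar (U := U) (0 : k))
    simpa using this
  map_add' f g := by rw [rel (.add f g), map_add]

/-- Vector fields as differential operators -/
def vec : Vect k U →+ DiffOp k U :=
  AddMonoidHom.mk' (fun ξ => RingQuot.mkAlgHom k (DiffOpRel k U) (.ι k (.inr ξ)))
    (fun ξ η => by rw [rel (.vadd ξ η), map_add])

theorem fn_algebraMap (a : k) : fn (algebraMap k Γ(X, U) a) = algebraMap k (DiffOp k U) a := by
  have := rel (DiffOpRel.scalar (U := U) a)
  rw [AlgHom.commutes] at this
  exact this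

theorem vec_fsmul (f : Γ(X, U)) (ξ : Vect k U) : vec (ξ.fsmul f) = fn f * vec ξ := by
  have := rel (.vsmul f ξ)
  rwa [map_mul] at this

theorem vec_mul_fn (ξ : Vect k U) (f : Γ(X, U)) :
    vec ξ * fn f = fn f * vec ξ + fn (ξ.der f) := by
  have := rel (.leibniz ξ f)
  rwa [map_add, map_mul, map_mul] at this

theorem vec_bracket (ξ η : Vect k U) : vec (ξ.bracket η) = vec ξ * vec η - vec η * vec ξ := by
  have := rel (.comm ξ η)
  rwa [map_sub, map_mul, map_mul] at this

/-- The image `ξ + c ξ(h) / h` of a vector field under the gluing homomorphism -/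
def glueVec (i : V ≤ U) (h : Γ(X, V)ˣ) (c : k) (ξ : Vect k U) : DiffOp k V :=
  vec (ξ.restrict i) + c • fn ((ξ.restrict i).dlog h)

theorem glue_rel (i : V ≤ U) (h : Γ(X, V)ˣ) (c : k) {a b : FreeAlgebra k (Γ(X, U) ⊕ Vect k U)}
    (hab : DiffOpRel k U a b) :
    FreeAlgebra.lift k (Sum.elim (fun f => fn (res k i f)) (glueVec i h c)) a =
      FreeAlgebra.lift k (Sum.elim (fun f => fn (res k i f)) (glueVec i h c)) b := by
  induction hab with
  | scalar a => simp [fn_algebraMap]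
  | add f g => simp
  | mul f g => simp
  | vadd ξ η =>
    simp only [FreeAlgebra.lift_ι_apply, Sum.elim_inr, map_add, glueVec, Vect.dlog_add, smul_add]
    abel
  | vsmul f ξ =>
    simp only [FreeAlgebra.lift_ι_apply, Sum.elim_inr, Sum.elim_inl, map_mul, glueVec,
      Vect.restrict_fsmul, Vect.dlog_fsmul, vec_fsmul, mul_add, mul_smul_comm]
  | leibniz ξ f =>
    simp only [map_mul, map_add, FreeAlgebra.lift_ι_apply, Sum.elim_inr, Sum.elim_inl, glueVec,
      ← Vect.der_restrict, add_mul, mul_add, vec_mul_fn, mul_smul_comm, smul_mul_assoc]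
    simp only [← map_mul fn, mul_comm (res k i f)]
    abel
  | comm ξ η =>
    have hc : ∀ f g : Γ(X, V), (fn f : DiffOp k V) * fn g = fn g * fn f := fun f g => by
      rw [← map_mul, mul_comm, map_mul]
    simp only [map_mul, map_sub, FreeAlgebra.lift_ι_apply, Sum.elim_inr, glueVec,
      Vect.restrict_bracket, ← Vect.dlog_bracket, vec_bracket, add_mul, mul_add, mul_smul_comm,
      smul_mul_assoc, smul_sub, vec_mul_fn, smul_add, hc (Vect.dlog (Vect.restrict i ξ) h)]
    abel

/-- For a unit `h` on `V ≤ U`, the homomorphism `D(U) → D(V)` that is restriction followed by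
`f ↦ f` on functions and `ξ ↦ ξ + c ξ(h) / h` on vector fields. -/
def glue (i : V ≤ U) (h : Γ(X, V)ˣ) (c : k) : DiffOp k U →ₐ[k] DiffOp k V :=
  RingQuot.liftAlgHom k ⟨FreeAlgebra.lift k (Sum.elim (fun f => fn (res k i f)) (glueVec i h c)),
    fun _ _ hab => glue_rel i h c hab⟩

theorem glue_fn (i : V ≤ U) (h : Γ(X, V)ˣ) (c : k) (f : Γ(X, U)) :
    glue i h c (fn f) = fn (res k i f) := by
  simp [glue, fn]

theorem glue_vec (i : V ≤ U) (h : Γ(X, V)ˣ) (c : k) (ξ : Vect k U) :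
    glue i h c (vec ξ) = vec (ξ.restrict i) + c • fn ((ξ.restrict i).dlog h) := by
  simp [glue, vec, glueVec]

end DiffOp

end DiffOp
section Connections

variable (k : Type u) [Field k] {X : Scheme.{u}} [X.Over (Spec (.of k))]

/-- Restriction of sections of `Ω¹ ⊗ M`. -/
def tres (M : X.Modules) {U V : X.Opens} (h : V ≤ U) :
    Ω[Γ(X, U)⁄k] ⊗[Γ(X, U)] Γ(M, U) →+ Ω[Γ(X, V)⁄k] ⊗[Γ(X, V)] Γ(M, V) :=
  TensorProduct.liftAddHom
    { toFun := fun ω => ((TensorProduct.mk Γ(X, V) Ω[Γ(X, V)⁄k] Γ(M, V)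
        (formMap (res k h) ω)).toAddMonoidHom).comp (mres M h)
      map_zero' := by ext; simp
      map_add' := fun a b => by ext; simp }
    (fun f ω s => by
      simp [formMap_smul, mres_smul k])

theorem tres_tmul (M : X.Modules) {U V : X.Opens} (h : V ≤ U) (ω : Ω[Γ(X, U)⁄k]) (s : Γ(M, U)) :
    tres k M h (ω ⊗ₜ s) = formMap (res k h) ω ⊗ₜ mres M h s := rfl

variable {k} in
/-- The contraction `Ω¹ ⊗ M → M` with a vector field. -/
def contract (M : X.Modules) {U : X.Opens} (ξ : Vect k U) :
    Ω[Γ(X, U)⁄k] ⊗[Γ(X, U)] Γ(M, U) →ₗ[Γ(X, U)] Γ(M, U) :=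
  (TensorProduct.lid Γ(X, U) Γ(M, U)).toLinearMap ∘ₗ ξ.pair.rTensor Γ(M, U)

/-- `b` is a basis of `M` over the open set `U`: it induces an isomorphism `𝒪_U ^ n ≅ M|_U`. -/
def IsFrame (M : X.Modules) (U : X.Opens) {n : ℕ} (b : Fin n → Γ(M, U)) : Prop :=
  ∀ (V : X.Opens) (h : V ≤ U),
    Function.Bijective fun f : Fin n → Γ(X, V) => ∑ i, f i • mres M h (b i)

/-- `M` is a vector bundle: it is locally free of finite rank. -/
def IsVectorBundle (M : X.Modules) : Prop :=
  ∀ x : X, ∃ (U : X.Opens) (n : ℕ) (b : Fin n → Γ(M, U)), x ∈ U ∧ IsFrame M U b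

/-- `e` generates `M` freely over the open set `U`: it induces an isomorphism `𝒪_U ≅ M|_U`. -/
def IsGenerator (M : X.Modules) (U : X.Opens) (e : Γ(M, U)) : Prop :=
  ∀ (V : X.Opens) (h : V ≤ U), Function.Bijective fun f : Γ(X, V) => f • mres M h e

/-- `M` is a line bundle: it is locally free of rank one. -/
def IsLineBundle (M : X.Modules) : Prop :=
  ∀ x : X, ∃ (U : X.Opens) (e : Γ(M, U)), x ∈ U ∧ IsGenerator M U e

/-- A line bundle `L` with a connection `∇ : L → Ω¹ ⊗ L`. As the sheaves are quasi-coherent, `∇` is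
given by its values on sections over affine open sets. -/
structure LineConn (X : Scheme.{u}) [X.Over (Spec (.of k))] where
  L : X.Modules
  isLineBundle : IsLineBundle L
  conn (U : X.affineOpens) : Γ(L, U.1) →+ Ω[Γ(X, U.1)⁄k] ⊗[Γ(X, U.1)] Γ(L, U.1)
  conn_smul (U : X.affineOpens) (f : Γ(X, U.1)) (s : Γ(L, U.1)) :
    conn U (f • s) = f • conn U s + KaehlerDifferential.D k Γ(X, U.1) f ⊗ₜ s
  conn_res (U V : X.affineOpens) (h : V.1 ≤ U.1) (s : Γ(L, U.1)) :
    conn V (mres L h s) = tres k L h (conn U s)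

variable {k}

/-- A local trivialization of the line bundle, over an affine open set. -/
structure Triv (M : LineConn k X) where
  U : X.affineOpens
  e : Γ(M.L, U.1)
  isGenerator : IsGenerator M.L U.1 e

namespace Triv

variable {M : LineConn k X}

theorem bijective (T : Triv M) : Function.Bijective fun f : Γ(X, T.U.1) => f • T.e := by
  have := T.isGenerator T.U.1 le_rfl
  simpa only [mres_self] using this

/-- The coordinate of a section in a trivialization -/
def coord (T : Triv M) : Γ(M.L, T.U.1) ≃ₗ[Γ(X, T.U.1)] Γ(X, T.U.1) :=
  (LinearEquiv.ofBijective (LinearMap.toSpanSingleton _ _ T.e) T.bijective).symm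

theorem coord_smul_e (T : Triv M) (s : Γ(M.L, T.U.1)) : T.coord s • T.e = s :=
  (LinearEquiv.ofBijective (LinearMap.toSpanSingleton _ _ T.e) T.bijective).apply_symm_apply s

theorem coord_e (T : Triv M) : T.coord T.e = 1 :=
  T.bijective.1 (by simp [coord_smul_e])

/-- The connection form `ω` of the connection in a trivialization, `∇ e = ω ⊗ e`. -/
def form (T : Triv M) : Ω[Γ(X, T.U.1)⁄k] :=
  TensorProduct.rid _ _ (T.coord.toLinearMap.lTensor Ω[Γ(X, T.U.1)⁄k] (M.conn T.U T.e))

theorem eq_form_tmul (T : Triv M) (t : Ω[Γ(X, T.U.1)⁄k] ⊗[Γ(X, T.U.1)] Γ(M.L, T.U.1)) :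
    t = TensorProduct.rid _ _ (T.coord.toLinearMap.lTensor Ω[Γ(X, T.U.1)⁄k] t) ⊗ₜ T.e := by
  induction t using TensorProduct.induction_on with
  | zero => simp
  | add x y hx hy =>
    conv_lhs => rw [hx, hy]
    simp only [map_add, TensorProduct.add_tmul]
  | tmul ω s =>
    simp only [LinearMap.lTensor_tmul, TensorProduct.rid_tmul, LinearEquiv.coe_coe]
    rw [TensorProduct.smul_tmul, coord_smul_e]

theorem conn_e (T : Triv M) : M.conn T.U T.e = T.form ⊗ₜ T.e := T.eq_form_tmul _

theorem form_eq_of_smul (T T' : Triv M) (i : T'.U.1 ≤ T.U.1) (h : Γ(X, T'.U.1)ˣ)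
    (he : T'.e = (h : Γ(X, T'.U.1)) • mres M.L i T.e) :
    T'.form = formMap (res k i) T.form +
      (↑h⁻¹ : Γ(X, T'.U.1)) • KaehlerDifferential.D k _ (h : Γ(X, T'.U.1)) := by
  have h1 : mres M.L i T.e = (↑h⁻¹ : Γ(X, T'.U.1)) • T'.e := by
    rw [he, smul_smul]; simp
  have h2 : M.conn T'.U T'.e = (formMap (res k i) T.form +
      (↑h⁻¹ : Γ(X, T'.U.1)) • KaehlerDifferential.D k _ (h : Γ(X, T'.U.1))) ⊗ₜ T'.e := by
    conv_lhs => rw [he]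
    rw [M.conn_smul, M.conn_res T.U T'.U i, conn_e, tres_tmul, h1, TensorProduct.add_tmul,
      TensorProduct.tmul_smul, smul_smul, TensorProduct.tmul_smul, TensorProduct.smul_tmul']
    simp [TensorProduct.smul_tmul']
  rw [form, h2]
  simp [coord_e]

/-- Restriction of a trivialization -/
def restrict (T : Triv M) (V : X.affineOpens) (h : V.1 ≤ T.U.1) : Triv M where
  U := V
  e := mres M.L h T.e
  isGenerator W hW := by
    simp only [mres_mres]
    exact T.isGenerator W (hW.trans h)

theorem exists_mem (M : LineConn k X) (x : X) : ∃ T : Triv M, x ∈ T.U.1 := by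
  obtain ⟨U, e, hx, he⟩ := M.isLineBundle x
  obtain ⟨V, hV, hxV, hVU⟩ := Opens.isBasis_iff_nbhd.1 X.isBasis_affineOpens hx
  refine ⟨⟨⟨V, hV⟩, mres M.L hVU e, fun W hW => ?_⟩, hxV⟩
  simp only [mres_mres]
  exact he W (hW.trans hVU)

theorem exists_unit (T T' : Triv M) (i : T'.U.1 ≤ T.U.1) :
    ∃ h : Γ(X, T'.U.1)ˣ, T'.e = (h : Γ(X, T'.U.1)) • mres M.L i T.e := by
  obtain ⟨a, ha⟩ := (T.isGenerator T'.U.1 i).2 T'.e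
  obtain ⟨b, hb⟩ := T'.bijective.2 (mres M.L i T.e)
  simp only at ha hb
  refine ⟨⟨a, b, T'.bijective.1 ?_, T'.bijective.1 ?_⟩, ha.symm⟩
  · simp only [mul_smul, one_smul]; rw [hb, ha]
  · simp only [mul_smul, one_smul, mul_comm b a]; rw [hb, ha]

end Triv

end Connections

section ExtendedCurvature

variable (k : Type u) [Field k] (X : Scheme.{u}) [X.Over (Spec (.of k))]

/-- The global sections of the sheaf `𝓕 = Ω¹ / d𝒪` associated with `U ↦ Ω¹(U) / d𝒪(U)`: the
families of elements of its stalks `Ω[𝒪_{X,x}⁄k] / d𝒪_{X,x}` that are locally given by forms. -/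
def FSections : Submodule k (∀ x : X, GenForms k (X.presheaf.stalk x)) where
  carrier := {s | ∀ x : X, ∃ (U : X.Opens) (_ : x ∈ U) (ω : Ω[Γ(X, U)⁄k]),
    ∀ (y : X) (hy : y ∈ U), s y = delta k (formMap (germ k hy) ω)}
  zero_mem' := fun x => ⟨⊤, trivial, 0, fun y hy => by simp⟩
  add_mem' := by
    intro a b ha hb x
    obtain ⟨U, hU, ω, h⟩ := ha x
    obtain ⟨V, hV, η, h'⟩ := hb x
    refine ⟨U ⊓ V, ⟨hU, hV⟩, formMap (res k inf_le_left) ω + formMap (res k inf_le_right) η,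
      fun y hy => ?_⟩
    rw [map_add, map_add, formMap_comp _ _ _ (germ_res k inf_le_left hy),
      formMap_comp _ _ _ (germ_res k inf_le_right hy), Pi.add_apply, h, h']
  smul_mem' := by
    intro c a ha x
    obtain ⟨U, hU, ω, h⟩ := ha x
    exact ⟨U, hU, c • ω, fun y hy => by rw [Pi.smul_apply, h y hy, map_smul, map_smul]⟩

variable {k X} (p : ℕ) [Fact p.Prime] [CharP k p]

theorem germ_kappa_eq (M : LineConn k X) {x : X} (T T' : Triv M) (h : x ∈ T.U.1)
    (h' : x ∈ T'.U.1) : kappa k p (formMap (germ k h) T.form) =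
      kappa k p (formMap (germ k h') T'.form) := by
  have key : ∀ (S S' : Triv M) (i : S'.U.1 ≤ S.U.1) (hx : x ∈ S'.U.1),
      kappa k p (formMap (germ k hx) S'.form) = kappa k p (formMap (germ k (i hx)) S.form) := by
    intro S S' i hx
    obtain ⟨a, ha⟩ := S.exists_unit S' i
    rw [S.form_eq_of_smul S' i a ha, map_add, map_add, formMap_comp _ _ _ (germ_res k i hx),
      ← genFormMap_kappa, ← genFormMap_kappa, kappa_dlog, map_zero, add_zero]
  obtain ⟨V, hV, hxV, hVU⟩ := Opens.isBasis_iff_nbhd.1 X.isBasis_affineOpens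
    (show x ∈ T.U.1 ⊓ T'.U.1 from ⟨h, h'⟩)
  rw [← key T (T.restrict ⟨V, hV⟩ (hVU.trans inf_le_left)) (hVU.trans inf_le_left) hxV]
  exact key T' _ (hVU.trans inf_le_right) hxV

/-- The extended curvature of a line bundle with connection: the section of `𝓕` locally given by
`κ(ω)`, where `ω` is the connection form in a local trivialization. -/
def extCurv (M : LineConn k X) : FSections k X :=
  ⟨fun x => kappa k p (formMap (germ k (Triv.exists_mem M x).choose_spec)
      (Triv.exists_mem M x).choose.form), fun x => by
    obtain ⟨T, hT⟩ := Triv.exists_mem M x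
    obtain ⟨η, hη⟩ := Submodule.mkQ_surjective _ (kappa k p T.form)
    refine ⟨T.U.1, hT, η, fun y hy => ?_⟩
    rw [← genFormMap_delta]
    erw [hη]
    rw [genFormMap_kappa]
    exact germ_kappa_eq p M _ _ _ _⟩

theorem extCurv_apply (M : LineConn k X) (T : Triv M) {x : X} (hx : x ∈ T.U.1) :
    (extCurv p M).1 x = kappa k p (formMap (germ k hx) T.form) :=
  germ_kappa_eq p M _ _ _ _

end ExtendedCurvature

section TwistedDiffOps

variable {k : Type u} [Field k] {X : Scheme.{u}} [X.Over (Spec (.of k))]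

/-- The sections over `U` of the sheaf of twisted differential operators `D_{L^c}`: it is glued from
the algebras `D(V)`, one for each trivialization `e` of `L` over some `V ≤ U`, by the isomorphisms
`f ↦ f`, `ξ ↦ ξ + c ξ(h) / h` for `e' = h e`. -/
def TDO (M : LineConn k X) (c : k) (U : X.Opens) :
    Subring (∀ T : {T : Triv M // T.U.1 ≤ U}, DiffOp k T.1.U.1) where
  carrier := {a | ∀ (T T' : {T : Triv M // T.U.1 ≤ U}) (i : T'.1.U.1 ≤ T.1.U.1)
    (h : Γ(X, T'.1.U.1)ˣ), T'.1.e = (h : Γ(X, T'.1.U.1)) • mres M.L i T.1.e →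
      a T' = DiffOp.glue i h c (a T)}
  zero_mem' := fun T T' i h he => by simp
  one_mem' := fun T T' i h he => by simp
  add_mem' := fun {a b} ha hb T T' i h he => by simp [ha T T' i h he, hb T T' i h he]
  mul_mem' := fun {a b} ha hb T T' i h he => by simp [ha T T' i h he, hb T T' i h he]
  neg_mem' := fun {a} ha T T' i h he => by simp [ha T T' i h he]

/-- A function as a section of `D_{L^c}`. -/
def TDO.fn (M : LineConn k X) (c : k) {U : X.Opens} : Γ(X, U) →+* TDO M c U :=
  RingHom.codRestrict (RingHom.pi fun T => DiffOp.fn.comp (res k T.2).toRingHom) (TDO M c U)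
    (fun f T T' i h he => by
      change DiffOp.fn (res k T'.2 f) = DiffOp.glue i h c (DiffOp.fn (res k T.2 f))
      rw [DiffOp.glue_fn, res_res])

/-- The lift of a vector field `ξ` to `D_{L^c}` defined by the connection `∇`; it is `ξ + c ω(ξ)` in
a trivialization with connection form `ω`. -/
def TDO.vec (M : LineConn k X) (c : k) {U : X.Opens} (ξ : Vect k U) : TDO M c U :=
  ⟨fun T => DiffOp.vec (ξ.restrict T.2) + c • DiffOp.fn ((ξ.restrict T.2).pair T.1.form),
    fun T T' i h he => by
      have e1 : ξ.restrict T'.2 = (ξ.restrict T.2).restrict i := rfl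
      simp only [map_add, map_smul, DiffOp.glue_fn, DiffOp.glue_vec, e1]
      rw [T.1.form_eq_of_smul T'.1 i h he, map_add, Vect.pair_restrict, map_smul, Vect.pair_D,
        map_add, smul_add, smul_eq_mul, add_assoc, add_comm (c • DiffOp.fn (Vect.dlog _ _))]
      rfl⟩

variable (p : ℕ) [Fact p.Prime] [CharP k p]

/-- The section `(c ^ p - c) ∇⁽¹⁾` of the spectrum `Conn_{c ^ p - c}(L⁽¹⁾)` of the center of
`D_{L^c}` is, in a trivialization with connection form `ω`, the character
`ξ ^ p - ξ^[p] ↦ - (c ^ p - c) ω(ξ) ^ p`, `f ^ p ↦ f ^ p`. These are the elements generating its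
kernel. -/
def centralElt {M : LineConn k X} (c : k) (T : Triv M) (ξ : Vect k T.U.1) : DiffOp k T.U.1 :=
  DiffOp.vec ξ ^ p - DiffOp.vec (ξ.pPow p) + (c ^ p - c) • DiffOp.fn (ξ.pair T.form ^ p)

/-- The relations of the central reduction -/
inductive RedRel {M : LineConn k X} (c : k) (T : Triv M) :
    DiffOp k T.U.1 → DiffOp k T.U.1 → Prop
  | central (ξ : Vect k T.U.1) : RedRel c T (centralElt p c T ξ) 0

/-- The central reduction of `D_{L^c}` at `(c ^ p - c) ∇⁽¹⁾`, in a trivialization -/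
abbrev RedLocal {M : LineConn k X} (c : k) (T : Triv M) : Type u := RingQuot (RedRel p c T)

/-- The quotient map to the central reduction -/
abbrev RedLocal.mk {M : LineConn k X} (c : k) (T : Triv M) : DiffOp k T.U.1 →+* RedLocal p c T :=
  RingQuot.mkRingHom (RedRel p c T)

/-- The sections over `U` of the central reduction `D_{L^c, ∇⁽¹⁾}` of `D_{L^c}`: it is glued from
the local central reductions by the gluing isomorphisms of `D_{L^c}`. -/
def Red (M : LineConn k X) (c : k) (U : X.Opens) :
    Subring (∀ T : {T : Triv M // T.U.1 ≤ U}, RedLocal p c T.1) where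
  carrier := {a | ∀ (T T' : {T : Triv M // T.U.1 ≤ U}) (i : T'.1.U.1 ≤ T.1.U.1)
    (h : Γ(X, T'.1.U.1)ˣ), T'.1.e = (h : Γ(X, T'.1.U.1)) • mres M.L i T.1.e →
      ∃ d : DiffOp k T.1.U.1, a T = RedLocal.mk p c T.1 d ∧
        a T' = RedLocal.mk p c T'.1 (DiffOp.glue i h c d)}
  zero_mem' := fun T T' i h he => ⟨0, by simp⟩
  one_mem' := fun T T' i h he => ⟨1, by simp⟩
  add_mem' := fun {a b} ha hb T T' i h he => by
    obtain ⟨d, h1, h2⟩ := ha T T' i h he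
    obtain ⟨d', h1', h2'⟩ := hb T T' i h he
    exact ⟨d + d', by simp [h1, h1'], by simp [h2, h2']⟩
  mul_mem' := fun {a b} ha hb T T' i h he => by
    obtain ⟨d, h1, h2⟩ := ha T T' i h he
    obtain ⟨d', h1', h2'⟩ := hb T T' i h he
    exact ⟨d * d', by simp [h1, h1'], by simp [h2, h2']⟩
  neg_mem' := fun {a} ha T T' i h he => by
    obtain ⟨d, h1, h2⟩ := ha T T' i h he
    exact ⟨-d, by simp [h1], by simp [h2]⟩

/-- The quotient map `D_{L^c} → D_{L^c, ∇⁽¹⁾}` -/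
def TDO.toRed (M : LineConn k X) (c : k) (U : X.Opens) : TDO M c U →+* Red p M c U :=
  RingHom.codRestrict
    ((RingHom.pi fun T => (RedLocal.mk p c T.1).comp (Pi.evalRingHom _ T)).comp (TDO M c U).subtype)
    (Red p M c U) (fun a T T' i h he => ⟨a.1 T, rfl, congrArg _ (a.2 T T' i h he)⟩)

/-- Restriction of sections of `D_{L^c, ∇⁽¹⁾}`. -/
def Red.restrict (M : LineConn k X) (c : k) {U V : X.Opens} (i : V ≤ U) :
    Red p M c U →+* Red p M c V :=
  RingHom.codRestrict ((RingHom.pi fun T : {T : Triv M // T.U.1 ≤ V} =>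
      Pi.evalRingHom (fun T : {T : Triv M // T.U.1 ≤ U} => RedLocal p c T.1)
        ⟨T.1, T.2.trans i⟩).comp (Red p M c U).subtype)
    (Red p M c V) (fun a T T' j h he => a.2 ⟨T.1, _⟩ ⟨T'.1, _⟩ j h he)

end TwistedDiffOps

section Endomorphisms

variable {Y : Scheme.{u}}

/-- The sections over `U` of the sheaf of rings `End(E)`. -/
def EndSec (E : Y.Modules) (U : Y.Opens) :
    Subring (∀ V : {V : Y.Opens // V ≤ U}, Module.End Γ(Y, V.1) Γ(E, V.1)) where
  carrier := {a | ∀ (V W : {V : Y.Opens // V ≤ U}) (i : W.1 ≤ V.1) (s : Γ(E, V.1)),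
    a W (mres E i s) = mres E i (a V s)}
  zero_mem' := fun V W i s => by simp
  one_mem' := fun V W i s => by simp
  add_mem' := fun {a b} ha hb V W i s => by simp [ha V W i, hb V W i]
  mul_mem' := fun {a b} ha hb V W i s => by simp [ha V W i, hb V W i]
  neg_mem' := fun {a} ha V W i s => by simp [ha V W i]

namespace EndSec

variable {E : Y.Modules} {U V : Y.Opens}

/-- The action of a section of `End(E)` on sections of `E`. -/
def act (a : EndSec E U) : Module.End Γ(Y, U) Γ(E, U) := a.1 ⟨U, le_rfl⟩

/-- Restriction of sections of `End(E)`. -/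
def restrict (i : V ≤ U) (a : EndSec E U) : EndSec E V :=
  ⟨fun W => a.1 ⟨W.1, W.2.trans i⟩, fun W W' j s => a.2 ⟨W.1, _⟩ ⟨W'.1, _⟩ j s⟩

end EndSec

end Endomorphisms

section Splittings

variable {k : Type u} [Field k] {X : Scheme.{u}} [X.Over (Spec (.of k))]

namespace LineConn

/-- The map on sections of `Ω¹ ⊗ L` induced by a morphism of sheaves of modules. -/
def formTensor (k : Type u) [Field k] [X.Over (Spec (.of k))] {M N : X.Modules} (f : M ⟶ N)
    (U : X.Opens) :
    Ω[Γ(X, U)⁄k] ⊗[Γ(X, U)] Γ(M, U) →ₗ[Γ(X, U)] Ω[Γ(X, U)⁄k] ⊗[Γ(X, U)] Γ(N, U) :=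
  LinearMap.lTensor Ω[Γ(X, U)⁄k]
    { toFun := f.app U
      map_add' := map_add (f.app U).hom
      map_smul' := fun a s => f.app_smul a s }

/-- Isomorphisms of line bundles with connection. -/
@[ext]
structure Hom (M N : LineConn k X) where
  iso : M.L ≅ N.L
  comm (U : X.affineOpens) (s : Γ(M.L, U.1)) :
    N.conn U (iso.hom.app U.1 s) = formTensor k iso.hom U.1 (M.conn U s)

instance : Category (LineConn k X) where
  Hom := Hom
  id M := ⟨Iso.refl _, fun U s => by
    have : formTensor k (𝟙 M.L) U.1 = LinearMap.id := LinearMap.lTensor_id _ _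
    simp [this]⟩
  comp {M N P} f g := ⟨f.iso ≪≫ g.iso, fun U s => by
    have : formTensor k (f.iso.hom ≫ g.iso.hom) U.1 =
      formTensor k g.iso.hom U.1 ∘ₗ formTensor k f.iso.hom U.1 :=
        TensorProduct.ext' fun ω t => rfl
    simp only [Iso.trans_hom, this, LinearMap.comp_apply, ← f.comm, ← g.comm]
    simp⟩
  id_comp f := by apply Hom.ext; simp
  comp_id f := by apply Hom.ext; simp
  assoc f g h := by apply Hom.ext; simp

end LineConn

variable (p : ℕ) [Fact p.Prime] [CharP k p]

/-- A splitting of the sheaf of algebras `D_{L^c, ∇⁽¹⁾}` on `X⁽¹⁾`: a vector bundle `E` on `X⁽¹⁾`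
with an isomorphism of sheaves of `𝒪_{X⁽¹⁾}`-algebras `D_{L^c, ∇⁽¹⁾} ≅ End(E)`. -/
structure Splitting (M : LineConn k X) (c : k) where
  E : (frobTwist X k p).Modules
  isVectorBundle : IsVectorBundle E
  toEnd (U : (frobTwist X k p).Opens) : Red p M c (relFrob X k p ⁻¹ᵁ U) ≃+* EndSec E U
  toEnd_res {U V : (frobTwist X k p).Opens} (i : V ≤ U)
    (a : Red p M c (relFrob X k p ⁻¹ᵁ U)) :
    toEnd V (Red.restrict p M c ((relFrob X k p).preimage_mono i) a) =
      EndSec.restrict i (toEnd U a)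
  toEnd_scalar (U : (frobTwist X k p).Opens) (f : Γ(frobTwist X k p, U)) (s : Γ(E, U)) :
    EndSec.act (toEnd U (TDO.toRed p M c _ (TDO.fn M c ((relFrob X k p).app U f)))) s = f • s

namespace Splitting

variable {p} {M : LineConn k X} {c : k}

/-- The action of a section of `D_{L^c}` on sections of the splitting bundle. -/
def act (S : Splitting p M c) {U : (frobTwist X k p).Opens}
    (a : TDO M c (relFrob X k p ⁻¹ᵁ U)) : Module.End Γ(frobTwist X k p, U) Γ(S.E, U) :=
  EndSec.act (S.toEnd U (TDO.toRed p M c _ a))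

/-- Isomorphisms of splittings. -/
@[ext]
structure Hom (S S' : Splitting p M c) where
  iso : S.E ≅ S'.E
  comm (U : (frobTwist X k p).Opens) (a : Red p M c (relFrob X k p ⁻¹ᵁ U)) (s : Γ(S.E, U)) :
    iso.hom.app U (EndSec.act (S.toEnd U a) s) = EndSec.act (S'.toEnd U a) (iso.hom.app U s)

instance : Category (Splitting p M c) where
  Hom := Hom
  id S := ⟨Iso.refl _, fun U a s => by simp⟩
  comp f g := ⟨f.iso ≪≫ g.iso, fun U a s => by simp [f.comm, g.comm]⟩
  id_comp f := by apply Hom.ext; simp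
  comp_id f := by apply Hom.ext; simp
  assoc f g h := by apply Hom.ext; simp

end Splitting

/-- An identification of the splitting bundle `E` with the direct image `Fr_* L'`, under which
functions act on `E` by multiplication and the lifts of vector fields act by `∇'`. -/
structure Identification {M : LineConn k X} {c : k} (S : Splitting p M c) (N : LineConn k X) where
  iso (U : (frobTwist X k p).Opens) : Γ(S.E, U) ≃+ Γ(N.L, relFrob X k p ⁻¹ᵁ U)
  iso_res {U V : (frobTwist X k p).Opens} (i : V ≤ U) (s : Γ(S.E, U)) :
    iso V (mres S.E i s) = mres N.L ((relFrob X k p).preimage_mono i) (iso U s)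
  iso_fn (U : (frobTwist X k p).Opens) (f : Γ(X, relFrob X k p ⁻¹ᵁ U)) (s : Γ(S.E, U)) :
    iso U (S.act (TDO.fn M c f) s) = f • iso U s
  iso_vec (U : (frobTwist X k p).Opens) (hU : IsAffineOpen (relFrob X k p ⁻¹ᵁ U))
    (ξ : Vect k (relFrob X k p ⁻¹ᵁ U)) (s : Γ(S.E, U)) :
    iso U (S.act (TDO.vec M c ξ) s) = contract N.L ξ (N.conn ⟨_, hU⟩ (iso U s))

/-- The groupoid of line bundles with connection whose extended curvature is `α`. -/
abbrev LineConnWithCurv (α : FSections k X) :=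
  ObjectProperty.FullSubcategory fun N : LineConn k X => extCurv p N = α

end Splittings
end
end PCurv

open PCurv

/-! On a pair `(L', ∇')` the lift of a vector field `ξ` is to act as `∇'_ξ`. In trivializations with
connection forms `ω` of `∇` and `ω'` of `∇'`, the field `ξ` of the local algebra then acts on
functions as `ξ + η(ξ)`, where `η = ω' - cω`. The commutator relation requires `dη = 0`. By
Jacobson's formula for the `p`-th power of `ξ + η(ξ)`, the central relation requires `ξ^(p-1)(η(ξ))
- η(ξ^[p]) = c ω(ξ)^p - ω'(ξ)^p`.

Both `dη` and the left side of the second equation depend only on `η` modulo exact forms. The values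
of `C⁻¹` are closed, and Katz's formula (`katzMap_invCartier`) says that the left side takes the
value `-θ(ξ)^p` on `C⁻¹(θ)`. Since `κ(ω') = c κ(ω)` means `δ(η) = C⁻¹(ω') - c C⁻¹(ω)`, it implies
the two equations (`katz_of_kappa`, `curl_of_kappa`). Conversely, Cartier's theorem
(`Coordinates.exists_delta_eq_invCartier`) writes a closed `η` as `C⁻¹(θ)` modulo exact forms, and
the second equation then determines `θ` (`kappa_of_katz`). So the curvature equation says exactly
that the central reduction acts on `L'`.

From a pair to a splitting: the action maps the central reduction to the endomorphisms of `L'`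
linear over `p`-th powers, that is, to the endomorphisms of `Fr_* L'`. The direct image is a vector
bundle because the monomials in local coordinates with exponents below `p` form a `p`-basis
(`isVectorBundle_pushforward`). The map is bijective (`rep_bijective`): commutators with the
coordinates lower the order in the `∂_i`, which gives injectivity, and they are nilpotent on
endomorphisms, which gives surjectivity.

From a splitting to a pair: `E` is a module over the functions and lifts contained in the algebra.
The point that is not formal is that it has rank one over `X` (`Splitting.isLineBundle_bundle`). At
a closed point the algebra is represented on functions modulo `p`-th powers of the maximal ideal
(`exists_fiber`); comparison with the matrix units of `End(E)` yields a cyclic vector of `E`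
(`Splitting.exists_cyclic`), and this vector is free because functions act faithfully.

Morphisms on the two sides agree because functions and lifts generate the algebra locally. As `k` is
perfect, `X⁽¹⁾ → X` is an isomorphism of schemes, and objects on `X⁽¹⁾` are handled through open
sets of `X` and `p`-th powers. -/

namespace PCurv
noncomputable section

/-! ### Jacobson's formula in noncommutative rings of characteristic `p` -/

section Jacobson

theorem pow_mul_eq_sum_choose {R : Type*} [Ring R] {x : R} {y : ℕ → R}
    (h : ∀ i, x * y i = y i * x + y (i + 1)) (n : ℕ) :
    x ^ n * y 0 = ∑ j ∈ Finset.range (n + 1), (n.choose j : R) * (y j * x ^ (n - j)) := by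
  -- The induction needs every starting index, because a commutator with `x` replaces `y m` by `y (m
  -- + 1)`.
  have key : ∀ n m, x ^ n * y m = ∑ ij ∈ Finset.HasAntidiagonal.antidiagonal n,
      n.choose ij.1 • (y (m + ij.1) * x ^ ij.2) := by
    intro n
    induction n with
    | zero => simp
    | succ n ih =>
      intro m
      rw [Finset.sum_antidiagonal_choose_succ_nsmul (fun i j => y (m + i) * x ^ j), pow_succ,
        mul_assoc, h, mul_add, ← mul_assoc, ih, ih, Finset.sum_mul]
      congr 1
      · refine Finset.sum_congr rfl fun ij _ => ?_
        rw [smul_mul_assoc, mul_assoc, pow_succ]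
      · refine Finset.sum_congr rfl fun ij hij => ?_
        have hs : n.choose ij.2 = n.choose ij.1 := Nat.choose_symm_of_eq_add (by
          have := Finset.HasAntidiagonal.mem_antidiagonal.1 hij; omega)
        rw [hs, add_right_comm, add_assoc]
  rw [key n 0, Finset.Nat.sum_antidiagonal_eq_sum_range_succ
    (fun i j => n.choose i • (y (0 + i) * x ^ j))]
  simp

/-- After every `x ^ i` is moved past `y 0`, the coefficient of `y j * x ^ (p - 1 - j)` is `∑ i,
i.choose j = p.choose (j + 1)`, a multiple of `p` unless `j = p - 1`. -/
theorem sum_pow_mul_pow_eq {R : Type*} [Ring R] {p : ℕ} [Fact p.Prime] (hp : (p : R) = 0)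
    {x : R} {y : ℕ → R} (h : ∀ i, x * y i = y i * x + y (i + 1)) :
    ∑ i ∈ Finset.range p, x ^ i * y 0 * x ^ (p - 1 - i) = y (p - 1) := by
  have hp1 := (Fact.out : p.Prime).one_le
  have e1 : ∀ i ∈ Finset.range p, x ^ i * y 0 * x ^ (p - 1 - i) =
      ∑ j ∈ Finset.range p, (i.choose j : R) * (y j * x ^ (p - 1 - j)) := by
    intro i hi
    have hi := Finset.mem_range.1 hi
    rw [pow_mul_eq_sum_choose h, Finset.sum_mul,
      ← Finset.sum_subset (Finset.range_subset_range.2 (by omega : i + 1 ≤ p))]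
    · refine Finset.sum_congr rfl fun j hj => ?_
      have := Finset.mem_range.1 hj
      rw [mul_assoc, mul_assoc, ← pow_add, show i - j + (p - 1 - i) = p - 1 - j by omega]
    · intro j _ hj
      rw [Nat.choose_eq_zero_of_lt (by simpa using hj)]
      simp
  rw [Finset.sum_congr rfl e1, Finset.sum_comm]
  have e2 : ∀ j, ∑ i ∈ Finset.range p, (i.choose j : R) = ((p.choose (j + 1) : ℕ) : R) := by
    intro j
    rw [← Nat.cast_sum]
    congr 1
    clear * -
    induction p with
    | zero => simp
    | succ n ih => rw [Finset.sum_range_succ, ih, Nat.choose_succ_succ n j, add_comm]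
  simp only [← Finset.sum_mul, e2]
  rw [Finset.sum_eq_single_of_mem (p - 1) (Finset.mem_range.2 (by omega))]
  · simp [Nat.sub_add_cancel hp1]
  · intro j hj hj'
    have := Finset.mem_range.1 hj
    obtain ⟨m, hm⟩ := (Fact.out : p.Prime).dvd_choose_self (k := j + 1) (by omega) (by omega)
    rw [hm, Nat.cast_mul, hp]
    simp

theorem derivative_pow_eq_sum {R : Type*} [Ring R] (P : Polynomial R) (n : ℕ) :
    Polynomial.derivative (P ^ n) =
      ∑ i ∈ Finset.range n, P ^ i * Polynomial.derivative P * P ^ (n - 1 - i) := by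
  induction n with
  | zero => simp
  | succ n ih =>
    rw [pow_succ, Polynomial.derivative_mul, ih, Finset.sum_range_succ, Finset.sum_mul]
    congr 1
    · refine Finset.sum_congr rfl fun i hi => ?_
      have := Finset.mem_range.1 hi
      rw [mul_assoc, ← pow_succ, show n - 1 - i + 1 = n + 1 - 1 - i by omega]
    · simp

theorem eq_zero_of_natCast_mul_eq_zero {R : Type*} [Ring R] {p : ℕ} [Fact p.Prime]
    (hp : (p : R) = 0) {m : ℕ} (hm : ¬ p ∣ m) {r : R} (h : (m : R) * r = 0) : r = 0 := by
  have hc : Nat.Coprime m p := ((Nat.Prime.coprime_iff_not_dvd Fact.out).2 hm).symm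
  have := Nat.isCoprime_iff_coprime.2 hc
  obtain ⟨a, b, hab⟩ := this
  have : ((a * m + b * p : ℤ) : R) * r = r := by rw [hab]; simp
  rw [← this]
  push_cast
  rw [hp, mul_zero, add_zero, mul_assoc, h, mul_zero]

/-- Jacobson's formula for the `p`-th power of `D + f`, where `f` commutes with its iterated
commutators with `D`. -/
theorem add_pow_prime_of_commutator {R : Type*} [Ring R] {p : ℕ} [Fact p.Prime] (hp : (p : R) = 0)
    {D : R} {f : ℕ → R} (h : ∀ i, D * f i = f i * D + f (i + 1))
    (hc : ∀ i j, Commute (f i) (f j)) : (D + f 0) ^ p = D ^ p + f (p - 1) + f 0 ^ p := by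
  have hp2 := (Fact.out : p.Prime).two_le
  -- Deformation to `D + f 0 * t`: by `sum_pow_mul_pow_eq` the `t`-derivative of its `p`-th power is
  -- the constant `f (p - 1)`, so only the coefficients in degrees `0`, `1` and `p` survive. The
  -- formula is the value at `t = 1`.
  let P : Polynomial R := Polynomial.C D + Polynomial.C (f 0) * Polynomial.X
  have hP : ∀ i, P * Polynomial.C (f i) = Polynomial.C (f i) * P + Polynomial.C (f (i + 1)) := by
    intro i
    simp only [P, add_mul, mul_add, ← Polynomial.C_mul, h, mul_assoc, Polynomial.X_mul_C]
    rw [← mul_assoc, ← mul_assoc, ← Polynomial.C_mul, ← Polynomial.C_mul, (hc 0 i).eq,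
      Polynomial.C_add]
    abel
  have hd : Polynomial.derivative (P ^ p) = Polynomial.C (f (p - 1)) := by
    rw [derivative_pow_eq_sum,
      ← sum_pow_mul_pow_eq (by rw [← Polynomial.C_eq_natCast, hp, Polynomial.C_0]) hP]
    simp [P]
  have hco : ∀ k, (P ^ p).coeff (k + 1) * ((k + 1 : ℕ) : R) =
      if k = 0 then f (p - 1) else 0 := by
    intro k
    have := congrArg (fun Q => Polynomial.coeff Q k) hd
    simpa [Polynomial.coeff_derivative, Polynomial.coeff_C] using this
  have hdeg : P.natDegree ≤ 1 := by
    simp only [P]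
    rw [add_comm]
    exact Polynomial.natDegree_linear_le
  have h0 : (P ^ p).coeff 0 = D ^ p := by
    have := map_pow (Polynomial.constantCoeff (R := R)) P p
    simpa [P] using this
  have h1 : (P ^ p).coeff 1 = f (p - 1) := by simpa using hco 0
  have hpp : (P ^ p).coeff p = f 0 ^ p := by
    have := Polynomial.coeff_pow_of_natDegree_le (m := p) hdeg
    simpa [P] using this
  have hk : ∀ k, 2 ≤ k → k < p → (P ^ p).coeff k = 0 := by
    intro k hk hk'
    have := hco (k - 1)
    rw [if_neg (by omega), Nat.sub_add_cancel (by omega), ← (Nat.cast_commute k _).eq] at this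
    exact eq_zero_of_natCast_mul_eq_zero hp (Nat.not_dvd_of_pos_of_lt (by omega) hk') this
  -- Evaluation at `1` is multiplicative although `R` is not commutative, because `1` is central.
  let ev := Polynomial.eval₂RingHom' (RingHom.id R) 1 (fun a => Commute.one_right a)
  have hev : ev P = D + f 0 := by
    simp [ev, P]
  rw [← hev, ← map_pow]
  change Polynomial.eval₂ (RingHom.id R) 1 (P ^ p) = _
  have hdegp : (P ^ p).natDegree < p + 1 := Nat.lt_succ_of_le
    (Polynomial.natDegree_pow_le_of_le p hdeg |>.trans (by simp))
  rw [Polynomial.eval₂_eq_sum_range' _ hdegp, Finset.sum_range_succ, hpp]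
  simp only [RingHom.id_apply, one_pow, mul_one]
  congr 1
  rw [← Finset.sum_subset (s₁ := Finset.range 2) (Finset.range_subset_range.2 hp2)]
  · rw [Finset.sum_range_succ, Finset.sum_range_one, h0, h1]
  · intro k hk' hk''
    exact hk k (by rw [Finset.mem_range] at hk''; omega) (by simpa using hk')

end Jacobson

/-! ### Identities of Hochschild and Katz for `p`-th iterates of derivations -/

section Katz

variable {k : Type u} [Field k] {A : Type u} [CommRing A] [Algebra k A]
variable {p : ℕ} [Fact p.Prime]

theorem add_pow_prime_of_derivation {R : Type*} [Ring R] (hp : (p : A) = 0) (ι : A →+* R) (D : R)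
    (ξ : Derivation k A A) (h : ∀ a, D * ι a = ι a * D + ι (ξ a)) (f : A) :
    (D + ι f) ^ p = D ^ p + ι (ξ^[p - 1] f) + ι (f ^ p) := by
  have hR : (p : R) = 0 := by rw [← map_natCast ι, hp, map_zero]
  have := add_pow_prime_of_commutator hR (D := D) (f := fun i => ι (ξ^[i] f))
    (fun i => by rw [h, Function.iterate_succ_apply'])
    (fun i j => by
      change ι _ * ι _ = ι _ * ι _
      rw [← map_mul, mul_comm, map_mul])
  rw [map_pow]
  exact this

/-- As operators on `A`, `h⁻¹ ∘ ξ ∘ h = ξ + ξ(h) / h`. Take `p`-th powers by Jacobson's formula and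
apply both sides to `1`. -/
theorem iterate_derivation_dlog (hp : (p : A) = 0) (ξ : Derivation k A A) (h : Aˣ) :
    (↑h⁻¹ : A) * ξ^[p] (h : A) =
      ξ^[p - 1] ((↑h⁻¹ : A) * ξ (h : A)) + ((↑h⁻¹ : A) * ξ (h : A)) ^ p := by
  let R := Module.End k A
  let D : R := (ξ : A →ₗ[k] A)
  let ι : A →+* R := (Algebra.lmul k A).toRingHom
  have key := add_pow_prime_of_derivation hp ι D ξ (fun a => by
    ext b
    change ξ (a * b) = a * ξ b + ξ a * b
    rw [Derivation.leibniz, smul_eq_mul, smul_eq_mul, mul_comm b]) ((↑h⁻¹ : A) * ξ (h : A))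
  have conj : ∀ n (a : A), ((D + ι ((↑h⁻¹ : A) * ξ (h : A))) ^ n) a =
      (↑h⁻¹ : A) * ξ^[n] ((h : A) * a) := by
    intro n
    induction n with
    | zero =>
      intro a
      rw [pow_zero]
      exact (h.inv_mul_cancel_left a).symm
    | succ n ih =>
      intro a
      rw [pow_succ, Module.End.mul_apply, ih, Function.iterate_succ_apply]
      congr 2
      change (h : A) * (ξ a + (↑h⁻¹ : A) * ξ (h : A) * a) = _
      rw [Derivation.leibniz, smul_eq_mul, smul_eq_mul, mul_add, ← mul_assoc, ← mul_assoc,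
        Units.mul_inv, one_mul, mul_comm a]
  have h1 := congrArg (fun φ : R => φ 1) key
  simp only [conj, mul_one] at h1
  rw [h1]
  have h2 : (D ^ p) (1 : A) = 0 := by
    have hp' : p - 1 + 1 = p := Nat.succ_pred_prime Fact.out
    rw [← hp', pow_succ, Module.End.mul_apply]
    change (D ^ (p - 1)) (ξ 1) = 0
    simp
  change (D ^ p) 1 + _ * 1 + _ * 1 = _
  rw [h2, zero_add, mul_one, mul_one]

/-- A derivation acting on the coefficients of power series. -/
def powerSeriesDerivation (ξ : Derivation k A A) :
    Derivation k (PowerSeries A) (PowerSeries A) :=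
  Derivation.mk'
    { toFun := fun f => PowerSeries.mk fun n => ξ (PowerSeries.coeff n f)
      map_add' := fun f g => by ext; simp
      map_smul' := fun a f => by ext; simp }
    (fun f g => by
      ext n
      simp only [LinearMap.coe_mk, AddHom.coe_mk, PowerSeries.coeff_mk, PowerSeries.coeff_mul,
        map_sum, Derivation.leibniz, smul_eq_mul, map_add, Finset.sum_add_distrib]
      congr 1
      rw [← Finset.Nat.sum_antidiagonal_swap]
      rfl)

theorem coeff_powerSeriesDerivation (ξ : Derivation k A A) (n : ℕ) (f : PowerSeries A) :
    PowerSeries.coeff n (powerSeriesDerivation ξ f) = ξ (PowerSeries.coeff n f) :=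
  PowerSeries.coeff_mk n fun n => ξ (PowerSeries.coeff n f)

theorem coeff_iterate_powerSeriesDerivation (ξ : Derivation k A A) (m n : ℕ) (f : PowerSeries A) :
    PowerSeries.coeff n ((powerSeriesDerivation ξ)^[m] f) = ξ^[m] (PowerSeries.coeff n f) := by
  induction m generalizing f with
  | zero => rfl
  | succ m ih => rw [Function.iterate_succ_apply, ih, coeff_powerSeriesDerivation]; rfl

theorem derivation_pow_mul {q : ℕ} (hq : (q : A) = 0) (ξ : Derivation k A A) (a b : A) :
    ξ (a ^ q * b) = a ^ q * ξ b := by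
  rw [Derivation.leibniz, Derivation.leibniz_pow, ← Nat.cast_smul_eq_nsmul A, hq]
  simp

theorem iterate_derivation_pow_mul {q : ℕ} (hq : (q : A) = 0) (ξ : Derivation k A A) (n : ℕ)
    (a b : A) : ξ^[n] (a ^ q * b) = a ^ q * ξ^[n] b := by
  induction n generalizing b with
  | zero => rfl
  | succ n ih => rw [Function.iterate_succ_apply, derivation_pow_mul hq, ih]; rfl

/-- This is `iterate_derivation_dlog` multiplied by `h ^ p`, which is a constant for `ξ`. -/
theorem iterate_derivation_pow_pred_mul_of_unit (hp : (p : A) = 0) (ξ : Derivation k A A) (h : Aˣ) :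
    ξ^[p - 1] ((h : A) ^ (p - 1) * ξ h) = (h : A) ^ (p - 1) * ξ^[p] (h : A) - ξ (h : A) ^ p := by
  have hp' : p - 1 + 1 = p := Nat.succ_pred_prime Fact.out
  have e : ∀ b : A, (h : A) ^ p * ((↑h⁻¹ : A) * b) = (h : A) ^ (p - 1) * b := fun b => by
    rw [← mul_assoc]
    congr 1
    rw [← hp', pow_succ, mul_assoc, Units.mul_inv, mul_one, add_tsub_cancel_right]
  have := congrArg ((h : A) ^ p * ·) (iterate_derivation_dlog hp ξ h)
  rw [e, mul_add, ← iterate_derivation_pow_mul hp, e, ← mul_pow, Units.mul_inv_cancel_left] at this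
  rw [this, add_sub_cancel_right]

/-- Hochschild's identity. -/
theorem iterate_derivation_pow_pred_mul (hp : (p : A) = 0) (ξ : Derivation k A A) (g : A) :
    ξ^[p - 1] (g ^ (p - 1) * ξ g) = g ^ (p - 1) * ξ^[p] g - ξ g ^ p := by
  have hp1 : p - 1 + 1 = p := Nat.succ_pred_prime Fact.out
  -- Reduction to units: the identity for the unit `1 + g X` of the power series ring, with `ξ`
  -- acting on coefficients, gives the identity for `g` in the coefficient of `X ^ p`.
  let P : Polynomial A := Polynomial.C g * Polynomial.X + 1
  let H : PowerSeries A := P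
  have hH : H = PowerSeries.C g * PowerSeries.X + 1 := by simp [H, P]
  have hu : IsUnit H := by
    rw [PowerSeries.isUnit_iff_constantCoeff, hH]
    simp
  have hc : ∀ n, PowerSeries.coeff n H = if n = 0 then 1 else if n = 1 then g else 0 := by
    intro n
    rw [hH]
    rcases n with _ | _ | n
    · simp
    · simp [PowerSeries.coeff_one]
    · simp [PowerSeries.coeff_one]
  have hpS : (p : PowerSeries A) = 0 := by
    rw [← map_natCast (PowerSeries.C (R := A)), hp, map_zero]
  have hi : ∀ m, 0 < m → (powerSeriesDerivation ξ)^[m] H = PowerSeries.C (ξ^[m] g) * PowerSeries.X := by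
    intro m hm
    ext n
    rw [coeff_iterate_powerSeriesDerivation, hc]
    obtain ⟨m, rfl⟩ : ∃ l, m = l + 1 := ⟨m - 1, by omega⟩
    rcases n with _ | _ | n
    · simp
    · simp
    · simp
  have hdeg : P.natDegree ≤ 1 := Polynomial.natDegree_linear_le
  have hcP : PowerSeries.coeff (p - 1) (H ^ (p - 1)) = g ^ (p - 1) := by
    have := Polynomial.coeff_pow_of_natDegree_le (m := p - 1) hdeg
    simp only [H]
    rw [← Polynomial.coe_pow, Polynomial.coeff_coe]
    simpa [P, Polynomial.coeff_one] using this
  have hcm : ∀ b : A, PowerSeries.coeff p (H ^ (p - 1) * (PowerSeries.C b * PowerSeries.X)) =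
      g ^ (p - 1) * b := by
    intro b
    rw [← mul_assoc]
    conv_lhs => rw [← hp1]
    rw [PowerSeries.coeff_succ_mul_X, PowerSeries.coeff_mul_C]
    simp only [add_tsub_cancel_right]
    rw [hcP]
  obtain ⟨h, hh⟩ := hu
  have := iterate_derivation_pow_pred_mul_of_unit hpS (powerSeriesDerivation ξ) h
  rw [hh] at this
  have h1 : powerSeriesDerivation ξ H = PowerSeries.C (ξ g) * PowerSeries.X := hi 1 one_pos
  rw [h1, hi p (Fact.out : p.Prime).pos] at this
  have := congrArg (PowerSeries.coeff p) this
  rw [coeff_iterate_powerSeriesDerivation, hcm, map_sub, hcm, mul_pow, ← map_pow,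
    PowerSeries.coeff_C_mul_X_pow, if_pos rfl] at this
  exact this

variable [CharP k p]

variable (p) in
/-- The map on forms modulo exact forms induced by `η ↦ ξ ^ (p - 1) (η(ξ)) - η(ξ ^ p)`. -/
def katzMap (ξ : Derivation k A A) : GenForms k A →ₗ[k] A :=
  Submodule.liftQ _
    (((ξ : A →ₗ[k] A) ^ (p - 1)) ∘ₗ (ξ.liftKaehlerDifferential.restrictScalars k) -
      (derivationPow p ξ).liftKaehlerDifferential.restrictScalars k) (by
    -- On `da` both terms are the `p`-th iterate of `ξ` at `a`.
    rintro _ ⟨a, rfl⟩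
    have hp1 : p - 1 + 1 = p := Nat.succ_pred_prime Fact.out
    simp only [LinearMap.mem_ker, LinearMap.sub_apply, LinearMap.comp_apply,
      LinearMap.restrictScalars_apply, Derivation.coeFn_coe,
      Derivation.liftKaehlerDifferential_comp_D, derivationPow_apply]
    rw [Module.End.pow_apply, sub_eq_zero]
    conv_rhs => rw [← hp1, Function.iterate_succ_apply]
    rfl)

theorem katzMap_delta (ξ : Derivation k A A) (η : Ω[A⁄k]) : katzMap p ξ (delta k η) =
    ξ^[p - 1] (ξ.liftKaehlerDifferential η) - (derivationPow p ξ).liftKaehlerDifferential η := by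
  change (((ξ : A →ₗ[k] A) ^ (p - 1)) (ξ.liftKaehlerDifferential η)) - _ = _
  rw [Module.End.pow_apply]
  rfl

/-- Katz's formula. On `f ^ p g ^ (p - 1) dg` the factor `f ^ p` is constant for `ξ`, and by
Hochschild's identity the term `g ^ (p - 1) ξ^[p](g)` cancels. -/
theorem katzMap_invCartier (ξ : Derivation k A A) (θ : Ω[A⁄k]) :
    katzMap p ξ (invCartier k p θ) = - ξ.liftKaehlerDifferential θ ^ p := by
  have hp : (p : A) = 0 := cast_eq_zero_of_charP k A p
  induction θ using form_induction with
  | h0 => simp [(Fact.out : p.Prime).ne_zero]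
  | hadd x y hx hy =>
    rw [map_add, map_add, hx, hy, map_add, add_pow_of_cast_eq_zero hp, neg_add]
  | hD f g =>
    rw [invCartier_smul_D, katzMap_delta]
    simp only [map_smul, Derivation.liftKaehlerDifferential_comp_D, smul_eq_mul,
      derivationPow_apply]
    rw [iterate_derivation_pow_mul hp, iterate_derivation_pow_pred_mul hp, mul_pow]
    ring

/-- The map on forms modulo exact forms induced by `η ↦ dη(ξ, ζ)`. -/
def curlMap (ξ ζ : Derivation k A A) : GenForms k A →ₗ[k] A :=
  Submodule.liftQ _
    ((ξ : A →ₗ[k] A) ∘ₗ (ζ.liftKaehlerDifferential.restrictScalars k) -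
      (ζ : A →ₗ[k] A) ∘ₗ (ξ.liftKaehlerDifferential.restrictScalars k) -
      (⁅ξ, ζ⁆).liftKaehlerDifferential.restrictScalars k) (by
    rintro _ ⟨a, rfl⟩
    simp [Derivation.commutator_apply])

theorem curlMap_delta (ξ ζ : Derivation k A A) (η : Ω[A⁄k]) : curlMap ξ ζ (delta k η) =
    ξ (ζ.liftKaehlerDifferential η) - ζ (ξ.liftKaehlerDifferential η) -
      (⁅ξ, ζ⁆).liftKaehlerDifferential η := rfl

/-- The values of `C⁻¹` are closed, since `d(f ^ p g ^ (p - 1) dg) = f ^ p d(g ^ (p - 1)) ∧ dg = 0`.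
-/
theorem curlMap_invCartier (ξ ζ : Derivation k A A) (θ : Ω[A⁄k]) :
    curlMap ξ ζ (invCartier k p θ) = 0 := by
  have hp : (p : A) = 0 := cast_eq_zero_of_charP k A p
  induction θ using form_induction with
  | h0 => simp
  | hadd x y hx hy => rw [map_add, map_add, hx, hy, add_zero]
  | hD f g =>
    rw [invCartier_smul_D, curlMap_delta]
    simp only [map_smul, Derivation.liftKaehlerDifferential_comp_D, smul_eq_mul,
      Derivation.commutator_apply, derivation_pow_mul hp, Derivation.leibniz,
      Derivation.leibniz_pow, nsmul_eq_mul]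
    ring

end Katz
end
end PCurv

namespace PCurv
noncomputable section

/-! ### Local coordinates and reducedness of smooth algebras -/

section Coordinates

/-- Local coordinates on a `k`-algebra: functions whose differentials form a basis of the module of
differentials, with the dual derivations. -/
structure Coordinates (k : Type u) [Field k] (A : Type u) [CommRing A] [Algebra k A] (n : ℕ) where
  x : Fin n → A
  d : Fin n → Derivation k A A
  d_x (i j : Fin n) : d i (x j) = if i = j then 1 else 0
  D_eq_sum (a : A) : KaehlerDifferential.D k A a = ∑ i, d i a • KaehlerDifferential.D k A (x i)

variable {k : Type u} [Field k] {A : Type u} [CommRing A] [Algebra k A]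

theorem exists_etale_of_isStandardSmooth [Algebra.IsStandardSmooth k A] :
    ∃ (n : ℕ) (_ : Algebra (MvPolynomial (Fin n) k) A)
      (_ : IsScalarTower k (MvPolynomial (Fin n) k) A), Algebra.Etale (MvPolynomial (Fin n) k) A := by
  obtain ⟨n, g, hg, hg'⟩ := RingHom.IsStandardSmooth.exists_etale_mvPolynomial
    (RingHom.isStandardSmooth_algebraMap.2 ‹Algebra.IsStandardSmooth k A›)
  let := g.toAlgebra
  exact ⟨n, this, IsScalarTower.of_algebraMap_eq' hg.symm, hg'⟩

/-- An étale algebra over a polynomial ring is flat, so it embeds in its base change to the fraction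
field, and an unramified algebra over a field is reduced. -/
theorem isReduced_of_isStandardSmooth [Algebra.IsStandardSmooth k A] : IsReduced A := by
  obtain ⟨n, _, _, _⟩ := exists_etale_of_isStandardSmooth (k := k) (A := A)
  let P := MvPolynomial (Fin n) k
  let K := FractionRing P
  have : IsReduced (K ⊗[P] A) := Algebra.FormallyUnramified.isReduced_of_field K _
  have hinj : Function.Injective (Algebra.TensorProduct.includeRight : A →ₐ[P] K ⊗[P] A) :=
    Algebra.TensorProduct.includeRight_injective (IsFractionRing.injective P K)
  exact isReduced_of_injective _ hinj

/-- Along an étale map from affine space the differentials of the variables remain a basis; the dual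
basis gives the derivations. -/
theorem exists_coordinates_of_isStandardSmooth [Algebra.IsStandardSmooth k A] :
    ∃ n, Nonempty (Coordinates k A n) := by
  obtain ⟨n, _, _, _⟩ := exists_etale_of_isStandardSmooth (k := k) (A := A)
  let P := MvPolynomial (Fin n) k
  let b : Module.Basis (Fin n) A Ω[A⁄k] := ((KaehlerDifferential.mvPolynomialBasis k (Fin n)).baseChange A).map
    (KaehlerDifferential.tensorKaehlerEquivOfFormallyEtale k P A)
  have hb : ∀ i, b i = KaehlerDifferential.D k A (algebraMap P A (MvPolynomial.X i)) := fun i => by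
    simp [b, P]
  refine ⟨n, ⟨fun i => algebraMap P A (MvPolynomial.X i),
    fun i => (b.coord i).compDer (KaehlerDifferential.D k A), fun i j => ?_, fun a => ?_⟩⟩
  · simp [← hb, Finsupp.single_apply, eq_comm]
  · simp only [← hb]
    exact (b.sum_repr _).symm

theorem exists_coordinates_away [Algebra.Smooth k A] (q : Ideal A) [q.IsPrime] :
    ∃ (f : A) (n : ℕ), f ∉ q ∧ Nonempty (Coordinates k (Localization.Away f) n) := by
  obtain ⟨f, hf, h⟩ := Algebra.IsSmoothAt.exists_notMem_isStandardSmooth k q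
  obtain ⟨n, hn⟩ := exists_coordinates_of_isStandardSmooth (k := k) (A := Localization.Away f)
  exact ⟨f, n, hf, hn⟩

/-- The annihilator of a nonzero nilpotent `a` would lie in a maximal ideal `q`. But `a` dies in a
standard smooth localization at some `f ∉ q`, so a power of `f` annihilates it. -/
theorem isReduced_of_smooth (k : Type u) [Field k] {A : Type u} [CommRing A] [Algebra k A]
    [Algebra.Smooth k A] : IsReduced A := by
  constructor
  intro a ha
  by_contra h0
  have hI : Ideal.span {a} ≠ ⊥ := by simpa using h0
  have hann : (⊥ : Ideal A).colon {a} ≠ ⊤ := by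
    rw [Ne, Ideal.eq_top_iff_one, Submodule.mem_colon_singleton]
    simpa using h0
  obtain ⟨q, hq, hle⟩ := Ideal.exists_le_maximal _ hann
  obtain ⟨f, hf, h⟩ := Algebra.IsSmoothAt.exists_notMem_isStandardSmooth k q
  have := isReduced_of_isStandardSmooth (k := k) (A := Localization.Away f)
  have h1 : algebraMap A (Localization.Away f) a = 0 := (ha.map _).eq_zero
  rw [IsLocalization.map_eq_zero_iff (Submonoid.powers f)] at h1
  obtain ⟨⟨_, m, rfl⟩, hm⟩ := h1
  exact hf (hq.isPrime.mem_of_pow_mem m (hle (Submodule.mem_colon_singleton.2 (by simpa using hm))))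

variable {n : ℕ}

namespace Coordinates

theorem derivation_eq (X : Coordinates k A n) (ξ : Derivation k A A) (a : A) :
    ξ a = ∑ i, ξ (X.x i) * X.d i a := by
  have := congrArg ξ.liftKaehlerDifferential (X.D_eq_sum a)
  simpa [mul_comm] using this

theorem form_eq (X : Coordinates k A n) (η : Ω[A⁄k]) :
    η = ∑ i, (X.d i).liftKaehlerDifferential η • KaehlerDifferential.D k A (X.x i) := by
  induction η using form_induction with
  | h0 => simp
  | hadd x y hx hy =>
    conv_lhs => rw [hx, hy]
    simp [add_smul, Finset.sum_add_distrib]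
  | hD f g =>
    conv_lhs => rw [X.D_eq_sum g]
    simp [Finset.smul_sum, mul_smul]

theorem derivation_ext (X : Coordinates k A n) {ξ ζ : Derivation k A A}
    (h : ∀ i, ξ (X.x i) = ζ (X.x i)) : ξ = ζ := by
  ext a
  rw [X.derivation_eq ξ, X.derivation_eq ζ]
  simp [h]

/-- A derivation is determined by its values on the coordinates, and each `X.d i` takes these to the
constants `0` and `1`. The same reason makes the `p`-th power vanish in `d_pow`. -/
theorem d_comm (X : Coordinates k A n) (i j : Fin n) : ⁅X.d i, X.d j⁆ = 0 := by
  refine X.derivation_ext fun l => ?_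
  simp only [Derivation.commutator_apply, X.d_x, Derivation.zero_apply]
  split_ifs <;> simp

theorem d_pow (X : Coordinates k A n) (p : ℕ) [Fact p.Prime] [CharP k p] (i : Fin n) :
    derivationPow p (X.d i) = 0 := by
  refine X.derivation_ext fun l => ?_
  obtain ⟨m, rfl⟩ : ∃ m, p = m + 2 :=
    ⟨p - 2, by have := (Fact.out : p.Prime).two_le; omega⟩
  simp only [derivationPow_apply, Function.iterate_succ_apply, X.d_x, Derivation.zero_apply]
  have : X.d i (if i = l then 1 else 0) = 0 := by split_ifs <;> simp
  rw [this]
  exact Function.iterate_fixed (map_zero _) m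

end Coordinates

end Coordinates

/-! ### Values of functions at closed points -/

section ClosedPoints

variable {k : Type u} [Field k] [IsAlgClosed k] {A : Type u} [CommRing A] [Algebra k A]

theorem exists_sub_algebraMap_mem [Algebra.FiniteType k A] (n : Ideal A) [n.IsMaximal] (a : A) :
    ∃ l : k, a - algebraMap k A l ∈ n := by
  let := Ideal.Quotient.field n
  have : Module.Finite k (A ⧸ n) := finite_of_finite_type_of_isJacobsonRing k (A ⧸ n)
  obtain ⟨l, hl⟩ := (IsAlgClosed.algebraMap_bijective_of_isIntegral (k := k) (K := A ⧸ n)).2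
    (Ideal.Quotient.mk n a)
  refine ⟨l, ?_⟩
  rw [← Ideal.Quotient.eq, ← hl]
  rfl

end ClosedPoints

/-! ### Generation of a smooth algebra over its `p`-th powers -/

section Frobenius

variable (k : Type u) [Field k] {A : Type u} [CommRing A] [Algebra k A]
variable (p : ℕ) [Fact p.Prime] [CharP k p]

variable (A) in
/-- The subring of `p`-th powers. -/
abbrev powSubring : Subring A := (frobHom (cast_eq_zero_of_charP k A p)).range

variable {k p}

theorem pow_mem_powSubring (a : A) : a ^ p ∈ powSubring k A p := ⟨a, rfl⟩

theorem exists_pow_prime_eq {k : Type u} [Field k] [IsAlgClosed k] {p : ℕ} [Fact p.Prime] (l : k) : ∃ m : k, m ^ p = l :=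
  IsAlgClosed.exists_pow_nat_eq l (Fact.out : p.Prime).pos

theorem algebraMap_mem_powSubring [IsAlgClosed k] (l : k) : algebraMap k A l ∈ powSubring k A p := by
  obtain ⟨m, rfl⟩ := exists_pow_prime_eq (p := p) l
  rw [map_pow]
  exact pow_mem_powSubring _

/-- `A` is integral over `A ^ p`, and it is of finite type over `A ^ p` because `k = k ^ p` maps
into it. -/
theorem finite_powSubring [IsAlgClosed k] [Algebra.FiniteType k A] :
    Module.Finite (powSubring k A p) A := by
  have h1 : Algebra.IsIntegral (powSubring k A p) A := ⟨fun a =>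
    IsIntegral.of_pow (Fact.out : p.Prime).pos
      (isIntegral_algebraMap (x := (⟨a ^ p, pow_mem_powSubring a⟩ : powSubring k A p)))⟩
  have h2 : Algebra.FiniteType (powSubring k A p) A := by
    obtain ⟨s, hs⟩ := Algebra.FiniteType.out (R := k) (A := A)
    refine ⟨s, eq_top_iff.2 fun a _ => ?_⟩
    have ha : a ∈ Algebra.adjoin k (s : Set A) := by rw [hs]; trivial
    induction ha using Algebra.adjoin_induction with
    | mem x hx => exact Algebra.subset_adjoin hx
    | algebraMap r =>
      exact Subalgebra.algebraMap_mem _ (⟨_, algebraMap_mem_powSubring r⟩ : powSubring k A p)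
    | add x y _ _ hx hy => exact add_mem (hx trivial) (hy trivial)
    | mul x y _ _ hx hy => exact mul_mem (hx trivial) (hy trivial)
  exact Algebra.IsIntegral.finite

/-- Nakayama over `B = A ^ p`: it suffices that `S = B[x]` surjects onto `A / mA` for every maximal
ideal `m` of `B`. For a maximal ideal `q` of `A` over `m`, some power of `q` lies in `mA`, so
surjectivity onto all `A / q ^ j` is enough. Modulo `q ^ 2` this is the first-order Taylor expansion
in the coordinates, and products give the higher powers. -/
theorem Coordinates.adjoin_eq_top [IsAlgClosed k] [Algebra.FiniteType k A] {n : ℕ}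
    (X : Coordinates k A n) : Algebra.adjoin (powSubring k A p) (Set.range X.x) = ⊤ := by
  let B := powSubring k A p
  let S := Algebra.adjoin B (Set.range X.x)
  have hfin : Module.Finite B A := finite_powSubring
  have hkS : ∀ l : k, algebraMap k A l ∈ S := fun l =>
    Subalgebra.algebraMap_mem _ (⟨_, algebraMap_mem_powSubring l⟩ : B)
  have hxS : ∀ i, X.x i ∈ S := fun i => Algebra.subset_adjoin ⟨i, rfl⟩
  suffices hkey : ∀ m : Ideal B, m.IsMaximal → ∀ a : A, ∃ s ∈ S, a - s ∈ m.map (algebraMap B A) by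
    let N : Submodule B A := Subalgebra.toSubmodule S
    have hQ : ∀ m : Ideal B, m.IsMaximal → (⊤ : Submodule B (A ⧸ N)) ≤ m • ⊤ := by
      intro m hm q _
      obtain ⟨a, rfl⟩ := N.mkQ_surjective q
      obtain ⟨s, hs, has⟩ := hkey m hm a
      have h1 : N.mkQ a = N.mkQ (a - s) := by
        rw [map_sub, eq_comm, sub_eq_self]
        exact (Submodule.Quotient.mk_eq_zero N).2 hs
      have h2 : a - s ∈ m • (⊤ : Submodule B A) := by
        rw [Ideal.smul_top_eq_map]; exact has
      rw [h1, ← Submodule.range_mkQ N, LinearMap.range_eq_map, ← Submodule.map_smul'']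
      exact Submodule.mem_map_of_mem h2
    -- Nakayama yields `r ≡ 1` modulo `m` that annihilates the quotient, which is absurd if the
    -- annihilator lies in `m`.
    have hann : Module.annihilator B (A ⧸ N) = ⊤ := by
      by_contra hne
      obtain ⟨m, hm, hle⟩ := Ideal.exists_le_maximal _ hne
      obtain ⟨r, hr, hr'⟩ := Submodule.exists_sub_one_mem_and_smul_eq_zero_of_fg_of_le_smul m ⊤
        (Module.finite_def.1 inferInstance) (hQ m hm)
      have : r ∈ m := hle (Module.mem_annihilator.2 fun q => hr' q trivial)
      refine hm.ne_top ((Ideal.eq_top_iff_one _).2 ?_)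
      have := m.sub_mem this hr
      rwa [sub_sub_cancel] at this
    rw [eq_top_iff]
    intro a _
    have := Module.mem_annihilator.1
      (show (1 : B) ∈ Module.annihilator B (A ⧸ N) by rw [hann]; trivial) (N.mkQ a)
    rw [one_smul] at this
    exact (Submodule.Quotient.mk_eq_zero N).1 this
  intro m hm
  obtain ⟨q, hq, hqm⟩ := Ideal.exists_ideal_over_maximal_of_isIntegral (S := A) m (by
    rw [(RingHom.injective_iff_ker_eq_bot _).1 Subtype.val_injective]; exact bot_le)
  have hnoeth : IsNoetherianRing A := Algebra.FiniteType.isNoetherianRing k A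
  have h0 : ∀ a : A, ∃ s ∈ S, a - s ∈ q := fun a => by
    obtain ⟨l, hl⟩ := exists_sub_algebraMap_mem (k := k) q a
    exact ⟨_, hkS l, hl⟩
  have h1 : ∀ a ∈ q, ∃ s ∈ S, a - s ∈ q ^ 2 := by
    intro a _
    let ev : A → k := fun a => (exists_sub_algebraMap_mem (k := k) q a).choose
    have hev : ∀ a, a - algebraMap k A (ev a) ∈ q := fun a =>
      (exists_sub_algebraMap_mem (k := k) q a).choose_spec
    have hevadd : ∀ a b, ev (a + b) = ev a + ev b ∧ ev (a * b) = ev a * ev b := by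
      have huniq : ∀ l : k, algebraMap k A l ∈ q → l = 0 := by
        intro l hl
        by_contra h
        exact hq.ne_top (Ideal.eq_top_of_isUnit_mem _ hl ((isUnit_iff_ne_zero.2 h).map _))
      intro a b
      refine ⟨sub_eq_zero.1 (huniq _ ?_), sub_eq_zero.1 (huniq _ ?_)⟩
      · have := q.sub_mem (q.add_mem (hev a) (hev b)) (hev (a + b))
        convert! this using 1
        simp only [map_add, map_sub]; ring
      · have := q.sub_mem (q.add_mem (q.mul_mem_right b (hev a))
          (q.mul_mem_left (algebraMap k A (ev a)) (hev b))) (hev (a * b))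
        convert! this using 1
        simp only [map_mul, map_sub]; ring
    have hevk : ∀ l : k, ev (algebraMap k A l) = l := by
      intro l
      by_contra h
      have := hev (algebraMap k A l)
      rw [← map_sub] at this
      exact hq.ne_top (Ideal.eq_top_of_isUnit_mem _ this
        ((isUnit_iff_ne_zero.2 (sub_ne_zero.2 (Ne.symm h))).map _))
    let mk := Ideal.Quotient.mk (q ^ 2)
    have hmk : ∀ a b, mk (a - algebraMap k A (ev a)) * mk (b - algebraMap k A (ev b)) = 0 := by
      intro a b
      rw [← map_mul, Ideal.Quotient.eq_zero_iff_mem, pow_two]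
      exact Ideal.mul_mem_mul (hev a) (hev b)
    -- Products of two differences `a - a(q)` vanish modulo `q ^ 2`, so `a ↦ a - a(q)` is a
    -- derivation and `δ a = ∑ ∂_i a * δ x_i`. Replacing `∂_i a` by its value at `q` changes this by
    -- an element of `q ^ 2` only.
    let δ : Derivation k A (A ⧸ q ^ 2) := Derivation.mk'
      { toFun := fun a => mk (a - algebraMap k A (ev a))
        map_add' := fun a b => by
          rw [(hevadd a b).1, ← map_add]; congr 1; simp only [map_add]; ring
        map_smul' := fun l a => by
          rw [Algebra.smul_def, (hevadd _ _).2, hevk, RingHom.id_apply, Algebra.smul_def, map_mul,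
            ← mul_sub, map_mul]
          rfl }
      (fun a b => by
        change mk (a * b - algebraMap k A (ev (a * b))) =
          mk a * mk (b - algebraMap k A (ev b)) + mk b * mk (a - algebraMap k A (ev a))
        have := hmk a b
        rw [(hevadd a b).2]
        simp only [map_sub, map_mul] at this ⊢
        linear_combination -this)
    have hδ := congrArg δ.liftKaehlerDifferential (X.D_eq_sum a)
    simp only [map_sum, map_smul, Derivation.liftKaehlerDifferential_comp_D] at hδ
    have hδ' : δ a = mk (∑ i, X.d i a * (X.x i - algebraMap k A (ev (X.x i)))) := by
      rw [hδ, map_sum]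
      rfl
    refine ⟨algebraMap k A (ev a) + ∑ i, algebraMap k A (ev (X.d i a)) *
      (X.x i - algebraMap k A (ev (X.x i))), add_mem (hkS _) (sum_mem fun i _ =>
        mul_mem (hkS _) (sub_mem (hxS i) (hkS _))), ?_⟩
    rw [← sub_sub]
    change mk (a - algebraMap k A (ev a)) = _ at hδ'
    rw [← Ideal.Quotient.eq_zero_iff_mem]
    change mk (a - algebraMap k A (ev a) - _) = 0
    rw [map_sub, hδ', ← map_sub, ← Finset.sum_sub_distrib, map_sum]
    refine Finset.sum_eq_zero fun i _ => ?_
    rw [← sub_mul, map_mul]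
    exact hmk _ _
  have hj : ∀ j, ∀ a ∈ q ^ j, ∃ s ∈ S, a - s ∈ q ^ (j + 1) := by
    intro j
    induction j with
    | zero => intro a _; simpa using h0 a
    | succ j ih =>
      intro a ha
      rw [pow_succ] at ha
      induction ha using Submodule.mul_induction_on' with
      | mem_mul_mem u hu v hv =>
        obtain ⟨s, hs, hs'⟩ := ih u hu
        obtain ⟨t, ht, ht'⟩ := h1 v hv
        refine ⟨s * t, mul_mem hs ht, ?_⟩
        have e : u * v - s * t = (u - s) * t + u * (v - t) := by ring
        have htq : t ∈ q := by
          have := q.sub_mem hv (Ideal.pow_le_self two_ne_zero ht')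
          rwa [sub_sub_cancel] at this
        rw [e]
        refine Ideal.add_mem _ ?_ ?_
        · rw [pow_succ]; exact Ideal.mul_mem_mul hs' htq
        · have := Ideal.mul_mem_mul hu ht'
          rwa [← pow_add] at this
      | add x _ y _ hx hy =>
        obtain ⟨s, hs, hs'⟩ := hx
        obtain ⟨t, ht, ht'⟩ := hy
        exact ⟨s + t, add_mem hs ht, by rw [add_sub_add_comm]; exact add_mem hs' ht'⟩
  have hall : ∀ j, ∀ a : A, ∃ s ∈ S, a - s ∈ q ^ j := by
    intro j
    induction j with
    | zero => intro a; exact ⟨0, zero_mem _, by simp⟩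
    | succ j ih =>
      intro a
      obtain ⟨s, hs, hs'⟩ := ih a
      obtain ⟨t, ht, ht'⟩ := hj j _ hs'
      exact ⟨s + t, add_mem hs ht, by rwa [← sub_sub]⟩
  -- For `a ∈ q` the `p`-th power lies in `q ∩ B = m`; as `q` is finitely generated, a power of `q`
  -- lies in `mA`.
  obtain ⟨N, hN⟩ := Ideal.exists_pow_le_of_le_radical_of_fg (I := q) (J := m.map (algebraMap B A))
    (fun a ha => ⟨p, by
      have : (⟨a ^ p, pow_mem_powSubring a⟩ : B) ∈ m := by
        rw [← hqm, Ideal.mem_comap]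
        exact Ideal.pow_mem_of_mem _ ha _ (Fact.out : p.Prime).pos
      exact Ideal.mem_map_of_mem (algebraMap B A) this⟩) ((isNoetherianRing_iff_ideal_fg A).1 hnoeth q)
  intro a
  obtain ⟨s, hs, hs'⟩ := hall N a
  exact ⟨s, hs, hN hs'⟩

end Frobenius
end
end PCurv

namespace PCurv
noncomputable section

/-! ### The `p`-basis of monomials in the coordinates -/

section PBasis

variable {k : Type u} [Field k] {A : Type u} [CommRing A] [Algebra k A]
variable {p : ℕ} [Fact p.Prime] [CharP k p] {n : ℕ}

namespace Coordinates

theorem exists_eq_sum [IsAlgClosed k] [Algebra.FiniteType k A] (X : Coordinates k A n) (a : A) :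
    ∃ (s : Finset (Fin n →₀ ℕ)) (c : (Fin n →₀ ℕ) → A), a = ∑ α ∈ s, c α ^ p * ∏ i, X.x i ^ α i := by
  have ha : a ∈ Algebra.adjoin (powSubring k A p) (Set.range X.x) := by
    rw [X.adjoin_eq_top]; trivial
  rw [Algebra.adjoin_range_eq_range_aeval] at ha
  obtain ⟨q, rfl⟩ := ha
  choose r hr using fun b : powSubring k A p => b.2
  refine ⟨q.support, fun α => r (q.coeff α), ?_⟩
  change MvPolynomial.aeval X.x q = _
  rw [MvPolynomial.aeval_def, MvPolynomial.eval₂_eq']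
  refine Finset.sum_congr rfl fun α _ => ?_
  congr 1
  exact (hr (q.coeff α)).symm

theorem d_aeval (X : Coordinates k A n) (i : Fin n) (q : MvPolynomial (Fin n) (powSubring k A p)) :
    X.d i (MvPolynomial.aeval X.x q) = MvPolynomial.aeval X.x (MvPolynomial.pderiv i q) := by
  have hp : (p : A) = 0 := cast_eq_zero_of_charP k A p
  induction q using MvPolynomial.induction_on with
  | C b =>
    obtain ⟨b, c, rfl⟩ := b
    simp only [MvPolynomial.algHom_C, MvPolynomial.pderiv_C, map_zero]
    have := derivation_pow_mul hp (X.d i) c 1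
    rw [mul_one] at this
    exact this.trans (by simp)
  | add f g hf hg => simp [hf, hg]
  | mul_X f j hf =>
    rw [map_mul, Derivation.leibniz, hf, MvPolynomial.aeval_X, X.d_x, Derivation.leibniz,
      MvPolynomial.pderiv_X]
    simp only [map_add, smul_eq_mul, map_mul, MvPolynomial.aeval_X]
    by_cases h : i = j
    · subst h; simp
    · simp [h]

/-- Induction on the degree. The partial derivatives of a relation are relations of lower degree,
hence zero; exponents strictly between `0` and `p` are invertible, so only the constant term is
left, and this is an element of `A ^ p ⊆ A`. -/
theorem aeval_injective (X : Coordinates k A n) (d : ℕ) :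
    ∀ q : MvPolynomial (Fin n) (powSubring k A p),
      (∀ α, q.coeff α ≠ 0 → (∀ i, α i < p) ∧ α.degree < d) → MvPolynomial.aeval X.x q = 0 →
        q = 0 := by
  have hp : (p : A) = 0 := cast_eq_zero_of_charP k A p
  have hpB : (p : powSubring k A p) = 0 := Subtype.ext (by simpa using hp)
  induction d with
  | zero =>
    intro q hq _
    ext α : 1
    by_contra h
    simpa using (hq α h).2
  | succ d ih =>
    intro q hq h0
    have hd : ∀ i, MvPolynomial.pderiv i q = 0 := by
      intro i
      refine ih _ (fun α hα => ?_) ?_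
      · rw [MvPolynomial.coeff_pderiv] at hα
        have := hq _ (left_ne_zero_of_mul hα)
        refine ⟨fun j => lt_of_le_of_lt ?_ (this.1 j), ?_⟩
        · simp
        · have := this.2
          simp only [map_add, Finsupp.degree_single] at this
          omega
      · rw [← d_aeval, h0, map_zero]
    have hne : ∀ α, α ≠ 0 → q.coeff α = 0 := by
      intro α hα
      by_contra hc
      obtain ⟨i, hi⟩ := Finsupp.ne_iff.1 hα
      rw [Finsupp.coe_zero, Pi.zero_apply] at hi
      have h1 := MvPolynomial.coeff_pderiv (i := i) q (α - Finsupp.single i 1)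
      have h2 : α - Finsupp.single i 1 + Finsupp.single i 1 = α :=
        tsub_add_cancel_of_le (by simpa using Nat.one_le_iff_ne_zero.2 hi)
      have h3 : ((((α - Finsupp.single i 1 : Fin n →₀ ℕ)) i : ℕ) : powSubring k A p) + 1 = ((α i : ℕ) : _) := by
        rw [← Nat.cast_add_one]
        congr 1
        simp
        omega
      rw [hd i, MvPolynomial.coeff_zero, h2, h3, mul_comm] at h1
      exact hc (eq_zero_of_natCast_mul_eq_zero hpB
        (Nat.not_dvd_of_pos_of_lt (Nat.pos_of_ne_zero hi) ((hq α hc).1 i)) h1.symm)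
    have hC : q = MvPolynomial.C (q.coeff 0) := by
      ext α : 1
      rw [MvPolynomial.coeff_C]
      split_ifs with h
      · rw [h]
      · exact hne α (Ne.symm h)
    rw [hC, MvPolynomial.algHom_C] at h0
    rw [hC, (show q.coeff 0 = 0 from Subtype.ext h0), map_zero]

/-- The map from tuples of coefficients to functions given by the monomials in the coordinates with
exponents `< p`. -/
def monomialSum (X : Coordinates k A n) (p : ℕ) [Fact p.Prime] [CharP k p] :
    ((Fin n → Fin p) → A) →+ A where
  toFun c := ∑ I, c I ^ p * ∏ i, X.x i ^ (I i : ℕ)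
  map_zero' := by simp [(Fact.out : p.Prime).ne_zero]
  map_add' c c' := by
    rw [← Finset.sum_add_distrib]
    exact Finset.sum_congr rfl fun I _ => by
      rw [← add_mul, ← add_pow_of_cast_eq_zero (cast_eq_zero_of_charP k A p)]; rfl

theorem monomialSum_apply (X : Coordinates k A n) (c : (Fin n → Fin p) → A) :
    X.monomialSum p c = ∑ I, c I ^ p * ∏ i, X.x i ^ (I i : ℕ) := rfl

theorem monomialSum_bijective [IsAlgClosed k] [Algebra.FiniteType k A] [IsReduced A] (X : Coordinates k A n) :
    Function.Bijective (X.monomialSum p) := by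
  have hp0 : p ≠ 0 := (Fact.out : p.Prime).ne_zero
  constructor
  · rw [injective_iff_map_eq_zero]
    intro c hc
    let e : (Fin n → Fin p) → (Fin n →₀ ℕ) := fun I => Finsupp.equivFunOnFinite.symm fun i => (I i : ℕ)
    have he : Function.Injective e := fun I J h => by
      ext i
      exact DFunLike.congr_fun h i
    let q : MvPolynomial (Fin n) (powSubring k A p) :=
      ∑ I, MvPolynomial.monomial (e I) ⟨c I ^ p, pow_mem_powSubring _⟩
    have hcoeff : ∀ I, q.coeff (e I) = ⟨c I ^ p, pow_mem_powSubring _⟩ := by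
      intro I
      rw [MvPolynomial.coeff_sum, Finset.sum_eq_single I]
      · simp
      · intro J _ hJ
        rw [MvPolynomial.coeff_monomial, if_neg fun h => hJ (he h)]
      · simp
    have hq : q = 0 := by
      refine X.aeval_injective (n * p + 1) q (fun α hα => ?_) ?_
      · have : ∃ I, e I = α := by
          by_contra! h
          refine hα ?_
          rw [MvPolynomial.coeff_sum]
          exact Finset.sum_eq_zero fun I _ => by rw [MvPolynomial.coeff_monomial, if_neg (h I)]
        obtain ⟨I, rfl⟩ := this
        refine ⟨fun i => (I i).2, Nat.lt_succ_of_le ?_⟩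
        rw [Finsupp.degree_eq_sum]
        calc ∑ i, e I i ≤ ∑ _i : Fin n, p := Finset.sum_le_sum fun i _ => (I i).2.le
          _ = n * p := by simp
      · rw [map_sum, ← hc, monomialSum_apply]
        refine Finset.sum_congr rfl fun I _ => ?_
        rw [MvPolynomial.aeval_monomial, Finsupp.prod_fintype _ _ (fun i => pow_zero _)]
        rfl
    ext I
    have := hcoeff I
    rw [hq, MvPolynomial.coeff_zero] at this
    -- Reducedness passes from the vanishing of `c I ^ p` to that of `c I`.
    exact eq_zero_of_pow_eq_zero (congrArg Subtype.val this).symm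
  · intro a
    obtain ⟨s, c, rfl⟩ := X.exists_eq_sum (p := p) a
    change _ ∈ AddMonoidHom.range _
    -- Division of the exponents by `p` with remainder: the quotients go into the coefficient as a
    -- `p`-th power.
    refine sum_mem fun α _ => ⟨Pi.single (fun i => ⟨α i % p, Nat.mod_lt _ (Nat.pos_of_ne_zero hp0)⟩)
      (c α * ∏ i, X.x i ^ (α i / p)), ?_⟩
    rw [monomialSum_apply, Finset.sum_eq_single_of_mem _ (Finset.mem_univ _)]
    · rw [Pi.single_eq_same, mul_pow, mul_assoc, ← Finset.prod_pow, ← Finset.prod_mul_distrib]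
      congr 1
      refine Finset.prod_congr rfl fun i _ => ?_
      rw [← pow_mul, ← pow_add, Nat.div_add_mod']
    · intro I _ hI
      rw [Pi.single_eq_of_ne hI, zero_pow hp0, zero_mul]

end Coordinates

end PBasis

/-! ### Cartier's theorem on closed one-forms -/

section Cartier

variable {k : Type u} [Field k] {A : Type u} [CommRing A] [Algebra k A]
variable {p : ℕ} [Fact p.Prime] [CharP k p] {n : ℕ}

namespace Coordinates

/-- The Lie derivative along `x_j ∂_j` on the components of forms. -/
def euler (X : Coordinates k A n) (j : Fin n) : AddMonoid.End (Fin n → A) where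
  toFun e i := X.x j * X.d j (e i) + if i = j then e j else 0
  map_zero' := by ext i; simp
  map_add' e e' := by
    ext i
    simp only [Pi.add_apply, map_add, mul_add]
    split_ifs <;> ring

theorem euler_apply (X : Coordinates k A n) (j : Fin n) (e : Fin n → A) (i : Fin n) :
    X.euler j e i = X.x j * X.d j (e i) + if i = j then e j else 0 := rfl

theorem d_d_comm (X : Coordinates k A n) (i j : Fin n) (a : A) : X.d i (X.d j a) = X.d j (X.d i a) := by
  have := congrArg (fun D : Derivation k A A => D a) (X.d_comm i j)
  simpa [Derivation.commutator_apply, sub_eq_zero] using this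

theorem d_monomial {q : ℕ} [CharP k q] (X : Coordinates k A n) (j : Fin n) (c : A) (α : Fin n →₀ ℕ) :
    X.x j * X.d j (c ^ q * ∏ i, X.x i ^ α i) = (α j : A) * (c ^ q * ∏ i, X.x i ^ α i) := by
  rw [derivation_pow_mul (cast_eq_zero_of_charP k A q)]
  have h0 : X.d j (∏ i ∈ Finset.univ.erase j, X.x i ^ α i) = 0 := by
    refine Finset.prod_induction _ (fun a => X.d j a = 0) (fun a b ha hb => by simp [ha, hb])
      (by simp) fun i hi => ?_
    rw [Derivation.leibniz_pow, X.d_x, if_neg (Finset.ne_of_mem_erase hi).symm]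
    simp
  rw [← Finset.mul_prod_erase _ _ (Finset.mem_univ j), Derivation.leibniz, h0,
    Derivation.leibniz_pow, X.d_x, if_pos rfl]
  simp only [smul_eq_mul, nsmul_eq_mul, mul_zero, zero_add, mul_one]
  rcases h : α j with _ | m
  · simp
  · simp only [add_tsub_cancel_right, pow_succ]; ring

/-- By Cartan's formula the Lie derivative `L_j` of a closed form along `x_j ∂_j` is exact, so `1 -
L_j ^ (p - 1)` changes a closed form by an exact one. On monomial forms `L_j` is multiplication by
the weight in `x_j`, and by Fermat's little theorem `1 - L_j ^ (p - 1)` is the projector onto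
weights divisible by `p`. After projecting for all `j`, only forms `∑ f_i ^ p x_i ^ (p - 1) dx_i`
remain, and these represent values of `C⁻¹`. -/
theorem exists_delta_eq_invCartier [IsAlgClosed k] [Algebra.FiniteType k A] (X : Coordinates k A n) (η : Ω[A⁄k])
    (hη : ∀ i j, X.d i ((X.d j).liftKaehlerDifferential η) =
      X.d j ((X.d i).liftKaehlerDifferential η)) : ∃ θ, delta k η = invCartier k p θ := by
  have hp : (p : A) = 0 := cast_eq_zero_of_charP k A p
  have hp1 : p - 1 + 1 = p := Nat.succ_pred_prime Fact.out
  have hp2 := (Fact.out : p.Prime).two_le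
  have hmul : ∀ (f g : AddMonoid.End (Fin n → A)) (e : Fin n → A), (f * g) e = f (g e) :=
    fun _ _ _ => rfl
  let Z : AddSubgroup (Fin n → A) :=
    { carrier := {e | ∀ i j, X.d i (e j) = X.d j (e i)}
      zero_mem' := fun i j => by simp
      add_mem' := fun ha hb i j => by simp [ha i j, hb i j]
      neg_mem' := fun ha i j => by simp [ha i j] }
  let gr : A →+ (Fin n → A) :=
    { toFun := fun a i => X.d i a
      map_zero' := by ext; simp
      map_add' := fun a b => by ext; simp }
  have hgr : ∀ a i, gr a i = X.d i a := fun _ _ => rfl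
  have hEZ : gr.range ≤ Z := by rintro _ ⟨a, rfl⟩ i j; exact X.d_d_comm i j a
  have hL : ∀ j, ∀ e ∈ Z, X.euler j e ∈ gr.range := fun j e he => ⟨X.x j * e j, by
    ext i
    rw [hgr, Derivation.leibniz, he i j, euler_apply, X.d_x, smul_eq_mul, smul_eq_mul, mul_ite,
      mul_one, mul_zero]⟩
  have hLp : ∀ j m, ∀ e ∈ Z, (X.euler j ^ (m + 1)) e ∈ gr.range := by
    intro j m
    induction m with
    | zero => simpa using hL j
    | succ m ih =>
      intro e he
      rw [pow_succ, hmul]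
      exact ih _ (hEZ (hL j e he))
  let M : Fin n → AddMonoid.End (Fin n → A) := fun j => 1 - X.euler j ^ (p - 1)
  have hM : ∀ j e, M j e = e - (X.euler j ^ (p - 1)) e := fun _ _ => rfl
  have hMl : ∀ l : List (Fin n), ∀ e ∈ Z, e - (l.map M).prod e ∈ gr.range := by
    intro l
    induction l with
    | nil => intro e _; simp
    | cons j l ih =>
      intro e he
      have h1 := ih e he
      have h2 : (l.map M).prod e ∈ Z := by
        have := Z.sub_mem he (hEZ h1)
        rwa [sub_sub_cancel] at this
      rw [List.map_cons, List.prod_cons, hmul, hM, ← sub_add]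
      refine add_mem h1 ?_
      obtain ⟨m, hm⟩ : ∃ m, p - 1 = m + 1 := ⟨p - 2, by omega⟩
      rw [hm]
      exact hLp j m _ h2
  let C : AddSubgroup (Fin n → A) :=
    { carrier := {e | ∃ f : Fin n → A, ∀ i, e i = f i ^ p * X.x i ^ (p - 1)}
      zero_mem' := ⟨0, fun i => by simp [(Fact.out : p.Prime).ne_zero]⟩
      add_mem' := by
        rintro _ _ ⟨f, hf⟩ ⟨g, hg⟩
        exact ⟨f + g, fun i => by
          simp [hf i, hg i, add_pow_of_cast_eq_zero hp, add_mul]⟩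
      neg_mem' := by
        rintro _ ⟨f, hf⟩
        refine ⟨-f, fun i => ?_⟩
        have := add_pow_of_cast_eq_zero hp (f i) (-f i)
        rw [add_neg_cancel, zero_pow (Fact.out : p.Prime).ne_zero, eq_comm, add_comm,
          ← eq_neg_iff_add_eq_zero] at this
        rw [Pi.neg_apply, Pi.neg_apply, this, hf i, neg_mul] }
  have hgen : ∀ i c (α : Fin n →₀ ℕ),
      ((List.finRange n).map M).prod (Pi.single i (c ^ p * ∏ l, X.x l ^ α l)) ∈ C := by
    intro i c α
    set g : Fin n → A := Pi.single i (c ^ p * ∏ l, X.x l ^ α l) with hg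
    -- The weight of `x ^ α dx_i` in `x_j`; the factor `dx_i` contributes `1` to the weight in
    -- `x_i`.
    let N : Fin n → ℕ := fun j => α j + if i = j then 1 else 0
    have h1 : ∀ j, X.euler j g = N j • g := by
      intro j
      ext l
      rw [euler_apply, Pi.smul_apply]
      by_cases hl : l = i
      · subst hl
        rw [hg, Pi.single_eq_same, X.d_monomial]
        by_cases hj : l = j
        · subst hj
          simp [N, add_mul]
        · simp [N, hj]
      · rw [hg, Pi.single_eq_of_ne hl, map_zero, mul_zero, zero_add, smul_zero]
        split_ifs with h
        · subst h; exact Pi.single_eq_of_ne hl _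
        · rfl
    have h2 : ∀ j m, (X.euler j ^ m) g = (N j ^ m) • g := by
      intro j m
      induction m with
      | zero => simp
      | succ m ih =>
        rw [pow_succ, hmul, h1, map_nsmul, ih, smul_smul, pow_succ, mul_comm]
    have hpsmul : ∀ m : ℕ, p ∣ m → m • g = 0 := by
      rintro _ ⟨m, rfl⟩
      ext l
      simp [hp]
    have h3 : ∀ j, M j g = if p ∣ N j then g else 0 := by
      intro j
      rw [hM, h2]
      split_ifs with h
      · rw [hpsmul _ (dvd_pow h (by omega)), sub_zero]
      · have hc : Nat.Coprime (N j) p := ((Nat.Prime.coprime_iff_not_dvd Fact.out).2 h).symm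
        have h4 : N j ^ (p - 1) ≡ 1 [MOD p] := by
          have := Nat.ModEq.pow_totient hc
          rwa [Nat.totient_prime Fact.out] at this
        have h5 : 1 ≤ N j ^ (p - 1) := Nat.one_le_pow _ _ (Nat.pos_of_ne_zero fun h0 => h (by simp [h0]))
        have h6 := hpsmul _ ((Nat.modEq_iff_dvd' h5).1 h4.symm)
        rw [← Nat.sub_add_cancel h5, add_smul, h6, one_smul, zero_add, sub_self]
    have h4 : ∀ l : List (Fin n), (l.map M).prod g = if ∀ j ∈ l, p ∣ N j then g else 0 := by
      intro l
      induction l with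
      | nil => simp
      | cons j l ih =>
        rw [List.map_cons, List.prod_cons, hmul, ih]
        by_cases hl : ∀ j ∈ l, p ∣ N j
        · rw [if_pos hl, h3]
          simp only [List.forall_mem_cons]
          by_cases hj : p ∣ N j
          · rw [if_pos hj, if_pos ⟨hj, hl⟩]
          · rw [if_neg hj, if_neg fun h => hj h.1]
        · rw [if_neg hl, map_zero, if_neg]
          exact fun h => hl fun j hj => h j (List.mem_cons_of_mem _ hj)
    rw [h4]
    split_ifs with hall
    swap
    · exact zero_mem _
    have hall' : ∀ j, p ∣ N j := fun j => hall j (List.mem_finRange j)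
    -- All weights are divisible by `p`: the exponents other than that of `x_i` are multiples of
    -- `p`, and that of `x_i` is `N i - 1 = p (N i / p - 1) + (p - 1)`.
    refine ⟨Pi.single i (c * ((∏ l ∈ Finset.univ.erase i, X.x l ^ (α l / p)) *
      X.x i ^ (N i / p - 1))), fun l => ?_⟩
    by_cases hl : l = i
    · subst hl
      rw [hg, Pi.single_eq_same, Pi.single_eq_same, mul_pow, mul_assoc, mul_pow, ← Finset.prod_pow,
        ← Finset.mul_prod_erase _ _ (Finset.mem_univ l), mul_assoc, ← pow_mul, ← pow_add, mul_comm (X.x l ^ _)]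
      congr 2
      · refine Finset.prod_congr rfl fun j hj => ?_
        have := hall' j
        simp only [N, if_neg (Finset.ne_of_mem_erase hj).symm, add_zero] at this
        rw [← pow_mul, Nat.div_mul_cancel this]
      · congr 1
        have h1 := hall' l
        have h2 : N l = α l + 1 := by simp [N]
        obtain ⟨m, hm⟩ := h1
        rw [hm, Nat.mul_div_cancel_left _ (by omega)]
        obtain ⟨m, rfl⟩ : ∃ m', m = m' + 1 := ⟨m - 1, by
          rcases m with _ | m
          · omega
          · omega⟩
        simp only [add_tsub_cancel_right]
        rw [mul_add, mul_one] at hm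
        rw [mul_comm]
        omega
    · rw [hg, Pi.single_eq_of_ne hl, Pi.single_eq_of_ne hl, zero_pow (by omega), zero_mul]
  let e : Fin n → A := fun i => (X.d i).liftKaehlerDifferential η
  have he : ((List.finRange n).map M).prod e ∈ C := by
    rw [← Finset.univ_sum_single e, map_sum]
    refine sum_mem fun i _ => ?_
    obtain ⟨s, c, hs⟩ := X.exists_eq_sum (p := p) (e i)
    have : Pi.single i (e i) = ∑ α ∈ s, (Pi.single i (c α ^ p * ∏ l, X.x l ^ α l) : Fin n → A) := by
      rw [hs]
      exact map_sum (AddMonoidHom.single (fun _ : Fin n => A) i) _ _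
    rw [this, map_sum]
    exact sum_mem fun α _ => hgen i _ α
  obtain ⟨a, ha⟩ := hMl (List.finRange n) e hη
  obtain ⟨f, hf⟩ := he
  refine ⟨∑ i, f i • KaehlerDifferential.D k A (X.x i), ?_⟩
  have h1 : η = KaehlerDifferential.D k A a +
      ∑ i, f i ^ p • X.x i ^ (p - 1) • KaehlerDifferential.D k A (X.x i) := by
    conv_lhs => rw [X.form_eq η]
    rw [X.D_eq_sum a, ← Finset.sum_add_distrib]
    refine Finset.sum_congr rfl fun i _ => ?_
    have := congrFun ha i
    rw [Pi.sub_apply, hf, hgr] at this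
    rw [this, smul_smul, sub_smul, sub_add_cancel]
  rw [h1, map_add, (delta_eq_zero_iff k _).2 ⟨a, rfl⟩, zero_add, map_sum, map_sum]
  exact Finset.sum_congr rfl fun i _ => (invCartier_smul_D k p _ _).symm

end Coordinates

end Cartier
end
end PCurv

namespace PCurv
noncomputable section

/-! ### Coordinates with denominators, without localizing the algebra -/

section Denominators

/-- Functions and derivations on a `k`-algebra that become coordinates, with the dual derivations
up to the factor `g ^ p`, when `g` is inverted. -/
structure ApproxCoordinates (k : Type u) [Field k] (A : Type u) [CommRing A] [Algebra k A] (p : ℕ)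
    [Fact p.Prime] [CharP k p] (n : ℕ) (g : A) where
  x : Fin n → A
  d : Fin n → Derivation k A A
  d_x (i j : Fin n) : d i (x j) = if i = j then g ^ p else 0
  derivation_eq (ξ : Derivation k A A) (a : A) : g ^ p * ξ a = ∑ i, ξ (x i) * d i a
  d_comm (i j : Fin n) : ⁅d i, d j⁆ = 0
  d_pow (i : Fin n) : derivationPow p (d i) = 0
  exists_mem_adjoin (a : A) :
    ∃ m : ℕ, (g ^ p) ^ m * a ∈ Algebra.adjoin (powSubring k A p) (Set.range x)

variable {k : Type u} [Field k] {A : Type u} [CommRing A] [Algebra k A]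
variable {p : ℕ} [Fact p.Prime] [CharP k p]

/-- Rescaling of coordinates by `p`-th powers of units. -/
def Coordinates.rescale {n : ℕ} (X : Coordinates k A n) (p : ℕ) [CharP k p] (c : Fin n → Aˣ) :
    Coordinates k A n where
  x i := (c i : A) ^ p * X.x i
  d i := (↑(c i)⁻¹ : A) ^ p • X.d i
  d_x i j := by
    rw [Derivation.smul_apply, derivation_pow_mul (cast_eq_zero_of_charP k A p), X.d_x]
    split_ifs with h
    · subst h
      rw [smul_eq_mul, mul_one, ← mul_pow, Units.inv_mul, one_pow]
    · simp
  D_eq_sum a := by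
    rw [X.D_eq_sum a]
    refine Finset.sum_congr rfl fun i _ => ?_
    rw [← pow_smul_mem_exact, Derivation.smul_apply, smul_smul, smul_eq_mul, mul_right_comm,
      ← mul_pow, Units.inv_mul, one_pow, one_mul]

/-- Coordinates on `A_f` are multiplied by `p`-th powers of powers of `f` until they come from `A`,
and powers of `f` lift the dual derivations to `A` because `Ω` is finitely presented. Denominators
of the form `g ^ p` are constants for every derivation, so the commutators and `p`-th powers of the
lifted derivations still vanish. -/
theorem exists_approxCoordinates [IsAlgClosed k] [Algebra.Smooth k A] (q : Ideal A) [hq : q.IsPrime] :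
    ∃ (n : ℕ) (g : A), g ∉ q ∧ Nonempty (ApproxCoordinates k A p n g) := by
  have hp : (p : A) = 0 := cast_eq_zero_of_charP k A p
  have hp0 : p ≠ 0 := (Fact.out : p.Prime).ne_zero
  have hred : IsReduced A := isReduced_of_smooth k
  obtain ⟨f, n, hf, ⟨X₀⟩⟩ := exists_coordinates_away (k := k) q
  let L := Localization.Away f
  let φ : A →+* L := algebraMap A L
  have hu : IsUnit (φ f) := IsLocalization.Away.algebraMap_isUnit f
  have hpL : (p : L) = 0 := cast_eq_zero_of_charP k L p
  -- In a reduced ring an element killed by a power of `f` is killed by `f`, so equality of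
  -- multiples of `f` may be tested in `A_f`.
  have hker : ∀ a, φ a = 0 → f * a = 0 := by
    intro a ha
    obtain ⟨⟨_, m, rfl⟩, hm⟩ := (IsLocalization.map_eq_zero_iff (Submonoid.powers f) L a).1 ha
    have : (f * a) ^ (m + 1) = 0 := by
      have : f ^ m * a = 0 := hm
      rw [show (f * a) ^ (m + 1) = f ^ m * a * (f * a ^ m) by ring, this, zero_mul]
    exact eq_zero_of_pow_eq_zero this
  have heq : ∀ a b, f ∣ a → f ∣ b → φ a = φ b → a = b := by
    rintro _ _ ⟨a, rfl⟩ ⟨b, rfl⟩ h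
    rw [map_mul, map_mul] at h
    have := hker (a - b) (by rw [map_sub, hu.mul_left_cancel h, sub_self])
    rwa [mul_sub, sub_eq_zero] at this
  have hsurj : ∀ z : L, ∃ (m : ℕ) (a : A), φ f ^ m * z = φ a := by
    intro z
    obtain ⟨⟨a, ⟨_, m, rfl⟩⟩, h⟩ := IsLocalization.surj (Submonoid.powers f) z
    exact ⟨m, a, by rw [mul_comm, ← map_pow]; exact h⟩
  have hsurjp : ∀ z : L, ∃ (m : ℕ) (a : A), (φ f ^ m) ^ p * z = φ a := by
    intro z
    obtain ⟨m, a, h⟩ := hsurj z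
    refine ⟨m, f ^ (m * p - m) * a, ?_⟩
    rw [map_mul, ← h, map_pow, ← mul_assoc, ← pow_add, ← pow_mul, Nat.sub_add_cancel]
    exact Nat.le_mul_of_pos_right _ (Nat.pos_of_ne_zero hp0)
  choose N x hx using fun i => hsurjp (X₀.x i)
  let X : Coordinates k L n := X₀.rescale p fun i => hu.unit ^ N i
  have hX : ∀ i, X.x i = φ (x i) := fun i => by
    rw [← hx i]
    change ((hu.unit ^ N i : Lˣ) : L) ^ p * _ = _
    simp
  have hlift : ∀ i, ∃ (m : ℕ) (D : Derivation k A A), ∀ a, φ (D a) = φ f ^ m * X.d i (φ a) := by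
    intro i
    have : IsLocalizedModule (Submonoid.powers f) (Algebra.linearMap A L) := inferInstance
    let g : Ω[A⁄k] →ₗ[A] L :=
      ((X.d i).compAlgebraMap A).liftKaehlerDifferential
    obtain ⟨h, ⟨_, m, rfl⟩, hh⟩ := Module.FinitePresentation.exists_lift_of_isLocalizedModule
      (Submonoid.powers f) (Algebra.linearMap A L) g
    refine ⟨m, h.compDer (KaehlerDifferential.D k A), fun a => ?_⟩
    have := congrArg (fun l => l (KaehlerDifferential.D k A a)) hh
    simp only [LinearMap.comp_apply] at this
    refine this.trans ?_
    have h2 : g (KaehlerDifferential.D k A a) = X.d i (φ a) := by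
      simp only [g, Derivation.liftKaehlerDifferential_comp_D]
      rfl
    rw [LinearMap.smul_apply, h2, Submonoid.smul_def]
    change f ^ m • _ = _
    rw [Algebra.smul_def, map_pow]
  choose m D hD using hlift
  let e : ℕ := 1 + ∑ i, m i
  have hm : ∀ i, m i + 1 ≤ e * p := fun i => by
    have h1 : m i ≤ ∑ i, m i := Finset.single_le_sum (fun _ _ => Nat.zero_le _) (Finset.mem_univ i)
    calc m i + 1 ≤ e := by simp only [e]; omega
      _ ≤ e * p := Nat.le_mul_of_pos_right _ (Nat.pos_of_ne_zero hp0)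
  let g : A := f ^ e
  have hg : g ^ p = f ^ (e * p) := (pow_mul f e p).symm
  let y : Fin n → Derivation k A A := fun i => f ^ (e * p - m i) • D i
  have hy : ∀ i a, φ (y i a) = φ g ^ p * X.d i (φ a) := fun i a => by
    change φ (f ^ (e * p - m i) * D i a) = _
    rw [map_mul, hD, map_pow, ← mul_assoc, ← pow_add, Nat.sub_add_cancel (by have := hm i; omega),
      ← map_pow, ← map_pow, hg]
  have hyf : ∀ i a, f ∣ y i a := fun i a =>
    Dvd.dvd.mul_right (dvd_pow_self f (by have := hm i; omega)) _
  have hfg : f ∣ g ^ p := by rw [hg]; exact dvd_pow_self f (by simp [e, hp0])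
  have hXd : ∀ i a b, X.d i (φ a ^ p * b) = φ a ^ p * X.d i b :=
    fun i a b => derivation_pow_mul hpL (X.d i) (φ a) b
  refine ⟨n, g, fun h => hf (hq.mem_of_pow_mem _ h), ⟨⟨x, y, fun i j => ?_, fun ξ a => ?_,
    fun i j => ?_, fun i => ?_, fun a => ?_⟩⟩⟩
  · refine heq _ _ (hyf _ _) (by split_ifs <;> simp [hfg]) ?_
    rw [hy, ← hX, X.d_x]
    split_ifs <;> simp
  · refine heq _ _ (hfg.mul_right _) (Finset.dvd_sum fun i _ => (hyf i a).mul_left _) ?_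
    let E : Ω[L⁄k] →ₗ[L] L := IsLocalizedModule.mapExtendScalars (Submonoid.powers f)
      (KaehlerDifferential.map k k A L) (Algebra.linearMap A L) L ξ.liftKaehlerDifferential
    have hE : ∀ a, E (KaehlerDifferential.D k L (φ a)) = φ (ξ a) := fun a => by
      rw [← KaehlerDifferential.map_D k k A L a]
      simp only [E, IsLocalizedModule.mapExtendScalars_apply_apply]
      erw [IsLocalizedModule.map_apply, Derivation.liftKaehlerDifferential_comp_D]
      rfl
    have h2 : ∀ a, φ (ξ a) = ∑ i, φ (ξ (x i)) * X.d i (φ a) := fun a => by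
      rw [← hE, X.D_eq_sum (φ a), map_sum]
      exact Finset.sum_congr rfl fun i _ => by
        rw [map_smul, hX, hE, smul_eq_mul, mul_comm]
    simp only [map_sum, map_mul, h2 a, hy, map_pow, Finset.mul_sum]
    exact Finset.sum_congr rfl fun i _ => by ring
  · ext a
    refine heq _ _ ?_ (dvd_zero _) ?_
    · rw [Derivation.commutator_apply]; exact dvd_sub (hyf _ _) (hyf _ _)
    · rw [Derivation.commutator_apply, map_sub, hy, hy, hy, hy, hXd, hXd, X.d_d_comm i j, sub_self]
      simp
  · ext a
    rw [derivationPow_apply]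
    have hp1 : p - 1 + 1 = p := Nat.succ_pred_prime Fact.out
    refine heq _ _ ?_ (dvd_zero _) ?_
    · rw [← hp1, Function.iterate_succ_apply']; exact hyf _ _
    · have : ∀ m, φ ((y i)^[m] a) = (φ g ^ p) ^ m * (X.d i)^[m] (φ a) := by
        intro m
        induction m with
        | zero => simp
        | succ m ih =>
          have h3 : (φ g ^ p) ^ m = φ (g ^ m) ^ p := by rw [map_pow φ g m, pow_right_comm]
          rw [Function.iterate_succ_apply', Function.iterate_succ_apply', hy, ih, h3, hXd, ← h3]
          ring
      have h2 := congrArg (fun D : Derivation k L L => D (φ a)) (X.d_pow p i)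
      simp only [derivationPow_apply, Derivation.zero_apply] at h2
      rw [this, h2, mul_zero, Derivation.zero_apply, map_zero]
  · let S := Algebra.adjoin (powSubring k A p) (Set.range x)
    have hfS : ∀ l, (f ^ l) ^ p ∈ S := fun l =>
      Subalgebra.algebraMap_mem S (⟨_, pow_mem_powSubring _⟩ : powSubring k A p)
    have key : ∀ z : L, ∃ (l : ℕ), ∃ s ∈ S, φ ((f ^ l) ^ p) * z = φ s := by
      intro z
      have hz : z ∈ Algebra.adjoin (powSubring k L p) (Set.range X.x) := by
        rw [X.adjoin_eq_top]; trivial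
      induction hz using Algebra.adjoin_induction with
      | mem z hz =>
        obtain ⟨i, rfl⟩ := hz
        exact ⟨0, x i, Algebra.subset_adjoin ⟨i, rfl⟩, by simp [hX]⟩
      | algebraMap b =>
        obtain ⟨_, c, rfl⟩ := b
        obtain ⟨l, a, h⟩ := hsurj c
        refine ⟨l, a ^ p, Subalgebra.algebraMap_mem S (⟨_, pow_mem_powSubring _⟩ : powSubring k A p), ?_⟩
        rw [map_pow, map_pow, map_pow, ← h, mul_pow]
        rfl
      | add z w _ _ hz hw =>
        obtain ⟨l, s, hs, h⟩ := hz
        obtain ⟨l', s', hs', h'⟩ := hw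
        refine ⟨l + l', (f ^ l') ^ p * s + (f ^ l) ^ p * s',
          add_mem (mul_mem (hfS _) hs) (mul_mem (hfS _) hs'), ?_⟩
        rw [map_add, map_mul, map_mul, ← h, ← h', pow_add, mul_pow, map_mul]
        ring
      | mul z w _ _ hz hw =>
        obtain ⟨l, s, hs, h⟩ := hz
        obtain ⟨l', s', hs', h'⟩ := hw
        refine ⟨l + l', s * s', mul_mem hs hs', ?_⟩
        rw [map_mul, ← h, ← h', pow_add, mul_pow, map_mul]
        ring
    obtain ⟨l, s, hs, h⟩ := key (φ a)
    refine ⟨l + 1, ?_⟩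
    have e1 : (f ^ (e - 1 + (e - 1) * l + (l + 1))) = g ^ (l + 1) := by
      rw [← pow_mul]
      congr 1
      obtain ⟨e', he'⟩ : ∃ e', e = e' + 1 := ⟨∑ i, m i, add_comm _ _⟩
      rw [he']
      simp only [add_tsub_cancel_right]
      ring
    -- The exponent `l + 1` in place of `l` makes both sides multiples of `f`, as `heq` requires.
    have e2 : (f ^ (l + 1)) ^ p * a = f ^ p * s := by
      refine heq _ _ ?_ (Dvd.dvd.mul_right (dvd_pow_self f hp0) _) ?_
      · rw [← pow_mul]; exact Dvd.dvd.mul_right (dvd_pow_self f (by simp [hp0])) _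
      · rw [map_mul φ (f ^ p), ← h, pow_succ, mul_pow, map_mul, map_mul]
        ring
    rw [pow_right_comm, ← e1, pow_add, mul_pow, mul_assoc, e2]
    refine mul_mem (hfS _) (mul_mem ?_ hs)
    simpa using hfS 1

end Denominators
end
end PCurv

namespace PCurv
noncomputable section

/-! ### A bijectivity criterion for representations of algebras of operators -/

section Azumaya

variable {k : Type u} [Field k] {A : Type u} [CommRing A] [Algebra k A]
variable {p : ℕ} [Fact p.Prime] [CharP k p] {n : ℕ} {g : A}

/-- Multiplication of the denominator of coordinates by a function. -/
def ApproxCoordinates.mul (X : ApproxCoordinates k A p n g) (h : A) :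
    ApproxCoordinates k A p n (h * g) where
  x := X.x
  d i := h ^ p • X.d i
  d_x i j := by
    rw [Derivation.smul_apply, X.d_x, mul_pow]
    split_ifs <;> simp
  derivation_eq ξ a := by
    rw [mul_pow, mul_assoc, X.derivation_eq, Finset.mul_sum]
    exact Finset.sum_congr rfl fun i _ => by
      rw [Derivation.smul_apply, smul_eq_mul, mul_left_comm]
  d_comm i j := by
    have hp : (p : A) = 0 := cast_eq_zero_of_charP k A p
    ext a
    have := congrArg (fun D : Derivation k A A => D a) (X.d_comm i j)
    simp only [Derivation.commutator_apply, Derivation.smul_apply, smul_eq_mul,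
      derivation_pow_mul hp, Derivation.zero_apply] at this ⊢
    linear_combination h ^ p * h ^ p * this
  d_pow i := by
    have hp : (p : A) = 0 := cast_eq_zero_of_charP k A p
    ext a
    have h1 := congrArg (fun D : Derivation k A A => D a) (X.d_pow i)
    simp only [derivationPow_apply, Derivation.zero_apply] at h1 ⊢
    have : ∀ m, (⇑(h ^ p • X.d i))^[m] a = (h ^ m) ^ p * (X.d i)^[m] a := by
      intro m
      induction m with
      | zero => simp
      | succ m ih =>
        rw [Function.iterate_succ_apply', Function.iterate_succ_apply', ih, Derivation.smul_apply,
          derivation_pow_mul hp, smul_eq_mul, ← mul_assoc, ← mul_pow, ← pow_succ']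
    rw [this, h1, mul_zero]
  exists_mem_adjoin a := by
    obtain ⟨m, hm⟩ := X.exists_mem_adjoin a
    refine ⟨m, ?_⟩
    rw [mul_pow, mul_pow, mul_assoc, ← pow_mul, mul_comm p m, pow_mul]
    exact mul_mem (Subalgebra.algebraMap_mem _ (⟨_, pow_mem_powSubring _⟩ : powSubring k A p)) hm

variable (X : ApproxCoordinates k A p n g)

/-- The relations between functions and operators `Y i` with symbols `X.d i` in a central reduction
of the algebra of differential operators. -/
structure OperatorAlgebra {R V : Type*} [Ring R] (fn : A →+* R) (vec : V → R) (Y : Fin n → R) :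
    Prop where
  mul_fn (i : Fin n) (a : A) : Y i * fn a = fn a * Y i + fn (X.d i a)
  comm (i j : Fin n) : Commute (Y i) (Y j)
  pow (i : Fin n) : ∃ a : A, Y i ^ p = fn (a ^ p)
  commute_vec (v : V) (a : A) : Commute (fn (a ^ p)) (vec v)
  mul_vec (v : V) : ∃ a : Fin n → A, fn (g ^ p) * vec v = ∑ i, fn (a i) * Y i
  closure_eq : Subring.closure (Set.range fn ∪ Set.range vec) = ⊤

namespace OperatorAlgebra

variable {X} {R V : Type*} [Ring R] {fn : A →+* R} {vec : V → R} {Y : Fin n → R}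

/-- The sums of the `fn a * ∏ i, Y i ^ j i` with `j i < p` and `j i = 0` unless `i < m`. -/
def filtration (p : ℕ) (fn : A →+* R) (Y : Fin n → R) : ℕ → AddSubgroup R
  | 0 => fn.range.toAddSubgroup
  | m + 1 =>
    { carrier := {r | ∃ κ : ℕ → R, (∀ j, κ j ∈ filtration p fn Y m) ∧
        r = ∑ j ∈ Finset.range p, κ j * (if h : m < n then Y ⟨m, h⟩ else 0) ^ j}
      zero_mem' := ⟨0, fun _ => zero_mem _, by simp⟩
      add_mem' := by
        rintro _ _ ⟨κ, h, rfl⟩ ⟨κ', h', rfl⟩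
        exact ⟨κ + κ', fun j => add_mem (h j) (h' j), by
          simp only [Pi.add_apply, add_mul, Finset.sum_add_distrib]⟩
      neg_mem' := by
        rintro _ ⟨κ, h, rfl⟩
        exact ⟨-κ, fun j => neg_mem (h j), by
          simp only [Pi.neg_apply, neg_mul, Finset.sum_neg_distrib]⟩ }

theorem mem_filtration_succ {m : ℕ} {hm : m < n} {r : R} : r ∈ filtration p fn Y (m + 1) ↔
    ∃ κ : ℕ → R, (∀ j, κ j ∈ filtration p fn Y m) ∧
      r = ∑ j ∈ Finset.range p, κ j * Y ⟨m, hm⟩ ^ j := by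
  have : (if h : m < n then Y ⟨m, h⟩ else 0) = Y ⟨m, hm⟩ := dif_pos hm
  rw [← this]
  rfl

theorem mul_pow_mem_filtration_succ {m j : ℕ} {hm : m < n} (hj : j < p) {r : R}
    (hr : r ∈ filtration p fn Y m) : r * Y ⟨m, hm⟩ ^ j ∈ filtration p fn Y (m + 1) := by
  refine (mem_filtration_succ (hm := hm)).2 ⟨fun l => if l = j then r else 0, fun l => ?_, ?_⟩
  · dsimp only
    split_ifs
    exacts [hr, zero_mem _]
  · rw [Finset.sum_eq_single j (by simp +contextual) (by simp [hj])]
    simp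

theorem filtration_induction {P : R → Prop} (hadd : ∀ r s, P r → P s → P (r + s)) (hz : P 0)
    {m : ℕ} (hm : m < n)
    (hmul : ∀ κ ∈ filtration p fn Y m, ∀ j < p, P (κ * Y ⟨m, hm⟩ ^ j))
    {r : R} (hr : r ∈ filtration p fn Y (m + 1)) : P r := by
  obtain ⟨κ, hκ, rfl⟩ := (mem_filtration_succ (hm := hm)).1 hr
  exact Finset.sum_induction _ P hadd hz fun j hj => hmul _ (hκ j) j (Finset.mem_range.1 hj)

theorem fn_mul_mem_filtration (a : A) {m : ℕ} (hm : m ≤ n) {r : R}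
    (hr : r ∈ filtration p fn Y m) : fn a * r ∈ filtration p fn Y m := by
  induction m generalizing r with
  | zero =>
    obtain ⟨b, rfl⟩ := hr
    exact ⟨a * b, map_mul _ _ _⟩
  | succ m ih =>
    refine filtration_induction (P := fun r => fn a * r ∈ filtration p fn Y (m + 1))
      (fun r s hr hs => ?_) ?_ hm (fun κ hκ j hj => ?_) hr
    · rw [mul_add]; exact add_mem hr hs
    · rw [mul_zero]; exact zero_mem _
    · rw [← mul_assoc]
      exact mul_pow_mem_filtration_succ hj (ih (by omega) hκ)

theorem one_mem_filtration {m : ℕ} (hm : m ≤ n) : (1 : R) ∈ filtration p fn Y m := by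
  induction m with
  | zero => exact ⟨1, map_one _⟩
  | succ m ih =>
    have := mul_pow_mem_filtration_succ (Y := Y) (hm := hm) (Fact.out : p.Prime).pos (ih (by omega))
    simpa using this


theorem commute_fn_pow (H : OperatorAlgebra X fn vec Y) (i : Fin n) (a : A) : Commute (fn (a ^ p)) (Y i) := by
  rw [commute_iff_eq, H.mul_fn, ← mul_one (a ^ p),
    derivation_pow_mul (cast_eq_zero_of_charP k A p)]
  simp

theorem commute_filtration {s : R} (hs : ∀ a, Commute s (fn a)) {m : ℕ} (hm : m ≤ n)
    (hY : ∀ i : Fin n, i.1 < m → Commute s (Y i)) {r : R} (hr : r ∈ filtration p fn Y m) :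
    Commute s r := by
  induction m generalizing r with
  | zero => obtain ⟨b, rfl⟩ := hr; exact hs b
  | succ m ih =>
    refine filtration_induction (P := fun r => Commute s r) (fun r t hr ht => hr.add_right ht)
      (Commute.zero_right _) hm (fun κ hκ j hj => ?_) hr
    exact (ih (by omega) (fun i hi => hY i (by omega)) hκ).mul_right
      ((hY ⟨m, hm⟩ (Nat.lt_succ_self m)).pow_right j)

theorem commutator_mem_filtration (H : OperatorAlgebra X fn vec Y) (i : Fin n) {m : ℕ} (hm : m ≤ n) {r : R}
    (hr : r ∈ filtration p fn Y m) : Y i * r - r * Y i ∈ filtration p fn Y m := by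
  induction m generalizing r with
  | zero =>
    obtain ⟨b, rfl⟩ := hr
    exact ⟨X.d i b, by rw [H.mul_fn]; abel⟩
  | succ m ih =>
    refine filtration_induction (P := fun r => Y i * r - r * Y i ∈ filtration p fn Y (m + 1))
      (fun r s hr hs => ?_) ?_ hm (fun κ hκ j hj => ?_) hr
    · convert add_mem hr hs using 1; noncomm_ring
    · simp
    · have : Y i * (κ * Y ⟨m, hm⟩ ^ j) - κ * Y ⟨m, hm⟩ ^ j * Y i =
          (Y i * κ - κ * Y i) * Y ⟨m, hm⟩ ^ j := by
        rw [mul_assoc κ, ← ((H.comm i ⟨m, hm⟩).pow_right j).eq]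
        noncomm_ring
      rw [this]
      exact mul_pow_mem_filtration_succ hj (ih (by omega) hκ)

/-- When the exponent of `Y i` reaches `p`, the power `Y i ^ p` is a `p`-th power of a function; it
commutes with functions and with all `Y j`, and is absorbed into the coefficients. -/
theorem mul_mem_filtration (H : OperatorAlgebra X fn vec Y) (i : Fin n) {m : ℕ} (him : i.1 < m) (hm : m ≤ n) {r : R}
    (hr : r ∈ filtration p fn Y m) : Y i * r ∈ filtration p fn Y m := by
  induction m generalizing r with
  | zero => omega
  | succ m ih =>
    refine filtration_induction (P := fun r => Y i * r ∈ filtration p fn Y (m + 1))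
      (fun r s hr hs => ?_) ?_ hm (fun κ hκ j hj => ?_) hr
    · rw [mul_add]; exact add_mem hr hs
    · rw [mul_zero]; exact zero_mem _
    · by_cases hi : i.1 < m
      · rw [← mul_assoc]
        exact mul_pow_mem_filtration_succ hj (ih hi (by omega) hκ)
      · obtain rfl : i = ⟨m, hm⟩ := Fin.ext (by simp; omega)
        have : Y ⟨m, hm⟩ * (κ * Y ⟨m, hm⟩ ^ j) =
          (Y ⟨m, hm⟩ * κ - κ * Y ⟨m, hm⟩) * Y ⟨m, hm⟩ ^ j + κ * Y ⟨m, hm⟩ ^ (j + 1) := by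
          rw [pow_succ']; noncomm_ring
        rw [this]
        refine add_mem (mul_pow_mem_filtration_succ hj
          (H.commutator_mem_filtration _ (by omega) hκ)) ?_
        by_cases hj' : j + 1 < p
        · exact mul_pow_mem_filtration_succ hj' hκ
        · obtain rfl : p = j + 1 := by omega
          obtain ⟨a, ha⟩ := H.pow ⟨m, hm⟩
          have hc : Commute (fn (a ^ (j + 1))) κ :=
            commute_filtration (fun b => by
              rw [commute_iff_eq, ← map_mul, mul_comm, map_mul]) (by omega)
              (fun i _ => H.commute_fn_pow i a) hκ
          rw [ha, ← hc.eq]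
          have := mul_pow_mem_filtration_succ (Y := Y) (hm := hm) (Fact.out : (j + 1).Prime).pos
            (fn_mul_mem_filtration (p := j + 1) (fn := fn) (Y := Y) (a ^ (j + 1)) (by omega) hκ)
          simpa using this

/-- The elements that enter the filtration after multiplication by a power of `g ^ p` contain `1`
and are stable under left multiplication by the generators. Only the generators in `V` cost a
denominator. -/
theorem exists_mem_filtration (H : OperatorAlgebra X fn vec Y) (r : R) :
    ∃ m : ℕ, fn ((g ^ p) ^ m) * r ∈ filtration p fn Y n := by
  have hβ : ∀ (l m : ℕ) (s : R), fn ((g ^ p) ^ m) * s ∈ filtration p fn Y n →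
      fn ((g ^ p) ^ (l + m)) * s ∈ filtration p fn Y n := fun l m s hs => by
    rw [pow_add, map_mul, mul_assoc]
    exact fn_mul_mem_filtration _ le_rfl hs
  let S : AddSubgroup R :=
    { carrier := {s | ∃ m : ℕ, fn ((g ^ p) ^ m) * s ∈ filtration p fn Y n}
      zero_mem' := ⟨0, by simp⟩
      add_mem' := by
        rintro s t ⟨l, hl⟩ ⟨m, hm⟩
        refine ⟨l + m, ?_⟩
        rw [mul_add]
        exact add_mem (by rw [add_comm l]; exact hβ _ _ _ hl) (hβ _ _ _ hm)
      neg_mem' := by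
        rintro s ⟨l, hl⟩
        exact ⟨l, by rw [mul_neg]; exact neg_mem hl⟩ }
  let T : Subring R :=
    { carrier := {t | ∀ s ∈ S, t * s ∈ S}
      zero_mem' := fun s _ => by rw [zero_mul]; exact zero_mem _
      one_mem' := fun s hs => by rwa [one_mul]
      add_mem' := fun ha hb s hs => by rw [add_mul]; exact add_mem (ha s hs) (hb s hs)
      neg_mem' := fun ha s hs => by rw [neg_mul]; exact neg_mem (ha s hs)
      mul_mem' := fun ha hb s hs => by rw [mul_assoc]; exact ha _ (hb s hs) }
  have hT : T = ⊤ := by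
    rw [eq_top_iff, ← H.closure_eq, Subring.closure_le]
    rintro _ (⟨a, rfl⟩ | ⟨v, rfl⟩) s ⟨m, hm⟩
    · refine ⟨m, ?_⟩
      rw [← mul_assoc, ← map_mul, mul_comm, map_mul, mul_assoc]
      exact fn_mul_mem_filtration _ le_rfl hm
    · refine ⟨1 + m, ?_⟩
      obtain ⟨a, ha⟩ := H.mul_vec v
      have : fn ((g ^ p) ^ (1 + m)) * (vec v * s) =
          ∑ i, fn (a i) * (Y i * (fn ((g ^ p) ^ m) * s)) := by
        rw [pow_add, pow_one, map_mul, pow_right_comm, mul_assoc, ← mul_assoc _ (vec v),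
          (H.commute_vec v (g ^ m)).eq, mul_assoc, ← mul_assoc, ha, Finset.sum_mul]
        simp only [mul_assoc]
      rw [this]
      exact sum_mem fun i _ => fn_mul_mem_filtration _ le_rfl (H.mul_mem_filtration i i.2 le_rfl hm)
  have h1 : (1 : R) ∈ S := ⟨0, by simpa using one_mem_filtration le_rfl⟩
  have : r ∈ T := hT ▸ trivial
  rw [← mul_one r]
  exact this 1 h1

theorem pow_mul_x (H : OperatorAlgebra X fn vec Y) (i : Fin n) (j : ℕ) :
    Y i ^ (j + 1) * fn (X.x i) =
      fn (X.x i) * Y i ^ (j + 1) + ((j + 1 : ℕ) : R) * fn (g ^ p) * Y i ^ j := by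
  have h1 : Y i * fn (X.x i) = fn (X.x i) * Y i + fn (g ^ p) := by
    rw [H.mul_fn, X.d_x, if_pos rfl]
  have hc := (H.commute_fn_pow i g).symm
  induction j with
  | zero => simp [h1]
  | succ j ih =>
    rw [pow_succ' (Y i) (j + 1), mul_assoc, ih, mul_add, ← mul_assoc, h1, ← mul_assoc (Y i),
      ← mul_assoc (Y i), ← (Nat.cast_commute (j + 1) (Y i)).eq, mul_assoc _ (Y i), hc.eq, add_mul,
      mul_assoc, ← pow_succ', mul_assoc, mul_assoc, ← pow_succ']
    push_cast
    noncomm_ring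

theorem commute_x (H : OperatorAlgebra X fn vec Y) {i j : Fin n} (hij : i ≠ j) : Commute (Y i) (fn (X.x j)) := by
  rw [commute_iff_eq, H.mul_fn, X.d_x, if_neg hij]; simp

/-- The commutator with `x_i` takes `Y_i ^ (j + 1)` to `(j + 1) g ^ p Y_i ^ j`, like a derivative in
`Y_i`. A relation in the image, read as a polynomial in the last `Y_i`, thus gives one of lower
degree, and `j + 1 < p` is invertible. The induction ends with functions, on which `ρ` is injective;
powers of `g ^ p` accumulate. -/
theorem eq_zero_of_filtration (H : OperatorAlgebra X fn vec Y) {E : Type*} [Ring E] (ρ : R →+* E)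
    (hρ : Function.Injective (ρ.comp fn)) {m : ℕ} (hm : m ≤ n) {r : R}
    (hr : r ∈ filtration p fn Y m) (h : ρ r = 0) : ∃ l : ℕ, fn ((g ^ p) ^ l) * r = 0 := by
  induction m generalizing r with
  | zero =>
    obtain ⟨a, rfl⟩ := hr
    have : a = 0 := hρ (by rw [map_zero]; exact h)
    exact ⟨0, by rw [this]; erw [map_zero, mul_zero]⟩
  | succ m ih =>
    let i : Fin n := ⟨m, hm⟩
    have key : ∀ t ≤ p, ∀ κ : ℕ → R, (∀ j, κ j ∈ filtration p fn Y m) →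
        ρ (∑ j ∈ Finset.range t, κ j * Y i ^ j) = 0 →
        ∃ l : ℕ, ∀ j < t, fn ((g ^ p) ^ l) * κ j = 0 := by
      intro t
      induction t with
      | zero => exact fun _ κ _ _ => ⟨0, by simp⟩
      | succ t iht =>
        intro ht κ hκ h0
        have hx : ∀ j, Commute (κ j) (fn (X.x i)) := fun j =>
          (commute_filtration (fun a => by rw [commute_iff_eq, ← map_mul, mul_comm, map_mul])
            (by omega) (fun l hl => (H.commute_x (fun e => by
              rw [e] at hl; exact lt_irrefl _ hl)).symm) (hκ j)).symm
        have h1 : ∀ j, κ (j + 1) * Y i ^ (j + 1) * fn (X.x i)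
            - fn (X.x i) * (κ (j + 1) * Y i ^ (j + 1)) =
            (fn (((j + 1 : ℕ) : A) * g ^ p) * κ (j + 1)) * Y i ^ j := by
          intro j
          have hc : Commute (fn (((j + 1 : ℕ) : A) * g ^ p)) (κ (j + 1)) :=
            commute_filtration (fun a => by rw [commute_iff_eq, ← map_mul, mul_comm, map_mul])
              (by omega) (fun l _ => by
                rw [map_mul, map_natCast]
                exact (Nat.cast_commute _ _).mul_left (H.commute_fn_pow l g)) (hκ _)
          rw [mul_assoc, H.pow_mul_x, mul_add, ← mul_assoc (fn _) (κ _), ← (hx _).eq,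
            mul_assoc (κ _) (fn (X.x i)), add_sub_cancel_left, ← map_natCast fn, ← map_mul,
            ← mul_assoc, hc.eq]
        have h2 : ρ (∑ j ∈ Finset.range t,
            (fn (((j + 1 : ℕ) : A) * g ^ p) * κ (j + 1)) * Y i ^ j) = 0 := by
          have h3 : ∑ j ∈ Finset.range t, (fn (((j + 1 : ℕ) : A) * g ^ p) * κ (j + 1)) * Y i ^ j =
              (∑ j ∈ Finset.range (t + 1), κ j * Y i ^ j) * fn (X.x i)
              - fn (X.x i) * ∑ j ∈ Finset.range (t + 1), κ j * Y i ^ j := by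
            rw [Finset.sum_range_succ', add_mul, mul_add, Finset.sum_mul, Finset.mul_sum,
              pow_zero, mul_one, (hx 0).eq, add_sub_add_right_eq_sub, ← Finset.sum_sub_distrib]
            exact Finset.sum_congr rfl fun j _ => (h1 j).symm
          rw [h3, map_sub, map_mul, map_mul, h0]; simp
        obtain ⟨l, hl⟩ := iht (by omega) _
          (fun j => fn_mul_mem_filtration _ (by omega) (hκ (j + 1))) h2
        have h4 : ∀ j < t, fn ((g ^ p) ^ (l + 1)) * κ (j + 1) = 0 := by
          intro j hj
          have hj0 : ((j + 1 : ℕ) : k) ≠ 0 := by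
            rw [Ne, CharP.cast_eq_zero_iff k p]
            exact Nat.not_dvd_of_pos_of_lt (by omega) (by omega)
          have : (g ^ p) ^ (l + 1) = algebraMap k A (((j + 1 : ℕ) : k)⁻¹) *
              ((g ^ p) ^ l * (((j + 1 : ℕ) : A) * g ^ p)) := by
            have h5 : algebraMap k A (((j + 1 : ℕ) : k)⁻¹) * ((j + 1 : ℕ) : A) = 1 := by
              rw [← map_natCast (algebraMap k A), ← map_mul, inv_mul_cancel₀ hj0, map_one]
            linear_combination (- (g ^ p) ^ (l + 1)) * h5
          rw [this, map_mul, map_mul _ ((g ^ p) ^ l), mul_assoc, mul_assoc, hl j hj, mul_zero]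
        have h6 : ρ (fn ((g ^ p) ^ (l + 1)) * κ 0) = 0 := by
          have h7 : fn ((g ^ p) ^ (l + 1)) * κ 0 = fn ((g ^ p) ^ (l + 1)) *
              ∑ j ∈ Finset.range (t + 1), κ j * Y i ^ j := by
            rw [Finset.sum_range_succ', mul_add, Finset.mul_sum, pow_zero, mul_one,
              Finset.sum_eq_zero, zero_add]
            intro j hj
            rw [← mul_assoc, h4 j (Finset.mem_range.1 hj), zero_mul]
          rw [h7, map_mul, h0, mul_zero]
        obtain ⟨l', hl'⟩ := ih (by omega) (fn_mul_mem_filtration _ (by omega) (hκ 0)) h6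
        refine ⟨l' + (l + 1), fun j hj => ?_⟩
        rw [pow_add, map_mul, mul_assoc]
        cases j with
        | zero => exact hl'
        | succ j => rw [h4 j (by omega), mul_zero]
    obtain ⟨κ, hκ, rfl⟩ := (mem_filtration_succ (hm := hm)).1 hr
    obtain ⟨l, hl⟩ := key p le_rfl κ hκ h
    refine ⟨l, ?_⟩
    rw [Finset.mul_sum]
    exact Finset.sum_eq_zero fun j hj => by
      rw [← mul_assoc, hl j (Finset.mem_range.1 hj), zero_mul]

theorem exists_mul_eq_zero (H : OperatorAlgebra X fn vec Y) {E : Type*} [Ring E] (ρ : R →+* E)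
    (hρ : Function.Injective (ρ.comp fn)) {r : R} (h : ρ r = 0) :
    ∃ l : ℕ, fn ((g ^ p) ^ l) * r = 0 := by
  obtain ⟨m, hm⟩ := H.exists_mem_filtration r
  obtain ⟨l, hl⟩ := H.eq_zero_of_filtration ρ hρ le_rfl hm (by rw [map_mul, h, mul_zero])
  exact ⟨l + m, by rw [pow_add, map_mul, mul_assoc, hl]⟩

/-- The commutator `φ ↦ x φ - φ x`. -/
def leftComm {E : Type*} [Ring E] (x : E) : E →+ E :=
  AddMonoidHom.mulLeft x - AddMonoidHom.mulRight x

theorem leftComm_apply {E : Type*} [Ring E] (x φ : E) : leftComm x φ = x * φ - φ * x := rfl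

/-- Left and right multiplication by `x` commute, so this is the binomial formula with its middle
coefficients divisible by `p`. -/
theorem leftComm_iterate_prime {E : Type*} [Ring E] (hp : (p : E) = 0) (x φ : E) :
    (leftComm x)^[p] φ = x ^ p * φ - φ * x ^ p := by
  have h := pow_mul_eq_sum_choose (x := x) (y := fun i => (leftComm x)^[i] φ) (fun i => by
    rw [Function.iterate_succ_apply', leftComm_apply]; abel) p
  have hp0 : p ≠ 0 := (Fact.out : p.Prime).ne_zero
  rw [Finset.sum_range_succ, Finset.sum_eq_single 0] at h
  · simp only [Function.iterate_zero, id_eq, Nat.choose_zero_right, Nat.cast_one, tsub_zero,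
      one_mul, Nat.choose_self, tsub_self, pow_zero, mul_one] at h
    rw [h]; abel
  · intro j hj hj0
    obtain ⟨m, hm⟩ := (Fact.out : p.Prime).dvd_choose_self hj0 (Finset.mem_range.1 hj)
    rw [hm, Nat.cast_mul, hp, zero_mul, zero_mul]
  · simp [hp0]

theorem leftComm_iterate_mul {E : Type*} [Ring E] {x c : E} (h : Commute c x) (φ : E) (t : ℕ) :
    (leftComm x)^[t] (c * φ) = c * (leftComm x)^[t] φ := by
  induction t with
  | zero => rfl
  | succ t ih =>
    rw [Function.iterate_succ_apply', Function.iterate_succ_apply', ih, leftComm_apply,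
      leftComm_apply, mul_sub, ← mul_assoc, ← h.eq, mul_assoc, mul_assoc]

/-- Integration in the variables `Y_i`. The commutator with a coordinate is nilpotent of order `p`,
because `p`-th powers of functions are central in `E`. The outer induction starts from elements
commuting with all coordinates, which are functions up to denominators, and releases one coordinate
at a time. The inner one subtracts a multiple of `r Y_i ^ t`, which lowers the order of nilpotency.
-/
theorem exists_mul_mem_range (H : OperatorAlgebra X fn vec Y) {E : Type*} [Ring E] (ρ : R →+* E)
    (hE : ∀ (a : A) (φ : E), Commute (ρ (fn (a ^ p))) φ)
    (h0 : ∀ φ : E, (∀ i, Commute φ (ρ (fn (X.x i)))) →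
      ∃ (l : ℕ) (a : A), ρ (fn ((g ^ p) ^ l)) * φ = ρ (fn a)) (φ : E) :
    ∃ l : ℕ, ρ (fn ((g ^ p) ^ l)) * φ ∈ ρ.range := by
  have hpE : (p : E) = 0 := by
    rw [← map_natCast (ρ.comp fn), cast_eq_zero_of_charP k A p, map_zero]
  have hβ : ∀ l (φ : E), Commute (ρ (fn ((g ^ p) ^ l))) φ := fun l φ => by
    rw [pow_right_comm]; exact hE _ _
  suffices key : ∀ m ≤ n, ∀ φ : E, (∀ i : Fin n, m ≤ i.1 → Commute φ (ρ (fn (X.x i)))) →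
      ∃ l : ℕ, ρ (fn ((g ^ p) ^ l)) * φ ∈ ρ.range from
    key n le_rfl φ fun i hi => absurd i.2 (not_lt.2 hi)
  intro m
  induction m with
  | zero =>
    intro _ φ hφ
    obtain ⟨l, a, h⟩ := h0 φ fun i => hφ i (Nat.zero_le _)
    exact ⟨l, fn a, h.symm⟩
  | succ m ih =>
    intro hm φ hφ
    let i : Fin n := ⟨m, hm⟩
    -- With this sign `leftComm x` is `φ ↦ φ x_i - x_i φ`, which differentiates powers of `Y_i` with
    -- positive coefficients.
    let x : E := ρ (fn (-X.x i))
    have hx : ∀ φ : E, leftComm x φ = φ * ρ (fn (X.x i)) - ρ (fn (X.x i)) * φ := fun φ => by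
      simp only [x, leftComm_apply, map_neg]; noncomm_ring
    have hcx : ∀ a, Commute (ρ (fn a)) x := fun a => by
      rw [commute_iff_eq, ← map_mul, ← map_mul, mul_comm, map_mul, map_mul]
    have hδY : ∀ (t : ℕ) (r : R), leftComm x (ρ r) = 0 →
        (leftComm x)^[t] (ρ (r * Y i ^ t)) =
          (t.factorial : E) * ρ (fn ((g ^ p) ^ t)) * ρ r := by
      intro t r hr
      induction t with
      | zero => simp
      | succ t iht =>
        have h1 : leftComm x (ρ (r * Y i ^ (t + 1))) =
            ρ (fn (((t + 1 : ℕ) : A) * g ^ p)) * ρ (r * Y i ^ t) := by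
          have hcen : Commute (ρ (fn (((t + 1 : ℕ) : A) * g ^ p))) (ρ r) := by
            rw [map_mul fn, map_natCast, map_mul, map_natCast]
            exact (Nat.cast_commute _ _).mul_left (by simpa only [pow_one] using hβ 1 (ρ r))
          rw [hx, sub_eq_zero] at hr
          rw [hx, map_mul, mul_assoc, ← map_mul ρ (Y i ^ (t + 1)), H.pow_mul_x, ← map_natCast fn,
            ← map_mul fn, map_add, mul_add, map_mul ρ (fn (X.x i)), ← mul_assoc (ρ r), hr,
            mul_assoc (ρ (fn (X.x i))), add_sub_cancel_left, map_mul ρ (fn _) (Y i ^ t),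
            ← mul_assoc, ← hcen.eq, mul_assoc, map_mul ρ r]
        rw [Function.iterate_succ_apply, h1, leftComm_iterate_mul (hcx _), iht, Nat.factorial_succ,
          pow_succ', map_mul, map_mul, map_mul, map_mul, map_natCast, map_natCast]
        push_cast
        have h2 := (Nat.cast_commute t.factorial (ρ (fn (g ^ p)))).eq
        simp only [mul_assoc]
        rw [← mul_assoc (ρ (fn (g ^ p))) (t.factorial : E), ← h2, mul_assoc]
    have key : ∀ t ≤ p, ∀ φ : E, (∀ j : Fin n, m + 1 ≤ j.1 → Commute φ (ρ (fn (X.x j)))) →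
        (leftComm x)^[t] φ = 0 → ∃ l : ℕ, ρ (fn ((g ^ p) ^ l)) * φ ∈ ρ.range := by
      intro t
      induction t with
      | zero =>
        intro _ φ _ h
        obtain rfl : φ = 0 := h
        exact ⟨0, by rw [mul_zero]; exact zero_mem _⟩
      | succ t iht =>
        intro ht φ hφ hδ
        rw [Function.iterate_succ_apply'] at hδ
        have hc : ∀ j : Fin n, m + 1 ≤ j.1 → ∀ t,
            Commute ((leftComm x)^[t] φ) (ρ (fn (X.x j))) := by
          intro j hj t
          induction t with
          | zero => exact hφ j hj
          | succ t ih' =>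
            rw [Function.iterate_succ_apply', leftComm_apply]
            have := (hcx (X.x j)).symm
            exact (this.mul_left ih').sub_left (ih'.mul_left this)
        obtain ⟨l, r, hr⟩ := ih (by omega) ((leftComm x)^[t] φ) fun j hj => by
          rcases hj.eq_or_lt with h | h
          · obtain rfl : j = i := Fin.ext h.symm
            rwa [hx, sub_eq_zero] at hδ
          · exact hc j h t
        have hδr : leftComm x (ρ r) = 0 := by
          rw [hr]
          have := leftComm_iterate_mul (hcx ((g ^ p) ^ l)) ((leftComm x)^[t] φ) 1
          simp only [Function.iterate_one] at this
          rw [this, hδ, mul_zero]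
        -- `ρ r` is `(g ^ p) ^ l` times the `t`-th iterated commutator of `φ`, and that of `ρ (r * Y
        -- i ^ t)` is `t! (g ^ p) ^ t` times `ρ r`. With this `c` the `t`-th commutator of the
        -- difference below vanishes; `t < p` makes `t!` invertible at the end.
        let c : A := (t.factorial : A) * (g ^ p) ^ (t + l)
        have hcc : ∀ φ : E, Commute (ρ (fn c)) φ := fun φ => by
          simp only [c, map_mul, map_natCast]
          exact (Nat.cast_commute _ _).mul_left (by simpa using hβ (t + l) φ)
        obtain ⟨l', s, hs⟩ := iht (by omega) (ρ (fn c) * φ - ρ (r * Y i ^ t))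
          (fun j hj => by
            refine ((hcc _).mul_left (hφ j hj)).sub_left ?_
            have h1 : Commute (Y i ^ t) (fn (X.x j)) :=
              (H.commute_x (fun e => by rw [← e] at hj; exact absurd hj (by simp [i]))).pow_left t
            rw [map_mul]
            refine Commute.mul_left ?_ (h1.map ρ)
            rw [hr]
            exact (hβ l _).mul_left (hc j hj t))
          (by
            rw [iterate_map_sub, leftComm_iterate_mul (hcx c), hδY t r hδr, hr]
            simp only [c, pow_add, map_mul, map_natCast, mul_assoc, sub_self])
        have ht0 : ((t.factorial : ℕ) : k) ≠ 0 := by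
          rw [Ne, CharP.cast_eq_zero_iff k p, (Fact.out : p.Prime).dvd_factorial]
          omega
        refine ⟨l' + (t + l), fn (algebraMap k A ((t.factorial : k)⁻¹)) *
          (s + fn ((g ^ p) ^ l') * (r * Y i ^ t)), ?_⟩
        have h5 : (g ^ p) ^ (l' + (t + l)) = algebraMap k A ((t.factorial : k)⁻¹) *
            ((g ^ p) ^ l' * c) := by
          have : algebraMap k A (((t.factorial : ℕ) : k)⁻¹) * (t.factorial : A) = 1 := by
            rw [← map_natCast (algebraMap k A), ← map_mul, inv_mul_cancel₀ ht0, map_one]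
          simp only [c]
          linear_combination (- (g ^ p) ^ (l' + (t + l))) * this
        rw [h5, map_mul ρ, map_add, map_mul ρ (fn _) (r * _), hs, mul_sub, sub_add_cancel]
        simp only [map_mul, mul_assoc]
    refine key p le_rfl φ hφ ?_
    rw [leftComm_iterate_prime hpE, sub_eq_zero]
    simp only [x, ← map_pow]
    exact hE _ _

end OperatorAlgebra

theorem eq_top_of_forall_prime {J : Ideal A} (h : ∀ q : Ideal A, q.IsPrime → ∃ a ∈ J, a ∉ q) :
    J = ⊤ := by
  by_contra hJ
  obtain ⟨m, hm, hJm⟩ := J.exists_le_maximal hJ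
  obtain ⟨a, ha, ha'⟩ := h m hm.isPrime
  exact ha' (hJm ha)

/-- An algebra of operators that is Zariski locally of the form `OperatorAlgebra` is isomorphic
to a ring in which the centralizer of coordinate functions consists of functions. -/
theorem operatorAlgebra_bijective {R V E : Type*} [Ring R] [Ring E] {fn : A →+* R} {vec : V → R}
    (ρ : R →+* E) (hρ : Function.Injective (ρ.comp fn))
    (hE : ∀ (a : A) (φ : E), Commute (ρ (fn (a ^ p))) φ)
    (h : ∀ q : Ideal A, q.IsPrime → ∃ (n : ℕ) (g : A) (X : ApproxCoordinates k A p n g)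
      (Y : Fin n → R), g ∉ q ∧ OperatorAlgebra X fn vec Y ∧
        ∀ φ : E, (∀ i, Commute φ (ρ (fn (X.x i)))) →
          ∃ (l : ℕ) (a : A), ρ (fn ((g ^ p) ^ l)) * φ = ρ (fn a)) :
    Function.Bijective ρ := by
  have hmem : ∀ {q : Ideal A} (_ : q.IsPrime) {g : A} (_ : g ∉ q) (l : ℕ), (g ^ p) ^ l ∉ q :=
    fun hq g hg l hl => hg (hq.mem_of_pow_mem _ (hq.mem_of_pow_mem _ hl))
  refine ⟨(injective_iff_map_eq_zero ρ).2 fun r hr => ?_, fun φ => ?_⟩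
  -- The functions annihilating `r` form an ideal, and the local statement provides an element of it
  -- outside any given prime.
  · let J : Ideal A :=
      { carrier := {a | fn a * r = 0}
        zero_mem' := by simp
        add_mem' := fun {a b} (ha : fn a * r = 0) (hb : fn b * r = 0) => by
          simp [add_mul, ha, hb]
        smul_mem' := fun c a (ha : fn a * r = 0) => by simp [mul_assoc, ha] }
    have hJ : J = ⊤ := eq_top_of_forall_prime fun q hq => by
      obtain ⟨n, g, X, Y, hg, H, _⟩ := h q hq
      obtain ⟨l, hl⟩ := H.exists_mul_eq_zero ρ hρ hr
      exact ⟨_, hl, hmem hq hg l⟩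
    have h1 : (1 : A) ∈ J := hJ ▸ trivial
    simpa [J] using h1
  · let J : Ideal A :=
      { carrier := {a | ρ (fn a) * φ ∈ ρ.range}
        zero_mem' := by
          change ρ (fn 0) * φ ∈ ρ.range
          rw [map_zero, map_zero, zero_mul]; exact zero_mem _
        add_mem' := fun {a b} (ha : ρ (fn a) * φ ∈ ρ.range) (hb : ρ (fn b) * φ ∈ ρ.range) => by
          change ρ (fn (a + b)) * φ ∈ ρ.range
          rw [map_add, map_add, add_mul]; exact add_mem ha hb
        smul_mem' := fun c a (ha : ρ (fn a) * φ ∈ ρ.range) => by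
          change ρ (fn (c * a)) * φ ∈ ρ.range
          rw [map_mul, map_mul, mul_assoc]; exact mul_mem ⟨_, rfl⟩ ha }
    have hJ : J = ⊤ := eq_top_of_forall_prime fun q hq => by
      obtain ⟨n, g, X, Y, hg, H, h0⟩ := h q hq
      obtain ⟨l, hl⟩ := H.exists_mul_mem_range ρ hE h0 φ
      exact ⟨_, hl, hmem hq hg l⟩
    have h1 : (1 : A) ∈ J := hJ ▸ trivial
    have h2 : ρ (fn 1) * φ ∈ ρ.range := h1
    rwa [map_one, map_one, one_mul] at h2

end Azumaya
end
end PCurv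

namespace PCurv
noncomputable section

/-! ### Gluing of sections, and vector fields on affine open sets -/

section SheafTools

variable {X : Scheme.{u}}

theorem mres_ext (M : X.Modules) {U : X.Opens} {ι : Type u} {V : ι → X.Opens} (hV : ∀ i, V i ≤ U)
    (hU : ∀ x ∈ U, ∃ i, x ∈ V i) {s t : Γ(M, U)} (h : ∀ i, mres M (hV i) s = mres M (hV i) t) :
    s = t :=
  TopCat.Sheaf.eq_of_locally_eq' ⟨M.presheaf, M.isSheaf⟩ V U (fun i => homOfLE (hV i))
    (fun x hx => Opens.mem_iSup.2 (hU x hx)) s t h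

theorem mres_glue (M : X.Modules) {U : X.Opens} {ι : Type u} {V : ι → X.Opens} (hV : ∀ i, V i ≤ U)
    (hU : ∀ x ∈ U, ∃ i, x ∈ V i) (s : ∀ i, Γ(M, V i))
    (h : ∀ i j (W : X.Opens) (hi : W ≤ V i) (hj : W ≤ V j), mres M hi (s i) = mres M hj (s j)) :
    ∃ t : Γ(M, U), ∀ i, mres M (hV i) t = s i :=
  (TopCat.Sheaf.existsUnique_gluing' ⟨M.presheaf, M.isSheaf⟩ V U (fun i => homOfLE (hV i))
    (fun x hx => Opens.mem_iSup.2 (hU x hx)) s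
    (fun i j => h i j _ (inf_le_left (a := V i)) inf_le_right)).exists

variable (k : Type u) [Field k] [X.Over (Spec (.of k))]

theorem res_ext {U : X.Opens} {ι : Type u} {V : ι → X.Opens} (hV : ∀ i, V i ≤ U)
    (hU : ∀ x ∈ U, ∃ i, x ∈ V i) {s t : Γ(X, U)} (h : ∀ i, res k (hV i) s = res k (hV i) t) :
    s = t :=
  TopCat.Sheaf.eq_of_locally_eq' X.sheaf V U (fun i => homOfLE (hV i))
    (fun x hx => Opens.mem_iSup.2 (hU x hx)) s t h

theorem res_glue {U : X.Opens} {ι : Type u} {V : ι → X.Opens} (hV : ∀ i, V i ≤ U)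
    (hU : ∀ x ∈ U, ∃ i, x ∈ V i) (s : ∀ i, Γ(X, V i))
    (h : ∀ i j (W : X.Opens) (hi : W ≤ V i) (hj : W ≤ V j), res k hi (s i) = res k hj (s j)) :
    ∃ t : Γ(X, U), ∀ i, res k (hV i) t = s i :=
  (TopCat.Sheaf.existsUnique_gluing' X.sheaf V U (fun i => homOfLE (hV i))
    (fun x hx => Opens.mem_iSup.2 (hU x hx)) s
    (fun i j => h i j _ (inf_le_left (a := V i)) inf_le_right)).exists

theorem exists_affine_le {U : X.Opens} {x : X} (hx : x ∈ U) :
    ∃ V : X.affineOpens, x ∈ V.1 ∧ V.1 ≤ U := by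
  obtain ⟨V, hV, hxV, hVU⟩ := Opens.isBasis_iff_nbhd.1 X.isBasis_affineOpens hx
  exact ⟨⟨V, hV⟩, hxV, hVU⟩

/-- Sections of a sheaf of modules that agree on the affine open subsets. -/
theorem mres_ext_affine (M : X.Modules) {U : X.Opens} {s t : Γ(M, U)}
    (h : ∀ x ∈ U, ∃ (V : X.affineOpens) (hV : V.1 ≤ U), x ∈ V.1 ∧ mres M hV s = mres M hV t) :
    s = t := by
  choose V hV hxV h using h
  exact mres_ext M (ι := U) (V := fun x => (V x.1 x.2).1) (fun x => hV x.1 x.2)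
    (fun x hx => ⟨⟨x, hx⟩, hxV x hx⟩) fun x => h x.1 x.2

theorem res_ext_affine {U : X.Opens} {s t : Γ(X, U)}
    (h : ∀ x ∈ U, ∃ (V : X.affineOpens) (hV : V.1 ≤ U), x ∈ V.1 ∧ res k hV s = res k hV t) :
    s = t := by
  choose V hV hxV h using h
  exact res_ext k (ι := U) (V := fun x => (V x.1 x.2).1) (fun x => hV x.1 x.2)
    (fun x hx => ⟨⟨x, hx⟩, hxV x hx⟩) fun x => h x.1 x.2

theorem IsGenerator.restrict {M : X.Modules} {U V : X.Opens} {e : Γ(M, U)} (he : IsGenerator M U e)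
    (h : V ≤ U) : IsGenerator M V (mres M h e) := fun W hW => by
  simp only [mres_mres]
  exact he W (hW.trans h)

theorem IsFrame.restrict {M : X.Modules} {U V : X.Opens} {n : ℕ} {b : Fin n → Γ(M, U)}
    (hb : IsFrame M U b) (h : V ≤ U) : IsFrame M V fun i => mres M h (b i) := fun W hW => by
  simp only [mres_mres]
  exact hb W (hW.trans h)

variable {k}

theorem Vect.ext_iff' {U : X.Opens} {ξ η : Vect k U} :
    ξ = η ↔ ∀ W : {W : X.Opens // W ≤ U}, ξ.1 W = η.1 W :=
  ⟨fun h _ => h ▸ rfl, fun h => Subtype.ext (funext h)⟩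

theorem res_eq_zero_iff_isLocalization {U : X.Opens} (hU : IsAffineOpen U) (f a : Γ(X, U)) :
    res k (X.basicOpen_le f) a = 0 ↔ ∃ m : ℕ, f ^ m * a = 0 := by
  have := hU.isLocalization_basicOpen f
  have h := IsLocalization.map_eq_zero_iff (Submonoid.powers f) Γ(X, X.basicOpen f) a
  refine h.trans ⟨?_, ?_⟩
  · rintro ⟨⟨_, m, rfl⟩, h⟩; exact ⟨m, h⟩
  · rintro ⟨m, h⟩; exact ⟨⟨_, m, rfl⟩, h⟩

theorem exists_res_eq_pow_mul {U : X.Opens} (hU : IsAffineOpen U) (f : Γ(X, U))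
    (z : Γ(X, X.basicOpen f)) : ∃ (m : ℕ) (a : Γ(X, U)),
      res k (X.basicOpen_le f) (f ^ m) * z = res k (X.basicOpen_le f) a := by
  have := hU.isLocalization_basicOpen f
  obtain ⟨⟨a, ⟨_, m, rfl⟩⟩, h⟩ := IsLocalization.surj (Submonoid.powers f) z
  exact ⟨m, a, by rw [mul_comm]; exact h⟩

theorem isUnit_res_basicOpen {U : X.Opens} (f : Γ(X, U)) :
    IsUnit (res k (X.basicOpen_le f) f) := X.toRingedSpace.isUnit_res_basicOpen f

theorem basicOpen_mul_eq_inf {U : X.Opens} (f g : Γ(X, U)) :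
    X.basicOpen (f * g) = X.basicOpen f ⊓ X.basicOpen g := X.basicOpen_mul f g

theorem exists_basicOpen_le' {U V : X.Opens} (hU : IsAffineOpen U) {x : X} (hx : x ∈ U)
    (hxV : x ∈ V) : ∃ f : Γ(X, U), X.basicOpen f ≤ V ∧ x ∈ X.basicOpen f := by
  obtain ⟨f, h1, h2⟩ := hU.exists_basicOpen_le ⟨x, hxV⟩ hx
  exact ⟨f, h1, h2⟩

/-- Vector fields on an affine open set are determined by their derivation. -/
theorem Vect.ext_of_der {U : X.Opens} (hU : IsAffineOpen U) {ξ η : Vect k U} (h : ξ.der = η.der) :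
    ξ = η := by
  rw [Vect.ext_iff']
  rintro ⟨W, hW⟩
  ext z
  refine res_ext_affine k fun x hx => ?_
  obtain ⟨f, hfW, hxf⟩ := exists_basicOpen_le' hU (hW hx) hx
  refine ⟨⟨_, hU.basicOpen f⟩, hfW, hxf, ?_⟩
  rw [← ξ.2 ⟨W, hW⟩ ⟨_, X.basicOpen_le f⟩ hfW, ← η.2 ⟨W, hW⟩ ⟨_, X.basicOpen_le f⟩ hfW]
  obtain ⟨m, a, ha⟩ := exists_res_eq_pow_mul (k := k) hU f (res k hfW z)
  have hu : IsUnit (res k (X.basicOpen_le f) (f ^ m)) := by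
    rw [map_pow]; exact (isUnit_res_basicOpen f).pow m
  have e : ∀ ζ : Vect k U, res k (X.basicOpen_le f) (f ^ m) *
      ζ.1 ⟨_, X.basicOpen_le f⟩ (res k hfW z) = res k (X.basicOpen_le f) (ζ.der a)
        - res k hfW z * res k (X.basicOpen_le f) (ζ.der (f ^ m)) := by
    intro ζ
    have h1 : ∀ b, ζ.1 ⟨_, X.basicOpen_le f⟩ (res k (X.basicOpen_le f) b) =
      res k (X.basicOpen_le f) (ζ.der b) := fun b => ζ.2 ⟨U, le_rfl⟩ ⟨_, _⟩ _ b
    rw [← h1, ← h1, ← ha, Derivation.leibniz, smul_eq_mul, smul_eq_mul]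
    ring
  exact hu.mul_left_cancel ((e ξ).trans (by rw [h, ← e η]))

theorem exists_derivation_localization {A L : Type u} [CommRing A] [CommRing L] [Algebra k A]
    [Algebra k L] [Algebra A L] [IsScalarTower k A L] (S : Submonoid A) [IsLocalization S L]
    (D : Derivation k A A) :
    ∃ D' : Derivation k L L, ∀ a, D' (algebraMap A L a) = algebraMap A L (D a) := by
  let E : Ω[L⁄k] →ₗ[L] L := IsLocalizedModule.mapExtendScalars S
    (KaehlerDifferential.map k k A L) (Algebra.linearMap A L) L D.liftKaehlerDifferential
  refine ⟨E.compDer (KaehlerDifferential.D k L), fun a => ?_⟩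
  change E (KaehlerDifferential.D k L (algebraMap A L a)) = _
  rw [← KaehlerDifferential.map_D k k A L a]
  simp only [E, IsLocalizedModule.mapExtendScalars_apply_apply]
  erw [IsLocalizedModule.map_apply, Derivation.liftKaehlerDifferential_comp_D]
  rfl

theorem exists_derivation_basicOpen {U : X.Opens} (hU : IsAffineOpen U)
    (D : Derivation k Γ(X, U) Γ(X, U)) (f : Γ(X, U)) :
    ∃ D' : Derivation k Γ(X, X.basicOpen f) Γ(X, X.basicOpen f),
      ∀ a, D' (res k (X.basicOpen_le f) a) = res k (X.basicOpen_le f) (D a) := by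
  have := hU.isLocalization_basicOpen f
  have : IsScalarTower k Γ(X, U) Γ(X, X.basicOpen f) :=
    IsScalarTower.of_algebraMap_eq' (res k (X.basicOpen_le f)).comp_algebraMap.symm
  exact exists_derivation_localization (Submonoid.powers f) D

/-- A derivation extends uniquely to the localizations on basic open sets, and the extensions glue
over any open `W ≤ U`. On affine open sets vector fields are therefore the same as derivations. -/
theorem exists_vect {U : X.Opens} (hU : IsAffineOpen U) (D : Derivation k Γ(X, U) Γ(X, U)) :
    ∃ ξ : Vect k U, ξ.der = D := by
  choose E hE using exists_derivation_basicOpen hU D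
  have hEE : ∀ (f h : Γ(X, U)) (i : X.basicOpen h ≤ X.basicOpen f) (y : Γ(X, X.basicOpen f)),
      res k i (E f y) = E h (res k i y) := by
    intro f h i y
    obtain ⟨m, a, ha⟩ := exists_res_eq_pow_mul (k := k) hU f y
    have hu : IsUnit (res k i (res k (X.basicOpen_le f) (f ^ m))) := by
      rw [map_pow, map_pow]; exact ((isUnit_res_basicOpen f).map (res k i)).pow m
    have h1 := congrArg (fun z => res k i (E f z)) ha
    have h2 := congrArg (fun z => E h (res k i z)) ha
    simp only [Derivation.leibniz, hE, map_mul, map_add, smul_eq_mul, res_res] at h1 h2 hu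
    exact hu.mul_left_cancel (add_right_cancel (h1.trans h2.symm))
  have key : ∀ (W : {W : X.Opens // W ≤ U}) (z : Γ(X, W.1)), ∃ z' : Γ(X, W.1),
      ∀ (f : Γ(X, U)) (i : X.basicOpen f ≤ W.1), res k i z' = E f (res k i z) := by
    rintro ⟨W, hW⟩ z
    obtain ⟨t, ht⟩ := res_glue k (U := W) (ι := {f : Γ(X, U) // X.basicOpen f ≤ W})
      (V := fun f => X.basicOpen f.1) (fun f => f.2) (fun x hx => by
        obtain ⟨f, hf, hxf⟩ := exists_basicOpen_le' hU (hW hx) hx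
        exact ⟨⟨f, hf⟩, hxf⟩) (fun f => E f.1 (res k f.2 z)) (fun f g W' hf hg => by
        have h1 : W' ≤ X.basicOpen (f.1 * g.1) := by
          rw [basicOpen_mul_eq_inf]; exact le_inf hf hg
        have i1 : X.basicOpen (f.1 * g.1) ≤ X.basicOpen f.1 := by
          rw [basicOpen_mul_eq_inf]; exact inf_le_left
        have i2 : X.basicOpen (f.1 * g.1) ≤ X.basicOpen g.1 := by
          rw [basicOpen_mul_eq_inf]; exact inf_le_right
        rw [← res_res k i1 h1, ← res_res k i2 h1, hEE, hEE, res_res, res_res])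
    exact ⟨t, fun f i => ht ⟨f, i⟩⟩
  choose G hG using key
  have hext : ∀ (W : {W : X.Opens // W ≤ U}) (z z' : Γ(X, W.1)),
      (∀ (f : Γ(X, U)) (i : X.basicOpen f ≤ W.1), res k i z = res k i z') → z = z' := by
    rintro ⟨W, hW⟩ z z' h
    refine res_ext_affine k fun x hx => ?_
    obtain ⟨f, hf, hxf⟩ := exists_basicOpen_le' hU (hW hx) hx
    exact ⟨⟨_, hU.basicOpen f⟩, hf, hxf, h f hf⟩
  let ξ : Vect k U := ⟨fun W => Derivation.mk'
    { toFun := G W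
      map_add' := fun a b => hext W _ _ fun f i => by simp only [map_add, hG]
      map_smul' := fun c a => hext W _ _ fun f i => by
        simp only [map_smul, hG, RingHom.id_apply]
        exact (E f).map_smul c _ }
    (fun a b => hext W _ _ fun f i => by
      simp only [LinearMap.coe_mk, AddHom.coe_mk, map_add, map_mul, smul_eq_mul, hG,
        Derivation.leibniz]), fun W W' h z => hext W' _ _ fun f i => by
      change res k i (G W' (res k h z)) = res k i (res k h (G W z))
      rw [hG, res_res, res_res, hG]⟩
  refine ⟨ξ, Derivation.ext fun a => hext ⟨U, le_rfl⟩ _ _ fun f i => ?_⟩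
  change res k i (G ⟨U, le_rfl⟩ a) = _
  rw [hG, hE]

/-- The vector field on an affine open set with a given derivation -/
def Vect.ofDer {U : X.Opens} (hU : IsAffineOpen U) (D : Derivation k Γ(X, U) Γ(X, U)) : Vect k U :=
  (exists_vect hU D).choose

theorem Vect.der_ofDer {U : X.Opens} (hU : IsAffineOpen U) (D : Derivation k Γ(X, U) Γ(X, U)) :
    (Vect.ofDer hU D).der = D := (exists_vect hU D).choose_spec

theorem Vect.pair_ofDer {U : X.Opens} (hU : IsAffineOpen U) (ℓ : Ω[Γ(X, U)⁄k] →ₗ[Γ(X, U)] Γ(X, U)) :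
    (Vect.ofDer hU (ℓ.compDer (KaehlerDifferential.D k Γ(X, U)))).pair = ℓ := by
  rw [Vect.pair, Vect.der_ofDer]
  exact Derivation.liftKaehlerDifferential_unique _ _ (by ext; simp)

end SheafTools
end
end PCurv

namespace PCurv
noncomputable section

/-! ### Dual bases of forms, and covariant derivatives over all open sets -/

section CovariantDerivative

variable {k : Type u} [Field k] {X : Scheme.{u}} [X.Over (Spec (.of k))]

theorem smooth_sections [Smooth (X ↘ Spec (.of k))] {U : X.Opens} (hU : IsAffineOpen U) :
    Algebra.Smooth k Γ(X, U) := by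
  have h := (X ↘ Spec (.of k)).smooth_appLE (isAffineOpen_top _) hU le_top
  have e : structMap k X U =
      ((X ↘ Spec (.of k)).appLE ⊤ U le_top).hom.comp (Scheme.ΓSpecIso (.of k)).inv.hom := by
    rfl
  have h2 : (structMap k X U).Smooth := by
    rw [e]
    exact (RingHom.Smooth.respectsIso.2 _ (Scheme.ΓSpecIso (.of k)).symm.commRingCatIsoToRingEquiv h)
  exact h2

/-- The module of forms is finite projective; a splitting of a surjection from a free module has
coordinate functionals, and these are contractions with vector fields. Unlike coordinates, a dual
basis exists on every affine open set. -/
theorem exists_dualBasis [Smooth (X ↘ Spec (.of k))] {U : X.Opens} (hU : IsAffineOpen U) :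
    ∃ (n : ℕ) (ω : Fin n → Ω[Γ(X, U)⁄k]) (ξ : Fin n → Vect k U),
      ∀ η, η = ∑ i, (ξ i).pair η • ω i := by
  have := smooth_sections (k := k) hU
  obtain ⟨n, π, hπ⟩ := Module.Finite.exists_fin' Γ(X, U) Ω[Γ(X, U)⁄k]
  obtain ⟨s, hs⟩ := Module.projective_lifting_property π LinearMap.id hπ
  refine ⟨n, fun i => π (Pi.single i 1), fun i => Vect.ofDer hU
    ((LinearMap.proj i ∘ₗ s).compDer (KaehlerDifferential.D k Γ(X, U))), fun η => ?_⟩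
  simp only [Vect.pair_ofDer]
  conv_lhs => rw [← LinearMap.id_apply (R := Γ(X, U)) η, ← hs, LinearMap.comp_apply,
    pi_eq_sum_univ (s η)]
  rw [map_sum]
  refine Finset.sum_congr rfl fun i _ => ?_
  rw [map_smul]
  congr 2
  ext j
  simp [Pi.single_apply, eq_comm]

theorem contract_tmul (M : X.Modules) {U : X.Opens} (ξ : Vect k U) (ω : Ω[Γ(X, U)⁄k])
    (s : Γ(M, U)) : contract M ξ (ω ⊗ₜ s) = ξ.pair ω • s := rfl

theorem eq_sum_contract (M : X.Modules) {U : X.Opens} {n : ℕ} {ω : Fin n → Ω[Γ(X, U)⁄k]}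
    {ξ : Fin n → Vect k U} (h : ∀ η, η = ∑ i, (ξ i).pair η • ω i)
    (t : Ω[Γ(X, U)⁄k] ⊗[Γ(X, U)] Γ(M, U)) : t = ∑ i, ω i ⊗ₜ contract M (ξ i) t := by
  induction t using TensorProduct.induction_on with
  | zero => simp
  | add x y hx hy =>
    conv_lhs => rw [hx, hy]
    simp only [map_add, TensorProduct.tmul_add, Finset.sum_add_distrib]
  | tmul η s =>
    conv_lhs => rw [h η, TensorProduct.sum_tmul]
    exact Finset.sum_congr rfl fun i _ => by
      rw [contract_tmul, TensorProduct.smul_tmul]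

theorem contract_ext [Smooth (X ↘ Spec (.of k))] {U : X.Opens} (hU : IsAffineOpen U) (M : X.Modules)
    {t t' : Ω[Γ(X, U)⁄k] ⊗[Γ(X, U)] Γ(M, U)}
    (h : ∀ ξ : Vect k U, contract M ξ t = contract M ξ t') : t = t' := by
  obtain ⟨n, ω, ξ, H⟩ := exists_dualBasis (k := k) hU
  rw [eq_sum_contract M H t, eq_sum_contract M H t']
  simp only [h]

theorem contract_tres (M : X.Modules) {U V : X.Opens} (i : V ≤ U) (ξ : Vect k U)
    (t : Ω[Γ(X, U)⁄k] ⊗[Γ(X, U)] Γ(M, U)) :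
    contract M (ξ.restrict i) (tres k M i t) = mres M i (contract M ξ t) := by
  induction t using TensorProduct.induction_on with
  | zero => simp
  | add x y hx hy => simp only [map_add, hx, hy]
  | tmul η s => rw [tres_tmul, contract_tmul, contract_tmul, Vect.pair_restrict, mres_smul k]

theorem Vect.pair_add {U : X.Opens} (ξ η : Vect k U) (ω : Ω[Γ(X, U)⁄k]) :
    (ξ + η).pair ω = ξ.pair ω + η.pair ω := by
  induction ω using form_induction with
  | h0 => simp
  | hadd x y hx hy => simp only [map_add, hx, hy]; abel
  | hD f g => simp only [map_smul, pair_D, der_add, smul_add]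

theorem Vect.pair_fsmul {U : X.Opens} (f : Γ(X, U)) (ξ : Vect k U) (ω : Ω[Γ(X, U)⁄k]) :
    (ξ.fsmul f).pair ω = f * ξ.pair ω := by
  induction ω using form_induction with
  | h0 => simp
  | hadd x y hx hy => simp only [map_add, hx, hy, mul_add]
  | hD g h => simp only [map_smul, pair_D, der_fsmul, smul_eq_mul]; ring

namespace LineConn

variable (N : LineConn k X)

/-- A connection is given on affine open sets only; its contractions with `ξ` are compatible with
restriction and hence glue. -/
theorem exists_nabla {U : X.Opens} (ξ : Vect k U) (s : Γ(N.L, U)) :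
    ∃ t : Γ(N.L, U), ∀ (V : X.affineOpens) (i : V.1 ≤ U),
      mres N.L i t = contract N.L (ξ.restrict i) (N.conn V (mres N.L i s)) := by
  have hres : ∀ (V W : X.affineOpens) (i : V.1 ≤ U) (j : W.1 ≤ V.1),
      mres N.L j (contract N.L (ξ.restrict i) (N.conn V (mres N.L i s))) =
        contract N.L (ξ.restrict (j.trans i)) (N.conn W (mres N.L (j.trans i) s)) := by
    intro V W i j
    rw [← contract_tres, ← N.conn_res, mres_mres]
    rfl
  obtain ⟨t, ht⟩ := mres_glue N.L (U := U) (ι := {V : X.affineOpens // V.1 ≤ U})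
    (V := fun V => V.1.1) (fun V => V.2) (fun x hx => by
      obtain ⟨V, hxV, hV⟩ := exists_affine_le hx
      exact ⟨⟨V, hV⟩, hxV⟩)
    (fun V => contract N.L (ξ.restrict V.2) (N.conn V.1 (mres N.L V.2 s)))
    (fun V V' W hi hj => mres_ext_affine N.L fun x hx => by
      obtain ⟨W', hxW', hW'⟩ := exists_affine_le hx
      refine ⟨W', hW', hxW', ?_⟩
      rw [mres_mres, mres_mres, hres, hres])
  exact ⟨t, fun V i => ht ⟨V, i⟩⟩

/-- The covariant derivative `∇_ξ` on sections over an open set -/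
def nabla {U : X.Opens} (ξ : Vect k U) : Γ(N.L, U) →+ Γ(N.L, U) :=
  AddMonoidHom.mk' (fun s => (N.exists_nabla ξ s).choose) fun s t =>
    mres_ext_affine N.L fun x hx => by
      obtain ⟨V, hxV, hV⟩ := exists_affine_le hx
      refine ⟨V, hV, hxV, ?_⟩
      rw [map_add, (N.exists_nabla ξ _).choose_spec, (N.exists_nabla ξ _).choose_spec,
        (N.exists_nabla ξ _).choose_spec, map_add, map_add, map_add]

theorem mres_nabla_affine {U : X.Opens} (ξ : Vect k U) (s : Γ(N.L, U)) (V : X.affineOpens)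
    (i : V.1 ≤ U) :
    mres N.L i (N.nabla ξ s) = contract N.L (ξ.restrict i) (N.conn V (mres N.L i s)) :=
  (N.exists_nabla ξ s).choose_spec V i

theorem nabla_affine (U : X.affineOpens) (ξ : Vect k U.1) (s : Γ(N.L, U.1)) :
    N.nabla ξ s = contract N.L ξ (N.conn U s) := by
  have h := N.mres_nabla_affine ξ s U le_rfl
  rwa [mres_self, mres_self] at h

theorem mres_nabla {U V : X.Opens} (i : V ≤ U) (ξ : Vect k U) (s : Γ(N.L, U)) :
    mres N.L i (N.nabla ξ s) = N.nabla (ξ.restrict i) (mres N.L i s) :=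
  mres_ext_affine N.L fun x hx => by
    obtain ⟨W, hxW, hW⟩ := exists_affine_le hx
    refine ⟨W, hW, hxW, ?_⟩
    rw [mres_mres, mres_nabla_affine, mres_nabla_affine, mres_mres]
    rfl

theorem nabla_ext {U : X.Opens} {s t : Γ(N.L, U)}
    (h : ∀ (V : X.affineOpens) (i : V.1 ≤ U), mres N.L i s = mres N.L i t) : s = t :=
  mres_ext_affine N.L fun x hx => by
    obtain ⟨W, hxW, hW⟩ := exists_affine_le hx
    exact ⟨W, hW, hxW, h W hW⟩

theorem nabla_smul {U : X.Opens} (ξ : Vect k U) (f : Γ(X, U)) (s : Γ(N.L, U)) :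
    N.nabla ξ (f • s) = f • N.nabla ξ s + ξ.der f • s := N.nabla_ext fun V i => by
  rw [map_add, mres_smul k, mres_smul k, mres_nabla_affine, mres_nabla_affine, mres_smul k,
    N.conn_smul, map_add, map_smul, contract_tmul, Vect.pair_D, Vect.der_restrict]

end LineConn

theorem Triv.nabla_e {N : LineConn k X} (T : Triv N) (ξ : Vect k T.U.1) :
    N.nabla ξ T.e = ξ.pair T.form • T.e := by
  rw [N.nabla_affine, T.conn_e, contract_tmul]

end CovariantDerivative
end
end PCurv

namespace PCurv
noncomputable section

/-! ### Universal properties and local structure of the central reduction -/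

section Operators

variable {k : Type u} [Field k] {X : Scheme.{u}} [X.Over (Spec (.of k))] {U : X.Opens}

/-- The universal property of the algebra of differential operators. -/
def DiffOp.lift {R : Type*} [Ring R] (φ : Γ(X, U) →+* R) (ν : Vect k U → R)
    (hk : ∀ (a : k) (r : R), φ (algebraMap k _ a) * r = r * φ (algebraMap k _ a))
    (hadd : ∀ ξ η, ν (ξ + η) = ν ξ + ν η) (hsmul : ∀ f ξ, ν (ξ.fsmul f) = φ f * ν ξ)
    (hleibniz : ∀ ξ f, ν ξ * φ f = φ f * ν ξ + φ (ξ.der f))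
    (hcomm : ∀ ξ η, ν (ξ.bracket η) = ν ξ * ν η - ν η * ν ξ) : DiffOp k U →+* R :=
  letI := (φ.comp (algebraMap k Γ(X, U))).toAlgebra' hk
  (RingQuot.liftAlgHom k (s := DiffOpRel k U) ⟨FreeAlgebra.lift k (Sum.elim φ ν), fun a b hab => by
    induction hab with
    | scalar a => simp only [FreeAlgebra.lift_ι_apply, Sum.elim_inl, AlgHom.commutes]; rfl
    | add f g => simp
    | mul f g => simp
    | vadd ξ η => simp [hadd]
    | vsmul f ξ => simp [hsmul]
    | leibniz ξ f => simp [hleibniz]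
    | comm ξ η => simp [hcomm]⟩ : DiffOp k U →ₐ[k] R).toRingHom

section
variable {R : Type*} [Ring R] (φ : Γ(X, U) →+* R) (ν : Vect k U → R)
    (hk : ∀ (a : k) (r : R), φ (algebraMap k _ a) * r = r * φ (algebraMap k _ a))
    (hadd : ∀ ξ η, ν (ξ + η) = ν ξ + ν η) (hsmul : ∀ f ξ, ν (ξ.fsmul f) = φ f * ν ξ)
    (hleibniz : ∀ ξ f, ν ξ * φ f = φ f * ν ξ + φ (ξ.der f))
    (hcomm : ∀ ξ η, ν (ξ.bracket η) = ν ξ * ν η - ν η * ν ξ)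

theorem DiffOp.lift_fn (f : Γ(X, U)) :
    DiffOp.lift φ ν hk hadd hsmul hleibniz hcomm (DiffOp.fn f) = φ f := by
  let := (φ.comp (algebraMap k Γ(X, U))).toAlgebra' hk
  change RingQuot.liftAlgHom k _ (RingQuot.mkAlgHom k (DiffOpRel k U) _) = _
  rw [RingQuot.liftAlgHom_mkAlgHom_apply]
  simp

theorem DiffOp.lift_vec (ξ : Vect k U) :
    DiffOp.lift φ ν hk hadd hsmul hleibniz hcomm (DiffOp.vec ξ) = ν ξ := by
  let := (φ.comp (algebraMap k Γ(X, U))).toAlgebra' hk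
  change RingQuot.liftAlgHom k _ (RingQuot.mkAlgHom k (DiffOpRel k U) _) = _
  rw [RingQuot.liftAlgHom_mkAlgHom_apply]
  simp

end

theorem DiffOp.closure_eq_top : Subring.closure
    (Set.range (DiffOp.fn (k := k) (U := U)) ∪ Set.range (DiffOp.vec (k := k) (U := U))) = ⊤ := by
  rw [eq_top_iff]
  rintro d -
  obtain ⟨a, rfl⟩ := RingQuot.mkAlgHom_surjective k (DiffOpRel k U) d
  induction a using FreeAlgebra.induction with
  | grade0 r =>
    rw [AlgHom.commutes, ← DiffOp.fn_algebraMap]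
    exact Subring.subset_closure (.inl ⟨_, rfl⟩)
  | grade1 x =>
    rcases x with f | ξ
    · exact Subring.subset_closure (.inl ⟨f, rfl⟩)
    · exact Subring.subset_closure (.inr ⟨ξ, rfl⟩)
  | mul a b ha hb => rw [map_mul]; exact mul_mem ha hb
  | add a b ha hb => rw [map_add]; exact add_mem ha hb

theorem DiffOp.smul_fn (a : k) (f : Γ(X, U)) : a • DiffOp.fn (k := k) f = DiffOp.fn (a • f) := by
  rw [Algebra.smul_def, ← DiffOp.fn_algebraMap, ← map_mul, Algebra.smul_def]

variable (p : ℕ) [Fact p.Prime] [CharP k p] {M : LineConn k X} (c : k) (T : Triv M)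

theorem RedLocal.mk_surjective : Function.Surjective (RedLocal.mk p c T) :=
  RingQuot.mkRingHom_surjective _

/-- Functions in the central reduction -/
abbrev RedLocal.fn : Γ(X, T.U.1) →+* RedLocal p c T := (RedLocal.mk p c T).comp DiffOp.fn

/-- Vector fields in the central reduction -/
abbrev RedLocal.vec : Vect k T.U.1 →+ RedLocal p c T :=
  (RedLocal.mk p c T).toAddMonoidHom.comp DiffOp.vec

theorem RedLocal.closure_eq_top :
    Subring.closure (Set.range (RedLocal.fn p c T) ∪ Set.range (RedLocal.vec p c T)) = ⊤ := by
  rw [eq_top_iff]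
  rintro r -
  obtain ⟨d, rfl⟩ := RedLocal.mk_surjective p c T r
  have hd : d ∈ Subring.closure
      (Set.range (DiffOp.fn (k := k) (U := T.U.1)) ∪ Set.range DiffOp.vec) :=
    DiffOp.closure_eq_top (k := k) (U := T.U.1) ▸ trivial
  induction hd using Subring.closure_induction with
  | mem d hd =>
    rcases hd with ⟨f, rfl⟩ | ⟨ξ, rfl⟩
    · exact Subring.subset_closure (.inl ⟨f, rfl⟩)
    · exact Subring.subset_closure (.inr ⟨ξ, rfl⟩)
  | zero => erw [map_zero]; exact zero_mem _
  | one => erw [map_one]; exact one_mem _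
  | add d e _ _ hd he => erw [map_add]; exact add_mem hd he
  | neg d _ hd => erw [map_neg]; exact neg_mem hd
  | mul d e _ _ hd he => erw [map_mul]; exact mul_mem hd he

theorem RedLocal.mk_centralElt (ξ : Vect k T.U.1) :
    RedLocal.mk p c T (centralElt p c T ξ) = 0 := by
  rw [← map_zero (RedLocal.mk p c T)]
  exact RingQuot.mkRingHom_rel (.central ξ)

/-- The universal property of the central reduction -/
def RedLocal.lift {R : Type*} [Semiring R] (Φ : DiffOp k T.U.1 →+* R)
    (h : ∀ ξ, Φ (centralElt p c T ξ) = 0) : RedLocal p c T →+* R :=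
  RingQuot.lift ⟨Φ, fun a b hab => by
    induction hab with
    | central ξ => rw [h, map_zero]⟩

theorem RedLocal.lift_mk {R : Type*} [Semiring R] (Φ : DiffOp k T.U.1 →+* R)
    (h : ∀ ξ, Φ (centralElt p c T ξ) = 0) (d : DiffOp k T.U.1) :
    RedLocal.lift p c T Φ h (RedLocal.mk p c T d) = Φ d :=
  RingQuot.lift_mkRingHom_apply _ _ _

theorem Triv.isAffineOpen (T : Triv M) : IsAffineOpen T.U.1 := T.U.2

theorem Vect.der_pPow (ξ : Vect k U) : (ξ.pPow p).der = derivationPow p ξ.der := rfl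

theorem Vect.der_pow_char (ξ : Vect k U) (f : Γ(X, U)) : ξ.der (f ^ p) = 0 := by
  rw [← mul_one (f ^ p), derivation_pow_mul (cast_eq_zero_of_charP k _ p)]
  simp

/-- Scalars are `p`-th powers and can be absorbed. This lets the function that equals the `p`-th
power of a coordinate operator be itself a `p`-th power. -/
theorem exists_neg_smul_pow {A : Type*} [CommRing A] [Algebra k A] [IsAlgClosed k] (c : k) (a : A) :
    ∃ a' : A, a' ^ p = -(c • a ^ p) := by
  have hA : (p : A) = 0 := by rw [← map_natCast (algebraMap k A), CharP.cast_eq_zero, map_zero]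
  obtain ⟨b, hb⟩ := IsAlgClosed.exists_pow_nat_eq c (Fact.out : p.Prime).pos
  refine ⟨-(b • a), ?_⟩
  have : (-(b • a)) ^ p = - (b • a) ^ p := map_neg (frobHom hA) (b • a)
  rw [this, smul_pow, hb]

/-- As `(C.d i)^[p] = 0`, the central relation turns the `p`-th power of the operator into the
function `-(c ^ p - c) ω(C.d i) ^ p`. The other axioms come from identities between vector fields,
which are tested on derivations. -/
theorem redLocal_operatorAlgebra [IsAlgClosed k] {n : ℕ} {g : Γ(X, T.U.1)}
    (C : ApproxCoordinates k Γ(X, T.U.1) p n g) :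
    OperatorAlgebra C (RedLocal.fn p c T) (RedLocal.vec p c T)
      (fun i => RedLocal.vec p c T (Vect.ofDer T.isAffineOpen (C.d i))) where
  mul_fn i a := by
    have := congrArg (RedLocal.mk p c T) (DiffOp.vec_mul_fn (Vect.ofDer T.isAffineOpen (C.d i)) a)
    rwa [map_mul, map_add, map_mul, Vect.der_ofDer] at this
  comm i j := by
    have h : (Vect.ofDer T.isAffineOpen (C.d i)).bracket (Vect.ofDer T.isAffineOpen (C.d j)) = 0 :=
      Vect.ext_of_der T.isAffineOpen (by
        ext f
        rw [Vect.der_bracket, Vect.der_ofDer, Vect.der_ofDer, ← Derivation.commutator_apply,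
          C.d_comm]
        rfl)
    have := congrArg (RedLocal.mk p c T)
      (DiffOp.vec_bracket (Vect.ofDer T.isAffineOpen (C.d i)) (Vect.ofDer T.isAffineOpen (C.d j)))
    rw [h, map_zero, map_zero, map_sub, map_mul, map_mul] at this
    exact (sub_eq_zero.1 this.symm)
  pow i := by
    obtain ⟨a, ha⟩ := exists_neg_smul_pow p (c ^ p - c) ((Vect.ofDer T.isAffineOpen (C.d i)).pair T.form)
    refine ⟨a, ?_⟩
    have h : (Vect.ofDer T.isAffineOpen (C.d i)).pPow p = 0 := Vect.ext_of_der T.isAffineOpen (by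
      rw [Vect.der_pPow, Vect.der_ofDer, C.d_pow]; rfl)
    have := RedLocal.mk_centralElt p c T (Vect.ofDer T.isAffineOpen (C.d i))
    rw [centralElt, h, map_zero, sub_zero, DiffOp.smul_fn, map_add, map_pow] at this
    rw [ha, map_neg]
    exact eq_neg_of_add_eq_zero_left this
  commute_vec ξ a := by
    have := congrArg (RedLocal.mk p c T) (DiffOp.vec_mul_fn ξ (a ^ p))
    rw [Vect.der_pow_char, map_zero, add_zero, map_mul, map_mul] at this
    exact this.symm
  mul_vec ξ := by
    refine ⟨fun i => ξ.der (C.x i), ?_⟩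
    have h : ξ.fsmul (g ^ p) =
        ∑ i, (Vect.ofDer T.isAffineOpen (C.d i)).fsmul (ξ.der (C.x i)) := Vect.ext_of_der T.isAffineOpen (by
      ext f
      have : ∀ (s : Finset (Fin n)) (ζ : Fin n → Vect k T.U.1),
          (∑ i ∈ s, ζ i).der f = ∑ i ∈ s, (ζ i).der f := fun s ζ =>
        map_sum (AddMonoidHom.mk' (fun ξ : Vect k T.U.1 => ξ.der f) fun _ _ => rfl) ζ s
      rw [this, Vect.der_fsmul, C.derivation_eq]
      simp only [Vect.der_fsmul, Vect.der_ofDer])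
    have h2 := congrArg (fun ξ => RedLocal.mk p c T (DiffOp.vec ξ)) h
    simp only [DiffOp.vec_fsmul, map_mul, map_sum] at h2
    rw [map_pow]
    simpa using h2
  closure_eq := RedLocal.closure_eq_top p c T

end Operators
end
end PCurv

namespace PCurv
noncomputable section

/-! ### Gluing of the local central reductions -/

section CentralReduction

variable {k : Type u} [Field k] {X : Scheme.{u}} [X.Over (Spec (.of k))]
variable (p : ℕ) [Fact p.Prime] [CharP k p] {M : LineConn k X} (c : k)

theorem Vect.iterate_der_smul {U : X.Opens} (ξ : Vect k U) (a : k) (f : Γ(X, U)) (m : ℕ) :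
    ξ.der^[m] (a • f) = a • ξ.der^[m] f := by
  induction m with
  | zero => rfl
  | succ m ih =>
    rw [Function.iterate_succ_apply', Function.iterate_succ_apply', ih]
    exact ξ.der.map_smul a _

theorem DiffOp.vec_add_fn_pow {U : X.Opens} (ξ : Vect k U) (f : Γ(X, U)) :
    (DiffOp.vec ξ + DiffOp.fn f) ^ p =
      DiffOp.vec ξ ^ p + DiffOp.fn (ξ.der^[p - 1] f) + DiffOp.fn (f ^ p) :=
  add_pow_prime_of_derivation (cast_eq_zero_of_charP k _ p) DiffOp.fn (DiffOp.vec ξ) ξ.der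
    (fun a => DiffOp.vec_mul_fn ξ a) f

/-- Put `λ = ξ(h) / h`. By Jacobson's formula `ξ ^ p` goes to `ξ ^ p + ξ^(p-1)(cλ) + (cλ) ^ p`, and
by `iterate_derivation_dlog` `ξ^[p]` goes to `ξ^[p] + c (ξ^(p-1)(λ) + λ ^ p)`. The difference
acquires `(c ^ p - c) λ ^ p`, which is the change of `(c ^ p - c) ω(ξ) ^ p` under `ω ↦ ω + dh / h`.
-/
theorem glue_centralElt (T T' : Triv M) (i : T'.U.1 ≤ T.U.1) (h : Γ(X, T'.U.1)ˣ)
    (he : T'.e = (h : Γ(X, T'.U.1)) • mres M.L i T.e) (ξ : Vect k T.U.1) :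
    DiffOp.glue i h c (centralElt p c T ξ) = centralElt p c T' (ξ.restrict i) := by
  have hp : (p : Γ(X, T'.U.1)) = 0 := cast_eq_zero_of_charP k _ p
  have e1 : (ξ.restrict i).pair T'.form = res k i (ξ.pair T.form) + (ξ.restrict i).dlog h := by
    rw [T.form_eq_of_smul T' i h he, map_add, Vect.pair_restrict, map_smul, Vect.pair_D]
    rfl
  have e2 : ((ξ.restrict i).pPow p).dlog h =
      (ξ.restrict i).der^[p - 1] ((ξ.restrict i).dlog h) + (ξ.restrict i).dlog h ^ p := by
    have := iterate_derivation_dlog hp (ξ.restrict i).der h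
    rw [← derivationPow_apply] at this
    exact this
  have e3 : (ξ.pPow p).restrict i = (ξ.restrict i).pPow p := rfl
  have e4 : (c ^ p - c) • (ξ.restrict i).pair T'.form ^ p =
      (ξ.restrict i).der^[p - 1] (c • (ξ.restrict i).dlog h) + (c • (ξ.restrict i).dlog h) ^ p
        - c • ((ξ.restrict i).pPow p).dlog h + res k i ((c ^ p - c) • ξ.pair T.form ^ p) := by
    rw [e1, e2, add_pow_of_cast_eq_zero hp, Vect.iterate_der_smul, smul_pow, map_smul, map_pow]
    simp only [smul_add, sub_smul]
    abel
  rw [centralElt, centralElt, DiffOp.smul_fn, DiffOp.smul_fn, map_add, map_sub, map_pow,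
    DiffOp.glue_vec, DiffOp.glue_vec, DiffOp.glue_fn, e3, DiffOp.smul_fn, DiffOp.smul_fn,
    DiffOp.vec_add_fn_pow, e4, map_add, map_sub, map_add]
  abel

/-- Restriction between the central reductions in two trivializations -/
def RedLocal.glue (T T' : Triv M) (i : T'.U.1 ≤ T.U.1) (h : Γ(X, T'.U.1)ˣ)
    (he : T'.e = (h : Γ(X, T'.U.1)) • mres M.L i T.e) : RedLocal p c T →+* RedLocal p c T' :=
  RedLocal.lift p c T ((RedLocal.mk p c T').comp (DiffOp.glue i h c).toRingHom) fun ξ => by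
    change RedLocal.mk p c T' (DiffOp.glue i h c (centralElt p c T ξ)) = 0
    rw [glue_centralElt p c T T' i h he]
    exact RedLocal.mk_centralElt p c T' _

theorem RedLocal.glue_mk (T T' : Triv M) (i : T'.U.1 ≤ T.U.1) (h : Γ(X, T'.U.1)ˣ)
    (he : T'.e = (h : Γ(X, T'.U.1)) • mres M.L i T.e) (d : DiffOp k T.U.1) :
    RedLocal.glue p c T T' i h he (RedLocal.mk p c T d) =
      RedLocal.mk p c T' (DiffOp.glue i h c d) :=
  RedLocal.lift_mk p c T _ _ d

instance Red.instRing (U : X.Opens) : Ring (Red p M c U) := inferInstance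

/-- The representative `d` in the definition of `Red` does not matter, since gluing descends to the
quotients; a section is thus determined at smaller trivializations by its value at a larger one. -/
theorem Red.apply_eq_glue {U : X.Opens} (a : Red p M c U) (T T' : {T : Triv M // T.U.1 ≤ U})
    (i : T'.1.U.1 ≤ T.1.U.1) (h : Γ(X, T'.1.U.1)ˣ)
    (he : T'.1.e = (h : Γ(X, T'.1.U.1)) • mres M.L i T.1.e) :
    a.1 T' = RedLocal.glue p c T.1 T'.1 i h he (a.1 T) := by
  obtain ⟨d, h1, h2⟩ := a.2 T T' i h he
  rw [h1, h2, RedLocal.glue_mk]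

theorem Red.ext_of_triv (T : Triv M) {a b : Red p M c T.U.1}
    (h : a.1 ⟨T, le_rfl⟩ = b.1 ⟨T, le_rfl⟩) : a = b := by
  refine Subtype.ext (funext fun T' => ?_)
  obtain ⟨u, hu⟩ := T.exists_unit T'.1 T'.2
  rw [Red.apply_eq_glue p c a ⟨T, le_rfl⟩ T' T'.2 u hu, h,
    Red.apply_eq_glue p c b ⟨T, le_rfl⟩ T' T'.2 u hu]

/-- Functions in the central reduction -/
abbrev Red.fn (M : LineConn k X) {U : X.Opens} : Γ(X, U) →+* Red p M c U :=
  (TDO.toRed p M c U).comp (TDO.fn M c)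

/-- Lifts of vector fields in the central reduction -/
abbrev Red.vec (M : LineConn k X) {U : X.Opens} (ξ : Vect k U) : Red p M c U :=
  TDO.toRed p M c U (TDO.vec M c ξ)

theorem Red.fn_apply {U : X.Opens} (f : Γ(X, U)) (T : {T : Triv M // T.U.1 ≤ U}) :
    (Red.fn p c M f).1 T = RedLocal.fn p c T.1 (res k T.2 f) := rfl

theorem Red.vec_apply {U : X.Opens} (ξ : Vect k U) (T : {T : Triv M // T.U.1 ≤ U}) :
    (Red.vec p c M ξ).1 T = RedLocal.vec p c T.1 (ξ.restrict T.2) +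
      RedLocal.fn p c T.1 (c • (ξ.restrict T.2).pair T.1.form) := by
  change RedLocal.mk p c T.1 (DiffOp.vec _ + c • DiffOp.fn _) = _
  rw [DiffOp.smul_fn, map_add]
  rfl

/-- At `T` the generator `ξ` is the lift of `ξ` minus the function `c ω(ξ)`, and a section over
`T.U` is determined by its value at `T`. -/
theorem Red.closure_eq_top (T : Triv M) :
    Subring.closure (Set.range (Red.fn p c M (U := T.U.1)) ∪ Set.range (Red.vec p c M)) = ⊤ := by
  set S := Subring.closure (Set.range (Red.fn p c M (U := T.U.1)) ∪ Set.range (Red.vec p c M))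
  have hf : ∀ f, Red.fn p c M f ∈ S := fun f => Subring.subset_closure (.inl ⟨f, rfl⟩)
  have key : ∀ r : RedLocal p c T, ∃ a ∈ S, a.1 ⟨T, le_rfl⟩ = r := by
    intro r
    have hr : r ∈ Subring.closure (Set.range (RedLocal.fn p c T) ∪ Set.range (RedLocal.vec p c T)) :=
      RedLocal.closure_eq_top p c T ▸ trivial
    induction hr using Subring.closure_induction with
    | mem r hr =>
      rcases hr with ⟨f, rfl⟩ | ⟨ξ, rfl⟩
      · exact ⟨_, hf f, by rw [Red.fn_apply, res_self]⟩
      · refine ⟨Red.vec p c M ξ - Red.fn p c M (c • ξ.pair T.form),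
          sub_mem (Subring.subset_closure (.inr ⟨ξ, rfl⟩)) (hf _), ?_⟩
        have h1 : ξ.restrict le_rfl = ξ := rfl
        change (Red.vec p c M ξ).1 _ - (Red.fn p c M _).1 _ = _
        rw [Red.fn_apply, Red.vec_apply, res_self, h1]
        exact add_sub_cancel_right (G := RedLocal p c T) _ _
    | zero => exact ⟨0, zero_mem _, rfl⟩
    | one => exact ⟨1, one_mem _, rfl⟩
    | add r s _ _ hr hs =>
      obtain ⟨a, ha, rfl⟩ := hr
      obtain ⟨b, hb, rfl⟩ := hs
      exact ⟨a + b, add_mem ha hb, rfl⟩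
    | neg r _ hr =>
      obtain ⟨a, ha, rfl⟩ := hr
      exact ⟨-a, neg_mem ha, rfl⟩
    | mul r s _ _ hr hs =>
      obtain ⟨a, ha, rfl⟩ := hr
      obtain ⟨b, hb, rfl⟩ := hs
      exact ⟨a * b, mul_mem ha hb, rfl⟩
  rw [eq_top_iff]
  rintro a -
  obtain ⟨b, hb, h⟩ := key (a.1 ⟨T, le_rfl⟩)
  rwa [← Red.ext_of_triv p c T h]

end CentralReduction

/-! ### Representations at closed points, and injectivity on functions -/

section Fibers

/-- The ideal generated by the `p`-th powers of the elements of an ideal -/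
def frobIdeal {A : Type u} [CommRing A] (p : ℕ) (n : Ideal A) : Ideal A :=
  Ideal.span ((fun a => a ^ p) '' n)

theorem pow_mem_frobIdeal {A : Type u} [CommRing A] {p : ℕ} {n : Ideal A} {a : A} (h : a ∈ n) :
    a ^ p ∈ frobIdeal p n := Ideal.subset_span ⟨a, h, rfl⟩

theorem frobIdeal_le {A : Type u} [CommRing A] {p : ℕ} [Fact p.Prime] (n : Ideal A) :
    frobIdeal p n ≤ n := Ideal.span_le.2 (by
  rintro _ ⟨a, ha, rfl⟩
  exact Ideal.pow_mem_of_mem n ha p (Fact.out : p.Prime).pos)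

variable {k : Type u} [Field k] (p : ℕ) [Fact p.Prime] [CharP k p]

/-- Additively the ideal is spanned by the products `a ^ p * b` with `a ∈ n`, and `a ^ p` is
constant for `ξ`. -/
theorem derivation_mem_frobIdeal {A : Type u} [CommRing A] [Algebra k A] (n : Ideal A)
    (ξ : Derivation k A A) {a : A} (ha : a ∈ frobIdeal p n) : ξ a ∈ frobIdeal p n := by
  refine Submodule.span_induction (p := fun a _ => ξ a ∈ frobIdeal p n) ?_ ?_ ?_ ?_
    ((Submodule.span_induction (p := fun a _ => ∀ b : A, b * a ∈
      Submodule.span ℤ {x | ∃ a ∈ n, ∃ b, x = a ^ p * b}) ?_ ?_ ?_ ?_ ha) 1 |> fun h => by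
        rwa [one_mul] at h)
  · rintro _ ⟨a, ha, b, rfl⟩
    rw [derivation_pow_mul (cast_eq_zero_of_charP k A p)]
    exact Ideal.mul_mem_right _ _ (pow_mem_frobIdeal ha)
  · rw [map_zero]; exact zero_mem _
  · intro x y _ _ hx hy; rw [map_add]; exact add_mem hx hy
  · intro m x _ hx
    rw [map_zsmul]; exact zsmul_mem hx m
  · rintro _ ⟨a, ha, rfl⟩ b
    exact Submodule.subset_span ⟨a, ha, b, mul_comm _ _⟩
  · intro b; rw [mul_zero]; exact zero_mem _
  · intro x y _ _ hx hy b; rw [mul_add]; exact add_mem (hx b) (hy b)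
  · intro a x _ hx b; rw [smul_eq_mul, ← mul_assoc]; exact hx _

/-- At a closed point, where the residue field is `k`, the form `f dg` has the same value as the
exact form `d(l g)`, with `l` the value of `f`. -/
theorem exists_sub_D_mem [IsAlgClosed k] {A : Type u} [CommRing A] [Algebra k A]
    [Algebra.FiniteType k A] (n : Ideal A) [n.IsMaximal] (ω : Ω[A⁄k]) :
    ∃ u : A, ∀ ξ : Derivation k A A, ξ u - ξ.liftKaehlerDifferential ω ∈ n := by
  induction ω using form_induction with
  | h0 => exact ⟨0, fun ξ => by simp⟩
  | hadd x y hx hy =>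
    obtain ⟨a, ha⟩ := hx
    obtain ⟨b, hb⟩ := hy
    refine ⟨a + b, fun ξ => ?_⟩
    rw [map_add, map_add, add_sub_add_comm]
    exact add_mem (ha ξ) (hb ξ)
  | hD f g =>
    obtain ⟨l, hl⟩ := exists_sub_algebraMap_mem (k := k) n f
    refine ⟨l • g, fun ξ => ?_⟩
    rw [ξ.map_smul, LinearMap.map_smul, Derivation.liftKaehlerDifferential_comp_D, Algebra.smul_def,
      smul_eq_mul, ← sub_mul, ← neg_sub, neg_mul]
    exact neg_mem (Ideal.mul_mem_right _ _ hl)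

variable {X : Scheme.{u}} [X.Over (Spec (.of k))] [Smooth (X ↘ Spec (.of k))] [IsAlgClosed k]
variable {M : LineConn k X} (c : k) (T : Triv M)

/-- Let `ξ` act by `ξ + ξ(u)`. The `p`-curvature of this flat connection is `ξ(u) ^ p`, so the
central element acts as `ξ(u) ^ p + (c ^ p - c) ω(ξ) ^ p = (ξ(u) + b ω(ξ)) ^ p` with `b ^ p = c ^ p
- c`. This is zero modulo `frobIdeal p n` as soon as `du` and `-b ω` agree at the point `n`. -/
theorem exists_fiber (n : Ideal Γ(X, T.U.1)) [n.IsMaximal] :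
    ∃ ψ : RedLocal p c T →+* Module.End k (Γ(X, T.U.1) ⧸ frobIdeal p n),
      ∀ f a, ψ (RedLocal.fn p c T f) (Ideal.Quotient.mk _ a) = Ideal.Quotient.mk _ (f * a) := by
  let A := Γ(X, T.U.1)
  let J := frobIdeal p n
  have hsm := smooth_sections (k := k) T.isAffineOpen
  have hp : (p : A) = 0 := cast_eq_zero_of_charP k A p
  obtain ⟨b, hb⟩ := IsAlgClosed.exists_pow_nat_eq (c ^ p - c) (Fact.out : p.Prime).pos
  obtain ⟨u, hu⟩ := exists_sub_D_mem (k := k) n (-(b • T.form))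
  let act (L : A →ₗ[k] A) (h : J.restrictScalars k ≤ (J.restrictScalars k).comap L) :
    Module.End k (A ⧸ J) := (J.restrictScalars k).mapQ (J.restrictScalars k) L h
  let φ : A →+* Module.End k (A ⧸ J) := (Algebra.lmul k (A ⧸ J)).toRingHom.comp
    (Ideal.Quotient.mk J)
  let D : Vect k T.U.1 → (A →ₗ[k] A) := fun ξ => (ξ.der : A →ₗ[k] A) + Algebra.lmul k A (ξ.der u)
  have hD : ∀ ξ a, D ξ a = ξ.der a + ξ.der u * a := fun ξ a => rfl
  have hDJ : ∀ ξ, J.restrictScalars k ≤ (J.restrictScalars k).comap (D ξ) := fun ξ a ha =>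
    add_mem (derivation_mem_frobIdeal p n ξ.der ha) (Ideal.mul_mem_left _ _ ha)
  let ν : Vect k T.U.1 → Module.End k (A ⧸ J) := fun ξ => act (D ξ) (hDJ ξ)
  have hν : ∀ ξ a, ν ξ (Ideal.Quotient.mk J a) = Ideal.Quotient.mk J (ξ.der a + ξ.der u * a) :=
    fun ξ a => rfl
  have hφ : ∀ f a, φ f (Ideal.Quotient.mk J a) = Ideal.Quotient.mk J (f * a) := fun f a => rfl
  have ext : ∀ {F G : Module.End k (A ⧸ J)}, (∀ a, F (Ideal.Quotient.mk J a) =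
      G (Ideal.Quotient.mk J a)) → F = G := fun h => LinearMap.ext fun z => by
    obtain ⟨a, rfl⟩ := Ideal.Quotient.mk_surjective z
    exact h a
  let Φ : DiffOp k T.U.1 →+* Module.End k (A ⧸ J) := DiffOp.lift φ ν
    (fun a r => ext fun x => by
      have : ∀ z, φ (algebraMap k A a) z = a • z := fun z => by
        obtain ⟨z, rfl⟩ := Ideal.Quotient.mk_surjective z
        rw [hφ, ← Algebra.smul_def]; rfl
      rw [Module.End.mul_apply, Module.End.mul_apply, this, this, map_smul])
    (fun ξ η => ext fun x => by
      rw [LinearMap.add_apply, hν, hν, hν, ← map_add, Vect.der_add, Vect.der_add]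
      congr 1; ring)
    (fun f ξ => ext fun x => by
      rw [Module.End.mul_apply, hν, hν, hφ, Vect.der_fsmul, Vect.der_fsmul]
      congr 1; ring)
    (fun ξ f => ext fun x => by
      rw [LinearMap.add_apply, Module.End.mul_apply, Module.End.mul_apply, hν, hφ, hφ, hφ, hν,
        ← map_add, Derivation.leibniz]
      congr 1; simp only [smul_eq_mul]; ring)
    (fun ξ η => ext fun x => by
      rw [LinearMap.sub_apply, Module.End.mul_apply, Module.End.mul_apply, hν, hν, hν, hν, hν,
        ← map_sub]
      congr 1
      simp only [Vect.der_bracket, map_add, Derivation.leibniz, smul_eq_mul]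
      ring)
  have hΦv : ∀ ξ, Φ (DiffOp.vec ξ) = ν ξ := fun ξ => DiffOp.lift_vec ..
  have hΦf : ∀ f, Φ (DiffOp.fn f) = φ f := fun f => DiffOp.lift_fn ..
  refine ⟨RedLocal.lift p c T Φ fun ξ => ?_, fun f a => ?_⟩
  · have h1 : (D ξ) ^ p = (ξ.der : A →ₗ[k] A) ^ p + Algebra.lmul k A (ξ.der^[p - 1] (ξ.der u)) +
        Algebra.lmul k A (ξ.der u ^ p) :=
      add_pow_prime_of_derivation hp (Algebra.lmul k A).toRingHom (ξ.der : A →ₗ[k] A) ξ.der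
        (fun a => LinearMap.ext fun x => by
          change ξ.der (a * x) = a * ξ.der x + ξ.der a * x
          rw [Derivation.leibniz]; simp only [smul_eq_mul]; ring) _
    have hνp : ∀ m a, (ν ξ ^ m) (Ideal.Quotient.mk J a) = Ideal.Quotient.mk J ((D ξ ^ m) a) := by
      intro m a
      induction m with
      | zero => rfl
      | succ m ih => rw [pow_succ', pow_succ', Module.End.mul_apply, ih]; rfl
    rw [centralElt, DiffOp.smul_fn, map_add, map_sub, map_pow, hΦv, hΦv, hΦf]
    refine ext fun a => ?_
    have hp1 : p - 1 + 1 = p := Nat.succ_pred_prime Fact.out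
    have h2 : (D ξ ^ p) a = ξ.der^[p] a + ξ.der^[p] u * a + ξ.der u ^ p * a := by
      rw [h1]
      change ((ξ.der : A →ₗ[k] A) ^ p) a + ξ.der^[p - 1] (ξ.der u) * a + ξ.der u ^ p * a = _
      rw [Module.End.pow_apply, ← Function.iterate_succ_apply, Nat.succ_eq_add_one, hp1]
      rfl
    rw [LinearMap.add_apply, LinearMap.sub_apply, hνp, hν, hφ, ← map_sub, ← map_add,
      LinearMap.zero_apply, Ideal.Quotient.eq_zero_iff_mem, Vect.der_pPow, derivationPow_apply,
      derivationPow_apply, h2, ← hb, ← smul_pow]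
    have h3 : ξ.der u + b • ξ.pair T.form ∈ n := by
      have := hu ξ.der
      rw [map_neg, sub_neg_eq_add] at this
      convert this using 2
      exact ((ξ.der.liftKaehlerDifferential.restrictScalars k).map_smul b T.form).symm
    have h4 := Ideal.mul_mem_right a _ (pow_mem_frobIdeal (p := p) h3)
    rw [add_pow_of_cast_eq_zero hp] at h4
    convert h4 using 1
    ring
  · erw [RedLocal.lift_mk]
    rw [hΦf]
    rfl

/-- A function in the kernel acts as zero on the representation at each closed point, so it vanishes
at all closed points; the ring of functions is Jacobson and reduced. -/
theorem RedLocal.fn_injective : Function.Injective (RedLocal.fn p c T) := by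
  have hsm := smooth_sections (k := k) T.isAffineOpen
  have hred : _root_.IsReduced Γ(X, T.U.1) := isReduced_of_smooth k
  have hjac : IsJacobsonRing Γ(X, T.U.1) := isJacobsonRing_of_finiteType (A := k)
  rw [injective_iff_map_eq_zero]
  intro f hf
  have h1 : f ∈ Ideal.jacobson (⊥ : Ideal Γ(X, T.U.1)) := by
    rw [Ideal.jacobson, Ideal.mem_sInf]
    rintro n ⟨-, hn⟩
    obtain ⟨ψ, hψ⟩ := exists_fiber p c T n
    have h2 := hψ f 1
    rw [hf, map_zero, LinearMap.zero_apply, mul_one] at h2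
    exact frobIdeal_le n (Ideal.Quotient.eq_zero_iff_mem.1 h2.symm)
  rw [IsJacobsonRing.out hjac Ideal.isRadical_bot] at h1
  exact h1

theorem Red.fn_injective (M : LineConn k X) (U : X.Opens) :
    Function.Injective (Red.fn p c M (U := U)) := by
  rw [injective_iff_map_eq_zero]
  intro f hf
  refine res_ext_affine k fun x hx => ?_
  obtain ⟨T, hT⟩ := Triv.exists_mem M x
  obtain ⟨V, hxV, hV⟩ := exists_affine_le (show x ∈ T.U.1 ⊓ U from ⟨hT, hx⟩)
  refine ⟨V, hV.trans inf_le_right, hxV, ?_⟩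
  rw [map_zero]
  refine RedLocal.fn_injective p c (T.restrict V (hV.trans inf_le_left)) ?_
  have := congrArg (fun a : Red p M c U =>
    a.1 ⟨T.restrict V (hV.trans inf_le_left), hV.trans inf_le_right⟩) hf
  erw [map_zero]
  exact this

end Fibers
end
end PCurv

namespace PCurv
noncomputable section

/-! ### The curvature equation in terms of connection forms -/

section CurvatureEquation

variable {k : Type u} [Field k] {p : ℕ} [Fact p.Prime] [CharP k p]

section Algebra

variable {A : Type u} [CommRing A] [Algebra k A]

/-- Transport of coordinates along an isomorphism -/
def Coordinates.ofAlgEquiv {A' : Type u} [CommRing A'] [Algebra k A'] {n : ℕ}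
    (C : Coordinates k A n) (e : A ≃ₐ[k] A') : Coordinates k A' n where
  x i := e (C.x i)
  d i := Derivation.mk' (e.toLinearMap ∘ₗ (C.d i : A →ₗ[k] A) ∘ₗ e.symm.toLinearMap) fun a b => by
    change e (C.d i (e.symm (a * b))) = a * e (C.d i (e.symm b)) + b * e (C.d i (e.symm a))
    rw [map_mul, Derivation.leibniz]
    simp
  d_x i j := by
    change e (C.d i (e.symm (e (C.x j)))) = _
    rw [e.symm_apply_apply, C.d_x]
    split_ifs <;> simp
  D_eq_sum a := by
    have h := congrArg (formMap (e : A →ₐ[k] A')) (C.D_eq_sum (e.symm a))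
    simp only [map_sum, formMap_smul, formMap_D] at h
    refine Eq.trans ?_ h
    congr 1
    exact (e.apply_symm_apply a).symm

theorem lift_zero_derivation (ω : Ω[A⁄k]) :
    (0 : Derivation k A A).liftKaehlerDifferential ω = 0 := by
  induction ω using form_induction with
  | h0 => simp
  | hadd x y hx hy => rw [map_add, hx, hy, add_zero]
  | hD f g => rw [LinearMap.map_smul, Derivation.liftKaehlerDifferential_comp_D]; simp

theorem lift_smul_scalar (ξ : Derivation k A A) (c : k) (ω : Ω[A⁄k]) :
    ξ.liftKaehlerDifferential (c • ω) = c • ξ.liftKaehlerDifferential ω :=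
  (ξ.liftKaehlerDifferential.restrictScalars k).map_smul c ω

/-- The curvature equation with the terms `δ` and `C⁻¹` on separate sides, ready for `katzMap` and
`curlMap`. -/
theorem delta_sub_smul_of_kappa {c : k} {ω ω' : Ω[A⁄k]} (h : kappa k p ω' = c • kappa k p ω) :
    delta k (ω' - c • ω) = invCartier k p ω' - c • invCartier k p ω := by
  have e : ∀ ω : Ω[A⁄k], kappa k p ω = invCartier k p ω - delta k ω := fun ω => rfl
  rw [e, e, smul_sub] at h
  rw [map_sub, map_smul, sub_eq_sub_iff_add_eq_add] at *
  rw [add_comm, ← h, add_comm]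

theorem katz_of_kappa {c : k} {ω ω' : Ω[A⁄k]} (h : kappa k p ω' = c • kappa k p ω)
    (ξ : Derivation k A A) :
    ξ^[p - 1] (ξ.liftKaehlerDifferential (ω' - c • ω)) -
      (derivationPow p ξ).liftKaehlerDifferential (ω' - c • ω) =
        c • ξ.liftKaehlerDifferential ω ^ p - ξ.liftKaehlerDifferential ω' ^ p := by
  rw [← katzMap_delta, delta_sub_smul_of_kappa h, map_sub, map_smul, katzMap_invCartier,
    katzMap_invCartier, smul_neg]
  abel

theorem curl_of_kappa {c : k} {ω ω' : Ω[A⁄k]} (h : kappa k p ω' = c • kappa k p ω)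
    (ξ ζ : Derivation k A A) :
    ξ (ζ.liftKaehlerDifferential (ω' - c • ω)) - ζ (ξ.liftKaehlerDifferential (ω' - c • ω)) =
      (⁅ξ, ζ⁆).liftKaehlerDifferential (ω' - c • ω) := by
  rw [← sub_eq_zero, ← curlMap_delta, delta_sub_smul_of_kappa h, map_sub, map_smul,
    curlMap_invCartier, curlMap_invCartier, smul_zero, sub_zero]

theorem invCartier_smul (d : k) (ω : Ω[A⁄k]) :
    invCartier k p (d • ω) = d ^ p • invCartier k p ω := by
  induction ω using form_induction with
  | h0 => simp
  | hadd x y hx hy => rw [smul_add, map_add, hx, hy, map_add, smul_add]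
  | hD f g =>
    rw [← smul_assoc, invCartier_smul_D, invCartier_smul_D, smul_pow, smul_assoc, map_smul]

/-- The second hypothesis says that `ω' - cω` is closed, so Cartier's theorem gives `δ(ω' - cω) =
C⁻¹(θ)`. By Katz's formula the first becomes `θ(∂_i) ^ p = (ω'(∂_i) - d ω(∂_i)) ^ p` with `d ^ p =
c`. As `A` is reduced, `θ = ω' - dω`, and the semilinear `C⁻¹` turns `d` back into `c`. -/
theorem kappa_of_katz [IsAlgClosed k] [Algebra.FiniteType k A] [_root_.IsReduced A] {n : ℕ}
    (C : Coordinates k A n) {c : k} {ω ω' : Ω[A⁄k]}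
    (h1 : ∀ ξ : Derivation k A A, ξ^[p - 1] (ξ.liftKaehlerDifferential (ω' - c • ω)) -
      (derivationPow p ξ).liftKaehlerDifferential (ω' - c • ω) =
        c • ξ.liftKaehlerDifferential ω ^ p - ξ.liftKaehlerDifferential ω' ^ p)
    (h2 : ∀ ξ ζ : Derivation k A A, ξ (ζ.liftKaehlerDifferential (ω' - c • ω)) -
      ζ (ξ.liftKaehlerDifferential (ω' - c • ω)) =
        (⁅ξ, ζ⁆).liftKaehlerDifferential (ω' - c • ω)) :
    kappa k p ω' = c • kappa k p ω := by
  have hp : (p : A) = 0 := cast_eq_zero_of_charP k A p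
  obtain ⟨d, hd⟩ := IsAlgClosed.exists_pow_nat_eq c (Fact.out : p.Prime).pos
  obtain ⟨θ, hθ⟩ := C.exists_delta_eq_invCartier (p := p) (ω' - c • ω) fun i j => by
    rw [← sub_eq_zero, h2, C.d_comm, lift_zero_derivation]
  have h3 : θ = ω' - d • ω := by
    rw [C.form_eq θ, C.form_eq (ω' - d • ω)]
    refine Finset.sum_congr rfl fun i _ => congrArg (· • _) ?_
    have h4 := h1 (C.d i)
    rw [← katzMap_delta, hθ, katzMap_invCartier, ← hd, ← smul_pow, ← neg_sub (_ ^ p), neg_inj] at h4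
    have h5 := (map_sub (frobHom hp) ((C.d i).liftKaehlerDifferential ω')
      (d • (C.d i).liftKaehlerDifferential ω)).trans h4.symm
    have h6 : ((C.d i).liftKaehlerDifferential θ - ((C.d i).liftKaehlerDifferential ω' -
        d • (C.d i).liftKaehlerDifferential ω)) ^ p = 0 :=
      (map_sub (frobHom hp) _ _).trans (sub_eq_zero.2 h5.symm)
    rw [sub_eq_zero.1 (eq_zero_of_pow_eq_zero h6), map_sub]
    rw [lift_smul_scalar]
  have e : ∀ ω : Ω[A⁄k], kappa k p ω = invCartier k p ω - delta k ω := fun ω => rfl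
  rw [h3, map_sub, map_sub (invCartier k p), invCartier_smul, hd, map_smul,
    sub_eq_sub_iff_add_eq_add] at hθ
  rw [e, e, smul_sub, sub_eq_sub_iff_add_eq_add, ← hθ, add_comm]

end Algebra

variable {X : Scheme.{u}} [X.Over (Spec (.of k))]

theorem exists_formMap_res_eq_zero {U : X.Opens} (hU : IsAffineOpen U) {x : X} (hx : x ∈ U)
    {ω : Ω[Γ(X, U)⁄k]} (h : formMap (germ k hx) ω = 0) :
    ∃ f : Γ(X, U), x ∈ X.basicOpen f ∧ formMap (res k (X.basicOpen_le f)) ω = 0 := by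
  let := X.presheaf.algebra_section_stalk ⟨x, hx⟩
  have : IsScalarTower k Γ(X, U) (X.presheaf.stalk x) :=
    IsScalarTower.of_algebraMap_eq' (germ k hx).comp_algebraMap.symm
  have hloc := hU.isLocalization_stalk ⟨x, hx⟩
  have h0 : KaehlerDifferential.map k k Γ(X, U) (X.presheaf.stalk x) ω = 0 := h
  obtain ⟨⟨f, hf⟩, hfω⟩ := (IsLocalizedModule.eq_zero_iff
    (hU.primeIdealOf ⟨x, hx⟩).asIdeal.primeCompl _).1 h0
  have hu : IsUnit (germ k hx f) := IsLocalization.map_units (X.presheaf.stalk x) ⟨f, hf⟩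
  refine ⟨f, (X.mem_basicOpen f x hx).2 hu, ?_⟩
  have h1 := congrArg (formMap (res k (X.basicOpen_le f))) hfω
  rw [map_zero] at h1
  have h2 : res k (X.basicOpen_le f) f • formMap (res k (X.basicOpen_le f)) ω = 0 := by
    rw [← formMap_smul]; exact h1
  exact ((isUnit_res_basicOpen f).smul_eq_zero).1 h2

/-- If the germ is `dt`, extend `t` to a neighbourhood; the form minus `dt` has zero germ, and forms
at the stalk are a localization of forms on an affine neighbourhood. -/
theorem exists_genFormMap_res_eq_zero {U : X.Opens} {x : X} (hx : x ∈ U)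
    {G : GenForms k Γ(X, U)} (h : genFormMap (germ k hx) G = 0) :
    ∃ (V : X.affineOpens) (i : V.1 ≤ U), x ∈ V.1 ∧ genFormMap (res k i) G = 0 := by
  obtain ⟨ω, rfl⟩ := Submodule.mkQ_surjective _ G
  obtain ⟨t, ht⟩ := (delta_eq_zero_iff k _).1 h
  obtain ⟨W, hxW, s, rfl⟩ := X.presheaf.exists_germ_eq t
  obtain ⟨V, hxV, hV⟩ := exists_affine_le (show x ∈ W ⊓ U from ⟨hxW, hx⟩)
  have iW := hV.trans inf_le_left
  have iU := hV.trans inf_le_right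
  have h1 : formMap (germ k hxV) (formMap (res k iU) ω -
      KaehlerDifferential.D k _ (res k iW s)) = 0 := by
    rw [map_sub, formMap_D, germ_res, formMap_comp _ _ (germ k hx) (germ_res k iU hxV), sub_eq_zero]
    exact ht.symm
  obtain ⟨f, hxf, hf⟩ := exists_formMap_res_eq_zero V.2 hxV h1
  refine ⟨⟨_, V.2.basicOpen f⟩, (X.basicOpen_le f).trans iU, hxf, ?_⟩
  change delta k (formMap _ ω) = 0
  rw [map_sub, formMap_D, formMap_comp _ _ (res k ((X.basicOpen_le f).trans iU))
    (res_res k iU (X.basicOpen_le f)), sub_eq_zero] at hf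
  exact (delta_eq_zero_iff k _).2 ⟨_, hf.symm⟩

variable {M N : LineConn k X} {c : k}

theorem kappa_res {U V : X.Opens} (i : V ≤ U) (ω : Ω[Γ(X, U)⁄k]) :
    genFormMap (res k i) (kappa k p ω) = kappa k p (formMap (res k i) ω) := genFormMap_kappa p _ _

theorem exists_kappa_eq_of_extCurv (h : extCurv p N = c • extCurv p M) (T : Triv M) (S : Triv N)
    (i : S.U.1 ≤ T.U.1) {x : X} (hx : x ∈ S.U.1) :
    ∃ (V : X.affineOpens) (j : V.1 ≤ S.U.1), x ∈ V.1 ∧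
      kappa k p (formMap (res k j) S.form) =
        c • kappa k p (formMap (res k j) (formMap (res k i) T.form)) := by
  obtain ⟨V, j, hxV, hV⟩ := exists_genFormMap_res_eq_zero hx
    (G := kappa k p S.form - c • kappa k p (formMap (res k i) T.form)) (by
      have h1 := congrArg (fun s : FSections k X => s.1 x) h
      change _ = c • (extCurv p M).1 x at h1
      simp only [extCurv_apply p N S hx, extCurv_apply p M T (i hx)] at h1
      rw [map_sub, map_smul, genFormMap_kappa, genFormMap_kappa, h1,
        formMap_comp _ _ _ (germ_res k i hx), sub_self])
  exact ⟨V, j, hxV, by rwa [map_sub, map_smul, kappa_res, kappa_res, sub_eq_zero] at hV⟩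

theorem Triv.form_restrict (T : Triv M) (V : X.affineOpens) (i : V.1 ≤ T.U.1) :
    (T.restrict V i).form = formMap (res k i) T.form := by
  rw [T.form_eq_of_smul (T.restrict V i) i 1 (by rw [Units.val_one, one_smul]; rfl)]
  rw [Units.val_one, Derivation.map_one_eq_zero, smul_zero, add_zero]
  rfl

theorem iterate_der_restrict {U V : X.Opens} (i : V ≤ U) (ξ : Vect k U) (m : ℕ) (f : Γ(X, U)) :
    (ξ.restrict i).der^[m] (res k i f) = res k i (ξ.der^[m] f) := by
  induction m with
  | zero => rfl
  | succ m ih =>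
    rw [Function.iterate_succ_apply', Function.iterate_succ_apply', ih, Vect.der_restrict]

/-- Equal extended curvatures give an equation of classes of forms only near each point, but the
identity is one between functions, so it may be verified locally. -/
theorem katz_of_extCurv (h : extCurv p N = c • extCurv p M) (T : Triv M) (S : Triv N)
    (i : S.U.1 ≤ T.U.1) (ξ : Vect k S.U.1) :
    ξ.der^[p - 1] (ξ.pair (S.form - c • formMap (res k i) T.form)) -
      (ξ.pPow p).pair (S.form - c • formMap (res k i) T.form) =
        c • ξ.pair (formMap (res k i) T.form) ^ p - ξ.pair S.form ^ p := by
  refine res_ext_affine k fun x hx => ?_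
  obtain ⟨V, j, hxV, hV⟩ := exists_kappa_eq_of_extCurv h T S i hx
  refine ⟨V, j, hxV, ?_⟩
  have h1 := katz_of_kappa hV (ξ.restrict j).der
  rw [map_sub (res k j), map_sub (res k j), map_smul (res k j), map_pow (res k j),
    map_pow (res k j), ← iterate_der_restrict, ← Vect.pair_restrict, ← Vect.pair_restrict,
    ← Vect.pair_restrict, ← Vect.pair_restrict, map_sub (formMap _), map_smul (formMap _)]
  exact h1

theorem curl_of_extCurv (h : extCurv p N = c • extCurv p M) (T : Triv M) (S : Triv N)
    (i : S.U.1 ≤ T.U.1) (ξ ζ : Vect k S.U.1) :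
    ξ.der (ζ.pair (S.form - c • formMap (res k i) T.form)) -
      ζ.der (ξ.pair (S.form - c • formMap (res k i) T.form)) =
        (ξ.bracket ζ).pair (S.form - c • formMap (res k i) T.form) := by
  refine res_ext_affine k fun x hx => ?_
  obtain ⟨V, j, hxV, hV⟩ := exists_kappa_eq_of_extCurv h T S i hx
  refine ⟨V, j, hxV, ?_⟩
  have h1 := curl_of_kappa hV (ξ.restrict j).der (ζ.restrict j).der
  rw [map_sub (res k j), ← Vect.der_restrict, ← Vect.der_restrict, ← Vect.pair_restrict,
    ← Vect.pair_restrict, ← Vect.pair_restrict, map_sub (formMap _), map_smul (formMap _)]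
  exact h1

theorem exists_coordinates_nhd [IsAlgClosed k] [Smooth (X ↘ Spec (.of k))] {U : X.Opens} {x : X}
    (hx : x ∈ U) : ∃ (V : X.affineOpens) (n : ℕ), x ∈ V.1 ∧ V.1 ≤ U ∧
      Nonempty (Coordinates k Γ(X, V.1) n) := by
  obtain ⟨W, hxW, hW⟩ := exists_affine_le hx
  have := smooth_sections (k := k) W.2
  let q : Ideal Γ(X, W.1) := (IsLocalRing.maximalIdeal (X.presheaf.stalk x)).comap (germ k hxW)
  have hq : q.IsPrime := Ideal.comap_isPrime _ _
  obtain ⟨f, n, hf, ⟨C⟩⟩ := exists_coordinates_away (k := k) q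
  have hxf : x ∈ X.basicOpen f := by
    refine (X.mem_basicOpen f x hxW).2 ?_
    by_contra hu
    exact hf ((IsLocalRing.mem_maximalIdeal _).2 hu)
  refine ⟨⟨_, IsAffineOpen.basicOpen W.2 f⟩, n, hxf, (X.basicOpen_le f).trans hW, ⟨?_⟩⟩
  have hloc := IsAffineOpen.isLocalization_basicOpen W.2 f
  have : IsScalarTower k Γ(X, W.1) Γ(X, X.basicOpen f) :=
    IsScalarTower.of_algebraMap_eq' (res k (X.basicOpen_le f)).comp_algebraMap.symm
  exact C.ofAlgEquiv ((IsLocalization.algEquiv (Submonoid.powers f) (Localization.Away f)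
    Γ(X, X.basicOpen f)).restrictScalars k)

/-- The equation of extended curvatures from the identities satisfied by connection forms. -/
theorem extCurv_eq_of_katz [IsAlgClosed k] [Smooth (X ↘ Spec (.of k))]
    (h1 : ∀ (T : Triv M) (S : Triv N) (i : S.U.1 ≤ T.U.1) (ξ : Vect k S.U.1),
      ξ.der^[p - 1] (ξ.pair (S.form - c • formMap (res k i) T.form)) -
        (ξ.pPow p).pair (S.form - c • formMap (res k i) T.form) =
          c • ξ.pair (formMap (res k i) T.form) ^ p - ξ.pair S.form ^ p)
    (h2 : ∀ (T : Triv M) (S : Triv N) (i : S.U.1 ≤ T.U.1) (ξ ζ : Vect k S.U.1),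
      ξ.der (ζ.pair (S.form - c • formMap (res k i) T.form)) -
        ζ.der (ξ.pair (S.form - c • formMap (res k i) T.form)) =
          (ξ.bracket ζ).pair (S.form - c • formMap (res k i) T.form)) :
    extCurv p N = c • extCurv p M := by
  refine Subtype.ext (funext fun x => ?_)
  obtain ⟨T, hT⟩ := Triv.exists_mem M x
  obtain ⟨S, hS⟩ := Triv.exists_mem N x
  obtain ⟨V, n, hxV, hV, ⟨C⟩⟩ := exists_coordinates_nhd (k := k)
    (show x ∈ T.U.1 ⊓ S.U.1 from ⟨hT, hS⟩)
  have iT := hV.trans inf_le_left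
  have iS := hV.trans inf_le_right
  have hsm := smooth_sections (k := k) V.2
  have hred : _root_.IsReduced Γ(X, V.1) := isReduced_of_smooth k
  let S' := S.restrict V iS
  have hV : IsAffineOpen V.1 := V.2
  have hpair : ∀ (D : Derivation k Γ(X, V.1) Γ(X, V.1)),
      (Vect.ofDer hV D).pair = D.liftKaehlerDifferential := fun D => by
    rw [Vect.pair, Vect.der_ofDer]
  have key : kappa k p S'.form = c • kappa k p (formMap (res k iT) T.form) := by
    refine kappa_of_katz C (fun D => ?_) (fun D E => ?_)
    · have h := h1 T S' iT (Vect.ofDer hV D)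
      have e : ((Vect.ofDer hV D).pPow p).pair = (derivationPow p D).liftKaehlerDifferential := by
        rw [Vect.pair, Vect.der_pPow, Vect.der_ofDer]
      have e' := Vect.der_ofDer hV D
      erw [e, hpair, e'] at h
      exact h
    · have h := h2 T S' iT (Vect.ofDer hV D) (Vect.ofDer hV E)
      have e : ((Vect.ofDer hV D).bracket (Vect.ofDer hV E)).pair =
          (⁅D, E⁆).liftKaehlerDifferential := by
        rw [Vect.pair]
        congr 1
        ext f
        rw [Vect.der_bracket, Vect.der_ofDer, Vect.der_ofDer, Derivation.commutator_apply]
      have e1 := Vect.der_ofDer hV D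
      have e2 := Vect.der_ofDer hV E
      erw [e, hpair, hpair, e1, e2] at h
      exact h
  have key2 := congrArg (genFormMap (germ k hxV)) key
  rw [map_smul (genFormMap _)] at key2
  erw [genFormMap_kappa, genFormMap_kappa, formMap_comp _ _ _ (germ_res k iT hxV)] at key2
  change _ = c • (extCurv p M).1 x
  rw [extCurv_apply p N S' hxV, extCurv_apply p M T (iT hxV)]
  exact key2

end CurvatureEquation
end
end PCurv

namespace PCurv
noncomputable section

/-! ### Endomorphisms of a sheaf that are linear over `p`-th powers -/

section FrobeniusLinear

variable {X : Scheme.{u}}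

/-- The additive endomorphisms of the sheaf `L` over `U` that are linear over the `p`-th powers of
functions. -/
def PEnd (k : Type u) [Field k] [X.Over (Spec (.of k))] (p : ℕ) (L : X.Modules) (U : X.Opens) :
    Subring (∀ V : {V : X.Opens // V ≤ U}, AddMonoid.End Γ(L, V.1)) where
  carrier := {a | (∀ (V W : {V : X.Opens // V ≤ U}) (i : W.1 ≤ V.1) (s : Γ(L, V.1)),
    a W (mres L i s) = mres L i (a V s)) ∧
    ∀ (V : {V : X.Opens // V ≤ U}) (f : Γ(X, V.1)) (s : Γ(L, V.1)),
      a V (f ^ p • s) = f ^ p • a V s}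
  zero_mem' := ⟨fun V W i s => by simp, fun V f s => by simp⟩
  one_mem' := ⟨fun V W i s => by simp, fun V f s => by simp⟩
  add_mem' := fun {a b} ha hb => ⟨fun V W i s => by
      change a W (mres L i s) + b W (mres L i s) = mres L i (a V s + b V s)
      rw [ha.1 V W, hb.1 V W, map_add],
    fun V f s => by
      change a V (f ^ p • s) + b V (f ^ p • s) = f ^ p • (a V s + b V s)
      rw [ha.2, hb.2, smul_add]⟩
  mul_mem' := fun {a b} ha hb => ⟨fun V W i s => by
      change a W (b W (mres L i s)) = mres L i (a V (b V s))
      rw [hb.1 V W, ha.1 V W],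
    fun V f s => by
      change a V (b V (f ^ p • s)) = f ^ p • a V (b V s)
      rw [hb.2, ha.2]⟩
  neg_mem' := fun {a} ha => ⟨fun V W i s => by
      change -a W (mres L i s) = mres L i (-a V s)
      rw [ha.1 V W, map_neg],
    fun V f s => by
      change -a V (f ^ p • s) = f ^ p • -a V s
      rw [ha.2, smul_neg]⟩

variable {k : Type u} [Field k] [X.Over (Spec (.of k))] {p : ℕ} {L : X.Modules} {U V : X.Opens}

namespace PEnd

/-- The action of an endomorphism on sections over a smaller open set -/
def app (a : PEnd k p L U) (i : V ≤ U) : AddMonoid.End Γ(L, V) := a.1 ⟨V, i⟩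

theorem app_mres (a : PEnd k p L U) (i : V ≤ U) {W : X.Opens} (j : W ≤ V) (s : Γ(L, V)) :
    PEnd.app a (j.trans i) (mres L j s) = mres L j (PEnd.app a i s) := a.2.1 ⟨V, i⟩ ⟨W, _⟩ j s

theorem app_pow_smul (a : PEnd k p L U) (i : V ≤ U) (f : Γ(X, V)) (s : Γ(L, V)) :
    PEnd.app a i (f ^ p • s) = f ^ p • PEnd.app a i s := a.2.2 ⟨V, i⟩ f s

theorem ext {a b : PEnd k p L U} (h : ∀ (V : X.Opens) (i : V ≤ U) s, PEnd.app a i s = PEnd.app b i s) :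
    a = b := Subtype.ext (funext fun V => AddMonoidHom.ext (h V.1 V.2))

theorem add_app (a b : PEnd k p L U) (i : V ≤ U) (s : Γ(L, V)) :
    PEnd.app (a + b) i s = PEnd.app a i s + PEnd.app b i s := rfl

theorem sub_app (a b : PEnd k p L U) (i : V ≤ U) (s : Γ(L, V)) :
    PEnd.app (a - b) i s = PEnd.app a i s - PEnd.app b i s := rfl

theorem mul_app (a b : PEnd k p L U) (i : V ≤ U) (s : Γ(L, V)) :
    PEnd.app (a * b) i s = PEnd.app a i (PEnd.app b i s) := rfl

theorem zero_app (i : V ≤ U) (s : Γ(L, V)) : PEnd.app (0 : PEnd k p L U) i s = 0 := rfl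

/-- Restriction of endomorphisms -/
def restrict (i : V ≤ U) : PEnd k p L U →+* PEnd k p L V where
  toFun a := ⟨fun W => a.1 ⟨W.1, W.2.trans i⟩,
    fun W W' j s => a.2.1 ⟨W.1, _⟩ ⟨W'.1, _⟩ j s, fun W f s => a.2.2 ⟨W.1, _⟩ f s⟩
  map_zero' := rfl
  map_one' := rfl
  map_add' _ _ := rfl
  map_mul' _ _ := rfl

theorem restrict_app (i : V ≤ U) (a : PEnd k p L U) {W : X.Opens} (j : W ≤ V) (s : Γ(L, W)) :
    PEnd.app (restrict i a) j s = PEnd.app a (j.trans i) s := rfl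

/-- Multiplication by a function -/
def fn : Γ(X, U) →+* PEnd k p L U where
  toFun f := ⟨fun V => Module.toAddMonoidEnd Γ(X, V.1) Γ(L, V.1) (res k V.2 f),
    fun V W i s => by
      change res k W.2 f • mres L i s = mres L i (res k V.2 f • s)
      rw [mres_smul k, res_res], fun V g s => smul_comm _ _ _⟩
  map_zero' := Subtype.ext (funext fun V => by
    change Module.toAddMonoidEnd Γ(X, V.1) Γ(L, V.1) (res k V.2 0) = 0
    rw [map_zero, map_zero])
  map_one' := Subtype.ext (funext fun V => by
    change Module.toAddMonoidEnd Γ(X, V.1) Γ(L, V.1) (res k V.2 1) = 1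
    rw [map_one, map_one])
  map_add' f g := Subtype.ext (funext fun V => by
    change Module.toAddMonoidEnd Γ(X, V.1) Γ(L, V.1) (res k V.2 (f + g)) = _
    rw [map_add, map_add]; rfl)
  map_mul' f g := Subtype.ext (funext fun V => by
    change Module.toAddMonoidEnd Γ(X, V.1) Γ(L, V.1) (res k V.2 (f * g)) = _
    rw [map_mul, map_mul]; rfl)

theorem fn_app (f : Γ(X, U)) (i : V ≤ U) (s : Γ(L, V)) :
    PEnd.app (fn (k := k) (p := p) (L := L) f) i s = res k i f • s := rfl

theorem fn_pow_commute (f : Γ(X, U)) (a : PEnd k p L U) : Commute (fn (f ^ p)) a :=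
  ext fun V i s => by
    rw [mul_app, mul_app, fn_app, fn_app, map_pow, app_pow_smul]

theorem restrict_fn (i : V ≤ U) (f : Γ(X, U)) :
    restrict i (fn f) = fn (k := k) (p := p) (L := L) (res k i f) :=
  ext fun W j s => by
    rw [restrict_app, fn_app, fn_app, res_res]

/-- Endomorphisms that agree locally are equal. -/
theorem ext_local {a b : PEnd k p L U} (h : ∀ x ∈ U, ∃ (V : X.Opens) (i : V ≤ U), x ∈ V ∧
    ∀ (W : X.Opens) (j : W ≤ V) (s : Γ(L, W)), PEnd.app a (j.trans i) s = PEnd.app b (j.trans i) s) :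
    a = b := ext fun W iW s => mres_ext_affine L fun x hx => by
  obtain ⟨V, i, hxV, hV⟩ := h x (iW hx)
  obtain ⟨W', hxW', hW'⟩ := exists_affine_le (show x ∈ W ⊓ V from ⟨hx, hxV⟩)
  refine ⟨W', hW'.trans inf_le_left, hxW', ?_⟩
  rw [← app_mres, ← app_mres]
  exact hV W' (hW'.trans inf_le_right) _

variable {N : LineConn k X}

theorem ext_triv {a b : PEnd k p N.L U} (h : ∀ (S : Triv N) (i : S.U.1 ≤ U) (f : Γ(X, S.U.1)),
    PEnd.app a i (f • S.e) = PEnd.app b i (f • S.e)) : a = b :=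
  ext fun V i s => mres_ext_affine N.L fun x hx => by
    obtain ⟨S, hxS⟩ := Triv.exists_mem N x
    obtain ⟨W, hxW, hW⟩ := exists_affine_le (show x ∈ V ⊓ S.U.1 from ⟨hx, hxS⟩)
    refine ⟨W, hW.trans inf_le_left, hxW, ?_⟩
    obtain ⟨f, hf⟩ := (S.restrict W (hW.trans inf_le_right)).bijective.2
      (mres N.L (hW.trans inf_le_left) s)
    rw [← app_mres, ← app_mres, ← hf]
    exact h (S.restrict W (hW.trans inf_le_right)) _ f

variable (N) [Fact p.Prime] [CharP k p]

/-- Covariant derivatives as endomorphisms -/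
def vec (ξ : Vect k U) : PEnd k p N.L U :=
  ⟨fun V => N.nabla (ξ.restrict V.2), fun V W i s => by
    change N.nabla _ (mres N.L i s) = mres N.L i (N.nabla _ s)
    rw [N.mres_nabla]; rfl, fun V f s => by
    change N.nabla _ (f ^ p • s) = f ^ p • N.nabla _ s
    rw [N.nabla_smul, Vect.der_pow_char, zero_smul, add_zero]⟩

theorem vec_app (ξ : Vect k U) (i : V ≤ U) (s : Γ(N.L, V)) :
    PEnd.app (vec (p := p) N ξ) i s = N.nabla (ξ.restrict i) s := rfl

theorem restrict_vec (i : V ≤ U) (ξ : Vect k U) :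
    restrict i (vec (p := p) N ξ) = vec N (ξ.restrict i) := rfl

end PEnd

end FrobeniusLinear

/-! ### The action of the central reduction on a line bundle with connection -/

section Representation

variable {k : Type u} [Field k] {X : Scheme.{u}} [X.Over (Spec (.of k))]
variable {p : ℕ} [Fact p.Prime] [CharP k p] {M N : LineConn k X} {c : k}

/-- The operator `∇_ξ - c ω(ξ)` -/
def repVec (p : ℕ) [Fact p.Prime] [CharP k p] (N : LineConn k X) (c : k) (T : Triv M)
    (ξ : Vect k T.U.1) : PEnd k p N.L T.U.1 :=
  PEnd.vec N ξ - PEnd.fn (c • ξ.pair T.form)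

theorem repVec_app_smul (T : Triv M) (ξ : Vect k T.U.1) (S : Triv N) (i : S.U.1 ≤ T.U.1)
    (f : Γ(X, S.U.1)) : PEnd.app (repVec p N c T ξ) i (f • S.e) = ((ξ.restrict i).der f +
      (ξ.restrict i).pair (S.form - c • formMap (res k i) T.form) * f) • S.e := by
  have h : (ξ.restrict i).pair (S.form - c • formMap (res k i) T.form) =
      (ξ.restrict i).pair S.form - c • res k i (ξ.pair T.form) := by
    rw [map_sub, ← Vect.pair_restrict]
    congr 1
    exact lift_smul_scalar _ _ _
  rw [repVec, PEnd.sub_app, PEnd.vec_app, PEnd.fn_app, N.nabla_smul, Triv.nabla_e, h, map_smul,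
    smul_smul, smul_smul, ← add_smul, ← sub_smul]
  congr 1
  ring

/-- Jacobson's formula for `ξ + η(ξ)` in the ring of `k`-linear operators on functions, where `η =
ω' - cω`. -/
theorem repVec_pow_app_smul (T : Triv M) (ξ : Vect k T.U.1) (S : Triv N) (i : S.U.1 ≤ T.U.1)
    (f : Γ(X, S.U.1)) : PEnd.app (repVec p N c T ξ ^ p) i (f • S.e) = ((ξ.restrict i).der^[p] f +
      ((ξ.restrict i).der^[p - 1] ((ξ.restrict i).pair (S.form - c • formMap (res k i) T.form)) +
      (ξ.restrict i).pair (S.form - c • formMap (res k i) T.form) ^ p) * f) • S.e := by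
  let A := Γ(X, S.U.1)
  let η := (ξ.restrict i).pair (S.form - c • formMap (res k i) T.form)
  let D : Derivation k A A := (ξ.restrict i).der
  let E : A →ₗ[k] A := (D : A →ₗ[k] A) + Algebra.lmul k A η
  have h1 : ∀ m, PEnd.app (repVec p N c T ξ ^ m) i (f • S.e) = ((E ^ m) f) • S.e := by
    intro m
    induction m with
    | zero => rfl
    | succ m ih =>
      rw [pow_succ', pow_succ', PEnd.mul_app, ih, repVec_app_smul]
      rfl
  have h2 : E ^ p = (D : A →ₗ[k] A) ^ p + Algebra.lmul k A (D^[p - 1] η) +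
      Algebra.lmul k A (η ^ p) :=
    add_pow_prime_of_derivation (cast_eq_zero_of_charP k A p) (Algebra.lmul k A).toRingHom
      (D : A →ₗ[k] A) D (fun a => LinearMap.ext fun x => by
        change D (a * x) = a * D x + D a * x
        rw [Derivation.leibniz]; simp only [smul_eq_mul]; ring) _
  rw [h1, h2]
  congr 1
  change ((D : A →ₗ[k] A) ^ p) f + D^[p - 1] η * f + η ^ p * f = _
  rw [Module.End.pow_apply, add_mul, ← add_assoc]
  rfl

variable [IsAlgClosed k]

/-- The action of differential operators on sections -/
def repDiffOp (hc : extCurv p N = c • extCurv p M) (T : Triv M) :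
    DiffOp k T.U.1 →+* PEnd k p N.L T.U.1 :=
  DiffOp.lift PEnd.fn (repVec p N c T)
    (fun a r => by
      -- Scalars are `p`-th powers, so multiplication by them is central in `PEnd`.
      obtain ⟨b, rfl⟩ := IsAlgClosed.exists_pow_nat_eq a (Fact.out : p.Prime).pos
      rw [map_pow]
      exact PEnd.fn_pow_commute _ _)
    (fun ξ η => by
      refine PEnd.ext_triv fun S i f => ?_
      rw [PEnd.add_app, repVec_app_smul, repVec_app_smul, repVec_app_smul, ← add_smul, map_add,
        Vect.pair_add, Vect.der_add]
      congr 1; ring)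
    (fun f ξ => by
      refine PEnd.ext_triv fun S i g => ?_
      rw [PEnd.mul_app, repVec_app_smul, repVec_app_smul, PEnd.fn_app, smul_smul,
        Vect.restrict_fsmul, Vect.pair_fsmul, Vect.der_fsmul]
      congr 1; ring)
    (fun ξ f => by
      refine PEnd.ext_triv fun S i g => ?_
      rw [PEnd.add_app, PEnd.mul_app, PEnd.mul_app, repVec_app_smul, PEnd.fn_app, PEnd.fn_app,
        PEnd.fn_app, smul_smul, smul_smul, repVec_app_smul, smul_smul, ← add_smul,
        Derivation.leibniz, Vect.der_restrict]
      congr 1; simp only [smul_eq_mul]; ring)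
    (fun ξ ζ => by
      -- The commutator relation amounts to closedness of `ω' - cω`.
      refine PEnd.ext_triv fun S i g => ?_
      rw [PEnd.sub_app, PEnd.mul_app, PEnd.mul_app, repVec_app_smul, repVec_app_smul,
        repVec_app_smul, repVec_app_smul, repVec_app_smul, ← sub_smul, Vect.restrict_bracket,
        ← curl_of_extCurv hc, Vect.der_bracket]
      congr 1
      simp only [map_add, Derivation.leibniz, smul_eq_mul]
      ring)

theorem repDiffOp_fn (hc : extCurv p N = c • extCurv p M) (T : Triv M) (f : Γ(X, T.U.1)) :
    repDiffOp hc T (DiffOp.fn f) = PEnd.fn f := DiffOp.lift_fn ..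

theorem repDiffOp_vec (hc : extCurv p N = c • extCurv p M) (T : Triv M) (ξ : Vect k T.U.1) :
    repDiffOp hc T (DiffOp.vec ξ) = repVec p N c T ξ := DiffOp.lift_vec ..

/-- The action of the central reduction on sections -/
def rep (hc : extCurv p N = c • extCurv p M) (T : Triv M) :
    RedLocal p c T →+* PEnd k p N.L T.U.1 :=
  RedLocal.lift p c T (repDiffOp hc T) fun ξ => by
    rw [centralElt, DiffOp.smul_fn, map_add, map_sub, map_pow, repDiffOp_fn, repDiffOp_vec,
      repDiffOp_vec]
    refine PEnd.ext_triv fun S i f => ?_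
    -- With `η = ω' - cω` one has `η(ξ) ^ p = ω'(ξ) ^ p - c ^ p ω(ξ) ^ p`. This, Katz's identity and
    -- the term `(c ^ p - c) ω(ξ) ^ p` of the central element cancel.
    have h := katz_of_extCurv hc T S i (ξ.restrict i)
    rw [PEnd.add_app, PEnd.sub_app, repVec_pow_app_smul, repVec_app_smul, PEnd.fn_app, smul_smul,
      ← sub_smul, ← add_smul, PEnd.zero_app]
    refine (congrArg (fun a : Γ(X, S.U.1) => a • S.e) ?_).trans (zero_smul Γ(X, S.U.1) S.e)
    have e1 : (ξ.pPow p).restrict i = (ξ.restrict i).pPow p := rfl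
    have e2 := map_sub (frobHom (cast_eq_zero_of_charP k Γ(X, S.U.1) p))
      ((ξ.restrict i).pair S.form) (c • (ξ.restrict i).pair (formMap (res k i) T.form))
    change ((ξ.restrict i).pair S.form - c • (ξ.restrict i).pair (formMap (res k i) T.form)) ^ p =
      (ξ.restrict i).pair S.form ^ p - (c • (ξ.restrict i).pair (formMap (res k i) T.form)) ^ p at e2
    have e3 : (ξ.restrict i).pair (S.form - c • formMap (res k i) T.form) =
        (ξ.restrict i).pair S.form - c • (ξ.restrict i).pair (formMap (res k i) T.form) := by
      rw [map_sub]
      congr 1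
      exact lift_smul_scalar _ _ _
    rw [e1, Vect.der_pPow, derivationPow_apply, map_smul, map_pow, ← Vect.pair_restrict]
    have e4 : (ξ.restrict i).pair (S.form - c • formMap (res k i) T.form) ^ p =
        (ξ.restrict i).pair S.form ^ p -
          c ^ p • (ξ.restrict i).pair (formMap (res k i) T.form) ^ p := by
      rw [e3, e2, smul_pow]
    rw [e4, sub_smul]
    linear_combination f * h

theorem rep_fn (hc : extCurv p N = c • extCurv p M) (T : Triv M) (f : Γ(X, T.U.1)) :
    rep hc T (RedLocal.fn p c T f) = PEnd.fn f :=
  (RedLocal.lift_mk p c T _ _ _).trans (repDiffOp_fn hc T f)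

theorem rep_vec (hc : extCurv p N = c • extCurv p M) (T : Triv M) (ξ : Vect k T.U.1) :
    rep hc T (RedLocal.vec p c T ξ) = repVec p N c T ξ :=
  (RedLocal.lift_mk p c T _ _ _).trans (repDiffOp_vec hc T ξ)

theorem rep_fn_injective (hc : extCurv p N = c • extCurv p M) (T : Triv M) :
    Function.Injective ((rep hc T).comp (RedLocal.fn p c T)) := by
  rw [injective_iff_map_eq_zero]
  intro f hf
  have h0 : PEnd.fn f = 0 := (rep_fn hc T f).symm.trans hf
  refine res_ext_affine k fun x hx => ?_
  obtain ⟨S, hxS⟩ := Triv.exists_mem N x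
  obtain ⟨V, hxV, hV⟩ := exists_affine_le (show x ∈ T.U.1 ⊓ S.U.1 from ⟨hx, hxS⟩)
  refine ⟨V, hV.trans inf_le_left, hxV, ?_⟩
  let S' := S.restrict V (hV.trans inf_le_right)
  refine S'.bijective.1 ?_
  have h1 := congrArg (fun a : PEnd k p N.L T.U.1 => PEnd.app a (hV.trans inf_le_left) S'.e) h0
  refine h1.trans ?_
  change 0 = (res k _ 0) • S'.e
  rw [map_zero, zero_smul]

/-- On the generators: the term `c ξ(h) / h` introduced by gluing compensates the change of `c ω(ξ)`
in `repVec`. -/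
theorem rep_glue (hc : extCurv p N = c • extCurv p M) (T T' : Triv M) (i : T'.U.1 ≤ T.U.1)
    (h : Γ(X, T'.U.1)ˣ) (he : T'.e = (h : Γ(X, T'.U.1)) • mres M.L i T.e) (r : RedLocal p c T) :
    rep hc T' (RedLocal.glue p c T T' i h he r) = PEnd.restrict i (rep hc T r) := by
  suffices H : (rep hc T').comp (RedLocal.glue p c T T' i h he) =
      (PEnd.restrict i).comp (rep hc T) from congrArg (fun F => F r) H
  refine RingHom.eq_of_eqOn_set_dense (RedLocal.closure_eq_top p c T) ?_
  rintro _ (⟨f, rfl⟩ | ⟨ξ, rfl⟩)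
  · change rep hc T' (RedLocal.glue p c T T' i h he (RedLocal.mk p c T _)) =
      PEnd.restrict i (rep hc T (RedLocal.fn p c T f))
    rw [RedLocal.glue_mk, DiffOp.glue_fn, rep_fn, PEnd.restrict_fn]
    exact rep_fn hc T' _
  · change rep hc T' (RedLocal.glue p c T T' i h he (RedLocal.mk p c T _)) =
      PEnd.restrict i (rep hc T (RedLocal.vec p c T ξ))
    rw [RedLocal.glue_mk, DiffOp.glue_vec, rep_vec, DiffOp.smul_fn, map_add, map_add]
    have h1 : rep hc T' (RedLocal.mk p c T' (DiffOp.vec (ξ.restrict i))) =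
      repVec p N c T' (ξ.restrict i) := rep_vec hc T' _
    have h2 := rep_fn hc T' (c • (ξ.restrict i).dlog h)
    change rep hc T' (RedLocal.mk p c T' (DiffOp.fn _)) = _ at h2
    rw [h1, h2, repVec, repVec, map_sub, PEnd.restrict_vec, PEnd.restrict_fn,
      T.form_eq_of_smul T' i h he, map_add, Vect.pair_restrict, smul_add, map_add]
    have h3 : (ξ.restrict i).pair ((↑h⁻¹ : Γ(X, T'.U.1)) •
        KaehlerDifferential.D k _ (h : Γ(X, T'.U.1))) = (ξ.restrict i).dlog h := by
      rw [map_smul, Vect.pair_D]; rfl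
    have h4 : res k i (c • ξ.pair T.form) = c • res k i (ξ.pair T.form) :=
      (res k i).toLinearMap.map_smul _ _
    rw [h3, h4]
    abel

end Representation
end
end PCurv

namespace PCurv
noncomputable section

/-! ### The local central reduction is the whole algebra of endomorphisms -/

section Bijectivity

variable {k : Type u} [Field k] {X : Scheme.{u}} [X.Over (Spec (.of k))]
variable {p : ℕ} [Fact p.Prime] [CharP k p] {L : X.Modules} {U V : X.Opens}

/-- The centralizer of an endomorphism in the ring of functions -/
theorem PEnd.commute_fn_of_mem_adjoin {n : ℕ} {x : Fin n → Γ(X, U)} {φ : PEnd k p L U}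
    (h : ∀ i, Commute φ (PEnd.fn (x i))) {a : Γ(X, U)}
    (ha : a ∈ Algebra.adjoin (powSubring k Γ(X, U) p) (Set.range x)) : Commute φ (PEnd.fn a) := by
  induction ha using Algebra.adjoin_induction with
  | mem y hy => obtain ⟨i, rfl⟩ := hy; exact h i
  | algebraMap r =>
    obtain ⟨r, ⟨y, rfl⟩⟩ := r
    exact (PEnd.fn_pow_commute y φ).symm
  | add y z _ _ hy hz => rw [map_add]; exact hy.add_right hz
  | mul y z _ _ hy hz => rw [map_mul]; exact hy.mul_right hz

theorem smul_cancel_of_isUnit {f : Γ(X, V)} (hf : IsUnit f) {s t : Γ(L, V)}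
    (h : f • s = f • t) : s = t := hf.smul_left_cancel.1 h

theorem isUnit_res_of_le (f : Γ(X, U)) (hV : V ≤ U) (h : V ≤ X.basicOpen f) :
    IsUnit (res k hV f) := by
  have := (isUnit_res_basicOpen (k := k) f).map (res k h)
  rwa [res_res] at this

/-- Up to a power of `g ^ p`, invertible on `V`, functions on `U` are polynomials in the coordinates
over `p`-th powers. Functions on `V` are locally fractions of those, with denominators that can be
made `p`-th powers. -/
theorem PEnd.app_smul_of_commute (hU : IsAffineOpen U) {n : ℕ} {g : Γ(X, U)}
    (C : ApproxCoordinates k Γ(X, U) p n g) {φ : PEnd k p L U}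
    (h : ∀ i, Commute φ (PEnd.fn (C.x i))) (hV : V ≤ U) (hg : V ≤ X.basicOpen g)
    (f : Γ(X, V)) (s : Γ(L, V)) : PEnd.app φ hV (f • s) = f • PEnd.app φ hV s := by
  have h1 : ∀ {W : X.Opens} (hW : W ≤ U) (_ : W ≤ X.basicOpen g) (a : Γ(X, U)) (s : Γ(L, W)),
      PEnd.app φ hW (res k hW a • s) = res k hW a • PEnd.app φ hW s := by
    intro W hW hgW a s
    obtain ⟨m, hm⟩ := C.exists_mem_adjoin a
    have h2 := congrArg (fun ψ : PEnd k p L U => PEnd.app ψ hW s)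
      (PEnd.commute_fn_of_mem_adjoin h hm)
    simp only [PEnd.mul_app, PEnd.fn_app] at h2
    rw [map_mul, mul_smul, mul_smul, ← pow_mul, mul_comm p m, pow_mul, map_pow,
      PEnd.app_pow_smul] at h2
    refine smul_cancel_of_isUnit ?_ h2
    rw [map_pow]
    exact ((isUnit_res_of_le (k := k) g hW hgW).pow m).pow p
  refine mres_ext_affine L fun x hx => ?_
  obtain ⟨f', hf', hxf'⟩ := exists_basicOpen_le' hU (hV hx) hx
  refine ⟨⟨X.basicOpen f', hU.basicOpen f'⟩, hf', hxf', ?_⟩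
  obtain ⟨m, a, ha⟩ := exists_res_eq_pow_mul (k := k) hU f' (res k hf' f)
  rw [mres_smul k, ← PEnd.app_mres, ← PEnd.app_mres, mres_smul k]
  have hp : p - 1 + 1 = p := Nat.succ_pred_prime Fact.out
  have hu : IsUnit (res k (X.basicOpen_le f') (f' ^ m)) := by
    rw [map_pow]; exact (isUnit_res_basicOpen f').pow m
  refine smul_cancel_of_isUnit (hu.pow p) ?_
  rw [← PEnd.app_pow_smul, smul_smul, smul_smul]
  have e : res k (X.basicOpen_le f') (f' ^ m) ^ p * res k hf' f =
      res k (X.basicOpen_le f') ((f' ^ m) ^ (p - 1) * a) := by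
    rw [map_mul, ← ha, ← mul_assoc]
    congr 1
    rw [map_pow (res k (X.basicOpen_le f')) (f' ^ m), ← pow_succ, hp]
  rw [e]
  exact h1 _ (hf'.trans hg) _ _

variable [Smooth (X ↘ Spec (.of k))] {M N : LineConn k X} {c : k}

/-- By reducedness the first power of `g` already kills the section. -/
theorem smul_eq_zero_of_mres_eq_zero (S : Triv N) (g : Γ(X, S.U.1)) (s : Γ(N.L, S.U.1))
    (h : mres N.L (X.basicOpen_le g) s = 0) : g • s = 0 := by
  obtain ⟨f, rfl⟩ := S.bijective.2 s
  simp only at h ⊢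
  rw [mres_smul k] at h
  have h1 : res k (X.basicOpen_le g) f = 0 :=
    (S.isGenerator _ (X.basicOpen_le g)).1 (h.trans (zero_smul _ _).symm)
  obtain ⟨m, hm⟩ := (res_eq_zero_iff_isLocalization S.isAffineOpen g f).1 h1
  have := smooth_sections (k := k) S.isAffineOpen
  have : IsReduced Γ(X, S.U.1) := isReduced_of_smooth k
  have h2 : g * f = 0 := by
    refine (isNilpotent_iff_eq_zero (x := g * f)).1 ⟨m + 1, ?_⟩
    linear_combination (g * f ^ m) * hm
  rw [smul_smul, h2, zero_smul]

/-- On `X.basicOpen g` the endomorphism is linear over functions, hence multiplication by a function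
`z`, because `N.L` is trivial there. A power of `g ^ p` clears the denominator of `z`, and one more
factor kills the difference, which vanishes on `X.basicOpen g`. -/
theorem PEnd.exists_fn_mul_eq_fn (hU : IsAffineOpen U) {n : ℕ} {g : Γ(X, U)}
    (C : ApproxCoordinates k Γ(X, U) p n g) {e : Γ(N.L, X.basicOpen g)}
    (he : IsGenerator N.L (X.basicOpen g) e) {φ : PEnd k p N.L U}
    (h : ∀ i, Commute φ (PEnd.fn (C.x i))) :
    ∃ (l : ℕ) (a : Γ(X, U)), PEnd.fn ((g ^ p) ^ l) * φ = PEnd.fn a := by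
  have hp : p - 1 + 1 = p := Nat.succ_pred_prime Fact.out
  obtain ⟨z, hz⟩ := (he _ le_rfl).2 (PEnd.app φ (X.basicOpen_le g) e)
  simp only [mres_self] at hz
  obtain ⟨m, a, ha⟩ := exists_res_eq_pow_mul (k := k) hU g z
  refine ⟨m + 1, g ^ p * ((g ^ m) ^ (p - 1) * a), PEnd.ext_triv fun S i f => ?_⟩
  have ha' : res k (X.basicOpen_le g) ((g ^ p) ^ m) * z =
      res k (X.basicOpen_le g) ((g ^ m) ^ (p - 1) * a) := by
    rw [map_mul _ _ a, ← ha, ← mul_assoc, ← map_mul, ← pow_succ, hp, ← pow_mul, ← pow_mul,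
      mul_comm p m]
  let s : Γ(N.L, S.U.1) := f • S.e
  have key : mres N.L (X.basicOpen_le (res k i g)) (res k i ((g ^ p) ^ m) • PEnd.app φ i s -
      res k i ((g ^ m) ^ (p - 1) * a) • s) = 0 := by
    have hD : X.basicOpen (res k i g) ≤ X.basicOpen g := by
      have : X.basicOpen (res k i g) = S.U.1 ⊓ X.basicOpen g := X.basicOpen_res g (homOfLE i).op
      rw [this]; exact inf_le_right
    obtain ⟨b, hb⟩ := (he _ hD).2 (mres N.L (X.basicOpen_le (res k i g)) s)
    simp only at hb
    rw [map_sub, mres_smul k, mres_smul k, ← PEnd.app_mres, ← hb,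
      PEnd.app_smul_of_commute hU C h _ hD, PEnd.app_mres φ (X.basicOpen_le g) hD, ← hz,
      mres_smul k, res_res, res_res, smul_smul, smul_smul, smul_smul, ← res_res k (X.basicOpen_le g) hD ((g ^ p) ^ m),
      ← res_res k (X.basicOpen_le g) hD ((g ^ m) ^ (p - 1) * a), ← ha', map_mul, sub_eq_zero]
    congr 1
    ring
  have h0 := smul_eq_zero_of_mres_eq_zero (k := k) S _ _ key
  have h1 : res k i (g ^ p) • (res k i ((g ^ p) ^ m) • PEnd.app φ i s -
      res k i ((g ^ m) ^ (p - 1) * a) • s) = 0 := by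
    have hg : g ^ p = g ^ (p - 1) * g := by rw [← pow_succ, hp]
    have hg' : res k i (g ^ p) = res k i (g ^ (p - 1)) * res k i g := by rw [hg, map_mul]
    rw [hg', mul_smul, h0, smul_zero]
  rw [PEnd.mul_app, PEnd.fn_app, PEnd.fn_app, ← sub_eq_zero, ← h1, smul_sub, pow_succ',
    map_mul _ (g ^ p), map_mul _ (g ^ p), mul_smul, mul_smul]

variable [IsAlgClosed k]

/-- The central reduction is the algebra of endomorphisms linear over the `p`-th powers. -/
theorem rep_bijective (hc : extCurv p N = c • extCurv p M) (T : Triv M) :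
    Function.Bijective (rep hc T) := by
  have hU := T.isAffineOpen
  have := smooth_sections (k := k) hU
  refine operatorAlgebra_bijective (k := k) (p := p) (fn := RedLocal.fn p c T)
    (vec := RedLocal.vec p c T) (rep hc T) (rep_fn_injective hc T) (fun a φ => ?_) fun q hq => ?_
  · rw [rep_fn]; exact PEnd.fn_pow_commute a φ
  · obtain ⟨n, g, hg, ⟨C⟩⟩ := exists_approxCoordinates (k := k) (p := p) q
    let y : Spec Γ(X, T.U.1) := ⟨q, hq⟩
    have hx : hU.fromSpec y ∈ T.U.1 := by
      have : hU.fromSpec y ∈ (T.U.1 : Set X) := hU.range_fromSpec ▸ ⟨y, rfl⟩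
      exact this
    obtain ⟨S, hxS⟩ := Triv.exists_mem N (hU.fromSpec y)
    -- The additional denominator `h` shrinks the open set to one on which `N.L` is trivial.
    obtain ⟨h, hhS, hxh⟩ := exists_basicOpen_le' hU hx hxS
    have hhq : h ∉ q := by
      have : y ∈ hU.fromSpec ⁻¹ᵁ X.basicOpen h := hxh
      rw [hU.fromSpec_preimage_basicOpen] at this
      exact this
    have hle : X.basicOpen (h * g) ≤ S.U.1 := by
      rw [basicOpen_mul_eq_inf]; exact inf_le_left.trans hhS
    refine ⟨n, h * g, C.mul h, _, fun hm => (hq.mem_or_mem hm).elim hhq hg,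
      redLocal_operatorAlgebra p c T (C.mul h), fun φ hφ => ?_⟩
    simp only [rep_fn] at hφ ⊢
    exact PEnd.exists_fn_mul_eq_fn hU (C.mul h) (S.isGenerator.restrict hle) hφ

end Bijectivity
end
end PCurv

namespace PCurv
noncomputable section

/-! ### The isomorphism over arbitrary open sets -/

section GlobalRepresentation

variable {k : Type u} [Field k] {X : Scheme.{u}} [X.Over (Spec (.of k))]
variable {p : ℕ} {L : X.Modules} {U V : X.Opens}

namespace PEnd

theorem ext_restrict {a b : PEnd k p L U} (h : ∀ x ∈ U, ∃ (V : X.Opens) (i : V ≤ U), x ∈ V ∧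
    restrict i a = restrict i b) : a = b := ext_local fun x hx => by
  obtain ⟨V, i, hxV, h⟩ := h x hx
  exact ⟨V, i, hxV, fun W j s => congrArg (fun φ : PEnd k p L V => PEnd.app φ j s) h⟩

/-- Endomorphisms can be glued. -/
theorem glue {ι : Type u} {V : ι → X.Opens} (hV : ∀ i, V i ≤ U) (hU : ∀ x ∈ U, ∃ i, x ∈ V i)
    (φ : ∀ i, PEnd k p L (V i)) (h : ∀ i j (W : X.Opens) (hi : W ≤ V i) (hj : W ≤ V j),
      restrict hi (φ i) = restrict hj (φ j)) : ∃ ψ : PEnd k p L U, ∀ i, restrict (hV i) ψ = φ i := by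
  have hcov : ∀ {W : X.Opens} (_ : W ≤ U), ∀ x ∈ W, ∃ i, x ∈ W ⊓ V i := fun hW x hx =>
    (hU x (hW hx)).imp fun i hi => ⟨hx, hi⟩
  have key : ∀ (W : X.Opens) (_ : W ≤ U) (s : Γ(L, W)), ∃ t : Γ(L, W), ∀ i,
      mres L inf_le_left t = PEnd.app (φ i) inf_le_right
        (mres L (inf_le_left : W ⊓ V i ≤ W) s) := fun W hW s =>
    mres_glue L (V := fun i => W ⊓ V i) (fun i => inf_le_left) (hcov hW)
      (fun i => PEnd.app (φ i) inf_le_right (mres L inf_le_left s)) fun i j W' hi hj => by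
        rw [← app_mres, ← app_mres, mres_mres, mres_mres]
        exact congrArg (fun a : PEnd k p L W' => PEnd.app a le_rfl (mres L (hi.trans inf_le_left) s))
          (h i j W' (hi.trans inf_le_right) (hj.trans inf_le_right))
  choose F hF using key
  have hext : ∀ {W : X.Opens} (_ : W ≤ U) {s t : Γ(L, W)}, (∀ i,
      mres L (inf_le_left : W ⊓ V i ≤ W) s = mres L (inf_le_left : W ⊓ V i ≤ W) t) → s = t :=
    fun hW _ _ h => mres_ext L (V := fun i => _ ⊓ V i) (fun i => inf_le_left) (hcov hW) h
  have hF' : ∀ {W W' : X.Opens} (hW : W ≤ U) (hW' : W' ≤ W) (s : Γ(L, W)) (i : ι)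
      (hi : W' ≤ V i), mres L hW' (F W hW s) = PEnd.app (φ i) hi (mres L hW' s) := by
    intro W W' hW hW' s i hi
    have := congrArg (mres L (le_inf hW' hi)) (hF W hW s i)
    rwa [mres_mres, ← app_mres, mres_mres] at this
  refine ⟨⟨fun W => AddMonoidHom.mk' (F W.1 W.2) fun s t => hext W.2 fun i => ?_, ?_, ?_⟩, ?_⟩
  · rw [map_add, hF, hF, hF, map_add, map_add]
  · intro W W' i s
    refine hext W'.2 fun j => ?_
    change mres L _ (F W'.1 W'.2 (mres L i s)) = mres L _ (mres L i (F W.1 W.2 s))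
    rw [hF, mres_mres, mres_mres, hF' W.2 _ s j inf_le_right]
  · intro W f s
    refine hext W.2 fun j => ?_
    change mres L _ (F W.1 W.2 (f ^ p • s)) = mres L _ (f ^ p • F W.1 W.2 s)
    rw [hF, mres_smul k, mres_smul k, hF, map_pow, app_pow_smul]
  · intro i
    refine ext fun W hW s => ?_
    change F W _ s = _
    have := hF' (hW.trans (hV i)) le_rfl s i hW
    rwa [mres_self, mres_self] at this

end PEnd

theorem exists_triv_le (M : LineConn k X) {x : X} (hx : x ∈ U) :
    ∃ T : Triv M, x ∈ T.U.1 ∧ T.U.1 ≤ U := by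
  obtain ⟨T, hT⟩ := Triv.exists_mem M x
  obtain ⟨V, hxV, hV⟩ := exists_affine_le (show x ∈ T.U.1 ⊓ U from ⟨hT, hx⟩)
  exact ⟨T.restrict V (hV.trans inf_le_left), hxV, hV.trans inf_le_right⟩

variable [Fact p.Prime] [CharP k p] [IsAlgClosed k]
variable {M N : LineConn k X} {c : k}

theorem rep_apply_restrict (hc : extCurv p N = c • extCurv p M) (a : Red p M c U)
    (T T' : {T : Triv M // T.U.1 ≤ U}) (i : T'.1.U.1 ≤ T.1.U.1) :
    rep hc T'.1 (a.1 T') = PEnd.restrict i (rep hc T.1 (a.1 T)) := by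
  obtain ⟨h, he⟩ := T.1.exists_unit T'.1 i
  rw [Red.apply_eq_glue p c a T T' i h he, rep_glue]

variable [Smooth (X ↘ Spec (.of k))]

/-- The representation as an isomorphism, in a trivialization -/
def repEquiv (hc : extCurv p N = c • extCurv p M) (T : Triv M) :
    RedLocal p c T ≃+* PEnd k p N.L T.U.1 := RingEquiv.ofBijective (rep hc T) (rep_bijective hc T)

/-- The ring homomorphism from the endomorphisms to the sections of the central reduction -/
def toRed (hc : extCurv p N = c • extCurv p M) (U : X.Opens) : PEnd k p N.L U →+* Red p M c U :=
  RingHom.codRestrict (RingHom.pi fun T =>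
      ((repEquiv hc T.1).symm : PEnd k p N.L T.1.U.1 →+* RedLocal p c T.1).comp
        (PEnd.restrict T.2)) (Red p M c U) fun a T T' i h he => by
    obtain ⟨d, hd⟩ := RedLocal.mk_surjective p c T.1 ((repEquiv hc T.1).symm (PEnd.restrict T.2 a))
    refine ⟨d, hd.symm, (rep_bijective hc T'.1).1 ?_⟩
    rw [← RedLocal.glue_mk p c T.1 T'.1 i h he, rep_glue, hd]
    change repEquiv hc T'.1 ((repEquiv hc T'.1).symm _) =
      PEnd.restrict i (repEquiv hc T.1 ((repEquiv hc T.1).symm _))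
    rw [RingEquiv.apply_symm_apply, RingEquiv.apply_symm_apply]
    rfl

theorem rep_toRed (hc : extCurv p N = c • extCurv p M) (φ : PEnd k p N.L U)
    (T : {T : Triv M // T.U.1 ≤ U}) : rep hc T.1 ((toRed hc U φ).1 T) = PEnd.restrict T.2 φ :=
  (repEquiv hc T.1).apply_symm_apply _

theorem Red.ext_rep (hc : extCurv p N = c • extCurv p M) {a b : Red p M c U}
    (h : ∀ T, rep hc T.1 (a.1 T) = rep hc T.1 (b.1 T)) : a = b :=
  Subtype.ext (funext fun T => (rep_bijective hc T.1).1 (h T))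

theorem toRed_bijective (hc : extCurv p N = c • extCurv p M) (U : X.Opens) :
    Function.Bijective (toRed hc U) := by
  refine ⟨fun φ ψ h => PEnd.ext_restrict fun x hx => ?_, fun a => ?_⟩
  · obtain ⟨T, hxT, hT⟩ := exists_triv_le M hx
    refine ⟨T.U.1, hT, hxT, ?_⟩
    rw [← rep_toRed hc φ ⟨T, hT⟩, ← rep_toRed hc ψ ⟨T, hT⟩, h]
  · obtain ⟨φ, hφ⟩ := PEnd.glue (U := U) (V := fun T : {T : Triv M // T.U.1 ≤ U} => T.1.U.1)
      (fun T => T.2) (fun x hx => by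
        obtain ⟨T, hxT, hT⟩ := exists_triv_le M hx
        exact ⟨⟨T, hT⟩, hxT⟩) (fun T => rep hc T.1 (a.1 T)) fun T T' W hT hT' => by
          refine PEnd.ext_restrict fun x hx => ?_
          obtain ⟨V, hxV, hV⟩ := exists_affine_le hx
          refine ⟨V, hV, hxV, ?_⟩
          let T'' : {T : Triv M // T.U.1 ≤ U} :=
            ⟨T.1.restrict V (hV.trans hT), (hV.trans hT).trans T.2⟩
          have h1 := rep_apply_restrict hc a T T'' (hV.trans hT)
          have h2 := rep_apply_restrict hc a T' T'' (hV.trans hT')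
          exact h1.symm.trans h2
    exact ⟨φ, Red.ext_rep hc fun T => (rep_toRed hc φ T).trans (hφ T)⟩

/-- The central reduction is the sheaf of endomorphisms of `L'` linear over `p`-th powers. -/
def redEquiv (hc : extCurv p N = c • extCurv p M) (U : X.Opens) :
    Red p M c U ≃+* PEnd k p N.L U := (RingEquiv.ofBijective (toRed hc U) (toRed_bijective hc U)).symm

theorem redEquiv_eq_iff (hc : extCurv p N = c • extCurv p M) (a : Red p M c U)
    (φ : PEnd k p N.L U) :
    redEquiv hc U a = φ ↔ ∀ T, rep hc T.1 (a.1 T) = PEnd.restrict T.2 φ := by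
  rw [redEquiv, RingEquiv.symm_apply_eq]
  refine ⟨fun h T => ?_, fun h => Red.ext_rep hc fun T => (h T).trans (rep_toRed hc φ T).symm⟩
  rw [h]
  exact rep_toRed hc φ T

theorem redEquiv_fn (hc : extCurv p N = c • extCurv p M) (f : Γ(X, U)) :
    redEquiv hc U (Red.fn p c M f) = PEnd.fn f := by
  rw [redEquiv_eq_iff]
  intro T
  rw [Red.fn_apply, rep_fn, PEnd.restrict_fn]

theorem redEquiv_vec (hc : extCurv p N = c • extCurv p M) (ξ : Vect k U) :
    redEquiv hc U (Red.vec p c M ξ) = PEnd.vec N ξ := by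
  rw [redEquiv_eq_iff]
  intro T
  rw [Red.vec_apply, PEnd.restrict_vec]
  have h := (map_add (rep hc T.1) (RedLocal.vec p c T.1 (ξ.restrict T.2))
    (RedLocal.fn p c T.1 (c • (ξ.restrict T.2).pair T.1.form)))
  rw [rep_fn, rep_vec, repVec, sub_add_cancel] at h
  exact h

theorem redEquiv_restrict (hc : extCurv p N = c • extCurv p M) (i : V ≤ U) (a : Red p M c U) :
    redEquiv hc V (Red.restrict p M c i a) = PEnd.restrict i (redEquiv hc U a) := by
  rw [redEquiv_eq_iff]
  intro T
  exact (redEquiv_eq_iff hc a _).1 rfl ⟨T.1, T.2.trans i⟩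

end GlobalRepresentation
end
end PCurv

namespace PCurv
noncomputable section

/-! ### Relative Frobenius over an algebraically closed field -/

section RelativeFrobenius

variable (X : Scheme.{u}) (k : Type u) [Field k] [X.Over (Spec (.of k))]

variable {X} in
theorem eq_zero_of_pow_eq_zero [Smooth (X ↘ Spec (.of k))] (p : ℕ) {V : X.Opens} {h : Γ(X, V)}
    (hp : h ^ p = 0) : h = 0 := res_ext_affine k fun x hx => by
  obtain ⟨W, hxW, hW⟩ := exists_affine_le hx
  refine ⟨W, hW, hxW, ?_⟩
  have := smooth_sections (k := k) W.2
  have : IsReduced Γ(X, W.1) := isReduced_of_smooth k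
  rw [map_zero]
  exact (isNilpotent_iff_eq_zero (x := res k hW h)).1 ⟨p, by rw [← map_pow, hp, map_zero]⟩

variable (p : ℕ) [Fact p.Prime] [CharP k p]

/-- The projection of the Frobenius twist -/
def twistProj : frobTwist X k p ⟶ X :=
  Limits.pullback.fst (X ↘ Spec (.of k)) (absFrob (spec_cast_eq_zero (k := k) p))

theorem relFrob_comp_twistProj : relFrob X k p ≫ twistProj X k p =
    absFrob (over_cast_eq_zero (X ↘ Spec (.of k)) p) := Limits.pullback.lift_fst _ _ _

variable {X} in
theorem preimage_twistProj (V : X.Opens) : relFrob X k p ⁻¹ᵁ twistProj X k p ⁻¹ᵁ V = V := by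
  have : relFrob X k p ⁻¹ᵁ twistProj X k p ⁻¹ᵁ V = (relFrob X k p ≫ twistProj X k p) ⁻¹ᵁ V := rfl
  rw [this, relFrob_comp_twistProj]
  rfl

variable {X} in
theorem relFrob_app_twistProj_app (V : X.Opens) (h : Γ(X, V)) :
    (relFrob X k p).app (twistProj X k p ⁻¹ᵁ V) ((twistProj X k p).app V h) =
      res k (preimage_twistProj k p V).le h ^ p := by
  have e := Scheme.Hom.congr_app (relFrob_comp_twistProj X k p) V
  have h1 := congr($e h)
  rw [Scheme.Hom.comp_app] at h1
  refine h1.trans ?_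
  rw [← map_pow]
  rfl

variable [IsAlgClosed k]

theorem bijective_pow : Function.Bijective fun a : k => a ^ p :=
  ⟨frobenius_inj k p, fun a => IsAlgClosed.exists_pow_nat_eq a (Fact.out : p.Prime).pos⟩

/-- `k` is perfect. By base change `twistProj` is an isomorphism of schemes, so open sets and
functions on `X⁽¹⁾` can be replaced by those of `X`. -/
theorem isIso_absFrob_spec : IsIso (absFrob (spec_cast_eq_zero (k := k) p)) := by
  let f := absFrob (spec_cast_eq_zero (k := k) p)
  have h1 : IsIso f.appTop := by
    rw [ConcreteCategory.isIso_iff_bijective]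
    let e := (Scheme.ΓSpecIso (.of k)).commRingCatIsoToRingEquiv
    have : ⇑f.appTop.hom = e.symm ∘ (fun a : k => a ^ p) ∘ e := by
      ext a
      refine e.injective ?_
      change e (a ^ p) = e (e.symm (e a ^ p))
      rw [map_pow, RingEquiv.apply_symm_apply]
    change Function.Bijective f.appTop.hom
    rw [this]
    exact e.symm.bijective.comp ((bijective_pow k p).comp e.bijective)
  have h2 : f = (Spec (.of k)).isoSpec.hom ≫ Spec.map f.appTop ≫ (Spec (.of k)).isoSpec.inv := by
    rw [Scheme.isoSpec_inv_naturality f, Iso.hom_inv_id_assoc]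
  change IsIso f
  rw [h2]
  infer_instance

instance : IsIso (twistProj X k p) := by
  have := isIso_absFrob_spec k p
  exact inferInstanceAs (IsIso (Limits.pullback.fst _ _))

variable {X}

theorem preimage_relFrob (U : (frobTwist X k p).Opens) :
    twistProj X k p ⁻¹ᵁ relFrob X k p ⁻¹ᵁ U = U := by
  have h : U = twistProj X k p ⁻¹ᵁ (inv (twistProj X k p)) ⁻¹ᵁ U := by
    have : twistProj X k p ⁻¹ᵁ (inv (twistProj X k p)) ⁻¹ᵁ U =
      (twistProj X k p ≫ inv (twistProj X k p)) ⁻¹ᵁ U := rfl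
    rw [this, IsIso.hom_inv_id]; rfl
  rw [h, preimage_twistProj]

/-- Under `twistProj` functions on `X⁽¹⁾` correspond to functions on `X`, and the comorphism of the
relative Frobenius becomes `h ↦ h ^ p`. -/
theorem exists_relFrob_app_eq (U : (frobTwist X k p).Opens) (f : Γ(X, relFrob X k p ⁻¹ᵁ U)) :
    ∃ g : Γ(frobTwist X k p, U), (relFrob X k p).app U g = f ^ p := by
  obtain ⟨V, rfl⟩ : ∃ V, U = twistProj X k p ⁻¹ᵁ V := ⟨_, (preimage_relFrob k p U).symm⟩
  refine ⟨(twistProj X k p).app V (res k (preimage_twistProj k p V).ge f), ?_⟩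
  rw [relFrob_app_twistProj_app, res_res, res_self]

theorem exists_relFrob_app_eq_pow (U : (frobTwist X k p).Opens) (g : Γ(frobTwist X k p, U)) :
    ∃ f : Γ(X, relFrob X k p ⁻¹ᵁ U), (relFrob X k p).app U g = f ^ p := by
  obtain ⟨V, rfl⟩ : ∃ V, U = twistProj X k p ⁻¹ᵁ V := ⟨_, (preimage_relFrob k p U).symm⟩
  obtain ⟨h, rfl⟩ := (ConcreteCategory.bijective_of_isIso ((twistProj X k p).app V)).2 g
  exact ⟨_, relFrob_app_twistProj_app k p V h⟩

theorem relFrob_app_injective [Smooth (X ↘ Spec (.of k))] (U : (frobTwist X k p).Opens) :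
    Function.Injective ((relFrob X k p).app U) := by
  obtain ⟨V, rfl⟩ : ∃ V, U = twistProj X k p ⁻¹ᵁ V := ⟨_, (preimage_relFrob k p U).symm⟩
  refine (injective_iff_map_eq_zero ((relFrob X k p).app (twistProj X k p ⁻¹ᵁ V)).hom).2
    fun g hg => ?_
  obtain ⟨h, rfl⟩ := (ConcreteCategory.bijective_of_isIso ((twistProj X k p).app V)).2 g
  have h1 : res k (preimage_twistProj k p V).le h = 0 :=
    eq_zero_of_pow_eq_zero k p ((relFrob_app_twistProj_app k p V h).symm.trans hg)
  have h2 := congrArg (res k (preimage_twistProj k p V).ge) h1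
  rw [res_res, res_self, map_zero] at h2
  rw [h2]
  exact map_zero ((twistProj X k p).app V).hom

end RelativeFrobenius
-- The Frobenius direct image of a line bundle is a vector bundle
section DirectImage

variable {X : Scheme.{u}} {k : Type u} [Field k] [X.Over (Spec (.of k))]
variable {p : ℕ} [Fact p.Prime] [CharP k p]

/-- The sum `∑ c_I ^ p x ^ I` of the monomials in coordinates -/
def monomialSum (p : ℕ) [Fact p.Prime] [CharP k p] {V : X.Opens} {n : ℕ} (x : Fin n → Γ(X, V)) :
    ((Fin n → Fin p) → Γ(X, V)) →+ Γ(X, V) where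
  toFun c := ∑ I, c I ^ p * ∏ i, x i ^ (I i : ℕ)
  map_zero' := by simp [(Fact.out : p.Prime).ne_zero]
  map_add' c c' := by
    rw [← Finset.sum_add_distrib]
    exact Finset.sum_congr rfl fun I _ => by
      rw [Pi.add_apply, add_pow_of_cast_eq_zero (cast_eq_zero_of_charP k _ p), add_mul]

theorem monomialSum_apply {V : X.Opens} {n : ℕ} (x : Fin n → Γ(X, V)) (c : (Fin n → Fin p) → Γ(X, V)) :
    monomialSum (k := k) p x c = ∑ I, c I ^ p * ∏ i, x i ^ (I i : ℕ) := rfl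

theorem res_monomialSum {V W : X.Opens} (i : W ≤ V) {n : ℕ} (x : Fin n → Γ(X, V))
    (c : (Fin n → Fin p) → Γ(X, V)) : res k i (monomialSum (k := k) p x c) =
      monomialSum (k := k) p (fun j => res k i (x j)) fun I => res k i (c I) := by
  simp [monomialSum_apply]

theorem pow_mul_monomialSum {V : X.Opens} {n : ℕ} (x : Fin n → Γ(X, V)) (f : Γ(X, V))
    (c : (Fin n → Fin p) → Γ(X, V)) :
    f ^ p * monomialSum (k := k) p x c = monomialSum (k := k) p x fun I => f * c I := by
  simp [monomialSum_apply, Finset.mul_sum, mul_pow, mul_assoc]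

variable [IsAlgClosed k] [Smooth (X ↘ Spec (.of k))]

/-- The `p`-basis survives localization because denominators can be raised to `p`-th powers, which
pass through the sum into the coefficients. -/
theorem monomialSum_bijective_basicOpen {V : X.Opens} (hV : IsAffineOpen V) {n : ℕ}
    (C : Coordinates k Γ(X, V) n) (f : Γ(X, V)) :
    Function.Bijective (monomialSum (k := k) p fun j => res k (X.basicOpen_le f) (C.x j)) := by
  have := smooth_sections (k := k) hV
  have : IsReduced Γ(X, V) := isReduced_of_smooth k
  have hC : Function.Bijective (monomialSum (k := k) p C.x) :=
    C.monomialSum_bijective (p := p)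
  have hu := isUnit_res_basicOpen (k := k) f
  constructor
  · rw [injective_iff_map_eq_zero]
    intro c hc
    choose m a ha using fun I => exists_res_eq_pow_mul (k := k) hV f (c I)
    let l := ∑ I, m I
    have hl : ∀ I, ∃ a, res k (X.basicOpen_le f) (f ^ l) * c I = res k (X.basicOpen_le f) a := by
      intro I
      refine ⟨f ^ (l - m I) * a I, ?_⟩
      rw [map_mul, ← ha, ← mul_assoc, ← map_mul, ← pow_add,
        Nat.sub_add_cancel (Finset.single_le_sum (fun _ _ => Nat.zero_le _) (Finset.mem_univ I))]
    choose b hb using hl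
    have h1 : res k (X.basicOpen_le f) (monomialSum (k := k) p C.x b) = 0 := by
      rw [res_monomialSum]
      simp only [← hb]
      rw [← pow_mul_monomialSum, hc, mul_zero]
    obtain ⟨r, hr⟩ := (res_eq_zero_iff_isLocalization hV f _).1 h1
    have h2 : monomialSum (k := k) p C.x (fun I => f ^ r * b I) = 0 := by
      have hp : p - 1 + 1 = p := Nat.succ_pred_prime Fact.out
      rw [← pow_mul_monomialSum, show (f ^ r) ^ p = (f ^ r) ^ (p - 1) * f ^ r by
        rw [← pow_succ, hp], mul_assoc, hr, mul_zero]
    have h3 := (injective_iff_map_eq_zero _).1 hC.1 _ h2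
    funext I
    have h4 : res k (X.basicOpen_le f) (f ^ r * b I) = 0 := by
      rw [show f ^ r * b I = 0 from congrFun h3 I, map_zero]
    rw [map_mul, ← hb, map_pow, map_pow] at h4
    exact ((hu.pow r).mul_right_eq_zero.1 h4 |> (hu.pow l).mul_right_eq_zero.1)
  · intro z
    obtain ⟨m, a, ha⟩ := exists_res_eq_pow_mul (k := k) hV f z
    obtain ⟨c, hc⟩ := hC.2 ((f ^ m) ^ (p - 1) * a)
    obtain ⟨v, hv⟩ := hu.pow m
    refine ⟨fun I => ↑v⁻¹ * res k (X.basicOpen_le f) (c I), ?_⟩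
    have hp : p - 1 + 1 = p := Nat.succ_pred_prime Fact.out
    rw [← pow_mul_monomialSum, ← res_monomialSum, hc, map_mul, ← ha, map_pow, map_pow, ← hv,
      ← mul_assoc, ← mul_assoc, mul_assoc _ _ (v : Γ(X, X.basicOpen f)), ← pow_succ, hp, ← mul_pow]
    simp

/-- Over basic open sets the coefficients exist and are unique, so they glue over any open subset.
-/
theorem monomialSum_bijective {V W : X.Opens} (hV : IsAffineOpen V) {n : ℕ}
    (C : Coordinates k Γ(X, V) n) (i : W ≤ V) :
    Function.Bijective (monomialSum (k := k) p fun j => res k i (C.x j)) := by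
  have hinj : ∀ {W : X.Opens} (i : W ≤ V),
      Function.Injective (monomialSum (k := k) p fun j => res k i (C.x j)) := by
    intro W i
    rw [injective_iff_map_eq_zero]
    intro c hc
    funext I
    refine res_ext_affine k fun x hx => ?_
    obtain ⟨f, hf, hxf⟩ := exists_basicOpen_le' hV (i hx) hx
    refine ⟨⟨_, hV.basicOpen f⟩, hf, hxf, ?_⟩
    have h1 := congrArg (res k hf) hc
    rw [res_monomialSum, map_zero] at h1
    simp only [res_res] at h1
    have h2 := (injective_iff_map_eq_zero _).1 (monomialSum_bijective_basicOpen hV C f).1 _ h1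
    exact (congrFun h2 I).trans (map_zero _).symm
  refine ⟨hinj i, fun z => ?_⟩
  choose f hf hxf using fun x : W => exists_basicOpen_le' hV (i x.2) x.2
  choose c hc using fun x : W => (monomialSum_bijective_basicOpen (p := p) hV C (f x)).2
    (res k (hf x) z)
  have hglue : ∀ I, ∃ t : Γ(X, W), ∀ x, res k (hf x) t = c x I := fun I =>
    res_glue k hf (fun x hx => ⟨⟨x, hx⟩, hxf ⟨x, hx⟩⟩) (fun x => c x I) fun x y W' hx hy => by
      refine congrFun (hinj (hx.trans (X.basicOpen_le _))
        (a₁ := fun I => res k hx (c x I)) (a₂ := fun I => res k hy (c y I)) ?_) I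
      have h1 := congrArg (res k hx) (hc x)
      have h2 := congrArg (res k hy) (hc y)
      rw [res_monomialSum, res_res] at h1 h2
      simp only [res_res] at h1 h2
      rw [h1, h2]
  choose t ht using hglue
  refine ⟨t, res_ext k hf (fun x hx => ⟨⟨x, hx⟩, hxf ⟨x, hx⟩⟩) fun x => ?_⟩
  rw [res_monomialSum, ← hc x]
  simp only [res_res, ht]

/-- For a local generator `e` the `p ^ n` sections `x ^ I e` with exponents below `p` are a frame,
since the functions coming from `X⁽¹⁾` are the `p`-th powers. -/
theorem isVectorBundle_pushforward (N : LineConn k X) :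
    IsVectorBundle ((Scheme.Modules.pushforward (relFrob X k p)).obj N.L) := by
  intro y
  let x := twistProj X k p y
  obtain ⟨T, hT⟩ := Triv.exists_mem N x
  obtain ⟨V, n, hxV, hVT, ⟨C⟩⟩ := exists_coordinates_nhd (k := k) hT
  let e : Γ(N.L, V.1) := mres N.L hVT T.e
  have he : IsGenerator N.L V.1 e := T.isGenerator.restrict hVT
  let ι := Fin n → Fin p
  let σ : Fin (Fintype.card ι) ≃ ι := (Fintype.equivFin ι).symm
  let U := twistProj X k p ⁻¹ᵁ V.1
  let hU : relFrob X k p ⁻¹ᵁ U ≤ V.1 := (preimage_twistProj k p V.1).le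
  refine ⟨U, Fintype.card ι, fun j => mres N.L hU ((∏ i, C.x i ^ (σ j i : ℕ)) • e), hxV, ?_⟩
  intro W hW
  let hW' : relFrob X k p ⁻¹ᵁ W ≤ V.1 := ((relFrob X k p).preimage_mono hW).trans hU
  have hbij := monomialSum_bijective (p := p) V.2 C hW'
  have hsum : ∀ (g : Fin (Fintype.card ι) → Γ(frobTwist X k p, W))
      (c : ι → Γ(X, relFrob X k p ⁻¹ᵁ W)) (_ : ∀ j, (relFrob X k p).app W (g j) = c (σ j) ^ p),
      (∑ j, g j • mres ((Scheme.Modules.pushforward (relFrob X k p)).obj N.L) hW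
        (mres N.L hU ((∏ i, C.x i ^ (σ j i : ℕ)) • e)) : Γ(N.L, relFrob X k p ⁻¹ᵁ W)) =
      monomialSum (k := k) p (fun j => res k hW' (C.x j)) c • mres N.L hW' e := by
    intro g c hc
    rw [monomialSum_apply, Finset.sum_smul, ← σ.sum_comp]
    refine Finset.sum_congr rfl fun j _ => ?_
    change (relFrob X k p).app W (g j) • mres N.L ((relFrob X k p).preimage_mono hW)
      (mres N.L hU ((∏ i, C.x i ^ (σ j i : ℕ)) • e)) = _
    rw [hc, mres_mres, mres_smul k, smul_smul, map_prod]
    simp only [map_pow]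
  constructor
  · let Φ : (Fin (Fintype.card ι) → Γ(frobTwist X k p, W)) →+
        Γ((Scheme.Modules.pushforward (relFrob X k p)).obj N.L, W) :=
      AddMonoidHom.mk' (fun g => ∑ j, g j • mres _ hW
        (mres N.L hU ((∏ i, C.x i ^ (σ j i : ℕ)) • e))) fun g g' => by
          simp only [Pi.add_apply, add_smul, Finset.sum_add_distrib]
    refine (injective_iff_map_eq_zero Φ).2 fun g hg => ?_
    choose c hc using fun j => exists_relFrob_app_eq_pow k p W (g (σ.symm j))
    have h1 := hsum g c fun j => by rw [← hc, Equiv.symm_apply_apply]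
    have h2 : monomialSum (k := k) p (fun j => res k hW' (C.x j)) c = 0 :=
      (he _ hW').1 ((h1.symm.trans hg).trans (zero_smul Γ(X, relFrob X k p ⁻¹ᵁ W)
        (mres N.L hW' e)).symm)
    have h3 := (injective_iff_map_eq_zero _).1 hbij.1 c h2
    funext j
    refine (injective_iff_map_eq_zero ((relFrob X k p).app W).hom).1
      (relFrob_app_injective k p W) _ ?_
    have h4 := hc (σ j)
    rw [Equiv.symm_apply_apply, congrFun h3 (σ j)] at h4
    exact h4.trans (zero_pow (Fact.out : p.Prime).ne_zero)
  · intro s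
    obtain ⟨z, hz⟩ := (he _ hW').2 s
    obtain ⟨c, hc⟩ := hbij.2 z
    choose g hg using fun I => exists_relFrob_app_eq k p W (c I)
    refine ⟨fun j => g (σ j), (hsum (fun j => g (σ j)) c fun j => hg (σ j)).trans ?_⟩
    rw [hc]
    exact hz

end DirectImage
end
end PCurv

namespace PCurv
noncomputable section

/-! ### From a line bundle with connection to a splitting -/

section SplittingOfLineConn

variable {X : Scheme.{u}} {k : Type u} [Field k] [X.Over (Spec (.of k))]
variable {p : ℕ} [Fact p.Prime] [CharP k p] [IsAlgClosed k]

/-- Endomorphisms of `L` linear over `p`-th powers, as endomorphisms of the direct image -/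
def PEnd.toEndSec (L : X.Modules) (U : (frobTwist X k p).Opens) :
    PEnd k p L (relFrob X k p ⁻¹ᵁ U) →+*
      EndSec ((Scheme.Modules.pushforward (relFrob X k p)).obj L) U where
  toFun a := ⟨fun V =>
    { toFun := fun s => PEnd.app a ((relFrob X k p).preimage_mono V.2) s
      map_add' := fun s t => map_add (PEnd.app a ((relFrob X k p).preimage_mono V.2)) s t
      map_smul' := fun g s => by
        obtain ⟨f, hf⟩ := exists_relFrob_app_eq_pow k p V.1 g
        change PEnd.app a _ ((relFrob X k p).app V.1 g • (show Γ(L, relFrob X k p ⁻¹ᵁ V.1) from s)) =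
          (relFrob X k p).app V.1 g • PEnd.app a _ _
        rw [hf, PEnd.app_pow_smul] },
    fun V W i s => PEnd.app_mres a ((relFrob X k p).preimage_mono V.2)
      ((relFrob X k p).preimage_mono i) s⟩
  map_zero' := rfl
  map_one' := rfl
  map_add' _ _ := rfl
  map_mul' _ _ := rfl

/-- Open sets of `X` and `X⁽¹⁾` correspond, and linearity over functions on `X⁽¹⁾` is linearity over
`p`-th powers. Restriction maps between equal open sets carry out the transport. -/
theorem PEnd.toEndSec_bijective (L : X.Modules) (U : (frobTwist X k p).Opens) :
    Function.Bijective (PEnd.toEndSec (k := k) L U) := by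
  constructor
  · intro a b h
    refine PEnd.ext fun V i s => ?_
    obtain ⟨W, rfl⟩ : ∃ W, V = relFrob X k p ⁻¹ᵁ W := ⟨_, (preimage_twistProj k p V).symm⟩
    have hW : W ≤ U := by
      rw [← preimage_relFrob k p W, ← preimage_relFrob k p U]
      exact (twistProj X k p).preimage_mono i
    have h1 := congrArg (fun c : EndSec _ U => c.1 ⟨W, hW⟩ s) h
    exact h1
  · intro a
    let τ := fun V : X.Opens => twistProj X k p ⁻¹ᵁ V
    have hτ : ∀ V, relFrob X k p ⁻¹ᵁ τ V = V := fun V => preimage_twistProj k p V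
    have hτU : ∀ {V}, V ≤ relFrob X k p ⁻¹ᵁ U → τ V ≤ U := fun {V} h => by
      rw [← preimage_relFrob k p U]; exact (twistProj X k p).preimage_mono h
    let φ (V : X.Opens) (h : V ≤ relFrob X k p ⁻¹ᵁ U) : Γ(L, V) →+ Γ(L, V) :=
      (mres L (hτ V).ge).comp (((a.1 ⟨τ V, hτU h⟩).toAddMonoidHom :
        Γ(L, relFrob X k p ⁻¹ᵁ τ V) →+ Γ(L, relFrob X k p ⁻¹ᵁ τ V)).comp (mres L (hτ V).le))
    have hφ : ∀ (W : (frobTwist X k p).Opens) (h : W ≤ U) (s : Γ(L, relFrob X k p ⁻¹ᵁ W)),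
        φ _ ((relFrob X k p).preimage_mono h) s = a.1 ⟨W, h⟩ s := by
      intro W h s
      have e : τ (relFrob X k p ⁻¹ᵁ W) = W := preimage_relFrob k p W
      have h1 := a.2 ⟨W, h⟩ ⟨_, hτU ((relFrob X k p).preimage_mono h)⟩ e.le s
      refine (congrArg (mres L (hτ _).ge) h1).trans ?_
      refine (mres_mres L _ _ _).trans ?_
      exact mres_self L _
    refine ⟨⟨fun V => φ V.1 V.2, ?_, ?_⟩, Subtype.ext (funext fun W => LinearMap.ext fun s =>
      hφ W.1 W.2 s)⟩
    · rintro ⟨V, hV⟩ ⟨W, hW⟩ i s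
      obtain ⟨V, rfl⟩ : ∃ V', V = relFrob X k p ⁻¹ᵁ V' := ⟨_, (hτ V).symm⟩
      obtain ⟨W, rfl⟩ : ∃ W', W = relFrob X k p ⁻¹ᵁ W' := ⟨_, (hτ W).symm⟩
      have hV' : V ≤ U := by
        rw [← preimage_relFrob k p V]; exact hτU hV
      have hW' : W ≤ U := by
        rw [← preimage_relFrob k p W]; exact hτU hW
      have i' : W ≤ V := by
        rw [← preimage_relFrob k p V, ← preimage_relFrob k p W]
        exact (twistProj X k p).preimage_mono i
      refine (hφ W hW' _).trans (.trans ?_ (congrArg (mres L i) (hφ V hV' s)).symm)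
      exact a.2 ⟨V, hV'⟩ ⟨W, hW'⟩ i' s
    · rintro ⟨V, hV⟩ f s
      obtain ⟨V, rfl⟩ : ∃ V', V = relFrob X k p ⁻¹ᵁ V' := ⟨_, (hτ V).symm⟩
      have hV' : V ≤ U := by
        rw [← preimage_relFrob k p V]; exact hτU hV
      obtain ⟨g, hg⟩ := exists_relFrob_app_eq k p V f
      refine (hφ V hV' _).trans (.trans ?_ (congrArg (f ^ p • ·) (hφ V hV' s)).symm)
      simp only [← hg]
      exact (a.1 ⟨V, hV'⟩).map_smul g s

variable [Smooth (X ↘ Spec (.of k))] {M : LineConn k X} {c : k}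

/-- The splitting given by a line bundle with connection -/
def splittingOfLineConn (N : LineConn k X) (hc : extCurv p N = c • extCurv p M) :
    Splitting p M c where
  E := (Scheme.Modules.pushforward (relFrob X k p)).obj N.L
  isVectorBundle := isVectorBundle_pushforward N
  toEnd U := (redEquiv hc _).trans
    (RingEquiv.ofBijective (PEnd.toEndSec N.L U) (PEnd.toEndSec_bijective N.L U))
  toEnd_res i a := by
    change PEnd.toEndSec N.L _ (redEquiv hc _ _) = _
    rw [redEquiv_restrict]
    rfl
  toEnd_scalar U f s := by
    change PEnd.app (redEquiv hc _ (Red.fn p c M ((relFrob X k p).app U f))) le_rfl _ = _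
    rw [redEquiv_fn]
    exact congrArg (fun g : Γ(X, relFrob X k p ⁻¹ᵁ U) =>
      g • (show Γ(N.L, relFrob X k p ⁻¹ᵁ U) from s)) (res_self k _)

theorem splittingOfLineConn_act (N : LineConn k X) (hc : extCurv p N = c • extCurv p M)
    (U : (frobTwist X k p).Opens) (a : Red p M c (relFrob X k p ⁻¹ᵁ U))
    (s : Γ(N.L, relFrob X k p ⁻¹ᵁ U)) :
    EndSec.act ((splittingOfLineConn N hc).toEnd U a) s = PEnd.app (redEquiv hc _ a) le_rfl s := rfl

end SplittingOfLineConn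
end
end PCurv

namespace PCurv
noncomputable section

/-! ### The splitting bundle as a module over functions on `X` -/

section BundleOfSplitting

/-- The action of the sections of `End(E)` on sections of `E`, as a ring homomorphism -/
def EndSec.actHom {Y : Scheme.{u}} (E : Y.Modules) (U : Y.Opens) :
    EndSec E U →+* AddMonoid.End Γ(E, U) where
  toFun a := (EndSec.act a).toAddMonoidHom
  map_zero' := rfl
  map_one' := rfl
  map_add' _ _ := rfl
  map_mul' _ _ := rfl

variable {X : Scheme.{u}} {k : Type u} [Field k] [X.Over (Spec (.of k))]
variable {p : ℕ} [Fact p.Prime] [CharP k p] {M : LineConn k X} {c : k} {U V W : X.Opens}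

namespace Splitting

variable (S : Splitting p M c)

theorem mres_act {U V : (frobTwist X k p).Opens} (i : V ≤ U)
    (a : Red p M c (relFrob X k p ⁻¹ᵁ U)) (s : Γ(S.E, U)) :
    mres S.E i (EndSec.act (S.toEnd U a) s) = EndSec.act (S.toEnd V
      (Red.restrict p M c ((relFrob X k p).preimage_mono i) a)) (mres S.E i s) := by
  rw [S.toEnd_res i]
  exact ((S.toEnd U a).2 ⟨U, le_rfl⟩ ⟨V, i⟩ i s).symm

/-- The action of `D_{L^c, ∇⁽¹⁾}` on the splitting bundle, indexed by open sets of `X` -/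
def redAct (V : X.Opens) : Red p M c V →+* AddMonoid.End Γ(S.E, twistProj X k p ⁻¹ᵁ V) :=
  (EndSec.actHom S.E _).comp ((S.toEnd (twistProj X k p ⁻¹ᵁ V)).toRingHom.comp
    (Red.restrict p M c (preimage_twistProj k p V).le))

theorem mres_redAct (i : W ≤ V) (a : Red p M c V) (s : Γ(S.E, twistProj X k p ⁻¹ᵁ V)) :
    mres S.E ((twistProj X k p).preimage_mono i) (S.redAct V a s) =
      S.redAct W (Red.restrict p M c i a) (mres S.E ((twistProj X k p).preimage_mono i) s) :=
  S.mres_act ((twistProj X k p).preimage_mono i)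
    (Red.restrict p M c (preimage_twistProj k p V).le a) s

theorem act_eq_redAct {U : (frobTwist X k p).Opens} (a : Red p M c (relFrob X k p ⁻¹ᵁ U))
    [IsAlgClosed k] (s : Γ(S.E, U)) : mres S.E (preimage_relFrob k p U).le (EndSec.act (S.toEnd U a) s) =
      S.redAct _ a (mres S.E (preimage_relFrob k p U).le s) :=
  S.mres_act (preimage_relFrob k p U).le a s

theorem restrict_fn (i : W ≤ V) (f : Γ(X, V)) :
    Red.restrict p M c i (Red.fn p c M f) = Red.fn p c M (res k i f) := by
  refine Subtype.ext (funext fun T => ?_)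
  rw [Red.fn_apply, res_res]
  rfl

theorem restrict_vec (i : W ≤ V) (ξ : Vect k V) :
    Red.restrict p M c i (Red.vec p c M ξ) = Red.vec p c M (ξ.restrict i) := rfl

instance sectionsModule (V : X.Opens) : Module Γ(X, V) Γ(S.E, twistProj X k p ⁻¹ᵁ V) :=
  Module.compHom _ ((S.redAct V).comp (Red.fn p c M))

theorem mres_redAct_fn (i : W ≤ V) (f : Γ(X, V)) (s : Γ(S.E, twistProj X k p ⁻¹ᵁ V)) :
    mres S.E ((twistProj X k p).preimage_mono i) (f • s) =
      res k i f • mres S.E ((twistProj X k p).preimage_mono i) s := by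
  change _ = S.redAct W (Red.fn p c M (res k i f)) _
  rw [← restrict_fn]
  exact S.mres_redAct i _ _

theorem isSheaf_pushforward : TopCat.Presheaf.IsSheaf (X := X)
    ((Opens.map (twistProj X k p).base).op ⋙ S.E.presheaf) :=
  ((Scheme.Modules.pushforward (twistProj X k p)).obj S.E).isSheaf

instance presheafModule (V : X.Opensᵒᵖ) : Module (X.ringCatSheaf.obj.obj V)
    (((Opens.map (twistProj X k p).base).op ⋙ S.E.presheaf).obj V) := S.sectionsModule V.unop

/-- The direct image of the splitting bundle along `X⁽¹⁾ → X`, as a presheaf of modules over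
`𝒪_X ⊆ D` -/
def presheafBundle : PresheafOfModules X.ringCatSheaf.obj :=
  PresheafOfModules.ofPresheaf (R := X.ringCatSheaf.obj)
    ((Opens.map (twistProj X k p).base).op ⋙ S.E.presheaf)
    fun _ _ i f s => S.mres_redAct_fn i.unop.le f s

/-- The direct image of the splitting bundle along `X⁽¹⁾ → X`, as a module over `𝒪_X ⊆ D` -/
def bundle : X.Modules where
  val := S.presheafBundle
  isSheaf := by
    have h : S.presheafBundle.presheaf = (Opens.map (twistProj X k p).base).op ⋙ S.E.presheaf := rfl
    rw [h]
    exact S.isSheaf_pushforward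

theorem bundle_smul (f : Γ(X, V)) (s : Γ(S.bundle, V)) : f • s = S.redAct V (Red.fn p c M f) s := rfl

end Splitting

end BundleOfSplitting

/-! ### Frames and matrix units -/

section Frames

variable {Y : Scheme.{u}} {E : Y.Modules} {U V : Y.Opens} {n : ℕ} {b : Fin n → Γ(E, U)}

/-- Coordinates in a frame -/
def IsFrame.coords (hb : IsFrame E U b) (h : V ≤ U) : Γ(E, V) ≃ₗ[Γ(Y, V)] (Fin n → Γ(Y, V)) :=
  (LinearEquiv.ofBijective (Fintype.linearCombination Γ(Y, V) fun i => mres E h (b i)) (hb V h)).symm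

theorem IsFrame.sum_coords (hb : IsFrame E U b) (h : V ≤ U) (s : Γ(E, V)) :
    ∑ i, hb.coords h s i • mres E h (b i) = s :=
  (LinearEquiv.ofBijective (Fintype.linearCombination Γ(Y, V) fun i => mres E h (b i))
    (hb V h)).apply_symm_apply s

theorem IsFrame.coords_sum (hb : IsFrame E U b) (h : V ≤ U) (f : Fin n → Γ(Y, V)) :
    hb.coords h (∑ i, f i • mres E h (b i)) = f :=
  (LinearEquiv.ofBijective (Fintype.linearCombination Γ(Y, V) fun i => mres E h (b i))
    (hb V h)).symm_apply_apply f

theorem IsFrame.coords_self (hb : IsFrame E U b) (h : V ≤ U) (i : Fin n) :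
    hb.coords h (mres E h (b i)) = Pi.single i 1 := by
  have := hb.coords_sum h (Pi.single i 1)
  simpa [Pi.single_apply, ite_smul] using this

theorem map_mres_smul {W : Y.Opens} (j : W ≤ V) (f : Γ(Y, V)) (s : Γ(E, V)) :
    mres E j (f • s) = Y.presheaf.map (homOfLE j).op f • mres E j s := E.map_smul (homOfLE j) f s

theorem IsFrame.coords_mres (hb : IsFrame E U b) (h : V ≤ U) {W : Y.Opens} (j : W ≤ V)
    (s : Γ(E, V)) (i : Fin n) : hb.coords (j.trans h) (mres E j s) i =
      Y.presheaf.map (homOfLE j).op (hb.coords h s i) := by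
  have h1 := congrArg (mres E j) (hb.sum_coords h s)
  rw [map_sum] at h1
  simp only [map_mres_smul, mres_mres] at h1
  rw [← h1, hb.coords_sum (j.trans h)]

/-- The matrix units of the algebra of endomorphisms -/
def EndSec.single (hb : IsFrame E U b) (i j : Fin n) : EndSec E U :=
  ⟨fun V => ((LinearMap.proj j).comp (hb.coords V.2).toLinearMap).smulRight (mres E V.2 (b i)),
    fun V W l s => by
      change hb.coords W.2 (mres E l s) j • mres E W.2 (b i) =
        mres E l (hb.coords V.2 s j • mres E V.2 (b i))
      rw [map_mres_smul, mres_mres]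
      congr 1
      exact hb.coords_mres V.2 l s j⟩

theorem EndSec.act_single (hb : IsFrame E U b) (i j : Fin n) (s : Γ(E, U)) :
    EndSec.act (EndSec.single hb i j) s = hb.coords le_rfl s j • b i := by
  change hb.coords le_rfl s j • mres E le_rfl (b i) = _
  rw [mres_self]

theorem EndSec.act_single_self (hb : IsFrame E U b) (i j l : Fin n) :
    EndSec.act (EndSec.single hb i j) (b l) = if l = j then b i else 0 := by
  have := hb.coords_self le_rfl l
  rw [mres_self] at this
  rw [EndSec.act_single, this, Pi.single_apply]
  split_ifs with h1 h2 h2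
  · rw [one_smul]
  · exact absurd h1.symm h2
  · exact absurd h2.symm h1
  · rw [zero_smul]

theorem EndSec.ext_frame (hb : IsFrame E U b) {a a' : EndSec E U}
    (h : ∀ l, EndSec.act a (b l) = EndSec.act a' (b l)) : a = a' := by
  refine Subtype.ext (funext fun V => LinearMap.ext fun s => ?_)
  rw [← hb.sum_coords V.2 s, map_sum, map_sum]
  refine Finset.sum_congr rfl fun l _ => ?_
  rw [map_smul, map_smul]
  congr 1
  exact (a.2 ⟨U, le_rfl⟩ V V.2 (b l)).trans ((congrArg (mres E V.2) (h l)).trans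
    (a'.2 ⟨U, le_rfl⟩ V V.2 (b l)).symm)

theorem EndSec.sum_single (hb : IsFrame E U b) : ∑ i, EndSec.single hb i i = 1 :=
  EndSec.ext_frame hb fun l => by
    have h : ∀ s : Finset (Fin n), EndSec.act (∑ i ∈ s, EndSec.single hb i i) (b l) =
        ∑ i ∈ s, EndSec.act (EndSec.single hb i i) (b l) := fun s =>
      map_sum ((AddMonoidHom.eval (b l)).comp (EndSec.actHom E U).toAddMonoidHom) _ _
    rw [h]
    simp only [EndSec.act_single_self]
    rw [Finset.sum_ite_eq Finset.univ l, if_pos (Finset.mem_univ l)]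
    rfl

end Frames
end
end PCurv

namespace PCurv
noncomputable section

theorem EndSec.single_mul_single {Y : Scheme.{u}} {E : Y.Modules} {U : Y.Opens} {n : ℕ}
    {b : Fin n → Γ(E, U)} (hb : IsFrame E U b) (j m i l : Fin n) :
    EndSec.single hb j m * EndSec.single hb i l = if m = i then EndSec.single hb j l else 0 := by
  refine EndSec.ext_frame hb fun t => ?_
  change EndSec.act (EndSec.single hb j m) (EndSec.act (EndSec.single hb i l) (b t)) = _
  rw [EndSec.act_single_self]
  split_ifs with h1 h2 h2
  · rw [EndSec.act_single_self, if_pos h2.symm, EndSec.act_single_self, if_pos h1]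
  · rw [EndSec.act_single_self, if_neg (Ne.symm h2)]; rfl
  · rw [map_zero, EndSec.act_single_self, if_neg h1]
  · exact map_zero _

/-- Cramer's rule: `G` is the identity modulo `n`, so its determinant `δ` lies outside `n`, and the
adjugate solves for `δ • β i`. -/
theorem exists_smul_eq_smul_of_matrix {A N : Type*} [CommRing A] [AddCommGroup N] [Module A N]
    (n : Ideal A) [n.IsPrime] {r : ℕ} (G : Matrix (Fin r) (Fin r) A) (β : Fin r → N)
    (f : Fin r → A) (w : N) (hG : ∀ i, ∑ m, G i m • β m = f i • w)
    (hn : ∀ i m, G i m - (if m = i then 1 else 0) ∈ n) :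
    ∃ (δ : A) (a : Fin r → A), δ ∉ n ∧ ∀ i, δ • β i = a i • w := by
  have hG1 : (Ideal.Quotient.mk n).mapMatrix G = 1 := by
    ext i m
    rw [RingHom.mapMatrix_apply, Matrix.map_apply, Ideal.Quotient.eq.2 (hn i m), Matrix.one_apply]
    simp only [eq_comm (a := m)]
    split_ifs <;> simp
  refine ⟨G.det, fun i => ∑ j, G.adjugate i j * f j, fun h => ?_, fun i => ?_⟩
  · have h1 := Ideal.Quotient.eq_zero_iff_mem.2 h
    rw [RingHom.map_det, hG1, Matrix.det_one] at h1
    exact one_ne_zero h1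
  · have h1 : G.det • β i = ∑ m, (G.adjugate * G) i m • β m := by
      rw [Matrix.adjugate_mul]
      simp [Matrix.one_apply]
    rw [h1]
    simp only [Matrix.mul_apply, Finset.sum_smul, mul_smul]
    rw [Finset.sum_comm]
    refine Finset.sum_congr rfl fun j _ => ?_
    rw [← Finset.smul_sum, hG]

/-! ### The splitting bundle has rank one over `X` -/

section LineBundle

variable {X : Scheme.{u}} {k : Type u} [Field k] [X.Over (Spec (.of k))]
variable {p : ℕ} [Fact p.Prime] [CharP k p] {M : LineConn k X} {c : k} {U V W : X.Opens}

namespace Splitting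

variable (S : Splitting p M c)

theorem toEnd_fn_act (V : X.Opens) (f : Γ(X, relFrob X k p ⁻¹ᵁ twistProj X k p ⁻¹ᵁ V))
    (s : Γ(S.bundle, V)) :
    EndSec.act (S.toEnd (twistProj X k p ⁻¹ᵁ V) (Red.fn p c M f)) s =
      (show Γ(S.bundle, V) from res k (preimage_twistProj k p V).ge f • s) := by
  rw [bundle_smul]
  change _ = EndSec.act (S.toEnd _ (Red.restrict p M c _ (Red.fn p c M _))) s
  rw [restrict_fn, res_res, res_self]

/-- The homomorphism from functions on `X⁽¹⁾` to functions on `X` -/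
def twistFn (X : Scheme.{u}) (k : Type u) [Field k] [X.Over (Spec (.of k))] (p : ℕ) [Fact p.Prime]
    [CharP k p] (V : X.Opens) : Γ(frobTwist X k p, twistProj X k p ⁻¹ᵁ V) →+* Γ(X, V) :=
  (res k (preimage_twistProj k p V).ge).toRingHom.comp
    ((relFrob X k p).app (twistProj X k p ⁻¹ᵁ V)).hom

theorem twistFn_smul (V : X.Opens) (g : Γ(frobTwist X k p, twistProj X k p ⁻¹ᵁ V))
    (s : Γ(S.bundle, V)) : twistFn X k p V g • s = (show Γ(S.bundle, V) from
      g • (show Γ(S.E, twistProj X k p ⁻¹ᵁ V) from s)) := by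
  refine Eq.trans ?_ (S.toEnd_scalar (twistProj X k p ⁻¹ᵁ V) g s)
  exact (S.toEnd_fn_act V _ s).symm

theorem eq_zero_of_redAct [IsAlgClosed k] {a : Red p M c V} (h : ∀ (W : X.Opens) (i : W ≤ V),
    S.redAct W (Red.restrict p M c i a) = 0) : a = 0 := by
  have h1 : Red.restrict p M c (preimage_twistProj k p V).le a = 0 := by
    refine (map_eq_zero_iff _ (S.toEnd (twistProj X k p ⁻¹ᵁ V)).injective).1 ?_
    refine Subtype.ext (funext fun W => LinearMap.ext fun s => ?_)
    obtain ⟨W, hW⟩ := W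
    obtain ⟨W, rfl⟩ : ∃ W', W = twistProj X k p ⁻¹ᵁ W' := ⟨_, (preimage_relFrob k p W).symm⟩
    have i : W ≤ V := by
      rw [← preimage_twistProj k p W, ← preimage_twistProj k p V]
      exact (relFrob X k p).preimage_mono hW
    have h2 := congrArg (fun φ : AddMonoid.End _ => φ s) (h W i)
    refine Eq.trans ?_ h2
    have h3 := congrArg (fun β => EndSec.act β s)
      (S.toEnd_res hW (Red.restrict p M c (preimage_twistProj k p V).le a))
    exact h3.symm
  have h2 := congrArg (Red.restrict p M c (preimage_twistProj k p V).ge) h1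
  rw [map_zero] at h2
  exact h2

/-- Functions embed in the central reduction, and the central reduction in the endomorphisms of `E`.
-/
theorem eq_zero_of_smul_eq_zero [IsAlgClosed k] [Smooth (X ↘ Spec (.of k))] {f : Γ(X, V)}
    (h : ∀ (W : X.Opens) (i : W ≤ V) (s : Γ(S.bundle, W)), res k i f • s = 0) : f = 0 := by
  refine (injective_iff_map_eq_zero _).1 (Red.fn_injective p c M V) f
    (S.eq_zero_of_redAct fun W i => AddMonoidHom.ext fun s => ?_)
  rw [restrict_fn]
  exact h W i s

theorem exists_twistFn_eq_pow [IsAlgClosed k] (V : X.Opens)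
    (g : Γ(frobTwist X k p, twistProj X k p ⁻¹ᵁ V)) : ∃ f : Γ(X, V), twistFn X k p V g = f ^ p := by
  obtain ⟨f, hf⟩ := exists_relFrob_app_eq_pow k p _ g
  refine ⟨res k (preimage_twistProj k p V).ge f, ?_⟩
  rw [← map_pow, ← hf]
  rfl

/-- Functions from `X⁽¹⁾` become `p`-th powers on `X`, and `f ^ p - μ ^ p = (f - μ) ^ p`. Hence they
act by scalars on functions modulo `frobIdeal p n`. -/
theorem exists_twistFn_sub_mem [IsAlgClosed k] [Smooth (X ↘ Spec (.of k))] {V : X.Opens}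
    (hV : IsAffineOpen V) (n : Ideal Γ(X, V)) [n.IsMaximal]
    (g : Γ(frobTwist X k p, twistProj X k p ⁻¹ᵁ V)) :
    ∃ ν : k, twistFn X k p V g - algebraMap k _ ν ∈ frobIdeal p n := by
  have := smooth_sections (k := k) hV
  obtain ⟨f, hf⟩ := exists_twistFn_eq_pow (k := k) (p := p) V g
  obtain ⟨μ, hμ⟩ := exists_sub_algebraMap_mem (k := k) n f
  refine ⟨μ ^ p, ?_⟩
  have h := map_sub (frobHom (cast_eq_zero_of_charP k Γ(X, V) p)) f (algebraMap k _ μ)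
  change (f - algebraMap k _ μ) ^ p = f ^ p - algebraMap k _ μ ^ p at h
  rw [hf, map_pow, ← h]
  exact pow_mem_frobIdeal hμ

-- Let `Θ` be the representation of the matrix algebra `End(E)` on `A / J`, and let `χ` be a
-- functional with `χ(Θ(e_jj) z) = 1`. Write `F_ml(f)` for the matrix of multiplication by `f` in
-- the frame. Applying `χ ∘ Θ` to `e_jm f = ∑ F_ml(f) e_jl` at `1` shows that `χ(Θ(e_jm) f)` is the
-- `m`-th coordinate at the point of `f w`, where `w = ∑ v_l β_l` and `v_l = χ(Θ(e_jl) 1)`. If `f_i`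
-- represents `Θ(e_ij) z`, then `f_i w` agrees with `β_i` at the point, so near it every `β_i` is a
-- multiple of `w`. The rank of `E` need not be known.
set_option maxHeartbeats 400000 in
theorem exists_cyclic [IsAlgClosed k] [Smooth (X ↘ Spec (.of k))] (T : Triv M) {r : ℕ}
    {b : Fin r → Γ(S.E, twistProj X k p ⁻¹ᵁ T.U.1)}
    (hb : IsFrame S.E (twistProj X k p ⁻¹ᵁ T.U.1) b) (n : Ideal Γ(X, T.U.1)) [n.IsMaximal] :
    ∃ (w : Γ(S.bundle, T.U.1)) (δ : Γ(X, T.U.1)) (a : Fin r → Γ(X, T.U.1)), δ ∉ n ∧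
      ∀ i, δ • (show Γ(S.bundle, T.U.1) from b i) = a i • w := by
  let V := T.U.1
  let A := Γ(X, V)
  let J := frobIdeal p n
  let Λ := twistFn X k p V
  let β : Fin r → Γ(S.bundle, V) := b
  let F : A → Fin r → Fin r → Γ(frobTwist X k p, twistProj X k p ⁻¹ᵁ V) :=
    fun f m l => hb.coords le_rfl (show Γ(S.bundle, V) from f • β l) m
  have hF : ∀ f l, f • β l = ∑ m, Λ (F f m l) • β m := by
    intro f l
    refine (hb.sum_coords le_rfl (show Γ(S.bundle, V) from f • β l)).symm.trans ?_
    refine Finset.sum_congr rfl fun m _ => ?_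
    rw [mres_self]
    exact (S.twistFn_smul V _ _).symm
  choose ν hν using exists_twistFn_sub_mem (k := k) (p := p) T.isAffineOpen n
  obtain ⟨ψ, hψ⟩ := exists_fiber p c T n
  let ev : Red p M c (relFrob X k p ⁻¹ᵁ twistProj X k p ⁻¹ᵁ V) →+* RedLocal p c T :=
    (Pi.evalRingHom (fun T : {T : Triv M // T.U.1 ≤ relFrob X k p ⁻¹ᵁ twistProj X k p ⁻¹ᵁ V} =>
      RedLocal p c T.1) ⟨T, (preimage_twistProj k p V).ge⟩).comp (Subring.subtype _)
  let Θ : EndSec S.E (twistProj X k p ⁻¹ᵁ V) →+* Module.End k (A ⧸ J) :=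
    ψ.comp (ev.comp (S.toEnd _).symm.toRingHom)
  let fnE : A → EndSec S.E (twistProj X k p ⁻¹ᵁ V) := fun f =>
    S.toEnd _ (Red.fn p c M (res k (preimage_twistProj k p V).le f))
  have hΘ : ∀ f a, Θ (fnE f) (Ideal.Quotient.mk J a) = Ideal.Quotient.mk J (f * a) := by
    intro f a
    rw [← hψ]
    change ψ (ev ((S.toEnd _).symm (S.toEnd _ _))) _ = _
    rw [RingEquiv.symm_apply_apply]
    change ψ (RedLocal.fn p c T (res k _ (res k _ f))) _ = _
    rw [res_res, res_self]
  have hact : ∀ f (s : Γ(S.bundle, V)), EndSec.act (fnE f) s =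
      (show Γ(S.bundle, V) from f • s) := by
    intro f s
    rw [S.toEnd_fn_act, res_res, res_self]
  let e := EndSec.single hb
  have key : ∀ j m f, e j m * fnE f = ∑ l, fnE (Λ (F f m l)) * e j l := by
    intro j m f
    refine EndSec.ext_frame hb fun t => ?_
    have h1 : EndSec.act (∑ l, fnE (Λ (F f m l)) * e j l) (b t) =
        ∑ l, EndSec.act (fnE (Λ (F f m l)) * e j l) (b t) :=
      map_sum ((AddMonoidHom.eval (b t)).comp (EndSec.actHom S.E _).toAddMonoidHom) _ _
    have h2 : ∀ l, EndSec.act (fnE (Λ (F f m l)) * e j l) (b t) =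
        if t = l then F f m t • b j else 0 := by
      intro l
      change EndSec.act (fnE (Λ (F f m l))) (EndSec.act (EndSec.single hb j l) (b t)) = _
      rw [EndSec.act_single_self]
      split_ifs with h
      · subst h
        exact (hact _ (β j)).trans (S.twistFn_smul V _ _)
      · exact map_zero _
    rw [h1, Finset.sum_congr rfl fun l _ => h2 l, Finset.sum_ite_eq Finset.univ t,
      if_pos (Finset.mem_univ t)]
    exact (congrArg (EndSec.act (EndSec.single hb j m)) (hact f (β t))).trans
      (EndSec.act_single hb j m _)
  have hJn : J ≤ n := frobIdeal_le n
  -- The `e j j` sum to `1`, and `A / J` is nonzero because `J ≤ n`.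
  obtain ⟨j, z, hz⟩ : ∃ j z, Θ (e j j) z ≠ 0 := by
    by_contra! h
    have h1 : Θ 1 (Ideal.Quotient.mk J 1) = 0 := by
      rw [← EndSec.sum_single hb, map_sum, LinearMap.sum_apply]
      exact Finset.sum_eq_zero fun j _ => h j _
    rw [map_one] at h1
    exact (Ideal.ne_top_iff_one n).1 (Ideal.IsMaximal.ne_top ‹_›)
      (hJn (Ideal.Quotient.eq_zero_iff_mem.1 h1))
  obtain ⟨χ, hχ⟩ := LinearMap.exists_leftInverse_of_injective
    (LinearMap.toSpanSingleton k (A ⧸ J) (Θ (e j j) z)) (LinearMap.ker_toSpanSingleton k hz)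
  have hχ1 : χ (Θ (e j j) z) = 1 := by
    simpa using congrArg (fun φ => φ (1 : k)) hχ
  let v : Fin r → k := fun l => χ (Θ (e j l) (Ideal.Quotient.mk J 1))
  have hv : ∀ f m, χ (Θ (e j m) (Ideal.Quotient.mk J f)) = ∑ l, ν (F f m l) * v l := by
    intro f m
    have h1 := congrArg (fun φ => Θ φ (Ideal.Quotient.mk J 1)) (key j m f)
    simp only [map_mul, map_sum, Module.End.mul_apply, hΘ, mul_one, LinearMap.sum_apply] at h1
    rw [h1, map_sum]
    refine Finset.sum_congr rfl fun l _ => ?_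
    obtain ⟨y, hy⟩ := Ideal.Quotient.mk_surjective (Θ (e j l) (Ideal.Quotient.mk J 1))
    have h2 : Θ (fnE (Λ (F f m l))) (Θ (e j l) (Ideal.Quotient.mk J 1)) =
        ν (F f m l) • Θ (e j l) (Ideal.Quotient.mk J 1) := by
      rw [← hy, hΘ]
      change _ = Ideal.Quotient.mk J (ν (F f m l) • y)
      rw [Ideal.Quotient.eq, Algebra.smul_def, ← sub_mul]
      exact Ideal.mul_mem_right _ _ (hν _)
    rw [h2, map_smul, smul_eq_mul]
  choose f hf using fun i => Ideal.Quotient.mk_surjective (Θ (e i j) z)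
  -- By `e_jm e_ij = δ_mi e_jj`, the coordinates of `f i • w` at the point are those of `β i`.
  have hδ : ∀ i m, ∑ l, ν (F (f i) m l) * v l = if m = i then 1 else 0 := by
    intro i m
    rw [← hv, hf, ← Module.End.mul_apply, ← map_mul, EndSec.single_mul_single]
    split_ifs
    · exact hχ1
    · rw [map_zero, LinearMap.zero_apply, map_zero]
  let w : Γ(S.bundle, V) := ∑ l, algebraMap k A (v l) • β l
  let G : Matrix (Fin r) (Fin r) A := fun i m => ∑ l, algebraMap k A (v l) * Λ (F (f i) m l)
  have hG : ∀ i, ∑ m, G i m • β m = f i • w := by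
    intro i
    simp only [w, G, Finset.smul_sum, Finset.sum_smul]
    rw [Finset.sum_comm]
    refine Finset.sum_congr rfl fun l _ => ?_
    rw [smul_comm, hF, Finset.smul_sum]
    exact Finset.sum_congr rfl fun m _ => mul_smul _ _ _
  obtain ⟨δ, a, hδn, ha⟩ := exists_smul_eq_smul_of_matrix n G β f w hG fun i m => by
    have h1 : G i m - algebraMap k A (if m = i then 1 else 0) ∈ n := by
      rw [← hδ i m, map_sum, ← Finset.sum_sub_distrib]
      refine Ideal.sum_mem _ fun l _ => ?_
      rw [map_mul, mul_comm (algebraMap k A (ν _)), ← mul_sub]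
      exact Ideal.mul_mem_left _ _ (hJn (hν _))
    rwa [apply_ite (algebraMap k A), map_one, map_zero] at h1
  exact ⟨w, δ, a, hδn, ha⟩

/-- `Splitting.exists_cyclic` at a closed point specializing `x` in an affine neighbourhood provides
a section `w` that generates near `x`. It generates freely: a function killing `w` kills all
sections, hence is zero. -/
theorem isLineBundle_bundle [IsAlgClosed k] [Smooth (X ↘ Spec (.of k))] :
    IsLineBundle S.bundle := by
  intro x
  obtain ⟨U₀, r, b, hx, hb⟩ := S.isVectorBundle (relFrob X k p x)
  obtain ⟨T, hxT, hT⟩ := exists_triv_le (U := relFrob X k p ⁻¹ᵁ U₀) M hx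
  let V := T.U.1
  have hV : twistProj X k p ⁻¹ᵁ V ≤ U₀ := by
    rw [← preimage_relFrob k p U₀]; exact (twistProj X k p).preimage_mono hT
  let q : Ideal Γ(X, V) := (IsLocalRing.maximalIdeal (X.presheaf.stalk x)).comap (germ k hxT)
  have hq : q.IsPrime := Ideal.comap_isPrime _ _
  obtain ⟨n, hn, hqn⟩ := q.exists_le_maximal hq.ne_top
  obtain ⟨w, δ, a, hδ, ha⟩ := S.exists_cyclic T (hb.restrict hV) n
  have hxδ : x ∈ X.basicOpen δ := by
    rw [Scheme.mem_basicOpen _ _ _ hxT]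
    by_contra h
    exact hδ (hqn ((IsLocalRing.mem_maximalIdeal _).2 h))
  refine ⟨X.basicOpen δ, mres S.bundle (X.basicOpen_le δ) w, hxδ, fun W hW => ?_⟩
  let hWV : W ≤ V := hW.trans (X.basicOpen_le δ)
  have hsurj : ∀ {W : X.Opens} (i : W ≤ V) (_ : W ≤ X.basicOpen δ) (s : Γ(S.bundle, W)),
      ∃ f : Γ(X, W), f • mres S.bundle i w = s := by
    intro W i hWδ s
    obtain ⟨u, hu⟩ := isUnit_res_of_le (k := k) δ i hWδ
    let g := hb.coords (((twistProj X k p).preimage_mono i).trans hV) s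
    refine ⟨∑ l, twistFn X k p W (g l) * (↑u⁻¹ * res k i (a l)), ?_⟩
    refine Eq.trans ?_ (hb.sum_coords (((twistProj X k p).preimage_mono i).trans hV) s)
    rw [Finset.sum_smul]
    refine Finset.sum_congr rfl fun l _ => ?_
    let β : Γ(S.bundle, V) := mres S.E hV (b l)
    have h1 : res k i δ • mres S.bundle i β = res k i (a l) • mres S.bundle i w := by
      rw [← mres_smul k, ← mres_smul k]
      exact congrArg _ (ha l)
    have h2 : (↑u⁻¹ * res k i (a l)) • mres S.bundle i w = mres S.bundle i β := by
      rw [mul_smul, ← h1, smul_smul, ← hu, Units.inv_mul, one_smul]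
    rw [mul_smul, h2, twistFn_smul]
    refine congrArg (g l • ·) ?_
    exact mres_mres S.E hV ((twistProj X k p).preimage_mono i) (b l)
  simp only [mres_mres]
  refine ⟨?_, fun s => hsurj hWV hW s⟩
  refine (injective_iff_map_eq_zero (AddMonoidHom.mk' (fun f : Γ(X, W) => f • mres S.bundle hWV w)
    fun f g => add_smul _ _ _)).2 fun f hf => ?_
  refine S.eq_zero_of_smul_eq_zero fun W' i s => ?_
  obtain ⟨g, rfl⟩ := hsurj (i.trans hWV) (i.trans hW) s
  have h1 := congrArg (mres S.bundle i) hf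
  change mres S.bundle i (f • mres S.bundle hWV w) = mres S.bundle i 0 at h1
  rw [mres_smul k, mres_mres, map_zero] at h1
  rw [smul_comm, h1, smul_zero]

end Splitting

end LineBundle
end
end PCurv

namespace PCurv
noncomputable section

/-! ### From a splitting to a line bundle with connection -/

section ConnectionOfSplitting

variable {X : Scheme.{u}} {k : Type u} [Field k] [X.Over (Spec (.of k))]

theorem Vect.eq_sum_fsmul {U : X.Opens} (hU : IsAffineOpen U) {n : ℕ} {ω : Fin n → Ω[Γ(X, U)⁄k]}
    {ξ : Fin n → Vect k U} (h : ∀ η, η = ∑ i, (ξ i).pair η • ω i) (ζ : Vect k U) :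
    ζ = ∑ i, (ξ i).fsmul (ζ.pair (ω i)) := by
  refine Vect.ext_of_der hU (Derivation.ext fun f => ?_)
  have h1 : ∀ s : Finset (Fin n), (∑ i ∈ s, (ξ i).fsmul (ζ.pair (ω i))).der f =
      ∑ i ∈ s, ((ξ i).fsmul (ζ.pair (ω i))).der f := fun s =>
    map_sum (AddMonoidHom.mk' (fun ζ : Vect k U => ζ.der f) fun _ _ => Vect.der_add _ _ _) _ _
  rw [h1, ← Vect.pair_D, h (KaehlerDifferential.D k _ f), map_sum]
  refine Finset.sum_congr rfl fun i _ => ?_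
  rw [LinearMap.map_smul, Vect.der_fsmul, Vect.pair_D, smul_eq_mul, mul_comm]

theorem dualBasis_basicOpen {U : X.Opens} (hU : IsAffineOpen U) {n : ℕ} {ω : Fin n → Ω[Γ(X, U)⁄k]}
    {ξ : Fin n → Vect k U} (h : ∀ η, η = ∑ i, (ξ i).pair η • ω i) (f : Γ(X, U))
    (η : Ω[Γ(X, X.basicOpen f)⁄k]) : η = ∑ i, ((ξ i).restrict (X.basicOpen_le f)).pair η •
      formMap (res k (X.basicOpen_le f)) (ω i) := by
  have := hU.isLocalization_basicOpen f
  have : IsScalarTower k Γ(X, U) Γ(X, X.basicOpen f) :=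
    IsScalarTower.of_algebraMap_eq' (res k (X.basicOpen_le f)).comp_algebraMap.symm
  have hη : η ∈ Submodule.span Γ(X, X.basicOpen f) (Set.range
      (KaehlerDifferential.map k k Γ(X, U) Γ(X, X.basicOpen f) ∘ KaehlerDifferential.D k Γ(X, U))) := by
    rw [KaehlerDifferential.span_range_map_derivation_of_isLocalization k Γ(X, U)
      Γ(X, X.basicOpen f) (Submonoid.powers f)]
    trivial
  induction hη using Submodule.span_induction with
  | mem x hx =>
    obtain ⟨a, rfl⟩ := hx
    have h1 : (KaehlerDifferential.map k k Γ(X, U) Γ(X, X.basicOpen f) ∘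
        KaehlerDifferential.D k Γ(X, U)) a =
        formMap (res k (X.basicOpen_le f)) (KaehlerDifferential.D k Γ(X, U) a) := by
      rw [formMap_D, Function.comp_apply, KaehlerDifferential.map_D]
      rfl
    rw [h1]
    conv_lhs => rw [h (KaehlerDifferential.D k _ a), map_sum]
    simp only [formMap_smul, Vect.pair_restrict]
  | zero => simp
  | add x y _ _ hx hy =>
    conv_lhs => rw [hx, hy]
    simp only [map_add, add_smul, Finset.sum_add_distrib]
  | smul a x _ hx =>
    conv_lhs => rw [hx]
    simp only [map_smul, smul_eq_mul, mul_smul, Finset.smul_sum]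

/-- Sections of `Ω¹ ⊗ N` over affine open sets are compatible with restriction if their contractions
with vector fields are. -/
theorem eq_tres_of_contract [Smooth (X ↘ Spec (.of k))] (N : X.Modules) {U V : X.Opens}
    (hU : IsAffineOpen U) (hV : IsAffineOpen V) (i : V ≤ U)
    (t : Ω[Γ(X, U)⁄k] ⊗[Γ(X, U)] Γ(N, U)) (t' : Ω[Γ(X, V)⁄k] ⊗[Γ(X, V)] Γ(N, V))
    (h : ∀ ξ : Vect k U, contract N (ξ.restrict i) t' = mres N i (contract N ξ t)) :
    t' = tres k N i t := by
  obtain ⟨n, ω, ξ, H⟩ := exists_dualBasis (k := k) hU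
  refine contract_ext (k := k) hV N fun ζ => mres_ext_affine N fun x hx => ?_
  -- Vector fields on `V` need not be restrictions from `U`. On a basic open set of `U` inside `V`,
  -- however, a dual basis of `U` remains one, and contractions with its members suffice.
  obtain ⟨f, hfV, hxf⟩ := exists_basicOpen_le' hU (i hx) hx
  refine ⟨⟨_, hU.basicOpen f⟩, hfV, hxf, ?_⟩
  have h1 := dualBasis_basicOpen hU H f
  rw [← contract_tres, ← contract_tres, eq_sum_contract N h1 (tres k N hfV t'),
    eq_sum_contract N h1 (tres k N hfV (tres k N i t))]
  refine congrArg _ (Finset.sum_congr rfl fun l _ => congrArg _ ?_)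
  have h2 : (ξ l).restrict (X.basicOpen_le f) = ((ξ l).restrict i).restrict hfV := rfl
  rw [h2, contract_tres, contract_tres, contract_tres, h]

variable {p : ℕ} [Fact p.Prime] [CharP k p] {M : LineConn k X} {c : k} {U V W : X.Opens}

theorem Red.vec_add (ξ ζ : Vect k U) :
    Red.vec p c M (ξ + ζ) = Red.vec p c M ξ + Red.vec p c M ζ := by
  refine Subtype.ext (funext fun T => ?_)
  change _ = (Red.vec p c M ξ).1 T + (Red.vec p c M ζ).1 T
  rw [Red.vec_apply, Red.vec_apply, Red.vec_apply, map_add, map_add, Vect.pair_add, smul_add,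
    map_add]
  exact add_add_add_comm (G := RedLocal p c T.1) _ _ _ _

theorem RedLocal.vec_fsmul (T : Triv M) (f : Γ(X, T.U.1)) (ξ : Vect k T.U.1) :
    RedLocal.vec p c T (ξ.fsmul f) = RedLocal.fn p c T f * RedLocal.vec p c T ξ :=
  (congrArg (RedLocal.mk p c T) (DiffOp.vec_fsmul f ξ)).trans (map_mul _ _ _)

theorem Red.vec_fsmul (f : Γ(X, U)) (ξ : Vect k U) :
    Red.vec p c M (ξ.fsmul f) = Red.fn p c M f * Red.vec p c M ξ := by
  refine Subtype.ext (funext fun T => ?_)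
  change _ = (Red.fn p c M f).1 T * (Red.vec p c M ξ).1 T
  rw [Red.vec_apply, Red.vec_apply, Red.fn_apply, Vect.restrict_fsmul, Vect.pair_fsmul,
    ← mul_smul_comm, map_mul, RedLocal.vec_fsmul]
  exact (mul_add (R := RedLocal p c T.1) _ _ _).symm

theorem Red.vec_mul_fn (ξ : Vect k U) (f : Γ(X, U)) :
    Red.vec p c M ξ * Red.fn p c M f = Red.fn p c M f * Red.vec p c M ξ +
      Red.fn p c M (ξ.der f) := by
  refine congrArg (TDO.toRed p M c U) (a₁ := TDO.vec M c ξ * TDO.fn M c f)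
    (a₂ := TDO.fn M c f * TDO.vec M c ξ + TDO.fn M c (ξ.der f)) ?_ |> fun h => by
      rwa [map_mul, map_add, map_mul] at h
  refine Subtype.ext (funext fun T => ?_)
  change (DiffOp.vec (ξ.restrict T.2) + c • DiffOp.fn ((ξ.restrict T.2).pair T.1.form)) *
    DiffOp.fn (res k T.2 f) = DiffOp.fn (res k T.2 f) *
      (DiffOp.vec (ξ.restrict T.2) + c • DiffOp.fn ((ξ.restrict T.2).pair T.1.form)) +
        DiffOp.fn (res k T.2 (ξ.der f))
  rw [add_mul, mul_add, DiffOp.vec_mul_fn, ← Vect.der_restrict, smul_mul_assoc, mul_smul_comm,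
    ← map_mul, ← map_mul, mul_comm (res k T.2 f)]
  abel

/-- The value of a section of the central reduction in a trivialization -/
def Red.eval (T : Triv M) : Red p M c T.U.1 →+* RedLocal p c T :=
  (Pi.evalRingHom (fun T' : {T' : Triv M // T'.U.1 ≤ T.U.1} => RedLocal p c T'.1)
    ⟨T, le_rfl⟩).comp (Subring.subtype _)

theorem Red.eval_injective (T : Triv M) : Function.Injective (Red.eval (p := p) (c := c) T) :=
  fun _ _ h => Red.ext_of_triv p c T h

theorem Red.eval_fn (T : Triv M) (f : Γ(X, T.U.1)) :
    Red.eval T (Red.fn p c M f) = RedLocal.fn p c T f := by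
  change RedLocal.fn p c T (res k _ f) = _
  rw [res_self]

theorem Red.eval_vec_sub (T : Triv M) (ξ : Vect k T.U.1) :
    Red.eval T (Red.vec p c M ξ - Red.fn p c M (c • ξ.pair T.form)) = RedLocal.vec p c T ξ := by
  rw [map_sub, eval_fn, sub_eq_iff_eq_add]
  exact Red.vec_apply p c ξ ⟨T, le_rfl⟩

theorem Red.centralElt_eq_zero (T : Triv M) (ξ : Vect k T.U.1) :
    (Red.vec p c M ξ - Red.fn p c M (c • ξ.pair T.form)) ^ p -
      (Red.vec p c M (ξ.pPow p) - Red.fn p c M (c • (ξ.pPow p).pair T.form)) +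
        Red.fn p c M ((c ^ p - c) • ξ.pair T.form ^ p) = 0 := by
  refine Red.eval_injective T ?_
  rw [map_zero, map_add, map_sub, map_pow, Red.eval_vec_sub, Red.eval_vec_sub, Red.eval_fn, ← RedLocal.mk_centralElt p c T ξ, centralElt,
    DiffOp.smul_fn, map_add, map_sub, map_pow]
  rfl

theorem Red.vec_bracket (T : Triv M) (ξ ζ : Vect k T.U.1) :
    Red.vec p c M (ξ.bracket ζ) - Red.fn p c M (c • (ξ.bracket ζ).pair T.form) =
      (Red.vec p c M ξ - Red.fn p c M (c • ξ.pair T.form)) *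
        (Red.vec p c M ζ - Red.fn p c M (c • ζ.pair T.form)) -
      (Red.vec p c M ζ - Red.fn p c M (c • ζ.pair T.form)) *
        (Red.vec p c M ξ - Red.fn p c M (c • ξ.pair T.form)) := by
  refine Red.eval_injective T ?_
  rw [Red.eval_vec_sub, map_sub (eval T), map_mul, map_mul, Red.eval_vec_sub, Red.eval_vec_sub]
  refine (congrArg (RedLocal.mk p c T) (DiffOp.vec_bracket ξ ζ)).trans ?_
  rw [map_sub, map_mul, map_mul]
  rfl

namespace Splitting

variable (S : Splitting p M c)

/-- The action of `D_{L^c, ∇⁽¹⁾}` on the bundle on `X` -/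
def bundleAct (V : X.Opens) : Red p M c V →+* AddMonoid.End Γ(S.bundle, V) := S.redAct V

theorem mres_bundleAct (i : W ≤ V) (a : Red p M c V) (s : Γ(S.bundle, V)) :
    mres S.bundle i (S.bundleAct V a s) =
      S.bundleAct W (Red.restrict p M c i a) (mres S.bundle i s) := S.mres_redAct i a s

theorem bundleAct_vec_smul (ξ : Vect k U) (f : Γ(X, U)) (s : Γ(S.bundle, U)) :
    S.bundleAct U (Red.vec p c M ξ) (f • s) =
      f • S.bundleAct U (Red.vec p c M ξ) s + ξ.der f • s := by
  have h := congrArg (fun a => S.bundleAct U a s) (Red.vec_mul_fn (p := p) (c := c) (M := M) ξ f)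
  simp only [map_mul, map_add] at h
  exact h

variable [Smooth (X ↘ Spec (.of k))]

/-- For a dual basis the connection is `s ↦ ∑ ω_i ⊗ ξ̃_i s`; its contraction with any `ζ` is as
required because the lift is linear over functions in the vector field. -/
theorem exists_conn (U : X.affineOpens) : ∃ D : Γ(S.bundle, U.1) →+
    Ω[Γ(X, U.1)⁄k] ⊗[Γ(X, U.1)] Γ(S.bundle, U.1), ∀ (ξ : Vect k U.1) (s : Γ(S.bundle, U.1)),
      contract S.bundle ξ (D s) = S.bundleAct U.1 (Red.vec p c M ξ) s := by
  have hU : IsAffineOpen U.1 := U.2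
  obtain ⟨n, ω, ξ, H⟩ := exists_dualBasis (k := k) hU
  refine ⟨AddMonoidHom.mk' (fun s => ∑ i, ω i ⊗ₜ S.bundleAct U.1 (Red.vec p c M (ξ i)) s)
    fun s t => ?_, fun ζ s => ?_⟩
  · simp only [map_add, TensorProduct.tmul_add, Finset.sum_add_distrib]
  · rw [AddMonoidHom.mk'_apply, map_sum]
    simp only [contract_tmul]
    have h1 : ∀ t : Finset (Fin n),
        S.bundleAct U.1 (Red.vec p c M (∑ i ∈ t, (ξ i).fsmul (ζ.pair (ω i)))) s =
        ∑ i ∈ t, S.bundleAct U.1 (Red.vec p c M ((ξ i).fsmul (ζ.pair (ω i)))) s := fun t =>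
      map_sum (AddMonoidHom.mk' (fun ζ : Vect k U.1 => S.bundleAct U.1 (Red.vec p c M ζ) s)
        fun ξ ζ => by rw [Red.vec_add, map_add]; rfl) _ _
    conv_rhs => rw [Vect.eq_sum_fsmul hU H ζ]
    rw [h1]
    refine Finset.sum_congr rfl fun i _ => ?_
    rw [Red.vec_fsmul, map_mul]
    rfl

/-- The connection on the bundle on `X` -/
def bundleConn (U : X.affineOpens) :
    Γ(S.bundle, U.1) →+ Ω[Γ(X, U.1)⁄k] ⊗[Γ(X, U.1)] Γ(S.bundle, U.1) := (S.exists_conn U).choose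

theorem contract_bundleConn (U : X.affineOpens) (ξ : Vect k U.1) (s : Γ(S.bundle, U.1)) :
    contract S.bundle ξ (S.bundleConn U s) = S.bundleAct U.1 (Red.vec p c M ξ) s :=
  (S.exists_conn U).choose_spec ξ s

variable [IsAlgClosed k]

/-- The line bundle with connection given by a splitting -/
def lineConn : LineConn k X where
  L := S.bundle
  isLineBundle := S.isLineBundle_bundle
  conn := S.bundleConn
  conn_smul U f s := contract_ext (k := k) U.2 _ fun ξ => by
    rw [map_add, LinearMap.map_smul, contract_tmul, Vect.pair_D, contract_bundleConn,
      contract_bundleConn, bundleAct_vec_smul]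
  conn_res U V i s := by
    refine eq_tres_of_contract S.bundle U.2 V.2 i _ _ fun ξ => ?_
    rw [contract_bundleConn, contract_bundleConn, mres_bundleAct, restrict_vec]

/-- The action of `D_{L^c, ∇⁽¹⁾}` on the line bundle with connection -/
def connAct (V : X.Opens) : Red p M c V →+* AddMonoid.End Γ(S.lineConn.L, V) := S.bundleAct V

theorem connAct_fn (f : Γ(X, V)) (s : Γ(S.lineConn.L, V)) :
    S.connAct V (Red.fn p c M f) s = f • s := rfl

theorem connAct_vec (U : X.Opens) (ξ : Vect k U) (s : Γ(S.lineConn.L, U)) :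
    S.connAct U (Red.vec p c M ξ) s = S.lineConn.nabla ξ s := by
  refine (S.lineConn.nabla_ext fun V i => ?_).symm
  refine (S.lineConn.mres_nabla_affine ξ s V i).trans ?_
  refine (S.contract_bundleConn V _ _).trans ?_
  rw [← restrict_vec i]
  exact (S.mres_bundleAct i _ s).symm

theorem mres_connAct (i : W ≤ V) (a : Red p M c V) (s : Γ(S.lineConn.L, V)) :
    mres S.lineConn.L i (S.connAct V a s) =
      S.connAct W (Red.restrict p M c i a) (mres S.lineConn.L i s) := S.mres_bundleAct i a s

theorem connAct_add (a b : Red p M c V) (s : Γ(S.lineConn.L, V)) :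
    S.connAct V (a + b) s = S.connAct V a s + S.connAct V b s := by
  rw [map_add]
  rfl

theorem connAct_sub (a b : Red p M c V) (s : Γ(S.lineConn.L, V)) :
    S.connAct V (a - b) s = S.connAct V a s - S.connAct V b s := by
  rw [map_sub]
  rfl

theorem connAct_mul (a b : Red p M c V) (s : Γ(S.lineConn.L, V)) :
    S.connAct V (a * b) s = S.connAct V a (S.connAct V b s) := by
  rw [map_mul]
  rfl

theorem connAct_vec_sub (T : Triv M) (ξ : Vect k T.U.1) (i : V ≤ T.U.1) (s : Γ(S.lineConn.L, V)) :
    S.connAct V (Red.restrict p M c i (Red.vec p c M ξ - Red.fn p c M (c • ξ.pair T.form))) s =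
      PEnd.app (repVec p S.lineConn c T ξ) i s := by
  rw [repVec, PEnd.sub_app, PEnd.vec_app, PEnd.fn_app, map_sub, restrict_fn, restrict_vec,
    connAct_sub, connAct_vec, connAct_fn]

theorem connAct_vec_sub_pow (T : Triv M) (ξ : Vect k T.U.1) (i : V ≤ T.U.1)
    (s : Γ(S.lineConn.L, V)) (m : ℕ) : S.connAct V (Red.restrict p M c i
      (Red.vec p c M ξ - Red.fn p c M (c • ξ.pair T.form)) ^ m) s =
      PEnd.app (repVec p S.lineConn c T ξ ^ m) i s := by
  induction m with
  | zero =>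
    rw [pow_zero, pow_zero, map_one]
    rfl
  | succ m ih => rw [pow_succ', pow_succ', connAct_mul, PEnd.mul_app, ih, connAct_vec_sub]

/-- The central element acts as zero; Jacobson's formula computes its action on the generator `R.e`.
In the same way `curl_lineConn` reads closedness off the commutator relation. -/
theorem katz_lineConn (T : Triv M) (R : Triv S.lineConn) (i : R.U.1 ≤ T.U.1) (ξ : Vect k T.U.1) :
    (ξ.restrict i).der^[p - 1] ((ξ.restrict i).pair (R.form - c • formMap (res k i) T.form)) -
      ((ξ.restrict i).pPow p).pair (R.form - c • formMap (res k i) T.form) =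
        c • (ξ.restrict i).pair (formMap (res k i) T.form) ^ p - (ξ.restrict i).pair R.form ^ p := by
  have h := congrArg (fun a => S.connAct R.U.1 (Red.restrict p M c i a) R.e)
    (Red.centralElt_eq_zero (p := p) (c := c) T ξ)
  rw [map_add, map_sub, map_pow, connAct_add, connAct_sub, connAct_vec_sub_pow, connAct_vec_sub,
    restrict_fn, connAct_fn, map_zero, map_zero] at h
  have h3 := repVec_pow_app_smul (p := p) (c := c) T ξ R i 1
  have h4 := repVec_app_smul (p := p) (c := c) T (ξ.pPow p) R i 1
  rw [one_smul] at h3 h4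
  rw [h3, h4, ← sub_smul, ← add_smul] at h
  have h5 := R.bijective.1 (h.trans (zero_smul Γ(X, R.U.1) R.e).symm)
  have e1 : (ξ.pPow p).restrict i = (ξ.restrict i).pPow p := rfl
  have e2 := map_sub (frobHom (cast_eq_zero_of_charP k Γ(X, R.U.1) p))
    ((ξ.restrict i).pair R.form) (c • (ξ.restrict i).pair (formMap (res k i) T.form))
  change ((ξ.restrict i).pair R.form - c • (ξ.restrict i).pair (formMap (res k i) T.form)) ^ p =
    (ξ.restrict i).pair R.form ^ p - (c • (ξ.restrict i).pair (formMap (res k i) T.form)) ^ p at e2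
  have e3 : (ξ.restrict i).pair (R.form - c • formMap (res k i) T.form) =
      (ξ.restrict i).pair R.form - c • (ξ.restrict i).pair (formMap (res k i) T.form) := by
    rw [map_sub]
    congr 1
    exact lift_smul_scalar _ _ _
  have e4 : (ξ.restrict i).pair (R.form - c • formMap (res k i) T.form) ^ p =
      (ξ.restrict i).pair R.form ^ p -
        c ^ p • (ξ.restrict i).pair (formMap (res k i) T.form) ^ p := by
    rw [e3, e2, smul_pow]
  have e5 : (ξ.restrict i).der^[p] 1 = 0 := by
    rw [← derivationPow_apply]
    exact Derivation.map_one_eq_zero _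
  rw [e1, map_smul, map_pow, ← Vect.pair_restrict, e4, e5, sub_smul, Derivation.map_one_eq_zero] at h5
  linear_combination h5

theorem curl_lineConn (T : Triv M) (R : Triv S.lineConn) (i : R.U.1 ≤ T.U.1) (ξ ζ : Vect k T.U.1) :
    (ξ.restrict i).der ((ζ.restrict i).pair (R.form - c • formMap (res k i) T.form)) -
      (ζ.restrict i).der ((ξ.restrict i).pair (R.form - c • formMap (res k i) T.form)) =
        ((ξ.restrict i).bracket (ζ.restrict i)).pair (R.form - c • formMap (res k i) T.form) := by
  have h := congrArg (fun a => S.connAct R.U.1 (Red.restrict p M c i a) ((1 : Γ(X, R.U.1)) • R.e))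
    (Red.vec_bracket (p := p) (c := c) T ξ ζ)
  rw [map_sub (Red.restrict p M c i) (_ * _), map_mul, map_mul, connAct_sub, connAct_mul, connAct_mul,
    connAct_vec_sub, connAct_vec_sub, connAct_vec_sub, repVec_app_smul, repVec_app_smul,
    repVec_app_smul, connAct_vec_sub, connAct_vec_sub, repVec_app_smul, repVec_app_smul,
    ← sub_smul] at h
  have h5 := R.bijective.1 h
  have e1 : (ξ.bracket ζ).restrict i = (ξ.restrict i).bracket (ζ.restrict i) := rfl
  simp only [e1, mul_one, Derivation.map_one_eq_zero, zero_add] at h5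
  linear_combination -h5

/-- The two identities are available for fields restricted from the trivialization of `M`, so that
trivialization is first restricted to `R.U`, where every field qualifies. -/
theorem extCurv_lineConn : extCurv p S.lineConn = c • extCurv p M := by
  have hT : ∀ (T : Triv M) (R : Triv S.lineConn) (i : R.U.1 ≤ T.U.1),
      formMap (res k i) T.form = formMap (res k (le_refl R.U.1)) (T.restrict R.U i).form := by
    intro T R i
    rw [Triv.form_restrict]
    exact (formMap_comp _ _ _ (res_res k i le_rfl) _).symm
  refine extCurv_eq_of_katz (fun T R i ξ => ?_) fun T R i ξ ζ => ?_
  · rw [hT]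
    exact S.katz_lineConn (T.restrict R.U i) R le_rfl ξ
  · rw [hT]
    exact S.curl_lineConn (T.restrict R.U i) R le_rfl ξ ζ

end Splitting

end ConnectionOfSplitting
end
end PCurv

namespace PCurv
noncomputable section

/-! ### Morphisms of sheaves of modules from maps on sections -/

section ModuleMorphisms

variable {Y : Scheme.{u}} {E F : Y.Modules}

/-- The morphism of sheaves of modules given by compatible linear maps on sections -/
def modulesHom (φ : ∀ U : Y.Opens, Γ(E, U) →+ Γ(F, U))
    (hres : ∀ (U V : Y.Opens) (i : V ≤ U) (s : Γ(E, U)), φ V (mres E i s) = mres F i (φ U s))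
    (hsmul : ∀ (U : Y.Opens) (f : Γ(Y, U)) (s : Γ(E, U)), φ U (f • s) = f • φ U s) : E ⟶ F where
  val := PresheafOfModules.homMk
    { app := fun U => AddCommGrpCat.ofHom (φ U.unop)
      naturality := fun U V i => by
        ext s
        exact hres U.unop V.unop i.unop.le s } fun U => hsmul U.unop

theorem modules_hom_ext {f g : E ⟶ F} (h : ∀ (U : Y.Opens) (s : Γ(E, U)), f.app U s = g.app U s) :
    f = g :=
  Scheme.Modules.hom_ext f g fun U => by
    ext s
    exact h U s

/-- The isomorphism of sheaves of modules given by compatible linear bijections on sections -/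
def modulesIso (φ : ∀ U : Y.Opens, Γ(E, U) ≃+ Γ(F, U))
    (hres : ∀ (U V : Y.Opens) (i : V ≤ U) (s : Γ(E, U)), φ V (mres E i s) = mres F i (φ U s))
    (hsmul : ∀ (U : Y.Opens) (f : Γ(Y, U)) (s : Γ(E, U)), φ U (f • s) = f • φ U s) : E ≅ F where
  hom := modulesHom (fun U => (φ U).toAddMonoidHom) hres hsmul
  inv := modulesHom (fun U => (φ U).symm.toAddMonoidHom)
    (fun U V i s => (φ V).injective <| by
      change φ V ((φ V).symm _) = φ V (mres E i ((φ U).symm s))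
      rw [hres, AddEquiv.apply_symm_apply, AddEquiv.apply_symm_apply])
    fun U f s => (φ U).injective <| by
      change φ U ((φ U).symm _) = φ U (f • (φ U).symm s)
      rw [hsmul, AddEquiv.apply_symm_apply, AddEquiv.apply_symm_apply]
  hom_inv_id := modules_hom_ext fun U s => (φ U).symm_apply_apply s
  inv_hom_id := modules_hom_ext fun U s => (φ U).apply_symm_apply s

theorem mres_app (f : E ⟶ F) {U V : Y.Opens} (i : V ≤ U) (s : Γ(E, U)) :
    f.app V (mres E i s) = mres F i (f.app U s) :=
  congr($(f.mapPresheaf.naturality (homOfLE i).op) s)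

/-- The bijections on sections given by an isomorphism of sheaves of modules -/
def appEquiv (e : E ≅ F) (U : Y.Opens) : Γ(E, U) ≃+ Γ(F, U) where
  toFun := e.hom.app U
  invFun := e.inv.app U
  left_inv s := congr(Scheme.Modules.Hom.app $(e.hom_inv_id) U s)
  right_inv s := congr(Scheme.Modules.Hom.app $(e.inv_hom_id) U s)
  map_add' := map_add (e.hom.app U).hom

/-- Restriction between equal open sets -/
def mresEquiv (E : Y.Modules) {U V : Y.Opens} (h : U = V) : Γ(E, U) ≃+ Γ(E, V) where
  toFun := mres E h.ge
  invFun := mres E h.le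
  left_inv s := by rw [mres_mres, mres_self]
  right_inv s := by rw [mres_mres, mres_self]
  map_add' := map_add _

end ModuleMorphisms

/-! ### Morphisms of connections from covariant derivatives -/

section Connections

variable {X : Scheme.{u}} {k : Type u} [Field k] [X.Over (Spec (.of k))]

theorem contract_formTensor {E F : X.Modules} (f : E ⟶ F) {U : X.Opens} (ξ : Vect k U)
    (t : Ω[Γ(X, U)⁄k] ⊗[Γ(X, U)] Γ(E, U)) :
    contract F ξ (LineConn.formTensor k f U t) = f.app U (contract E ξ t) := by
  induction t using TensorProduct.induction_on with
  | zero => simp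
  | add x y hx hy => simp only [map_add, hx, hy]
  | tmul η s => exact (f.app_smul _ _).symm

namespace LineConn

variable {N N' : LineConn k X}

theorem Hom.app_nabla (g : LineConn.Hom N N') {U : X.Opens} (ξ : Vect k U) (s : Γ(N.L, U)) :
    g.iso.hom.app U (N.nabla ξ s) = N'.nabla ξ (g.iso.hom.app U s) := by
  refine N'.nabla_ext fun V i => ?_
  rw [← mres_app, mres_nabla_affine, mres_nabla_affine, ← mres_app, g.comm, contract_formTensor]

/-- A morphism of line bundles with connection from compatibility with covariant derivatives -/
def Hom.ofNabla [Smooth (X ↘ Spec (.of k))] (e : N.L ≅ N'.L)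
    (h : ∀ (U : X.Opens) (ξ : Vect k U) (s : Γ(N.L, U)),
      e.hom.app U (N.nabla ξ s) = N'.nabla ξ (e.hom.app U s)) : N ⟶ N' where
  iso := e
  comm U s := contract_ext (k := k) U.2 _ fun ξ => by
    rw [contract_formTensor, ← nabla_affine, ← nabla_affine, h]

/-- An isomorphism of line bundles with connection from compatibility with covariant derivatives -/
def isoOfNabla [Smooth (X ↘ Spec (.of k))] (e : N.L ≅ N'.L)
    (h : ∀ (U : X.Opens) (ξ : Vect k U) (s : Γ(N.L, U)),
      e.hom.app U (N.nabla ξ s) = N'.nabla ξ (e.hom.app U s)) : N ≅ N' where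
  hom := Hom.ofNabla e h
  inv := Hom.ofNabla e.symm fun U ξ s => (appEquiv e U).injective <| by
    have h1 : ∀ t, appEquiv e U (e.inv.app U t) = t := (appEquiv e U).apply_symm_apply
    refine (h1 _).trans ?_
    refine Eq.trans ?_ (h U ξ _).symm
    exact congrArg _ (h1 s).symm
  hom_inv_id := Hom.ext e.self_symm_id
  inv_hom_id := Hom.ext e.symm_self_id

end LineConn

end Connections

/-! ### The equivalence of groupoids -/

section Equivalence

variable {X : Scheme.{u}} {k : Type u} [Field k] [X.Over (Spec (.of k))]
variable {p : ℕ} [Fact p.Prime] [CharP k p] {M : LineConn k X} {c : k}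
variable [Smooth (X ↘ Spec (.of k))] [IsAlgClosed k]

namespace Splitting

variable (S : Splitting p M c)

/-- The identification of the splitting bundle with the direct image of the line bundle -/
def sectionsEquiv (U : (frobTwist X k p).Opens) :
    Γ(S.E, U) ≃+ Γ(S.lineConn.L, relFrob X k p ⁻¹ᵁ U) :=
  mresEquiv S.E (preimage_relFrob k p U).symm

theorem sectionsEquiv_mres {U V : (frobTwist X k p).Opens} (i : V ≤ U) (s : Γ(S.E, U)) :
    S.sectionsEquiv V (mres S.E i s) =
      mres S.lineConn.L ((relFrob X k p).preimage_mono i) (S.sectionsEquiv U s) :=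
  (mres_mres S.E i _ s).trans (mres_mres S.E _ _ s).symm

theorem sectionsEquiv_act {U : (frobTwist X k p).Opens} (a : Red p M c (relFrob X k p ⁻¹ᵁ U))
    (s : Γ(S.E, U)) : S.sectionsEquiv U (EndSec.act (S.toEnd U a) s) =
      S.connAct _ a (S.sectionsEquiv U s) := S.act_eq_redAct a s

variable {S} {S' : Splitting p M c}

/-- The isomorphism of bundles given by an isomorphism of splittings -/
def bundleIso (g : Splitting.Hom S S') : S.lineConn.L ≅ S'.lineConn.L :=
  modulesIso (fun V => appEquiv g.iso (twistProj X k p ⁻¹ᵁ V))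
    (fun _ _ i => mres_app g.iso.hom ((twistProj X k p).preimage_mono i))
    fun _ _ => g.comm _ _

theorem bundleIso_connAct (g : Splitting.Hom S S') {V : X.Opens} (a : Red p M c V)
    (s : Γ(S.lineConn.L, V)) :
    (bundleIso g).hom.app V (S.connAct V a s) = S'.connAct V a ((bundleIso g).hom.app V s) :=
  g.comm _ _ _

theorem sectionsEquiv_app (g : Splitting.Hom S S') {U : (frobTwist X k p).Opens} (s : Γ(S.E, U)) :
    S'.sectionsEquiv U (g.iso.hom.app U s) = (bundleIso g).hom.app _ (S.sectionsEquiv U s) :=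
  (mres_app g.iso.hom _ s).symm

variable (p M c) in
/-- The line bundle with connection given by a splitting, as a functor -/
def lineConnFunctor : Splitting p M c ⥤ LineConnWithCurv p (c • extCurv p M) where
  obj S := ⟨S.lineConn, S.extCurv_lineConn⟩
  map g := ObjectProperty.homMk (LineConn.Hom.ofNabla (bundleIso g) fun U ξ s => by
    rw [← connAct_vec, ← connAct_vec, bundleIso_connAct])
  map_id S := rfl
  map_comp f g := rfl

instance : (lineConnFunctor p M c).Faithful where
  map_injective {S S'} g g' h := by
    refine Splitting.Hom.ext (Iso.ext (modules_hom_ext fun U s => (S'.sectionsEquiv U).injective ?_))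
    rw [sectionsEquiv_app, sectionsEquiv_app]
    have h1 : bundleIso g = bundleIso g' := congrArg (fun f => f.hom.iso) h
    rw [h1]

/-- Locally functions and lifts of vector fields generate the algebra, so a linear map that respects
the lifts respects the whole action. Fullness of the functor rests on this. -/
theorem connAct_ext {V : X.Opens} (e : S.lineConn.L ⟶ S'.lineConn.L)
    (h : ∀ (W : X.Opens) (ξ : Vect k W) (s : Γ(S.lineConn.L, W)),
      e.app W (S.connAct W (Red.vec p c M ξ) s) = S'.connAct W (Red.vec p c M ξ) (e.app W s))
    (a : Red p M c V) (s : Γ(S.lineConn.L, V)) :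
    e.app V (S.connAct V a s) = S'.connAct V a (e.app V s) := by
  refine mres_ext_affine _ fun x hx => ?_
  obtain ⟨T, hxT, hT⟩ := exists_triv_le M hx
  refine ⟨T.U, hT, hxT, ?_⟩
  rw [← mres_app, mres_connAct, mres_connAct, ← mres_app]
  generalize mres S.lineConn.L hT s = t
  generalize Red.restrict p M c hT a = b
  have ha : b ∈ Subring.closure
      (Set.range (Red.fn p c M (U := T.U.1)) ∪ Set.range (Red.vec p c M)) := by
    rw [Red.closure_eq_top]
    trivial
  induction ha using Subring.closure_induction generalizing t with
  | mem b hb =>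
    rcases hb with ⟨f, rfl⟩ | ⟨ξ, rfl⟩
    · exact e.app_smul f t
    · exact h _ ξ t
  | zero => rw [map_zero, map_zero]; exact map_zero (e.app T.U.1).hom
  | one => rw [map_one, map_one]; rfl
  | add b b' _ _ hb hb' => rw [connAct_add, connAct_add, map_add, hb, hb']
  | neg b _ hb =>
    rw [map_neg, map_neg]
    exact (map_neg (e.app T.U.1).hom _).trans (congrArg _ (hb t))
  | mul b b' _ _ hb hb' => rw [connAct_mul, connAct_mul, hb, hb']

/-- The isomorphism of splittings given by an isomorphism of line bundles with connection -/
def homOfLineConn (g : LineConn.Hom S.lineConn S'.lineConn) : S ⟶ S' :=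
  have hg : ∀ (U : (frobTwist X k p).Opens) (a : Red p M c (relFrob X k p ⁻¹ᵁ U)) (s : Γ(S.E, U)),
      (S'.sectionsEquiv U).symm (g.iso.hom.app _ (S.sectionsEquiv U
        (EndSec.act (S.toEnd U a) s))) = EndSec.act (S'.toEnd U a)
          ((S'.sectionsEquiv U).symm (g.iso.hom.app _ (S.sectionsEquiv U s))) := fun U a s => by
    rw [AddEquiv.symm_apply_eq, sectionsEquiv_act, sectionsEquiv_act, AddEquiv.apply_symm_apply]
    refine connAct_ext g.iso.hom (fun W ξ s => ?_) a _
    rw [connAct_vec, connAct_vec, g.app_nabla]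
  { iso := modulesIso (fun U => (S.sectionsEquiv U).trans ((appEquiv g.iso _).trans
        (S'.sectionsEquiv U).symm))
      (fun U V i s => by
        change (S'.sectionsEquiv V).symm (g.iso.hom.app _ (S.sectionsEquiv V (mres S.E i s))) =
          mres S'.E i ((S'.sectionsEquiv U).symm (g.iso.hom.app _ (S.sectionsEquiv U s)))
        rw [AddEquiv.symm_apply_eq, sectionsEquiv_mres, sectionsEquiv_mres,
          AddEquiv.apply_symm_apply, mres_app])
      (fun U f s => by
        change (S'.sectionsEquiv U).symm (g.iso.hom.app _ (S.sectionsEquiv U (f • s))) =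
          f • (S'.sectionsEquiv U).symm (g.iso.hom.app _ (S.sectionsEquiv U s))
        rw [← S.toEnd_scalar, ← S'.toEnd_scalar, hg])
    comm := hg }

/-- Over preimages of open sets of `X⁽¹⁾` the two maps agree by construction, and every open set of
`X` is such a preimage. -/
theorem bundleIso_homOfLineConn (g : LineConn.Hom S.lineConn S'.lineConn) :
    bundleIso (homOfLineConn g) = g.iso := by
  refine Iso.ext (modules_hom_ext fun V s => ?_)
  have e := preimage_twistProj k p V
  have h : ∀ t : Γ(S.lineConn.L, relFrob X k p ⁻¹ᵁ twistProj X k p ⁻¹ᵁ V),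
      (bundleIso (homOfLineConn g)).hom.app _ t = g.iso.hom.app _ t := fun t => by
    obtain ⟨t, rfl⟩ := (S.sectionsEquiv _).surjective t
    rw [← sectionsEquiv_app]
    exact (S'.sectionsEquiv _).apply_symm_apply _
  refine (mresEquiv S'.lineConn.L e.symm).injective ?_
  refine (mres_app _ e.le s).symm.trans ((h _).trans (mres_app _ e.le s))

instance : (lineConnFunctor p M c).Full where
  map_surjective g := ⟨homOfLineConn g.hom, by
    refine InducedCategory.Hom.ext (LineConn.Hom.ext ?_)
    exact bundleIso_homOfLineConn g.hom⟩

theorem connAct_splittingOfLineConn (N : LineConn k X) (hc : extCurv p N = c • extCurv p M)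
    {V : X.Opens} (a : Red p M c V) (s : Γ(N.L, relFrob X k p ⁻¹ᵁ twistProj X k p ⁻¹ᵁ V)) :
    (splittingOfLineConn N hc).connAct V a s =
      PEnd.app (redEquiv hc V a) (preimage_twistProj k p V).le s := by
  refine (splittingOfLineConn_act N hc _ _ s).trans ?_
  rw [redEquiv_restrict]
  rfl

/-- A line bundle with connection is isomorphic to the one given by its splitting. -/
def lineConnIso (N : LineConn k X) (hc : extCurv p N = c • extCurv p M) :
    (splittingOfLineConn N hc).lineConn ≅ N :=
  have h1 : ∀ (V : X.Opens) (a : Red p M c V)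
      (s : Γ(N.L, relFrob X k p ⁻¹ᵁ twistProj X k p ⁻¹ᵁ V)),
      mres N.L (preimage_twistProj k p V).ge ((splittingOfLineConn N hc).connAct V a s) =
        PEnd.app (redEquiv hc V a) le_rfl (mres N.L (preimage_twistProj k p V).ge s) :=
    fun V a s => (congrArg _ (connAct_splittingOfLineConn N hc a s)).trans
      (PEnd.app_mres _ _ _ _).symm
  LineConn.isoOfNabla
    (modulesIso (E := (splittingOfLineConn N hc).lineConn.L)
      (fun V => mresEquiv N.L (preimage_twistProj k p V))
      (fun U V i s => (mres_mres N.L _ _ _).trans (mres_mres N.L _ _ _).symm)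
      (fun U f s => by
        refine (h1 U (Red.fn p c M f) s).trans ?_
        rw [redEquiv_fn, PEnd.fn_app, res_self]
        rfl))
    (fun U ξ s => by
      rw [← connAct_vec]
      refine (h1 U (Red.vec p c M ξ) s).trans ?_
      rw [redEquiv_vec, PEnd.vec_app]
      rfl)

instance : (lineConnFunctor p M c).EssSurj where
  mem_essImage N := ⟨splittingOfLineConn N.obj N.property,
    ⟨ObjectProperty.isoMk _ (lineConnIso N.obj N.property)⟩⟩

instance : (lineConnFunctor p M c).IsEquivalence where

/-- The identification of the splitting bundle with the direct image of the line bundle, under which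
functions act by multiplication and the lifts of vector fields by covariant derivatives -/
def identification (S : Splitting p M c) : Identification p S S.lineConn where
  iso := S.sectionsEquiv
  iso_res := S.sectionsEquiv_mres
  iso_fn _ f s := S.sectionsEquiv_act (Red.fn p c M f) s
  iso_vec _ hU ξ s := (S.sectionsEquiv_act (Red.vec p c M ξ) s).trans
    ((S.connAct_vec _ ξ _).trans (S.lineConn.nabla_affine ⟨_, hU⟩ ξ _))

end Splitting

end Equivalence
end
end PCurv

theorem mainTheorem4 {k : Type u} [Field k] [IsAlgClosed k] (p : ℕ) [Fact p.Prime] [CharP k p]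
    (X : Scheme.{u}) [X.Over (Spec (.of k))] [Smooth (X ↘ Spec (.of k))]
    (M : LineConn k X) (c : k) :
    ∃ (F : Splitting p M c ≌ LineConnWithCurv p (c • extCurv p M))
      (θ : ∀ S : Splitting p M c, Identification p S (F.functor.obj S).obj),
      ∀ (S S' : Splitting p M c) (g : S ⟶ S') (U : (frobTwist X k p).Opens) (s : Γ(S.E, U)),
        (θ S').iso U (g.iso.hom.app U s) =
          (F.functor.map g).hom.iso.hom.app (relFrob X k p ⁻¹ᵁ U) ((θ S).iso U s) := by
  exact ⟨(Splitting.lineConnFunctor p M c).asEquivalence, Splitting.identification,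
    fun _ _ g _ s => Splitting.sectionsEquiv_app g s⟩
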